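/- Fix real numbers $b,\mathfrak g,\mu,\kappa>0$. Let $\Omega=\mathbb R^2\times(0,b)$, $\Sigma=\mathbb R^2\times\{b\}$ (identified with $\mathbb R^2$) and $\Sigma_0=\mathbb R^2\times\{0\}$. Write $\nabla_{\|}=(\partial_1,\partial_2)$, $\nabla_{\|}^\perp=(-\partial_2,\partial_1)$ and $\mathbb Du=\nabla u+\nabla u^{\mathrm t}$. For $m\in\mathbb N$ let $H^m(\Omega)$ be the usual $L^2$-based Sobolev space, and for $\sigma\ge 0$ let $H^\sigma(\Sigma)$ be the Bessel potential space with norm $\|(1+|\xi|^2)^{\sigma/2}\hat f\|_{L^2(\mathbb R^2)}$, where $\hat f(\xi)=\int f(x)e^{-2\pi i x\cdot\xi}\,dx$ (extended to $L^2$). A function $f\in L^2(\Sigma;\mathbb C)$ belongs to $\dot H^{-1}(\Sigma;\mathbb C)$ if $[f]_{\dot H^{-1}}:=\||\xi|^{-1}\hat f\|_{L^2(\mathbb R^2)}<\infty$. Theorem. Let $s\in\mathbb N=\{0,1,2,\dots\}$. For every $$(g,f,k,h,\omega)\in H^{1+s}(\Omega;\mathbb C)\times H^s(\Omega;\mathbb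 C^3)\times H^{1/2+s}(\Sigma;\mathbb C^3)\times H^{3/2+s}(\Sigma;\mathbb C)\times H^{1/2+s}(\Sigma;\mathbb C)$$ satisfying $$h-\int_0^b g(\cdot,y)\,dy\in\dot H^{-1}(\Sigma;\mathbb C)\quad\text{and}\quad \omega\in\dot H^{-1}(\Sigma;\mathbb C)$$ there exists a unique $(p,u,\chi)\in H^{1+s}(\Omega;\mathbb C)\times H^{2+s}(\Omega;\mathbb C^3)\times H^{3/2+s}(\Sigma;\mathbb C^2)$ such that $$\begin{cases}\mathfrak g(\chi,0)+\nabla p-\mu\nabla\cdot\mathbb Du=f&\text{in }\Omega,\\ \nabla\cdot u=g&\text{in }\Omega,\\ -(pI-\mu\mathbb Du)e_3-\kappa(\nabla_{\|}\cdot\chi)e_3=k&\text{on }\Sigma,\\ \nabla_{\|}^\perp\cdot\chi=\omega&\text{on }\Sigma,\\ u\cdot e_3=h&\text{on }\Sigma,\\ u=0&\text{on }\Sigma_0.\end{cases}$$ Here derivatives are weak derivatives, boundary values of functions on $\Omega$ are traces, and $\chi$ is regarded as a function on $\Omega$ that does not depend on the third variable. Moreover, there is a constant $C>0$, depending only on $b,\mathfrak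 g,\mu,\kappa$ and $s$, such that for all such data the solution satisfies $$\|p\|_{H^{1+s}}+\|u\|_{H^{2+s}}+\|\chi\|_{H^{3/2+s}}\le C\Big(\|g\|_{H^{1+s}}+\|f\|_{H^s}+\|k\|_{H^{1/2+s}}+\|h\|_{H^{3/2+s}}+\|\omega\|_{H^{1/2+s}}+\Big[h-\int_0^b g(\cdot,y)\,dy\Big]_{\dot H^{-1}}+[\omega]_{\dot H^{-1}}\Big).$$ -/

import Mathlib

open MeasureTheory Filter Topology FourierTransform LineDeriv
open scoped ENNReal ContDiff SchwartzMap

noncomputable section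

namespace StationaryWaves

/-! ### The equilibrium domain

Points of `ℝ³` are written `(x, y)` with `x ∈ ℝ²` and `y ∈ ℝ`.  The interface
`Σ = ℝ² × {b}` is identified with `ℝ²`. -/

/-- The horizontal plane `ℝ²`. -/
abbrev Plane : Type := EuclideanSpace ℝ (Fin 2)

/-- The slab `Ω = ℝ² × (0, b)`. -/
def slab (b : ℝ) : Set (Plane × ℝ) := Set.univ ×ˢ Set.Ioo 0 b

/-- `L²(Σ; ℂ)`, with `Σ` identified with `ℝ²`. -/
abbrev L2Sigma : Type := Lp ℂ 2 (volume : Measure Plane)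

/-- `L²(Ω; ℂ)`. -/
abbrev L2Omega (b : ℝ) : Type := Lp ℂ 2 ((volume : Measure (Plane × ℝ)).restrict (slab b))

/-- The coordinate directions `e₁, e₂, e₃` of `ℝ³` (indexed by `0, 1, 2`). -/
def dir : Fin 3 → Plane × ℝ :=
  ![(EuclideanSpace.single 0 1, 0), (EuclideanSpace.single 1 1, 0), (0, 1)]

lemma isOpen_slab (b : ℝ) : IsOpen (slab b) := isOpen_univ.prod isOpen_Ioo

/-! ### Weak derivatives and integer order Sobolev spaces on the slab -/

/-- `g` is the weak partial derivative `∂ⱼ f` in the slab: for every test function `φ`,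
`∫_Ω f ∂ⱼφ = - ∫_Ω g φ`. -/
def HasWeakPartial (b : ℝ) (j : Fin 3) (f g : L2Omega b) : Prop :=
  ∀ φ : Plane × ℝ → ℂ, ContDiff ℝ ∞ φ → HasCompactSupport φ → tsupport φ ⊆ slab b →
    ∫ z in slab b, f z * fderiv ℝ φ z (dir j) = - ∫ z in slab b, g z * φ z

lemma HasWeakPartial.unique {b : ℝ} {j : Fin 3} {f g g' : L2Omega b}
    (h : HasWeakPartial b j f g) (h' : HasWeakPartial b j f g') : g = g' := by
  have hg : LocallyIntegrable (fun z => g z - g' z) ((volume : Measure (Plane × ℝ)).restrict (slab b)) :=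
    ((Lp.memLp g).sub (Lp.memLp g')).locallyIntegrable (by norm_num)
  have key := (isOpen_slab b).ae_eq_zero_of_integral_contDiff_smul_eq_zero
    (hg.locallyIntegrableOn (slab b)) (fun φ hφ hc hs => by
      have hsupp : Function.support (fun z => (φ z : ℂ)) = Function.support φ := by
        ext z; simp
      have hts : tsupport (fun z => (φ z : ℂ)) = tsupport φ := by
        rw [tsupport, tsupport, hsupp]
      have hc' : HasCompactSupport (fun z => (φ z : ℂ)) := by
        rw [HasCompactSupport, hts]; exact hc
      have hφ' : ContDiff ℝ ∞ (fun z => (φ z : ℂ)) := Complex.ofRealCLM.contDiff.comp hφ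
      have h1 := h _ hφ' hc' (hts ▸ hs)
      have h2 := h' _ hφ' hc' (hts ▸ hs)
      have hm : MemLp (fun z => (φ z : ℂ)) 2 ((volume : Measure (Plane × ℝ)).restrict (slab b)) :=
        hφ'.continuous.memLp_of_hasCompactSupport hc'
      have i1 := (Lp.memLp g).integrable_mul hm
      have i2 := (Lp.memLp g').integrable_mul hm
      have h3 : ∫ z in slab b, g z * (φ z : ℂ) = ∫ z in slab b, g' z * (φ z : ℂ) :=
        neg_injective (h1.symm.trans h2)
      have h4 := integral_sub i1 i2
      simp only [Pi.mul_apply] at h4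
      rw [h3, sub_self] at h4
      rw [← h4]
      refine integral_congr_ae (Eventually.of_forall fun z => ?_)
      simp only [Complex.real_smul]
      ring)
  refine Lp.ext ?_
  filter_upwards [key, ae_restrict_mem (isOpen_slab b).measurableSet] with z h1 h2
  exact sub_eq_zero.1 (h1 h2)

open Classical in
/-- The weak partial derivative `∂ⱼ f ∈ L²(Ω)`; it has the value `0` when `f` has no weak partial
derivative in `L²(Ω)`. -/
def weakPartial (b : ℝ) (j : Fin 3) (f : L2Omega b) : L2Omega b :=
  if h : ∃ g, HasWeakPartial b j f g then h.choose else 0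

lemma HasWeakPartial.weakPartial_eq {b : ℝ} {j : Fin 3} {f g : L2Omega b}
    (h : HasWeakPartial b j f g) : weakPartial b j f = g := by
  have hex : ∃ g, HasWeakPartial b j f g := ⟨g, h⟩
  rw [weakPartial, dif_pos hex]
  exact hex.choose_spec.unique h

/-- Membership in `Hᵐ(Ω; ℂ)`, `m ∈ ℕ`: all weak derivatives of order at most `m` are in `L²`. -/
def MemH (b : ℝ) : ℕ → L2Omega b → Prop
  | 0, _ => True
  | m + 1, f => ∀ j, ∃ g, HasWeakPartial b j f g ∧ MemH b m g

/-- A norm of `Hᵐ(Ω; ℂ)`: `‖f‖_{L²}` for `m = 0`, and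
`‖f‖_{H^{m+1}} = ‖f‖_{L²} + ∑ⱼ ‖∂ⱼ f‖_{Hᵐ}`. -/
def normH (b : ℝ) : ℕ → L2Omega b → ℝ
  | 0, f => ‖f‖
  | m + 1, f => ‖f‖ + ∑ j, normH b m (weakPartial b j f)

/-! ### Sobolev spaces on the interface

Membership in `H^σ(Σ; ℂ)` is Mathlib's `TemperedDistribution.MemSobolev σ 2`. -/

/-- The norm of `H^σ(Σ; ℂ)`: `‖(1 + |ξ|²)^{σ/2} 𝓕 f‖_{L²}`. -/
def normHSigma (σ : ℝ) (f : L2Sigma) : ℝ :=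
  (eLpNorm (fun ξ : Plane => (((1 + ‖ξ‖ ^ 2) ^ (σ / 2) : ℝ) : ℂ) * (𝓕 f : L2Sigma) ξ)
    2 volume).toReal

/-- `f ∈ L²(Σ; ℂ)` belongs to `H^σ(Σ; ℂ)` exactly when the function measured by `normHSigma` is
square integrable. -/
lemma memSobolev_iff_memLp (σ : ℝ) (f : L2Sigma) :
    TemperedDistribution.MemSobolev σ 2 (f : 𝓢'(Plane, ℂ)) ↔
      MemLp (fun ξ : Plane => (((1 + ‖ξ‖ ^ 2) ^ (σ / 2) : ℝ) : ℂ) * (𝓕 f : L2Sigma) ξ)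
        2 volume := by
  have ht : (fun ξ : Plane => (((1 + ‖ξ‖ ^ 2) ^ (σ / 2) : ℝ) : ℂ)).HasTemperateGrowth := by
    fun_prop
  rw [TemperedDistribution.memSobolev_iff_exists_smulLeftCLM_fourier,
    Lp.fourier_toTemperedDistribution_eq f]
  constructor
  · rintro ⟨F, hF⟩
    have hae : (F : Plane → ℂ) =ᵐ[volume]
        fun ξ : Plane => (((1 + ‖ξ‖ ^ 2) ^ (σ / 2) : ℝ) : ℂ) * (𝓕 f : L2Sigma) ξ := by
      refine ae_eq_of_integral_contDiff_smul_eq ((Lp.memLp F).locallyIntegrable (by norm_num))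
        ?_ ?_
      · have := (Lp.memLp (𝓕 f : L2Sigma)).locallyIntegrable (by norm_num)
        rw [locallyIntegrable_iff] at this ⊢
        intro K hK
        exact (this K hK).continuousOn_mul ht.1.continuous.continuousOn hK
      · intro φ hφ hc
        have hc' : HasCompactSupport (fun z => (φ z : ℂ)) :=
          hc.comp_left (g := fun r : ℝ => (r : ℂ)) rfl
        have hφ' : ContDiff ℝ ∞ (fun z => (φ z : ℂ)) := Complex.ofRealCLM.contDiff.comp hφ
        have h1 := congrArg (fun T : 𝓢'(Plane, ℂ) => T (hc'.toSchwartzMap hφ')) hF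
        simp only [TemperedDistribution.smulLeftCLM_apply_apply, Lp.toTemperedDistribution_apply,
          SchwartzMap.smulLeftCLM_apply_apply ht] at h1
        refine Eq.trans (integral_congr_ae (Eventually.of_forall fun z => ?_))
          (h1.symm.trans (integral_congr_ae (Eventually.of_forall fun z => ?_)))
        · simp only [Complex.real_smul, smul_eq_mul]
          rfl
        · simp only [Complex.real_smul, smul_eq_mul]
          change ((_ : ℂ) * (φ z : ℂ)) * _ = _
          ring
    exact (memLp_congr_ae hae).1 (Lp.memLp F)
  · intro h
    refine ⟨h.toLp _, ?_⟩
    ext φ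
    simp only [TemperedDistribution.smulLeftCLM_apply_apply, Lp.toTemperedDistribution_apply,
      SchwartzMap.smulLeftCLM_apply_apply ht]
    refine integral_congr_ae ?_
    filter_upwards [h.coeFn_toLp] with z hz
    rw [hz]
    simp only [smul_eq_mul]
    ring

/-- The function `|ξ|⁻¹ 𝓕 f (ξ)`. -/
def invFreq (f : L2Sigma) (ξ : Plane) : ℂ := ((‖ξ‖⁻¹ : ℝ) : ℂ) * (𝓕 f : L2Sigma) ξ

/-- Membership in `Ḣ⁻¹(Σ; ℂ)`, for functions that already lie in `L²(Σ; ℂ)`. -/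
def MemHDotNegOne (f : L2Sigma) : Prop := MemLp (invFreq f) 2 volume

/-- The seminorm `[f]_{Ḣ⁻¹} = ‖|ξ|⁻¹ 𝓕 f‖_{L²}`. -/
def seminormHDotNegOne (f : L2Sigma) : ℝ := (eLpNorm (invFreq f) 2 volume).toReal

/-! ### Vertical integrals -/

lemma memLp_verticalIntegral (b : ℝ) (g : L2Omega b) :
    MemLp (fun x : Plane => ∫ y in Set.Ioo 0 b, g (x, y)) 2 volume := by
  have hvol : (volume : Measure (Plane × ℝ)).restrict (slab b) =
      (volume : Measure Plane).prod (volume.restrict (Set.Ioo 0 b)) := by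
    rw [slab, Measure.volume_eq_prod, ← Measure.prod_restrict, Measure.restrict_univ]
  have hg : MemLp (g : Plane × ℝ → ℂ) 2
      ((volume : Measure Plane).prod (volume.restrict (Set.Ioo 0 b))) := hvol ▸ Lp.memLp g
  refine ⟨hg.1.integral_prod_right', ?_⟩
  have hsl : ∀ᵐ x ∂(volume : Measure Plane),
      AEStronglyMeasurable (fun y => g (x, y)) (volume.restrict (Set.Ioo 0 b)) :=
    hg.1.prodMk_left
  have hfin := hg.2
  rw [eLpNorm_lt_top_iff_lintegral_rpow_enorm_lt_top (by norm_num) (by norm_num)] at hfin ⊢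
  rw [lintegral_prod _ (hg.1.enorm.pow_const _)] at hfin
  simp only [ENNReal.toReal_ofNat] at hfin ⊢
  have hbound : ∀ᵐ x ∂(volume : Measure Plane),
      ‖∫ y in Set.Ioo 0 b, g (x, y)‖ₑ ^ (2 : ℝ) ≤
        (volume (Set.Ioo 0 b)) * ∫⁻ y in Set.Ioo 0 b, ‖g (x, y)‖ₑ ^ (2 : ℝ) := by
    filter_upwards [hsl] with x hx
    have h1 := ENNReal.lintegral_mul_le_Lp_mul_Lq (volume.restrict (Set.Ioo 0 b))
      (Real.HolderConjugate.two_two) (f := fun _ => 1) aemeasurable_const hx.enorm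
    simp only [Pi.mul_apply, one_mul, ENNReal.one_rpow, lintegral_const,
      Measure.restrict_apply_univ] at h1
    calc ‖∫ y in Set.Ioo 0 b, g (x, y)‖ₑ ^ (2 : ℝ)
        ≤ (∫⁻ y in Set.Ioo 0 b, ‖g (x, y)‖ₑ) ^ (2 : ℝ) :=
          ENNReal.rpow_le_rpow (enorm_integral_le_lintegral_enorm _) (by norm_num)
      _ ≤ _ := ENNReal.rpow_le_rpow h1 (by norm_num)
      _ = _ := by
          rw [ENNReal.mul_rpow_of_nonneg _ _ (by norm_num), ← ENNReal.rpow_mul,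
            ← ENNReal.rpow_mul]
          norm_num
  refine (lintegral_mono_ae hbound).trans_lt ?_
  rw [lintegral_const_mul']
  · exact ENNReal.mul_lt_top (by simp) hfin
  · simp

/-- The function `x ↦ ∫₀ᵇ g(x, y) dy`, as an element of `L²(Σ; ℂ)`. -/
def verticalIntegral (b : ℝ) (g : L2Omega b) : L2Sigma := (memLp_verticalIntegral b g).toLp _

/-! ### Traces -/

/-- `τ ∈ L²(ℝ²)` is the trace of `f ∈ H¹(Ω; ℂ)` on the plane `ℝ² × {y₀}`, where `y₀ ∈ {0, b}`:
there are smooth compactly supported functions on `ℝ³` whose restrictions to `Ω` converge to `f`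
in `H¹(Ω)` and whose restrictions to `ℝ² × {y₀}` converge to `τ` in `L²`. -/
def HasTrace (b y₀ : ℝ) (f : L2Omega b) (τ : L2Sigma) : Prop :=
  ∃ φ : ℕ → Plane × ℝ → ℂ,
    (∀ n, ContDiff ℝ ∞ (φ n) ∧ HasCompactSupport (φ n)) ∧
    Tendsto (fun n => eLpNorm (fun z => φ n z - f z) 2 (volume.restrict (slab b))) atTop (𝓝 0) ∧
    (∀ j, ∃ g, HasWeakPartial b j f g ∧
      Tendsto (fun n => eLpNorm (fun z => fderiv ℝ (φ n) z (dir j) - g z) 2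
        (volume.restrict (slab b))) atTop (𝓝 0)) ∧
    Tendsto (fun n => eLpNorm (fun x => φ n (x, y₀) - τ x) 2 volume) atTop (𝓝 0)

/-! ### The differential operators -/

/-- The divergence `∇·u` in `Ω`. -/
def div (b : ℝ) (u : Fin 3 → L2Omega b) : L2Omega b := ∑ j, weakPartial b j (u j)

/-- The symmetrized gradient `(𝔻u)ᵢⱼ = ∂ᵢ uⱼ + ∂ⱼ uᵢ`. -/
def symGrad (b : ℝ) (u : Fin 3 → L2Omega b) (i j : Fin 3) : L2Omega b :=
  weakPartial b i (u j) + weakPartial b j (u i)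

/-- The tangential divergence `∂₁χ₁ + ∂₂χ₂`, as a tempered distribution on `ℝ²`. -/
def divSigma (χ : Fin 2 → L2Sigma) : 𝓢'(Plane, ℂ) :=
  ∂_{(EuclideanSpace.single 0 1 : Plane)} (χ 0 : 𝓢'(Plane, ℂ)) +
    ∂_{(EuclideanSpace.single 1 1 : Plane)} (χ 1 : 𝓢'(Plane, ℂ))

/-- The tangential curl `-∂₂χ₁ + ∂₁χ₂`, as a tempered distribution on `ℝ²`. -/
def curlSigma (χ : Fin 2 → L2Sigma) : 𝓢'(Plane, ℂ) :=
  -∂_{(EuclideanSpace.single 1 1 : Plane)} (χ 0 : 𝓢'(Plane, ℂ)) +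
    ∂_{(EuclideanSpace.single 0 1 : Plane)} (χ 1 : 𝓢'(Plane, ℂ))

/-! ### Data, solutions and the linear system -/

/-- A data tuple `(g, f, k, h, w)` of square integrable functions. -/
structure Data (b : ℝ) where
  g : L2Omega b
  f : Fin 3 → L2Omega b
  k : Fin 3 → L2Sigma
  h : L2Sigma
  w : L2Sigma

/-- A triple `(p, u, χ)` of square integrable functions. -/
structure Triple (b : ℝ) where
  p : L2Omega b
  u : Fin 3 → L2Omega b
  χ : Fin 2 → L2Sigma

/-- `(g, f, k, h, w) ∈ H^{1+s}(Ω) × H^s(Ω) × H^{1/2+s}(Σ) × H^{3/2+s}(Σ) × H^{1/2+s}(Σ)`. -/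
structure Data.MemSobolev {b : ℝ} (d : Data b) (s : ℕ) : Prop where
  g : MemH b (1 + s) d.g
  f : ∀ i, MemH b s (d.f i)
  k : ∀ i, TemperedDistribution.MemSobolev (1 / 2 + s : ℝ) 2 (d.k i : 𝓢'(Plane, ℂ))
  h : TemperedDistribution.MemSobolev (3 / 2 + s : ℝ) 2 (d.h : 𝓢'(Plane, ℂ))
  w : TemperedDistribution.MemSobolev (1 / 2 + s : ℝ) 2 (d.w : 𝓢'(Plane, ℂ))

/-- The function `h - ∫₀ᵇ g(·, y) dy`. -/
def Data.fluxDefect {b : ℝ} (d : Data b) : L2Sigma := d.h - verticalIntegral b d.g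

/-- The compatibility conditions `h - ∫₀ᵇ g(·, y) dy ∈ Ḣ⁻¹(Σ)` and `w ∈ Ḣ⁻¹(Σ)`. -/
def Data.Compatible {b : ℝ} (d : Data b) : Prop :=
  MemHDotNegOne d.fluxDefect ∧ MemHDotNegOne d.w

/-- The norm of `(g, f, k, h, w)` in
`H^{1+s}(Ω) × H^s(Ω) × H^{1/2+s}(Σ) × H^{3/2+s}(Σ) × H^{1/2+s}(Σ)`. -/
def Data.norm {b : ℝ} (d : Data b) (s : ℕ) : ℝ :=
  normH b (1 + s) d.g + ∑ i, normH b s (d.f i) + ∑ i, normHSigma (1 / 2 + s) (d.k i) +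
    normHSigma (3 / 2 + s) d.h + normHSigma (1 / 2 + s) d.w

/-- `(p, u, χ) ∈ H^{1+s}(Ω) × H^{2+s}(Ω; ℂ³) × H^{3/2+s}(Σ; ℂ²)`. -/
structure Triple.MemSobolev {b : ℝ} (t : Triple b) (s : ℕ) : Prop where
  p : MemH b (1 + s) t.p
  u : ∀ i, MemH b (2 + s) (t.u i)
  χ : ∀ i, TemperedDistribution.MemSobolev (3 / 2 + s : ℝ) 2 (t.χ i : 𝓢'(Plane, ℂ))

/-- The norm of `(p, u, χ)` in `H^{1+s}(Ω) × H^{2+s}(Ω; ℂ³) × H^{3/2+s}(Σ; ℂ²)`. -/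
def Triple.norm {b : ℝ} (t : Triple b) (s : ℕ) : ℝ :=
  normH b (1 + s) t.p + ∑ i, normH b (2 + s) (t.u i) + ∑ i, normHSigma (3 / 2 + s) (t.χ i)

/-- The linear system with gravity `grav`, viscosity `μ` and surface tension `κ`, for a triple with
`p ∈ H¹(Ω)`, `u ∈ H²(Ω; ℂ³)` and `χ ∈ L²(Σ; ℂ²)`. -/
structure Solves {b : ℝ} (grav μ κ : ℝ) (t : Triple b) (d : Data b) : Prop where
  /-- `grav (χ, 0) + ∇p - μ ∇·𝔻u = f` in `Ω`. -/
  momentum : ∀ i, ∀ᵐ z ∂((volume : Measure (Plane × ℝ)).restrict (slab b)),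
    (grav : ℂ) * ![t.χ 0 z.1, t.χ 1 z.1, 0] i + weakPartial b i t.p z
      - (μ : ℂ) * ∑ j, weakPartial b j (symGrad b t.u i j) z = d.f i z
  /-- `∇·u = g` in `Ω`. -/
  divergence : div b t.u = d.g
  /-- `-(p I - μ 𝔻u) e₃ - κ (∇_∥·χ) e₃ = k` on `Σ`. -/
  stress : ∃ (q : L2Sigma) (S : Fin 3 → L2Sigma),
    HasTrace b b t.p q ∧ (∀ i, HasTrace b b (symGrad b t.u i 2) (S i)) ∧
    ∀ i, -((![0, 0, 1] i : ℂ) • (q : 𝓢'(Plane, ℂ)) - (μ : ℂ) • (S i : 𝓢'(Plane, ℂ)))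
      - (![0, 0, 1] i : ℂ) • (κ : ℂ) • divSigma t.χ = (d.k i : 𝓢'(Plane, ℂ))
  /-- `∇_∥^⊥·χ = w` on `Σ`. -/
  curl : curlSigma t.χ = (d.w : 𝓢'(Plane, ℂ))
  /-- `u·e₃ = h` on `Σ`. -/
  kinematic : HasTrace b b (t.u 2) d.h
  /-- `u = 0` on `Σ₀`. -/
  noSlip : ∀ i, HasTrace b 0 (t.u i) 0

end StationaryWaves

end

noncomputable section

namespace StationaryWaves

open scoped InnerProductSpace ComplexConjugate TensorProduct

/-! The horizontal Fourier transform turns the problem in the slab into a boundary value problem on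
`(0, b)` for almost every frequency `ξ`. Solving these problems explicitly, estimating them
uniformly in `ξ` and integrating with Plancherel gives existence and the bound; applying the bound
to a difference of two solutions gives uniqueness.

On a fibre let `r = 2π|ξ|`, and split horizontal vectors into the components along `ξ` and
orthogonal to it, with a factor `-i` that makes all coefficients real. Write `a`, `w` for the
longitudinal and vertical velocities, `d` for the transversal velocity, `c` and `χd` for the two
components of `χ`. The gravity term `grav * c` of the longitudinal momentum equation is constant in
`y`, so it is absorbed by the shifted pressure `P = p + grav * c / r`. The system then becomes
triangular: `(a, w, P)` solves a Stokes problem with no slip at the bottom and with prescribed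
vertical velocity and tangential stress at the top; the normal stress gives `c`, because `grav + κ
r²` never vanishes; the curl equation gives `χd = -om / r`; and `d` solves a scalar problem with
Dirichlet condition below and Neumann condition above. Everything is explicit in hyperbolic
functions, and the determinant of the Stokes part is nonzero because `sinh x * cosh x > x` for `x >
0` (`FData.det_ne_zero`, `FData.Good.fsys`).

The uniform estimate is `FibreSol.exists_out_le`. With `σ⁴ = 1 + |ξ|²`, let `E` be the first order
energy, `δ` the size of the data and `K = σ² E + δ`. The equations bound `w''` and `P'` by `K`. To
bound `r P` and `a''` separately, expand the square of `r P - μ a''`, which is known to be of size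
`K`, and integrate the cross term by parts; the trace inequality bounds it by a quantity that can be
absorbed (`FibreSol.isBigO_Z`). The energy identity then yields `K² ≤ C K δ`
(`FibreSol.isBigO_energy`, `FibreSol.isBigO_K`). The only delicate term is the work `J` of the
pressure. At low frequency only `r P` is under control, so `J` is rewritten with the flux defect `h
- ∫ g`, which the compatibility condition allows to be divided by `r` (`FibreSol.isBigO_J`). The
condition on `om` plays the same role for `χd`. The physical pressure stays bounded at low frequency
because the singular parts of `P` and of `grav * c / r` cancel (`FibreSol.isBigO_p`).

The passage between the slab and its fibres rests on pairings with functions of `y`. They commute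
with the partial Fourier transform (`pair_pfourier`) and separate the points of `L²(Ω)`. Through
them, horizontal weak derivatives become multiplication by `2πiξⱼ`, and a function with a weak
vertical derivative becomes absolutely continuous on almost every fibre (`WeakV.exists_eq`). Traces
are continuous functions of the pair `(f, ∂₃f)`, so they are the boundary values on fibres; that the
definition by approximation agrees with this uses the density of test functions in `H¹(Ω)`, proved
by uniqueness for a Neumann problem (`eq_zero_of_orthogonal_test`, `hasTrace_aux`). Together these
give the equivalence `solves_iff`.

The integrated estimate controls at most two vertical derivatives of the velocity, but with all
horizontal weights needed for order `s`. Higher vertical derivatives are recovered from the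
equations one at a time, each in exchange for one horizontal derivative (`regO_vertical`);
`Reg.memH` and `MemH.reg` compare the resulting anisotropic bounds with the norms of `Hᵐ(Ω)`. -/

/-- Lebesgue measure on the vertical interval `(0, b)`. -/
abbrev volI (b : ℝ) : Measure ℝ := (volume : Measure ℝ).restrict (Set.Ioo 0 b)

/-- `L²((0, b); ℂ)`. -/
abbrev L2I (b : ℝ) : Type := Lp ℂ 2 (volI b)

/-- Lebesgue measure on the slab. -/
abbrev volO (b : ℝ) : Measure (Plane × ℝ) := (volume : Measure (Plane × ℝ)).restrict (slab b)

/-! ### The slab as a product and its vertical fibres -/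

lemma volO_eq_prod (b : ℝ) : volO b = (volume : Measure Plane).prod (volI b) := by
  rw [volO, slab, Measure.volume_eq_prod, ← Measure.prod_restrict, Measure.restrict_univ]

lemma quasiMeasurePreserving_fst (b : ℝ) :
    Measure.QuasiMeasurePreserving (Prod.fst : Plane × ℝ → Plane) (volO b) volume := by
  rw [volO_eq_prod]; exact Measure.quasiMeasurePreserving_fst

lemma quasiMeasurePreserving_snd (b : ℝ) :
    Measure.QuasiMeasurePreserving (Prod.snd : Plane × ℝ → ℝ) (volO b) (volI b) := by
  rw [volO_eq_prod]; exact Measure.quasiMeasurePreserving_snd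

/-- A property that holds on almost every vertical fibre holds almost everywhere in the slab. -/
lemma ae_volO_of_ae_ae {b : ℝ} {F G : Plane × ℝ → ℂ} (hF : AEStronglyMeasurable F (volO b))
    (hG : AEStronglyMeasurable G (volO b))
    (h : ∀ᵐ x : Plane, ∀ᵐ y ∂volI b, F (x, y) = G (x, y)) : F =ᵐ[volO b] G := by
  rw [volO_eq_prod] at *
  have h1 := Measure.ae_ae_of_ae_prod hF.ae_eq_mk
  have h2 := Measure.ae_ae_of_ae_prod hG.ae_eq_mk
  have hm : MeasurableSet {z : Plane × ℝ | hF.mk F z = hG.mk G z}ᶜ :=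
    (measurableSet_eq_fun hF.stronglyMeasurable_mk.measurable
      hG.stronglyMeasurable_mk.measurable).compl
  have : hF.mk F =ᵐ[(volume : Measure Plane).prod (volI b)] hG.mk G := by
    change _ = _
    rw [Measure.measure_prod_null hm]
    filter_upwards [h, h1, h2] with x a1 a2 a3
    change volI b _ = 0
    refine (ae_iff (p := fun y => hF.mk F (x, y) = hG.mk G (x, y))).1 ?_
    filter_upwards [a1, a2, a3] with y c1 c2 c3
    rw [← c2, ← c3, c1]
  exact hF.ae_eq_mk.trans (this.trans hG.ae_eq_mk.symm)

lemma ae_ae_of_ae_volO {b : ℝ} {p : Plane × ℝ → Prop} (h : ∀ᵐ z ∂volO b, p z) :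
    ∀ᵐ x : Plane, ∀ᵐ y ∂volI b, p (x, y) := by
  rw [volO_eq_prod] at h
  exact Measure.ae_ae_of_ae_prod h

lemma integral_volO {b : ℝ} {F : Plane × ℝ → ℂ} (hF : Integrable F (volO b)) :
    ∫ z, F z ∂volO b = ∫ x : Plane, ∫ y, F (x, y) ∂volI b := by
  rw [volO_eq_prod] at *
  exact integral_prod _ hF

/-! ### Tensor products -/

lemma memLp_tens {b : ℝ} {φ : Plane → ℂ} {ψ : ℝ → ℂ} (hφ : MemLp φ 2 volume)
    (hψ : MemLp ψ 2 (volI b)) : MemLp (fun z : Plane × ℝ => φ z.1 * ψ z.2) 2 (volO b) := by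
  rw [volO_eq_prod]
  have hm : AEStronglyMeasurable (fun z : Plane × ℝ => φ z.1 * ψ z.2)
      ((volume : Measure Plane).prod (volI b)) :=
    hφ.1.comp_fst.mul hψ.1.comp_snd
  rw [memLp_two_iff_integrable_sq_norm hm]
  have h1 := (memLp_two_iff_integrable_sq_norm hφ.1).1 hφ
  have h2 := (memLp_two_iff_integrable_sq_norm hψ.1).1 hψ
  refine (h1.mul_prod h2).congr (Eventually.of_forall fun z => ?_)
  simp [mul_pow]

/-- The function `(x, y) ↦ φ(x) ψ(y)`. -/
def tens (b : ℝ) (φ : L2Sigma) (ψ : L2I b) : L2Omega b :=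
  (memLp_tens (Lp.memLp φ) (Lp.memLp ψ)).toLp _

lemma coeFn_tens (b : ℝ) (φ : L2Sigma) (ψ : L2I b) :
    tens b φ ψ =ᵐ[volO b] fun z => φ z.1 * ψ z.2 := MemLp.coeFn_toLp _

/-- `tens` as a bilinear map. -/
def tensₗ (b : ℝ) : L2Sigma →ₗ[ℂ] L2I b →ₗ[ℂ] L2Omega b :=
  LinearMap.mk₂ ℂ (tens b)
    (fun φ φ' ψ => by
      refine Lp.ext ?_
      filter_upwards [coeFn_tens b (φ + φ') ψ, coeFn_tens b φ ψ, coeFn_tens b φ' ψ,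
        Lp.coeFn_add (tens b φ ψ) (tens b φ' ψ),
        (quasiMeasurePreserving_fst b).ae (Lp.coeFn_add φ φ')] with z h1 h2 h3 h4 h5
      rw [h1, h4, Pi.add_apply, h2, h3, h5, Pi.add_apply, add_mul])
    (fun c φ ψ => by
      refine Lp.ext ?_
      filter_upwards [coeFn_tens b (c • φ) ψ, coeFn_tens b φ ψ,
        Lp.coeFn_smul c (tens b φ ψ),
        (quasiMeasurePreserving_fst b).ae (Lp.coeFn_smul c φ)] with z h1 h2 h4 h5
      rw [h1, h4, Pi.smul_apply, h2, h5, Pi.smul_apply, smul_mul_assoc])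
    (fun φ ψ ψ' => by
      refine Lp.ext ?_
      filter_upwards [coeFn_tens b φ (ψ + ψ'), coeFn_tens b φ ψ, coeFn_tens b φ ψ',
        Lp.coeFn_add (tens b φ ψ) (tens b φ ψ'),
        (quasiMeasurePreserving_snd b).ae (Lp.coeFn_add ψ ψ')] with z h1 h2 h3 h4 h5
      rw [h1, h4, Pi.add_apply, h2, h3, h5, Pi.add_apply, mul_add])
    (fun c φ ψ => by
      refine Lp.ext ?_
      filter_upwards [coeFn_tens b φ (c • ψ), coeFn_tens b φ ψ,
        Lp.coeFn_smul c (tens b φ ψ),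
        (quasiMeasurePreserving_snd b).ae (Lp.coeFn_smul c ψ)] with z h1 h2 h4 h5
      rw [h1, h4, Pi.smul_apply, h2, h5, Pi.smul_apply, mul_smul_comm])

@[simp] lemma tensₗ_apply (b : ℝ) (φ : L2Sigma) (ψ : L2I b) : tensₗ b φ ψ = tens b φ ψ := rfl

lemma inner_tens (b : ℝ) (φ φ' : L2Sigma) (ψ ψ' : L2I b) :
    ⟪tens b φ ψ, tens b φ' ψ'⟫_ℂ = ⟪φ, φ'⟫_ℂ * ⟪ψ, ψ'⟫_ℂ := by
  rw [L2.inner_def, L2.inner_def, L2.inner_def, ← integral_prod_mul, ← volO_eq_prod]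
  refine integral_congr_ae ?_
  filter_upwards [coeFn_tens b φ ψ, coeFn_tens b φ' ψ'] with z h1 h2
  rw [h1, h2]
  simp only [RCLike.inner_apply, map_mul]
  ring

/-- The isometric linearisation of `tens`. -/
def tensLift (b : ℝ) : L2Sigma ⊗[ℂ] L2I b →ₗ[ℂ] L2Omega b := TensorProduct.lift (tensₗ b)

/-- Both sides are sesquilinear, so pure tensors suffice, where Fubini splits the inner product.
Hence the linearised product is an isometry, which is what allows operators to be extended from it
to `L²(Ω)`. -/
lemma inner_tensLift (b : ℝ) (x y : L2Sigma ⊗[ℂ] L2I b) :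
    ⟪tensLift b x, tensLift b y⟫_ℂ = ⟪x, y⟫_ℂ := by
  induction x with
  | zero => simp
  | add x x' hx hx' => rw [map_add, inner_add_left, hx, hx', inner_add_left]
  | tmul φ ψ =>
    induction y with
    | zero => simp
    | add y y' hy hy' => rw [map_add, inner_add_right, hy, hy', inner_add_right]
    | tmul φ' ψ' =>
      simp only [tensLift, TensorProduct.lift.tmul, tensₗ_apply, inner_tens,
        TensorProduct.inner_tmul]

lemma norm_tensLift (b : ℝ) (x : L2Sigma ⊗[ℂ] L2I b) : ‖tensLift b x‖ = ‖x‖ := by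
  rw [norm_eq_sqrt_re_inner (𝕜 := ℂ), norm_eq_sqrt_re_inner (𝕜 := ℂ) x, inner_tensLift]

lemma norm_tens (b : ℝ) (φ : L2Sigma) (ψ : L2I b) : ‖tens b φ ψ‖ = ‖φ‖ * ‖ψ‖ := by
  have := norm_tensLift b (φ ⊗ₜ ψ)
  simpa [tensLift] using this

/-! ### Vertical pairings and the density of products -/

/-- `φ ↦ φ ⊗ ψ`. -/
def tensRight (b : ℝ) (ψ : L2I b) : L2Sigma →L[ℂ] L2Omega b :=
  ((tensₗ b).flip ψ).mkContinuous ‖ψ‖ fun φ => by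
    rw [LinearMap.flip_apply, tensₗ_apply, norm_tens, mul_comm]

/-- The vertical pairing `f ↦ ∫₀ᵇ f(·, y) conj (ψ y) dy`. -/
def pair (b : ℝ) (ψ : L2I b) : L2Omega b →L[ℂ] L2Sigma :=
  ContinuousLinearMap.adjoint (tensRight b ψ)

lemma inner_pair (b : ℝ) (ψ : L2I b) (φ : L2Sigma) (f : L2Omega b) :
    ⟪φ, pair b ψ f⟫_ℂ = ⟪tens b φ ψ, f⟫_ℂ :=
  ContinuousLinearMap.adjoint_inner_right _ _ _

lemma pair_tens (b : ℝ) (ψ ψ' : L2I b) (φ : L2Sigma) :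
    pair b ψ (tens b φ ψ') = ⟪ψ, ψ'⟫_ℂ • φ := by
  refine ext_inner_left ℂ fun v => ?_
  rw [inner_pair, inner_tens, inner_smul_right, mul_comm]

lemma pair_add (b : ℝ) (ψ ψ' : L2I b) (f : L2Omega b) :
    pair b (ψ + ψ') f = pair b ψ f + pair b ψ' f := by
  refine ext_inner_left ℂ fun v => ?_
  rw [inner_add_right, inner_pair, inner_pair, inner_pair, ← inner_add_left]
  rw [← tensₗ_apply, map_add]; rfl

lemma pair_smul (b : ℝ) (c : ℂ) (ψ : L2I b) (f : L2Omega b) :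
    pair b (c • ψ) f = conj c • pair b ψ f := by
  refine ext_inner_left ℂ fun v => ?_
  rw [inner_smul_right, inner_pair, inner_pair, ← inner_smul_left]
  rw [← tensₗ_apply, map_smul]; rfl

lemma integrable_inner_L2 {α : Type*} {m : MeasurableSpace α} {μ : Measure α} {F G : α → ℂ}
    (hF : MemLp F 2 μ) (hG : MemLp G 2 μ) : Integrable (fun z => F z * conj (G z)) μ :=
  hF.integrable_mul (hG.star)

/-- The pairing is defined abstractly as an adjoint. Testing it against indicators of sets of finite
measure and using Fubini identifies it with the fibrewise integral. -/
lemma coeFn_pair (b : ℝ) (ψ : L2I b) (f : L2Omega b) :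
    pair b ψ f =ᵐ[volume] fun x => ∫ y, f (x, y) * conj (ψ y) ∂volI b := by
  have key : ∀ s : Set Plane, MeasurableSet s → volume s < ⊤ →
      Integrable (fun z : Plane × ℝ => s.indicator 1 z.1 * (f z * conj (ψ z.2))) (volO b) := by
    intro s hs hsf
    have h1 : MemLp (fun z : Plane × ℝ => s.indicator (1 : Plane → ℂ) z.1 * ψ z.2) 2 (volO b) :=
      memLp_tens (memLp_indicator_const 2 hs 1 (Or.inr hsf.ne)) (Lp.memLp ψ)
    refine (integrable_inner_L2 (Lp.memLp f) h1).congr (Eventually.of_forall fun z => ?_)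
    simp only [Set.indicator, map_mul]
    split_ifs <;> simp
  refine ae_eq_of_forall_setIntegral_eq_of_sigmaFinite ?_ ?_ ?_
  · intro s hs hsf
    have : IsFiniteMeasure ((volume : Measure Plane).restrict s) := ⟨by simpa using hsf⟩
    exact ((Lp.memLp (pair b ψ f)).restrict s).integrable (by norm_num)
  · intro s hs hsf
    have := key s hs hsf
    rw [volO_eq_prod] at this
    have h2 := this.integral_prod_left
    rw [← integrable_indicator_iff hs]
    refine h2.congr (Eventually.of_forall fun x => ?_)
    simp only [Set.indicator]
    split_ifs <;> simp
  · intro s hs hsf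
    have h0 : MemLp (s.indicator (1 : Plane → ℂ)) 2 volume :=
      memLp_indicator_const 2 hs 1 (Or.inr hsf.ne)
    have h := inner_pair b ψ (h0.toLp _) f
    rw [L2.inner_def, L2.inner_def] at h
    have e1 : ∫ x in s, (pair b ψ f) x = ∫ x, ⟪(h0.toLp _ : L2Sigma) x, pair b ψ f x⟫_ℂ := by
      rw [← integral_indicator hs]
      refine integral_congr_ae ?_
      filter_upwards [h0.coeFn_toLp] with x hx
      rw [hx]
      simp only [Set.indicator]
      split_ifs <;> simp
    have e2 : ∫ z, ⟪tens b (h0.toLp _) ψ z, f z⟫_ℂ ∂volO b =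
        ∫ z : Plane × ℝ, s.indicator 1 z.1 * (f z * conj (ψ z.2)) ∂volO b := by
      refine integral_congr_ae ?_
      filter_upwards [coeFn_tens b (h0.toLp _) ψ,
        (quasiMeasurePreserving_fst b).ae h0.coeFn_toLp] with z h1 h2
      rw [h1, h2]
      simp only [Set.indicator]
      split_ifs <;> simp
    rw [e1, h, e2, integral_volO (key s hs hsf), ← integral_indicator hs]
    refine integral_congr_ae (Eventually.of_forall fun x => ?_)
    simp only [Set.indicator]
    split_ifs <;> simp

/-- The primitive of `u` vanishes at the rationals, hence everywhere by continuity, and Lebesgue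
differentiation gives `u = 0`. Only countably many tests occur, so that the lemma can be applied on
almost every fibre at once. -/
lemma ae_eq_zero_of_forall_rat {b : ℝ} {u : ℝ → ℂ} (hu : Integrable u (volI b))
    (h : ∀ q : ℚ, ∫ y, u y * conj ((Set.Iic (q : ℝ)).indicator (1 : ℝ → ℂ) y) ∂volI b = 0) :
    u =ᵐ[volI b] 0 := by
  have hu' : Integrable ((Set.Ioo 0 b).indicator u) volume :=
    (integrable_indicator_iff measurableSet_Ioo).2 hu
  set v := (Set.Ioo 0 b).indicator u with hv
  have hq : ∀ q : ℚ, ∫ y in Set.Iic (q : ℝ), v y = 0 := by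
    intro q
    rw [← h q, ← integral_indicator measurableSet_Iic, ← integral_indicator measurableSet_Ioo]
    refine integral_congr_ae (Eventually.of_forall fun y => ?_)
    simp only [hv, Set.indicator]
    split_ifs <;> simp
  have hc : Continuous fun y => ∫ t in (0 : ℝ)..y, v t :=
    intervalIntegral.continuous_primitive (fun _ _ => hu'.intervalIntegrable) 0
  have hz : (fun y => ∫ t in (0 : ℝ)..y, v t) = fun _ => 0 := by
    refine hc.ext_on Rat.denseRange_cast continuous_const ?_
    rintro _ ⟨q, rfl⟩
    have := intervalIntegral.integral_Iic_sub_Iic (μ := volume) (f := v) (a := 0) (b := (q : ℝ))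
      hu'.integrableOn hu'.integrableOn
    have h0 := hq 0
    rw [Rat.cast_zero] at h0
    rw [hq, h0, sub_zero] at this
    exact this.symm
  have hd := LocallyIntegrable.ae_hasDerivAt_integral hu'.locallyIntegrable
  refine (ae_restrict_iff' measurableSet_Ioo).2 ?_
  filter_upwards [hd] with y hy hyI
  have h1 := hy 0
  rw [hz] at h1
  have h2 := h1.unique (hasDerivAt_const y (0 : ℂ))
  simpa [hv, Set.indicator_of_mem hyI] using h2

/-- The pairings with the indicators of `(-∞, q]`, `q` rational, vanish outside one common null set
of `x`; on each remaining fibre the function is zero. -/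
lemma eq_zero_of_pair_eq_zero {b : ℝ} {f : L2Omega b} (h : ∀ ψ, pair b ψ f = 0) : f = 0 := by
  refine Lp.ext ((ae_volO_of_ae_ae (Lp.aestronglyMeasurable f)
    aestronglyMeasurable_zero ?_).trans (Lp.coeFn_zero ℂ 2 (volO b)).symm)
  have hq : ∀ q : ℚ, ∀ᵐ x : Plane,
      ∫ y, f (x, y) * conj ((Set.Iic (q : ℝ)).indicator (1 : ℝ → ℂ) y) ∂volI b = 0 := by
    intro q
    have hm : MemLp ((Set.Iic (q : ℝ)).indicator (1 : ℝ → ℂ)) 2 (volI b) :=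
      memLp_indicator_const 2 measurableSet_Iic 1 (Or.inr (measure_ne_top _ _))
    have h1 := coeFn_pair b (hm.toLp _) f
    rw [h] at h1
    filter_upwards [h1, Lp.coeFn_zero ℂ 2 (volume : Measure Plane)] with x a1 a2
    rw [a2] at a1
    refine Eq.trans (integral_congr_ae ?_) a1.symm
    filter_upwards [hm.coeFn_toLp] with y hy
    rw [hy]
  have hi : ∀ᵐ x : Plane, MemLp (fun y => f (x, y)) 2 (volI b) := by
    have h2 := (memLp_two_iff_integrable_sq_norm (Lp.aestronglyMeasurable f)).1 (Lp.memLp f)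
    have h3 := Lp.aestronglyMeasurable f
    change Integrable _ (volO b) at h2
    change AEStronglyMeasurable _ (volO b) at h3
    rw [volO_eq_prod] at h2 h3
    filter_upwards [h2.prod_right_ae, h3.prodMk_left] with x hx hx'
    exact (memLp_two_iff_integrable_sq_norm hx').2 hx
  filter_upwards [ae_all_iff.2 hq, hi] with x h1 h2
  exact ae_eq_zero_of_forall_rat (h2.integrable (by norm_num)) h1

/-- A function orthogonal to all products has vanishing vertical pairings, hence is zero. -/
lemma denseRange_tensLift (b : ℝ) : DenseRange (tensLift b) := by
  have : (LinearMap.range (tensLift b)).topologicalClosure = ⊤ := by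
    rw [Submodule.topologicalClosure_eq_top_iff, Submodule.eq_bot_iff]
    intro f hf
    refine eq_zero_of_pair_eq_zero fun ψ => ext_inner_left ℂ fun φ => ?_
    rw [inner_pair, inner_zero_right]
    refine (Submodule.mem_orthogonal _ _).1 hf _ ⟨φ ⊗ₜ ψ, ?_⟩
    simp [tensLift]
  rw [DenseRange, dense_iff_closure_eq]
  have h2 := congrArg (fun S : Submodule ℂ (L2Omega b) => (S : Set (L2Omega b))) this
  simpa [LinearMap.coe_range] using h2

/-! ### The partial Fourier transform -/

/-- The Fourier transform in the horizontal variables on `L²(Ω; ℂ)`. -/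
def pfourier (b : ℝ) : L2Omega b ≃ₗᵢ[ℂ] L2Omega b :=
  (TensorProduct.congr (Lp.fourierTransformₗᵢ Plane ℂ).toLinearEquiv
    (LinearEquiv.refl ℂ (L2I b))).extendOfIsometry (tensLift b) (tensLift b)
    (denseRange_tensLift b) (denseRange_tensLift b) (fun x => by
      rw [norm_tensLift, norm_tensLift]
      exact TensorProduct.norm_map (Lp.fourierTransformₗᵢ Plane ℂ).toLinearIsometry
        (LinearIsometry.id) x)

lemma pfourier_tens (b : ℝ) (φ : L2Sigma) (ψ : L2I b) :
    pfourier b (tens b φ ψ) = tens b (𝓕 φ) ψ := by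
  have h1 : tensLift b (φ ⊗ₜ ψ) = tens b φ ψ := by simp [tensLift]
  have h2 : tensLift b (𝓕 φ ⊗ₜ ψ) = tens b (𝓕 φ) ψ := by simp [tensLift]
  rw [← h1, ← h2, pfourier, LinearEquiv.extendOfIsometry_eq]
  rfl

/-- Both transforms are unitary and agree on products, so the identity follows by moving them to the
other side of the inner product. The partial transform has no pointwise formula here; this
commutation is how nearly all of its properties are obtained. -/
lemma pair_pfourier (b : ℝ) (ψ : L2I b) (f : L2Omega b) :
    pair b ψ (pfourier b f) = 𝓕 (pair b ψ f) := by
  refine ext_inner_left ℂ fun φ => ?_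
  obtain ⟨φ, rfl⟩ := (Lp.fourierTransformₗᵢ Plane ℂ).surjective φ
  change ⟪𝓕 φ, _⟫_ℂ = ⟪𝓕 φ, _⟫_ℂ
  rw [inner_pair, ← pfourier_tens, LinearIsometryEquiv.inner_map_map, Lp.inner_fourier_eq,
    inner_pair]

/-! ### Pairings with continuous functions -/

lemma memLp_continuous (b : ℝ) (ψ : C(ℝ, ℝ)) : MemLp (fun y => (ψ y : ℂ)) 2 (volI b) := by
  obtain ⟨K, hK⟩ := isCompact_Icc.exists_bound_of_continuousOn (s := Set.Icc 0 b)
    ψ.continuous.continuousOn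
  refine MemLp.of_bound (by fun_prop) K ?_
  filter_upwards [ae_restrict_mem measurableSet_Ioo] with y hy
  simpa using hK y (Set.Ioo_subset_Icc_self hy)

/-- The restriction of a real continuous function to `(0, b)`. -/
def cvec (b : ℝ) (ψ : C(ℝ, ℝ)) : L2I b := (memLp_continuous b ψ).toLp _

lemma coeFn_cvec (b : ℝ) (ψ : C(ℝ, ℝ)) : cvec b ψ =ᵐ[volI b] fun y => (ψ y : ℂ) :=
  MemLp.coeFn_toLp _

lemma coeFn_pair_cvec (b : ℝ) (ψ : C(ℝ, ℝ)) (f : L2Omega b) :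
    pair b (cvec b ψ) f =ᵐ[volume] fun x => ∫ y, f (x, y) * (ψ y : ℂ) ∂volI b := by
  filter_upwards [coeFn_pair b (cvec b ψ) f] with x hx
  rw [hx]
  refine integral_congr_ae ?_
  filter_upwards [coeFn_cvec b ψ] with y hy
  rw [hy, Complex.conj_ofReal]

lemma verticalIntegral_eq_pair (b : ℝ) (g : L2Omega b) :
    verticalIntegral b g = pair b (cvec b 1) g := by
  refine Lp.ext ?_
  filter_upwards [coeFn_pair_cvec b 1 g, (memLp_verticalIntegral b g).coeFn_toLp] with x h1 h2
  rw [verticalIntegral, h1, h2]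
  simp

lemma cvec_eq_of_eqOn {b : ℝ} {ψ ψ' : C(ℝ, ℝ)} (h : ∀ y ∈ Set.Ioo 0 b, ψ y = ψ' y) :
    cvec b ψ = cvec b ψ' := by
  refine Lp.ext ?_
  filter_upwards [coeFn_cvec b ψ, coeFn_cvec b ψ', ae_restrict_mem measurableSet_Ioo]
    with y h1 h2 h3
  rw [h1, h2, h y h3]

lemma cvec_add (b : ℝ) (ψ ψ' : C(ℝ, ℝ)) : cvec b (ψ + ψ') = cvec b ψ + cvec b ψ' := by
  refine Lp.ext ?_
  filter_upwards [coeFn_cvec b ψ, coeFn_cvec b ψ', coeFn_cvec b (ψ + ψ'),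
    Lp.coeFn_add (cvec b ψ) (cvec b ψ')] with y h1 h2 h3 h4
  rw [h3, h4, Pi.add_apply, h1, h2]; simp

lemma cvec_smul (b : ℝ) (c : ℝ) (ψ : C(ℝ, ℝ)) : cvec b (c • ψ) = (c : ℂ) • cvec b ψ := by
  refine Lp.ext ?_
  filter_upwards [coeFn_cvec b ψ, coeFn_cvec b (c • ψ), Lp.coeFn_smul (c : ℂ) (cvec b ψ)]
    with y h1 h3 h4
  rw [h3, h4, Pi.smul_apply, h1]; simp

/-- Smooth functions with compact support in `(0, b)`. -/
def IsTestI (b : ℝ) (ψ : C(ℝ, ℝ)) : Prop :=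
  ContDiff ℝ ∞ ψ ∧ HasCompactSupport ψ ∧ tsupport ψ ⊆ Set.Ioo 0 b

lemma eq_zero_of_inner_test {b : ℝ} {v : L2I b}
    (h : ∀ ψ, IsTestI b ψ → ⟪cvec b ψ, v⟫_ℂ = 0) : v = 0 := by
  refine Lp.ext (EventuallyEq.trans ?_ (Lp.coeFn_zero ℂ 2 (volI b)).symm)
  refine (ae_restrict_iff' measurableSet_Ioo).2 ?_
  have hl : LocallyIntegrableOn v (Set.Ioo 0 b) volume :=
    IntegrableOn.locallyIntegrableOn ((Lp.memLp v).integrable (by norm_num))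
  refine isOpen_Ioo.ae_eq_zero_of_integral_contDiff_smul_eq_zero hl fun φ hφ hc hs => ?_
  have h1 := h ⟨φ, hφ.continuous⟩ ⟨hφ, hc, hs⟩
  rw [L2.inner_def] at h1
  rw [← setIntegral_eq_integral_of_forall_compl_eq_zero (s := Set.Ioo 0 b)]
  · rw [← h1]
    refine integral_congr_ae ?_
    filter_upwards [coeFn_cvec b ⟨φ, hφ.continuous⟩] with y hy
    rw [hy]
    simp [mul_comm]
  · intro x hx
    rw [image_eq_zero_of_notMem_tsupport (fun hx' => hx (hs hx')), zero_smul]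

/-- For fixed `φ` the map `ψ ↦ φ ⊗ ψ` is bounded, so its adjoint sends `f` to a vector of `L²(0,
b)`. This vector is orthogonal to the test functions, hence zero, and therefore all pairings vanish.
-/
lemma eq_zero_of_pair_test {b : ℝ} {f : L2Omega b}
    (h : ∀ ψ, IsTestI b ψ → pair b (cvec b ψ) f = 0) : f = 0 := by
  refine eq_zero_of_pair_eq_zero fun ψ => ext_inner_left ℂ fun φ => ?_
  let L : L2I b →L[ℂ] L2Omega b := (tensₗ b φ).mkContinuous ‖φ‖ fun ψ => by
    rw [tensₗ_apply, norm_tens]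
  have hL : ∀ ψ, L ψ = tens b φ ψ := fun _ => rfl
  have hz : ContinuousLinearMap.adjoint L f = 0 := by
    refine eq_zero_of_inner_test fun ψ hψ => ?_
    rw [ContinuousLinearMap.adjoint_inner_right, hL, ← inner_pair, h ψ hψ, inner_zero_right]
  rw [inner_pair, ← hL, ← ContinuousLinearMap.adjoint_inner_right, hz, inner_zero_right,
    inner_zero_right]

/-! ### Horizontal derivatives on the Fourier side -/

/-- The horizontal unit vectors. -/
abbrev hdir (j : Fin 2) : Plane := EuclideanSpace.single j 1

lemma inner_hdir (ξ : Plane) (j : Fin 2) : ⟪ξ, hdir j⟫_ℝ = ξ j := by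
  simp [hdir, EuclideanSpace.inner_single_right]

lemma locallyIntegrable_mul_Lp (σ : Plane → ℂ) (hσ : Continuous σ) (f : L2Sigma) :
    LocallyIntegrable (fun ξ => σ ξ * f ξ) := by
  have := (Lp.memLp f).locallyIntegrable (by norm_num)
  rw [locallyIntegrable_iff] at this ⊢
  intro K hK
  exact (this K hK).continuousOn_mul hσ.continuousOn hK

lemma toTemperedDistribution_injective {f g : L2Sigma} (h : (f : 𝓢'(Plane, ℂ)) = g) : f = g := by
  have := LinearMap.ker_eq_bot.1
    (Lp.ker_toTemperedDistributionCLM_eq_bot (F := ℂ) (μ := (volume : Measure Plane)) (p := 2))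
  exact this h

lemma temperedDistribution_add_apply (S T : 𝓢'(Plane, ℂ)) (g : 𝓢(Plane, ℂ)) :
    (S + T) g = S g + T g := rfl

lemma temperedDistribution_smul_apply (c : ℂ) (T : 𝓢'(Plane, ℂ)) (g : 𝓢(Plane, ℂ)) :
    (c • T) g = c * T g := rfl

/-- The equation `∂₀ f₀ + ∂₁ f₁ = w` (with signs) for tempered distributions, on the Fourier side. -/
lemma lineDeriv_add_eq_iff (m₀ m₁ : Plane) (f₀ f₁ w : L2Sigma) :
    ∂_{m₀} (f₀ : 𝓢'(Plane, ℂ)) + ∂_{m₁} (f₁ : 𝓢'(Plane, ℂ)) = w ↔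
      (𝓕 w : L2Sigma) =ᵐ[volume] fun ξ => 2 * Real.pi * Complex.I *
        ((⟪ξ, m₀⟫_ℝ : ℂ) * (𝓕 f₀ : L2Sigma) ξ + (⟪ξ, m₁⟫_ℝ : ℂ) * (𝓕 f₁ : L2Sigma) ξ) := by
  have hinj : ∂_{m₀} (f₀ : 𝓢'(Plane, ℂ)) + ∂_{m₁} (f₁ : 𝓢'(Plane, ℂ)) = w ↔
      𝓕 (∂_{m₀} (f₀ : 𝓢'(Plane, ℂ)) + ∂_{m₁} (f₁ : 𝓢'(Plane, ℂ))) = 𝓕 (w : 𝓢'(Plane, ℂ)) :=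
    ⟨fun h => by rw [h], fun h => by
      have := congrArg (fun T : 𝓢'(Plane, ℂ) => 𝓕⁻ T) h
      simpa using this⟩
  have ht : ∀ m : Plane, (fun ξ : Plane => (⟪ξ, m⟫_ℝ : ℂ)).HasTemperateGrowth := fun m => by
    fun_prop
  have hc : ∀ m : Plane, Continuous fun ξ : Plane => (⟪ξ, m⟫_ℝ : ℂ) := fun m => by fun_prop
  have hint : ∀ (m : Plane) (f : L2Sigma) (g : 𝓢(Plane, ℂ)),
      Integrable fun ξ => g ξ * ((⟪ξ, m⟫_ℝ : ℂ) * f ξ) := by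
    intro m f g
    have := ((SchwartzMap.smulLeftCLM ℂ (fun ξ : Plane => (⟪ξ, m⟫_ℝ : ℂ)) g).memLp 2
      volume).integrable_mul (Lp.memLp f)
    refine this.congr (Eventually.of_forall fun ξ => ?_)
    simp only [Pi.mul_apply, SchwartzMap.smulLeftCLM_apply_apply (ht m), smul_eq_mul]
    ring
  have hval : ∀ g : 𝓢(Plane, ℂ),
      (𝓕 (∂_{m₀} (f₀ : 𝓢'(Plane, ℂ)) + ∂_{m₁} (f₁ : 𝓢'(Plane, ℂ)))) g =
      ∫ ξ, g ξ * (2 * Real.pi * Complex.I *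
        ((⟪ξ, m₀⟫_ℝ : ℂ) * (𝓕 f₀ : L2Sigma) ξ + (⟪ξ, m₁⟫_ℝ : ℂ) * (𝓕 f₁ : L2Sigma) ξ)) := by
    intro g
    have e : ∀ (m : Plane) (f : L2Sigma), (𝓕 (∂_{m} (f : 𝓢'(Plane, ℂ)))) g =
        2 * Real.pi * Complex.I * ∫ ξ, g ξ * ((⟪ξ, m⟫_ℝ : ℂ) * (𝓕 f : L2Sigma) ξ) := by
      intro m f
      rw [TemperedDistribution.fourier_lineDerivOp_eq, Lp.fourier_toTemperedDistribution_eq]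
      rw [temperedDistribution_smul_apply]
      congr 1
      rw [TemperedDistribution.smulLeftCLM_apply_apply, Lp.toTemperedDistribution_apply]
      refine integral_congr_ae (Eventually.of_forall fun ξ => ?_)
      simp only [SchwartzMap.smulLeftCLM_apply_apply (ht m), smul_eq_mul]
      ring
    have : 𝓕 (∂_{m₀} (f₀ : 𝓢'(Plane, ℂ)) + ∂_{m₁} (f₁ : 𝓢'(Plane, ℂ))) =
        𝓕 (∂_{m₀} (f₀ : 𝓢'(Plane, ℂ))) + 𝓕 (∂_{m₁} (f₁ : 𝓢'(Plane, ℂ))) :=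
      FourierTransform.fourier_add _ _
    rw [this, temperedDistribution_add_apply, e, e, ← mul_add, ← integral_add (hint _ _ _) (hint _ _ _), ← integral_const_mul]
    refine integral_congr_ae (Eventually.of_forall fun ξ => ?_)
    ring
  rw [hinj]
  constructor
  · intro h
    refine ae_eq_of_integral_contDiff_smul_eq ((Lp.memLp _).locallyIntegrable (by norm_num)) ?_ ?_
    · have h1 := (locallyIntegrable_mul_Lp _ (hc m₀) (𝓕 f₀)).add
        (locallyIntegrable_mul_Lp _ (hc m₁) (𝓕 f₁))
      exact h1.smul (2 * Real.pi * Complex.I)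
    · intro φ hφ hcs
      have hc' : HasCompactSupport (fun z => (φ z : ℂ)) :=
        hcs.comp_left (g := fun r : ℝ => (r : ℂ)) rfl
      have hφ' : ContDiff ℝ ∞ (fun z => (φ z : ℂ)) := Complex.ofRealCLM.contDiff.comp hφ
      have h1 := congrArg (fun T : 𝓢'(Plane, ℂ) => T (hc'.toSchwartzMap hφ')) h
      rw [hval, Lp.fourier_toTemperedDistribution_eq] at h1
      simp only [Lp.toTemperedDistribution_apply] at h1
      refine Eq.trans (integral_congr_ae (Eventually.of_forall fun z => ?_))
        (h1.symm.trans (integral_congr_ae (Eventually.of_forall fun z => ?_)))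
      · simp only [Complex.real_smul, smul_eq_mul]
        rfl
      · simp only [Complex.real_smul]
        rfl
  · intro h
    ext g
    rw [hval, Lp.fourier_toTemperedDistribution_eq, Lp.toTemperedDistribution_apply]
    refine integral_congr_ae ?_
    filter_upwards [h] with ξ hξ
    rw [hξ, smul_eq_mul]

/-- A first order identity that holds against all test functions holds in the sense of tempered
distributions. -/
lemma fourier_eq_of_forall_test (a : L2Sigma) (f : Fin 2 → L2Sigma)
    (h : ∀ η : Plane → ℂ, ContDiff ℝ ∞ η → HasCompactSupport η →
      ∫ x, (a x * η x + (f 0 x * fderiv ℝ η x (hdir 0) + f 1 x * fderiv ℝ η x (hdir 1))) = 0) :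
    (𝓕 a : L2Sigma) =ᵐ[volume] fun ξ => 2 * Real.pi * Complex.I *
        ((ξ 0 : ℂ) * (𝓕 (f 0) : L2Sigma) ξ + (ξ 1 : ℂ) * (𝓕 (f 1) : L2Sigma) ξ) := by
  have hS : ∀ η : 𝓢(Plane, ℂ),
      ∫ x, (a x * η x + (f 0 x * (∂_{hdir 0} η) x + f 1 x * (∂_{hdir 1} η) x)) = 0 := by
    intro η
    -- The hypothesis only concerns compactly supported functions. A Schwartz function is cut off by
    -- `χ(ε x)`, whose gradient is `O(ε)`, and `ε → 0` by dominated convergence.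
    let χ : ContDiffBump (0 : Plane) := ⟨1, 2, one_pos, one_lt_two⟩
    have hχ : ContDiff ℝ ∞ (fun x : Plane => (χ x : ℂ)) :=
      Complex.ofRealCLM.contDiff.comp χ.contDiff
    have hχc : HasCompactSupport (fun x : Plane => (χ x : ℂ)) :=
      χ.hasCompactSupport.comp_left (g := fun r : ℝ => (r : ℂ)) rfl
    obtain ⟨K, hK⟩ := (hχ.continuous_fderiv (by simp)).bounded_above_of_compact_support
      (hχc.fderiv (𝕜 := ℝ))
    let ε : ℕ → ℝ := fun n => 1 / ((n : ℝ) + 1)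
    have hε0 : ∀ n, 0 < ε n := fun n => by positivity
    have hε1 : ∀ n, ε n ≤ 1 := fun n => by
      simp only [ε]; rw [div_le_one (by positivity)]; linarith [(n.cast_nonneg : (0 : ℝ) ≤ n)]
    have hεt : Tendsto ε atTop (𝓝 0) := tendsto_one_div_add_atTop_nhds_zero_nat
    let X : ℕ → Plane → ℂ := fun n x => (χ (ε n • x) : ℂ)
    have hX : ∀ n, ContDiff ℝ ∞ (X n) := fun n => hχ.comp (contDiff_const_smul (ε n))
    have hXc : ∀ n, HasCompactSupport (X n) := fun n => hχc.comp_smul (hε0 n).ne'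
    have hd : ∀ (n : ℕ) (x e : Plane), fderiv ℝ (fun x => X n x * η x) x e =
        X n x * (∂_{e} η) x + ε n * fderiv ℝ (fun x : Plane => (χ x : ℂ)) (ε n • x) e * η x := by
      intro n x e
      have h1 : HasFDerivAt (X n) ((fderiv ℝ (fun x : Plane => (χ x : ℂ)) (ε n • x)).comp
          (ε n • ContinuousLinearMap.id ℝ Plane)) x :=
        ((hχ.differentiable (by simp)) _).hasFDerivAt.comp x
          ((ContinuousLinearMap.id ℝ Plane).hasFDerivAt.const_smul (ε n))
      have h2 := (h1.mul ((η.differentiable) x).hasFDerivAt).fderiv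
      change fderiv ℝ (X n * ⇑η) x e = _
      rw [h2]
      simp [SchwartzMap.lineDerivOp_apply_eq_fderiv]
      ring
    have hn : ∀ n, ∫ x, (a x * (X n x * η x) +
        (f 0 x * (X n x * (∂_{hdir 0} η) x +
          ε n * fderiv ℝ (fun x : Plane => (χ x : ℂ)) (ε n • x) (hdir 0) * η x) +
        f 1 x * (X n x * (∂_{hdir 1} η) x +
          ε n * fderiv ℝ (fun x : Plane => (χ x : ℂ)) (ε n • x) (hdir 1) * η x))) = 0 := by
      intro n
      have := h (fun x => X n x * η x) ((hX n).mul (η.smooth _)) ((hXc n).mul_right)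
      simpa only [hd] using this
    have hη := η.memLp 2 (volume : Measure Plane)
    have hη' : ∀ e : Plane, MemLp (∂_{e} η : 𝓢(Plane, ℂ)) 2 (volume : Measure Plane) := fun e =>
      SchwartzMap.memLp _ 2 volume
    have hbd : Integrable fun x => ‖a x‖ * ‖η x‖ +
        (‖f 0 x‖ * (‖(∂_{hdir 0} η) x‖ + K * ‖η x‖) +
          ‖f 1 x‖ * (‖(∂_{hdir 1} η) x‖ + K * ‖η x‖)) :=
      ((Lp.memLp a).norm.integrable_mul hη.norm).add
        (((Lp.memLp (f 0)).norm.integrable_mul ((hη' _).norm.add (hη.norm.const_mul K))).add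
        ((Lp.memLp (f 1)).norm.integrable_mul ((hη' _).norm.add (hη.norm.const_mul K))))
    have hfd : ∀ e : Plane, Continuous fun x => fderiv ℝ (fun x : Plane => (χ x : ℂ)) x e :=
      fun e => (hχ.continuous_fderiv (by simp)).clm_apply continuous_const
    have hlim := tendsto_integral_of_dominated_convergence (μ := (volume : Measure Plane))
      (F := fun n x => a x * (X n x * η x) +
        (f 0 x * (X n x * (∂_{hdir 0} η) x +
          ε n * fderiv ℝ (fun x : Plane => (χ x : ℂ)) (ε n • x) (hdir 0) * η x) +
        f 1 x * (X n x * (∂_{hdir 1} η) x +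
          ε n * fderiv ℝ (fun x : Plane => (χ x : ℂ)) (ε n • x) (hdir 1) * η x)))
      (f := fun x => a x * η x + (f 0 x * (∂_{hdir 0} η) x + f 1 x * (∂_{hdir 1} η) x))
      _ ?_ hbd ?_ ?_
    · simp only [hn] at hlim
      exact tendsto_nhds_unique hlim tendsto_const_nhds
    · intro n
      have c1 : Continuous (X n) := (hX n).continuous
      have c2 : ∀ e, Continuous fun x => fderiv ℝ (fun x : Plane => (χ x : ℂ)) (ε n • x) e :=
        fun e => (hfd e).comp (continuous_const_smul _)
      have c3 : ∀ e : Plane, Continuous fun x => X n x * (∂_{e} η) x +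
          ε n * fderiv ℝ (fun x : Plane => (χ x : ℂ)) (ε n • x) e * η x := fun e =>
        (c1.mul (∂_{e} η : 𝓢(Plane, ℂ)).continuous).add ((continuous_const.mul (c2 e)).mul η.continuous)
      exact ((Lp.aestronglyMeasurable a).mul (c1.mul η.continuous).aestronglyMeasurable).add
        (((Lp.aestronglyMeasurable (f 0)).mul (c3 _).aestronglyMeasurable).add
        ((Lp.aestronglyMeasurable (f 1)).mul (c3 _).aestronglyMeasurable))
    · intro n
      refine Eventually.of_forall fun x => ?_
      have b1 : ‖X n x‖ ≤ 1 := by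
        simp only [X, Complex.norm_real, Real.norm_eq_abs, abs_of_nonneg χ.nonneg]
        exact χ.le_one
      have b2 : ∀ j, ‖X n x * (∂_{hdir j} η) x + ε n *
          fderiv ℝ (fun x : Plane => (χ x : ℂ)) (ε n • x) (hdir j) * η x‖ ≤
          ‖(∂_{hdir j} η) x‖ + K * ‖η x‖ := by
        intro j
        have hd1 : ‖fderiv ℝ (fun x : Plane => (χ x : ℂ)) (ε n • x) (hdir j)‖ ≤ K := by
          refine (ContinuousLinearMap.le_opNorm _ _).trans ?_
          simpa using hK (ε n • x)
        have hK0 : 0 ≤ K := (norm_nonneg _).trans hd1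
        refine (norm_add_le _ _).trans (add_le_add ?_ ?_)
        · rw [norm_mul]; exact mul_le_of_le_one_left (norm_nonneg _) b1
        · rw [norm_mul, norm_mul, Complex.norm_real, Real.norm_eq_abs, abs_of_pos (hε0 n)]
          gcongr
          calc _ ≤ 1 * K := mul_le_mul (hε1 n) hd1 (norm_nonneg _) zero_le_one
            _ = K := one_mul K
      refine (norm_add_le _ _).trans (add_le_add ?_ ((norm_add_le _ _).trans (add_le_add ?_ ?_)))
      · rw [norm_mul, norm_mul]
        gcongr
        exact mul_le_of_le_one_left (norm_nonneg _) b1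
      · rw [norm_mul]; gcongr; exact b2 0
      · rw [norm_mul]; gcongr; exact b2 1
    · refine Eventually.of_forall fun x => ?_
      have hsx : Tendsto (fun n => ε n • x) atTop (𝓝 0) := by
        simpa using hεt.smul_const x
      have t1 : Tendsto (fun n => X n x) atTop (𝓝 1) := by
        have := ((hχ.continuous.tendsto 0).comp hsx)
        simpa [Function.comp_def, χ.one_of_mem_closedBall, χ] using this
      have t2 : ∀ e : Plane, Tendsto (fun n => X n x * (∂_{e} η) x + ε n *
          fderiv ℝ (fun x : Plane => (χ x : ℂ)) (ε n • x) e * η x) atTop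
          (𝓝 ((∂_{e} η) x)) := by
        intro e
        have s1 := t1.mul_const ((∂_{e} η) x)
        have s2 := (((hfd e).tendsto 0).comp hsx)
        have s3 : Tendsto (fun n => (ε n : ℂ)) atTop (𝓝 0) := by
          simpa [Function.comp_def] using (Complex.continuous_ofReal.tendsto 0).comp hεt
        have s4 := s1.add ((s3.mul s2).mul_const (η x))
        simpa [Function.comp_def] using s4
      have s1 := (t1.mul_const (η x)).const_mul (a x)
      rw [one_mul] at s1
      exact s1.add (((t2 _).const_mul _).add ((t2 _).const_mul _))
  have hD : ∂_{hdir 0} (f 0 : 𝓢'(Plane, ℂ)) + ∂_{hdir 1} (f 1 : 𝓢'(Plane, ℂ)) = a := by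
    ext η
    rw [temperedDistribution_add_apply, TemperedDistribution.lineDerivOp_apply_apply, TemperedDistribution.lineDerivOp_apply_apply,
      map_neg, map_neg, Lp.toTemperedDistribution_apply, Lp.toTemperedDistribution_apply,
      Lp.toTemperedDistribution_apply]
    have i : ∀ (g : L2Sigma) (θ : 𝓢(Plane, ℂ)), Integrable fun x => g x * θ x := fun g θ =>
      (Lp.memLp g).integrable_mul (θ.memLp 2 volume)
    have e := hS η
    have i2 : Integrable fun x => f 0 x * (∂_{hdir 0} η) x + f 1 x * (∂_{hdir 1} η) x :=
      (i (f 0) (∂_{hdir 0} η)).add (i (f 1) (∂_{hdir 1} η))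
    rw [integral_add (i a η) i2, integral_add (i (f 0) (∂_{hdir 0} η)) (i (f 1) (∂_{hdir 1} η))] at e
    simp only [smul_eq_mul, mul_comm _ (a _), mul_comm _ (f 0 _), mul_comm _ (f 1 _)]
    linear_combination -e
  have := (lineDeriv_add_eq_iff _ _ _ _ _).1 hD
  simpa only [inner_hdir] using this

lemma fourier_eq_of_forall_test_single (j : Fin 2) (a f : L2Sigma)
    (h : ∀ η : Plane → ℂ, ContDiff ℝ ∞ η → HasCompactSupport η →
      ∫ x, (a x * η x + f x * fderiv ℝ η x (hdir j)) = 0) :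
    (𝓕 a : L2Sigma) =ᵐ[volume] fun ξ => 2 * Real.pi * Complex.I * ξ j * (𝓕 f : L2Sigma) ξ := by
  have h0 : (𝓕 (0 : L2Sigma) : L2Sigma) = 0 := (Lp.fourierTransformₗᵢ Plane ℂ).map_zero
  have hz := Lp.coeFn_zero ℂ 2 (volume : Measure Plane)
  fin_cases j
  · have := fourier_eq_of_forall_test a ![f, 0] (fun η h1 h2 => by
      rw [← h η h1 h2]
      refine integral_congr_ae ?_
      filter_upwards [hz] with x hx
      simp)
    filter_upwards [this] with ξ h1
    rw [h1]
    simp [h0]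
    ring
  · have := fourier_eq_of_forall_test a ![0, f] (fun η h1 h2 => by
      rw [← h η h1 h2]
      refine integral_congr_ae ?_
      filter_upwards [hz] with x hx
      simp)
    filter_upwards [this] with ξ h1
    rw [h1]
    simp [h0]
    ring

/-! ### Multiplication by symbols in the slab -/

/-- `G = σ(ξ) F`. -/
def MulRel {b : ℝ} (σ : Plane → ℂ) (F G : L2Omega b) : Prop :=
  G =ᵐ[volO b] fun z => σ z.1 * F z

lemma MulRel.pair {b : ℝ} {σ : Plane → ℂ} {F G : L2Omega b} (h : MulRel σ F G) (ψ : L2I b) :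
    pair b ψ G =ᵐ[volume] fun ξ => σ ξ * pair b ψ F ξ := by
  filter_upwards [coeFn_pair b ψ F, coeFn_pair b ψ G, ae_ae_of_ae_volO h] with ξ h1 h2 h3
  rw [h1, h2, ← integral_const_mul]
  refine integral_congr_ae ?_
  filter_upwards [h3] with y hy
  rw [hy, mul_assoc]

lemma aestronglyMeasurable_fst {b : ℝ} {σ : Plane → ℂ} (hσ : Measurable σ) :
    AEStronglyMeasurable (fun z : Plane × ℝ => σ z.1) (volO b) :=
  (hσ.comp measurable_fst).aestronglyMeasurable

lemma memLp_mul_of_norm_le {b : ℝ} {σ : Plane → ℂ} (hσ : Measurable σ) {K : ℝ}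
    (hK : ∀ ξ, ‖σ ξ‖ ≤ K) (F : L2Omega b) : MemLp (fun z => σ z.1 * F z) 2 (volO b) :=
  (Lp.memLp F).of_le_mul ((aestronglyMeasurable_fst hσ).mul (Lp.aestronglyMeasurable F))
    (Eventually.of_forall fun z => by
      rw [norm_mul]; exact mul_le_mul_of_nonneg_right (hK z.1) (norm_nonneg _))

/-- Since `σ` may be unbounded, `σ F` is not known to be in `L²`. After multiplication by the weight
`1 / (1 + |σ|)` both sides are square integrable and can be compared through their pairings; the
weight is nonzero and is cancelled at the end. -/
lemma mulRel_of_pair {b : ℝ} {σ : Plane → ℂ} (hσ : Measurable σ) {F G : L2Omega b}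
    (h : ∀ ψ, IsTestI b ψ → StationaryWaves.pair b (cvec b ψ) G =ᵐ[volume]
      fun ξ => σ ξ * StationaryWaves.pair b (cvec b ψ) F ξ) : MulRel σ F G := by
  let w : Plane → ℂ := fun ξ => ((1 + ‖σ ξ‖ : ℝ) : ℂ)⁻¹
  have hw : Measurable w := by fun_prop
  have hpos : ∀ ξ, 0 < 1 + ‖σ ξ‖ := fun ξ => by positivity
  have hw0 : ∀ ξ, w ξ ≠ 0 := fun ξ => inv_ne_zero (by exact_mod_cast (hpos ξ).ne')
  have hnw : ∀ ξ, ‖w ξ‖ = (1 + ‖σ ξ‖)⁻¹ := fun ξ => by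
    simp only [w, norm_inv, Complex.norm_real, Real.norm_eq_abs, abs_of_pos (hpos ξ)]
  have h1 : ∀ ξ, ‖w ξ‖ ≤ 1 := fun ξ => by
    rw [hnw]; exact inv_le_one_of_one_le₀ (by linarith [norm_nonneg (σ ξ)])
  have h2 : ∀ ξ, ‖w ξ * σ ξ‖ ≤ 1 := fun ξ => by
    rw [norm_mul, hnw, inv_mul_le_iff₀ (hpos ξ)]; linarith
  have mA := memLp_mul_of_norm_le hw h1 G
  have mB := memLp_mul_of_norm_le (hw.mul hσ) h2 F
  have rA : MulRel w G (mA.toLp _) := mA.coeFn_toLp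
  have rB : MulRel (fun ξ => w ξ * σ ξ) F (mB.toLp _) := mB.coeFn_toLp
  have hAB : mA.toLp _ = mB.toLp _ := by
    refine sub_eq_zero.1 (eq_zero_of_pair_test fun ψ hψ => ?_)
    rw [map_sub, sub_eq_zero]
    refine Lp.ext ?_
    filter_upwards [rA.pair (cvec b ψ), rB.pair (cvec b ψ), h ψ hψ] with ξ a1 a2 a3
    rw [a1, a2, a3, mul_assoc]
  rw [hAB] at rA
  unfold MulRel at *
  filter_upwards [rA, rB] with z a1 a2
  rw [a1, mul_assoc] at a2
  exact mul_left_cancel₀ (hw0 _) a2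

/-! ### Test functions -/

lemma dir_castSucc (j : Fin 2) : dir j.castSucc = (hdir j, 0) := by
  fin_cases j <;> rfl

lemma dir_two : dir 2 = (0, 1) := rfl

lemma hasFDerivAt_tens {η : Plane → ℂ} {ψ : ℝ → ℝ} (hη : ContDiff ℝ ∞ η) (hψ : ContDiff ℝ ∞ ψ)
    (z : Plane × ℝ) (v : Plane × ℝ) :
    fderiv ℝ (fun z : Plane × ℝ => η z.1 * (ψ z.2 : ℂ)) z v =
      fderiv ℝ η z.1 v.1 * (ψ z.2 : ℂ) + η z.1 * ((deriv ψ z.2 * v.2 : ℝ) : ℂ) := by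
  have h1 : HasFDerivAt (fun z : Plane × ℝ => η z.1)
      ((fderiv ℝ η z.1).comp (ContinuousLinearMap.fst ℝ Plane ℝ)) z :=
    ((hη.differentiable (by simp)) z.1).hasFDerivAt.comp z hasFDerivAt_fst
  have h2 : HasFDerivAt (fun z : Plane × ℝ => ((ψ z.2 : ℝ) : ℂ))
      (Complex.ofRealCLM.comp ((fderiv ℝ ψ z.2).comp (ContinuousLinearMap.snd ℝ Plane ℝ))) z :=
    Complex.ofRealCLM.hasFDerivAt.comp z
      (((hψ.differentiable (by simp)) z.2).hasFDerivAt.comp z hasFDerivAt_snd)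
  have h3 := (h1.mul h2).fderiv
  change fderiv ℝ ((fun z : Plane × ℝ => η z.1) * fun z : Plane × ℝ => ((ψ z.2 : ℝ) : ℂ)) z v = _
  rw [h3]
  have h4 : fderiv ℝ ψ z.2 v.2 = deriv ψ z.2 * v.2 := by
    have := (fderiv ℝ ψ z.2).map_smul v.2 1
    rw [smul_eq_mul, mul_one] at this
    rw [this, fderiv_apply_one_eq_deriv, smul_eq_mul, mul_comm]
  change η z.1 * ((fderiv ℝ ψ z.2 v.2 : ℝ) : ℂ) + (ψ z.2 : ℂ) * fderiv ℝ η z.1 v.1 = _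
  rw [h4]
  ring

lemma contDiff_tens {η : Plane → ℂ} {ψ : ℝ → ℝ} (hη : ContDiff ℝ ∞ η) (hψ : ContDiff ℝ ∞ ψ) :
    ContDiff ℝ ∞ fun z : Plane × ℝ => η z.1 * (ψ z.2 : ℂ) :=
  (hη.comp contDiff_fst).mul (Complex.ofRealCLM.contDiff.comp (hψ.comp contDiff_snd))

lemma tsupport_tens_subset {η : Plane → ℂ} {ψ : ℝ → ℝ} :
    tsupport (fun z : Plane × ℝ => η z.1 * (ψ z.2 : ℂ)) ⊆ tsupport η ×ˢ tsupport ψ := by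
  refine closure_minimal ?_ ((isClosed_tsupport _).prod (isClosed_tsupport _))
  intro z hz
  have h1 : η z.1 ≠ 0 := fun h => hz (by simp [h])
  have h2 : ψ z.2 ≠ 0 := fun h => hz (by simp [h])
  exact ⟨subset_tsupport _ h1, subset_tsupport _ h2⟩

lemma hasCompactSupport_tens {η : Plane → ℂ} {ψ : ℝ → ℝ} (hη : HasCompactSupport η)
    (hψ : HasCompactSupport ψ) : HasCompactSupport fun z : Plane × ℝ => η z.1 * (ψ z.2 : ℂ) :=
  (hη.isCompact.prod hψ.isCompact).of_isClosed_subset (isClosed_tsupport _) tsupport_tens_subset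

lemma integral_mul_tens {b : ℝ} (f : L2Omega b) {η : Plane → ℂ} (hη : MemLp η 2 volume)
    (ψ : C(ℝ, ℝ)) : ∫ z, f z * (η z.1 * (ψ z.2 : ℂ)) ∂volO b =
      ∫ x, pair b (cvec b ψ) f x * η x := by
  have hm := memLp_tens hη (memLp_continuous b ψ)
  have hi : Integrable (fun z : Plane × ℝ => f z * (η z.1 * (ψ z.2 : ℂ))) (volO b) :=
    (Lp.memLp f).integrable_mul hm
  rw [integral_volO hi]
  refine integral_congr_ae ?_
  filter_upwards [coeFn_pair_cvec b ψ f] with x hx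
  rw [hx, ← integral_mul_const]
  refine integral_congr_ae (Eventually.of_forall fun y => ?_)
  ring

lemma memLp_test {b : ℝ} {φ : Plane × ℝ → ℂ} (h1 : ContDiff ℝ ∞ φ) (h2 : HasCompactSupport φ) :
    MemLp φ 2 (volO b) := h1.continuous.memLp_of_hasCompactSupport h2

lemma contDiff_fderiv_apply {φ : Plane × ℝ → ℂ} (h1 : ContDiff ℝ ∞ φ) (v : Plane × ℝ) :
    ContDiff ℝ ∞ fun z => fderiv ℝ φ z v :=
  (h1.fderiv_right (m := ∞) (by simp)).clm_apply contDiff_const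

lemma hasCompactSupport_fderiv_apply {φ : Plane × ℝ → ℂ} (h2 : HasCompactSupport φ)
    (v : Plane × ℝ) : HasCompactSupport fun z => fderiv ℝ φ z v := h2.fderiv_apply ℝ v

/-- The function that tests the derivative has compact support inside the slab, so both integrals
extend to the whole space, where integration by parts has no boundary term. -/
lemma hasWeakPartial_of_contDiff {b : ℝ} (j : Fin 3) {φ : Plane × ℝ → ℂ} (h1 : ContDiff ℝ ∞ φ)
    (h2 : HasCompactSupport φ) : HasWeakPartial b j ((memLp_test h1 h2).toLp φ)
      ((memLp_test (contDiff_fderiv_apply h1 (dir j))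
        (hasCompactSupport_fderiv_apply h2 (dir j))).toLp _) := by
  intro θ t1 t2 t3
  have hz : ∀ z ∉ slab b, θ z = 0 := fun z hz => image_eq_zero_of_notMem_tsupport fun h => hz (t3 h)
  have hz' : ∀ z ∉ slab b, fderiv ℝ θ z (dir j) = 0 := fun z hz => by
    have : fderiv ℝ θ z = 0 := image_eq_zero_of_notMem_tsupport (f := fderiv ℝ θ)
      fun h => hz (t3 (tsupport_fderiv_subset ℝ (f := θ) h))
    rw [this]
    rfl
  have e1 : ∫ z in slab b, (memLp_test (b := b) h1 h2).toLp φ z * fderiv ℝ θ z (dir j) =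
      ∫ z, φ z * fderiv ℝ θ z (dir j) := by
    rw [← setIntegral_eq_integral_of_forall_compl_eq_zero (s := slab b) (μ := volume)
      (f := fun z => φ z * fderiv ℝ θ z (dir j)) (fun z hz => by rw [hz' z hz, mul_zero])]
    refine integral_congr_ae (μ := volO b) ?_
    filter_upwards [(memLp_test (b := b) h1 h2).coeFn_toLp] with z hz
    rw [hz]
  have e2 : ∫ z in slab b, (memLp_test (b := b) (contDiff_fderiv_apply h1 (dir j))
        (hasCompactSupport_fderiv_apply h2 (dir j))).toLp _ z * θ z =
      ∫ z, fderiv ℝ φ z (dir j) * θ z := by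
    rw [← setIntegral_eq_integral_of_forall_compl_eq_zero (s := slab b) (μ := volume)
      (f := fun z => fderiv ℝ φ z (dir j) * θ z) (fun z hz' => by rw [hz z hz', mul_zero])]
    refine integral_congr_ae (μ := volO b) ?_
    filter_upwards [(memLp_test (b := b) (contDiff_fderiv_apply h1 (dir j))
        (hasCompactSupport_fderiv_apply h2 (dir j))).coeFn_toLp] with z hz
    rw [hz]
  rw [e1, e2]
  have c1 := h1.continuous
  have c2 := (contDiff_fderiv_apply h1 (dir j)).continuous
  have c3 := t1.continuous
  have c4 := (contDiff_fderiv_apply t1 (dir j)).continuous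
  have : (volume : Measure (Plane × ℝ)).IsAddHaarMeasure := by
    rw [Measure.volume_eq_prod]; infer_instance
  exact integral_mul_fderiv_eq_neg_fderiv_mul_of_integrable
    ((c2.mul c3).integrable_of_hasCompactSupport t2.mul_left)
    ((c1.mul c4).integrable_of_hasCompactSupport h2.mul_right)
    ((c1.mul c3).integrable_of_hasCompactSupport t2.mul_left)
    (fun z _ => h1.differentiable (by simp) z) (fun z _ => t1.differentiable (by simp) z)

/-- The symbol `2πi ξⱼ`. -/
def symb (j : Fin 2) (ξ : Plane) : ℂ := 2 * Real.pi * Complex.I * ξ j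

lemma measurable_symb (j : Fin 2) : Measurable (symb j) := by unfold symb; fun_prop

lemma conj_symb (j : Fin 2) (ξ : Plane) : conj (symb j ξ) = -symb j ξ := by
  simp only [symb, map_mul, Complex.conj_ofReal, Complex.conj_I, map_ofNat]
  ring

/-- Tested with products `η(x) ψ(y)`, the definition becomes, for each `ψ`, an identity between
functions on the plane, which is transformed there. -/
lemma HasWeakPartial.mulRel {b : ℝ} {j : Fin 2} {f g : L2Omega b}
    (h : HasWeakPartial b j.castSucc f g) : MulRel (symb j) (pfourier b f) (pfourier b g) := by
  refine mulRel_of_pair (measurable_symb j) fun ψ hψ => ?_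
  rw [pair_pfourier, pair_pfourier]
  refine fourier_eq_of_forall_test_single j _ _ fun η h1 h2 => ?_
  have ht := h (fun z => η z.1 * (ψ z.2 : ℂ)) (contDiff_tens h1 hψ.1)
    (hasCompactSupport_tens h2 hψ.2.1)
    (tsupport_tens_subset.trans (Set.prod_mono (Set.subset_univ _) hψ.2.2))
  have hη : MemLp η 2 (volume : Measure Plane) := h1.continuous.memLp_of_hasCompactSupport h2
  have hη' : MemLp (fun x => fderiv ℝ η x (hdir j)) 2 (volume : Measure Plane) :=
    ((h1.continuous_fderiv (by simp)).clm_apply continuous_const).memLp_of_hasCompactSupport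
      (h2.fderiv_apply ℝ _)
  simp only [hasFDerivAt_tens h1 hψ.1, dir_castSucc, mul_zero, Complex.ofReal_zero, add_zero] at ht
  rw [integral_mul_tens f hη', integral_mul_tens g hη] at ht
  have i1 : Integrable fun x => pair b (cvec b ψ) g x * η x := (Lp.memLp _).integrable_mul hη
  have i2 : Integrable fun x => pair b (cvec b ψ) f x * fderiv ℝ η x (hdir j) :=
    (Lp.memLp _).integrable_mul hη'
  rw [integral_add i1 i2, ht]
  exact add_neg_cancel _

/-- By Plancherel. The test function is conjugated to turn the integrals into inner products, and
the minus sign of integration by parts comes from the symbol being purely imaginary. -/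
lemma MulRel.hasWeakPartial {b : ℝ} {j : Fin 2} {f g : L2Omega b}
    (h : MulRel (symb j) (pfourier b f) (pfourier b g)) : HasWeakPartial b j.castSucc f g := by
  intro φ h1 h2 h3
  have c1 : ContDiff ℝ ∞ fun z => conj (φ z) := Complex.conjCLE.contDiff.comp h1
  have c2 : HasCompactSupport fun z => conj (φ z) := h2.comp_left (map_zero _)
  have hr := (hasWeakPartial_of_contDiff (b := b) j.castSucc c1 c2).mulRel
  set Φ := (memLp_test (b := b) c1 c2).toLp _ with hΦ
  set Φ' := (memLp_test (b := b) (contDiff_fderiv_apply c1 (dir j.castSucc))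
    (hasCompactSupport_fderiv_apply c2 (dir j.castSucc))).toLp _ with hΦ'
  have hd : ∀ z, fderiv ℝ (fun z => conj (φ z)) z (dir j.castSucc) =
      conj (fderiv ℝ φ z (dir j.castSucc)) := by
    intro z
    have := (Complex.conjCLE.toContinuousLinearMap.hasFDerivAt.comp z
      ((h1.differentiable (by simp)) z).hasFDerivAt).fderiv
    change fderiv ℝ (Complex.conjCLE.toContinuousLinearMap ∘ φ) z _ = _
    rw [this]
    rfl
  have e1 : ∫ z in slab b, f z * fderiv ℝ φ z (dir j.castSucc) = ⟪Φ', f⟫_ℂ := by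
    rw [L2.inner_def]
    refine integral_congr_ae ?_
    filter_upwards [(memLp_test (b := b) (contDiff_fderiv_apply c1 (dir j.castSucc))
      (hasCompactSupport_fderiv_apply c2 (dir j.castSucc))).coeFn_toLp] with z hz
    rw [hΦ', hz, hd]
    simp
  have e2 : ∫ z in slab b, g z * φ z = ⟪Φ, g⟫_ℂ := by
    rw [L2.inner_def]
    refine integral_congr_ae ?_
    filter_upwards [(memLp_test (b := b) c1 c2).coeFn_toLp] with z hz
    rw [hΦ, hz]
    simp
  rw [e1, e2, ← (pfourier b).inner_map_map, ← (pfourier b).inner_map_map Φ, L2.inner_def,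
    L2.inner_def, ← integral_neg]
  refine integral_congr_ae ?_
  unfold MulRel at hr h
  filter_upwards [hr, h] with z a1 a2
  rw [a1, a2]
  simp only [RCLike.inner_apply, map_mul, conj_symb]
  ring

/-! ### Primitives on an interval -/

lemma intervalIntegral_eq_volI {b y : ℝ} (h0 : 0 ≤ y) (hy : y < b) (q : ℝ → ℂ) :
    ∫ t in (0 : ℝ)..y, q t = ∫ t, (Set.Iic y).indicator q t ∂volI b := by
  rw [intervalIntegral.integral_of_le h0, integral_indicator measurableSet_Iic,
    Measure.restrict_restrict measurableSet_Iic]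
  congr 2
  ext t
  simp only [Set.mem_Ioc, Set.mem_inter_iff, Set.mem_Iic, Set.mem_Ioo]
  constructor
  · rintro ⟨h1, h2⟩; exact ⟨h2, h1, h2.trans_lt hy⟩
  · rintro ⟨h1, h2, -⟩; exact ⟨h2, h1⟩

lemma intervalIntegral_eq_volI' {b : ℝ} (hb : 0 ≤ b) (q : ℝ → ℂ) :
    ∫ t in (0 : ℝ)..b, q t = ∫ t, q t ∂volI b := by
  rw [intervalIntegral.integral_of_le hb, integral_Ioc_eq_integral_Ioo]

/-- Symmetric form of integration by parts for primitives. -/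
lemma integral_mul_primitive_add {b : ℝ} (hb : 0 ≤ b) {p q : ℝ → ℂ} (hp : Integrable p (volI b))
    (hq : Integrable q (volI b)) :
    Integrable (fun y => p y * ∫ t in (0 : ℝ)..y, q t) (volI b) ∧
    Integrable (fun y => (∫ t in (0 : ℝ)..y, p t) * q y) (volI b) ∧
    ∫ y, p y * (∫ t in (0 : ℝ)..y, q t) ∂volI b + ∫ y, (∫ t in (0 : ℝ)..y, p t) * q y ∂volI b =
      (∫ t in (0 : ℝ)..b, p t) * ∫ t in (0 : ℝ)..b, q t := by
  -- Fubini on the square `(0, b)²`: the two integrals are those of `p(y) q(t)` over the triangles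
  -- `t ≤ y` and `y ≤ t`.
  have hpq := hp.mul_prod hq
  have hS : MeasurableSet {z : ℝ × ℝ | z.2 ≤ z.1} := measurableSet_le measurable_snd measurable_fst
  have hS' : MeasurableSet {z : ℝ × ℝ | z.1 ≤ z.2} := measurableSet_le measurable_fst measurable_snd
  have i1 := hpq.indicator hS
  have i2 := hpq.indicator hS'
  have e1 : (fun y => p y * ∫ t in (0 : ℝ)..y, q t) =ᵐ[volI b]
      fun y => ∫ t, {z : ℝ × ℝ | z.2 ≤ z.1}.indicator (fun z => p z.1 * q z.2) (y, t) ∂volI b := by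
    filter_upwards [ae_restrict_mem measurableSet_Ioo] with y hy
    rw [intervalIntegral_eq_volI hy.1.le hy.2, ← integral_const_mul]
    refine integral_congr_ae (Eventually.of_forall fun t => ?_)
    simp [Set.indicator]
  have e2 : (fun t => (∫ y in (0 : ℝ)..t, p y) * q t) =ᵐ[volI b]
      fun t => ∫ y, {z : ℝ × ℝ | z.1 ≤ z.2}.indicator (fun z => p z.1 * q z.2) (y, t) ∂volI b := by
    filter_upwards [ae_restrict_mem measurableSet_Ioo] with y hy
    rw [intervalIntegral_eq_volI hy.1.le hy.2, ← integral_mul_const]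
    refine integral_congr_ae (Eventually.of_forall fun t => ?_)
    simp [Set.indicator]
  refine ⟨i1.integral_prod_left.congr e1.symm, i2.integral_prod_right.congr e2.symm, ?_⟩
  rw [integral_congr_ae e1, integral_congr_ae e2, ← integral_prod _ i1,
    ← integral_prod_symm _ i2, ← integral_add i1 i2, intervalIntegral_eq_volI' hb,
    intervalIntegral_eq_volI' hb, ← integral_prod_mul]
  refine integral_congr_ae ?_
  -- The triangles overlap only on the diagonal, which is a null set.
  have hd : ∀ᵐ z ∂(volI b).prod (volI b), z.1 ≠ z.2 := by
    have hm : MeasurableSet {z : ℝ × ℝ | z.1 ≠ z.2}ᶜ :=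
      (measurableSet_eq_fun measurable_fst measurable_snd).compl.compl
    change _ = _
    rw [Measure.measure_prod_null hm]
    refine Eventually.of_forall fun y => ?_
    change volI b _ = 0
    refine measure_mono_null (t := {y}) ?_ (measure_singleton y)
    intro t ht
    simp at ht
    simp [ht]
  filter_upwards [hd] with z hz
  simp only [Set.indicator, Set.mem_ofPred_eq]
  rcases lt_or_gt_of_ne hz with h | h
  · simp [h.le, not_le.2 h]
  · simp [h.le, not_le.2 h]

/-- `v` is absolutely continuous on `[0, b]` with derivative `v'`. -/
def Prim (b : ℝ) (v v' : ℝ → ℂ) : Prop :=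
  Integrable v' (volI b) ∧ ∀ y ∈ Set.Icc 0 b, v y = v 0 + ∫ t in (0 : ℝ)..y, v' t

namespace Prim

variable {b : ℝ} {v v' z z' : ℝ → ℂ}

lemma of_primitive {q : ℝ → ℂ} (hq : Integrable q (volI b)) (c : ℂ) :
    Prim b (fun y => c + ∫ t in (0 : ℝ)..y, q t) q :=
  ⟨hq, fun y _ => by simp⟩

lemma intervalIntegrable {q : ℝ → ℂ} (hq : Integrable q (volI b)) {y : ℝ} (hy : y ∈ Set.Icc 0 b) :
    IntervalIntegrable q volume 0 y := by
  rw [intervalIntegrable_iff_integrableOn_Ioo_of_le hy.1]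
  exact IntegrableOn.mono_set hq (Set.Ioo_subset_Ioo_right hy.2)

lemma mono (h : Prim b v v') {y : ℝ} (hy : y ≤ b) : Prim y v v' :=
  ⟨IntegrableOn.mono_set h.1 (Set.Ioo_subset_Ioo_right hy),
    fun t ht => h.2 t ⟨ht.1, ht.2.trans hy⟩⟩

lemma add (h : Prim b v v') (k : Prim b z z') :
    Prim b (fun y => v y + z y) (fun y => v' y + z' y) := by
  refine ⟨h.1.add k.1, fun y hy => ?_⟩
  rw [intervalIntegral.integral_add (intervalIntegrable h.1 hy) (intervalIntegrable k.1 hy)]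
  beta_reduce
  rw [h.2 y hy, k.2 y hy]
  ring

lemma const_mul (h : Prim b v v') (c : ℂ) : Prim b (fun y => c * v y) (fun y => c * v' y) := by
  refine ⟨h.1.const_mul c, fun y hy => ?_⟩
  rw [intervalIntegral.integral_const_mul]
  beta_reduce
  rw [h.2 y hy]
  ring

lemma congr (h : Prim b v v') (e : ∀ y ∈ Set.Icc 0 b, z y = v y) (e' : z' =ᵐ[volI b] v') :
    Prim b z z' := by
  refine ⟨h.1.congr e'.symm, fun y hy => ?_⟩
  rw [e y hy, e 0 ⟨le_rfl, hy.1.trans hy.2⟩, h.2 y hy]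
  congr 1
  refine intervalIntegral.integral_congr_ae_restrict ?_
  rw [Set.uIoc_of_le hy.1, ← restrict_Ioo_eq_restrict_Ioc]
  exact ae_restrict_of_ae_restrict_of_subset (Set.Ioo_subset_Ioo_right hy.2) e'.symm

lemma sub (h : Prim b v v') (k : Prim b z z') :
    Prim b (fun y => v y - z y) (fun y => v' y - z' y) :=
  (h.add (k.const_mul (-1))).congr (fun y _ => by ring) (Eventually.of_forall fun y => by ring)

/-- Integration by parts for absolutely continuous functions. After subtraction of the values at `0`
it is the Fubini identity for two primitives, so no pointwise differentiability is used. -/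
lemma integral_mul (hb : 0 ≤ b) (h : Prim b v v') (k : Prim b z z') :
    Integrable (fun y => v' y * z y) (volI b) ∧ Integrable (fun y => v y * z' y) (volI b) ∧
    ∫ y, v' y * z y ∂volI b + ∫ y, v y * z' y ∂volI b = v b * z b - v 0 * z 0 := by
  obtain ⟨i1, i2, e⟩ := integral_mul_primitive_add hb h.1 k.1
  have c1 : (fun y => v' y * z y) =ᵐ[volI b]
      fun y => v' y * z 0 + v' y * ∫ t in (0 : ℝ)..y, z' t := by
    filter_upwards [ae_restrict_mem measurableSet_Ioo] with y hy
    rw [k.2 y (Set.Ioo_subset_Icc_self hy)]; ring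
  have c2 : (fun y => v y * z' y) =ᵐ[volI b]
      fun y => v 0 * z' y + (∫ t in (0 : ℝ)..y, v' t) * z' y := by
    filter_upwards [ae_restrict_mem measurableSet_Ioo] with y hy
    rw [h.2 y (Set.Ioo_subset_Icc_self hy)]; ring
  have j1 := h.1.mul_const (z 0)
  have j2 := k.1.const_mul (v 0)
  refine ⟨(j1.add i1).congr c1.symm, (j2.add i2).congr c2.symm, ?_⟩
  rw [integral_congr_ae c1, integral_congr_ae c2, integral_add j1 i1, integral_add j2 i2,
    integral_mul_const, integral_const_mul, h.2 b ⟨hb, le_rfl⟩, k.2 b ⟨hb, le_rfl⟩,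
    ← intervalIntegral_eq_volI' hb v', ← intervalIntegral_eq_volI' hb z']
  linear_combination e

lemma mul (hb : 0 ≤ b) (h : Prim b v v') (k : Prim b z z') :
    Prim b (fun y => v y * z y) (fun y => v' y * z y + v y * z' y) := by
  obtain ⟨i1, i2, -⟩ := integral_mul hb h k
  refine ⟨i1.add i2, fun y hy => ?_⟩
  obtain ⟨j1, j2, e⟩ := integral_mul hy.1 (h.mono hy.2) (k.mono hy.2)
  rw [intervalIntegral_eq_volI' hy.1, integral_add j1 j2, e]
  ring

lemma of_hasDerivAt (h : ∀ y, HasDerivAt v (v' y) y) (hc : Continuous v') : Prim b v v' := by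
  refine ⟨(hc.integrableOn_Icc (a := 0) (b := b)).mono_set Set.Ioo_subset_Icc_self, fun y hy => ?_⟩
  rw [intervalIntegral.integral_eq_sub_of_hasDerivAt (fun t _ => h t) (hc.intervalIntegrable 0 y)]
  ring

lemma const (c : ℂ) : Prim b (fun _ => c) (fun _ => 0) :=
  of_hasDerivAt (fun y => hasDerivAt_const y c) continuous_const

lemma continuousOn (h : Prim b v v') : ContinuousOn v (Set.Icc 0 b) := by
  rcases lt_or_ge b 0 with hb | hb
  · rw [Set.Icc_eq_empty (not_le.2 hb)]; exact continuousOn_empty _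
  have h1 := intervalIntegral.continuousOn_primitive_interval (f := v') (μ := volume) (a := 0)
    (b := b) (by
      rw [Set.uIcc_of_le hb, integrableOn_Icc_iff_integrableOn_Ioo]; exact h.1)
  rw [Set.uIcc_of_le hb] at h1
  exact (continuousOn_const.add h1).congr h.2

lemma memLp (h : Prim b v v') (p : ℝ≥0∞) : MemLp v p (volI b) := by
  obtain ⟨K, hK⟩ := isCompact_Icc.exists_bound_of_continuousOn h.continuousOn
  refine MemLp.of_bound ((h.continuousOn.mono Set.Ioo_subset_Icc_self).aestronglyMeasurable
    measurableSet_Ioo) K ?_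
  filter_upwards [ae_restrict_mem measurableSet_Ioo] with y hy
  exact hK y (Set.Ioo_subset_Icc_self hy)

end Prim

/-! ### Vertical derivatives -/

/-- The vertical primitive `(x, y) ↦ ∫₀ʸ G(x, t) dt`. -/
def vint (G : Plane × ℝ → ℂ) (z : Plane × ℝ) : ℂ := ∫ t in (0 : ℝ)..z.2, G (z.1, t)

/-- The upper limit depends on the point, so the integral is rewritten over the whole line with the
indicators of two measurable sets in `(x, y, t)`; one of them accounts for negative `y`. -/
lemma stronglyMeasurable_vint {G : Plane × ℝ → ℂ} (hG : StronglyMeasurable G) :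
    StronglyMeasurable (vint G) := by
  have key : ∀ s : Set ((Plane × ℝ) × ℝ), MeasurableSet s →
      StronglyMeasurable fun z : Plane × ℝ => ∫ t, s.indicator (fun w => G (w.1.1, w.2)) (z, t) := by
    intro s hs
    have : StronglyMeasurable (s.indicator fun w : (Plane × ℝ) × ℝ => G (w.1.1, w.2)) :=
      (hG.comp_measurable (by fun_prop)).indicator hs
    exact this.integral_prod_right'
  have m1 : Measurable fun w : (Plane × ℝ) × ℝ => w.2 := measurable_snd
  have m2 : Measurable fun w : (Plane × ℝ) × ℝ => w.1.2 := by fun_prop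
  have h1 : MeasurableSet {w : (Plane × ℝ) × ℝ | 0 < w.2 ∧ w.2 ≤ w.1.2} := by
    simpa only [Set.ofPred_and] using
      (measurableSet_lt measurable_const m1).inter (measurableSet_le m1 m2)
  have h2 : MeasurableSet {w : (Plane × ℝ) × ℝ | w.1.2 < w.2 ∧ w.2 ≤ 0} := by
    simpa only [Set.ofPred_and] using
      (measurableSet_lt m2 m1).inter (measurableSet_le m1 measurable_const)
  have e : vint G = fun z : Plane × ℝ =>
      (∫ t, {w : (Plane × ℝ) × ℝ | 0 < w.2 ∧ w.2 ≤ w.1.2}.indicator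
        (fun w => G (w.1.1, w.2)) (z, t)) -
      ∫ t, {w : (Plane × ℝ) × ℝ | w.1.2 < w.2 ∧ w.2 ≤ 0}.indicator
        (fun w => G (w.1.1, w.2)) (z, t) := by
    funext z
    rw [vint, intervalIntegral, ← integral_indicator measurableSet_Ioc,
      ← integral_indicator measurableSet_Ioc]
    rfl
  rw [e]
  exact (key _ h1).sub (key _ h2)

lemma ae_memLp_fibre {b : ℝ} {G : Plane × ℝ → ℂ} (hG : MemLp G 2 (volO b)) :
    ∀ᵐ x : Plane, MemLp (fun y => G (x, y)) 2 (volI b) := by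
  have h2 := (memLp_two_iff_integrable_sq_norm hG.1).1 hG
  have h3 := hG.1
  rw [volO_eq_prod] at h2 h3
  filter_upwards [h2.prod_right_ae, h3.prodMk_left] with x hx hx'
  exact (memLp_two_iff_integrable_sq_norm hx').2 hx

lemma ae_prim_vint {b : ℝ} {G : Plane × ℝ → ℂ} (hG : MemLp G 2 (volO b)) (c : Plane → ℂ) :
    ∀ᵐ x : Plane, Prim b (fun y => c x + vint G (x, y)) (fun y => G (x, y)) := by
  filter_upwards [ae_memLp_fibre hG] with x hx
  exact Prim.of_primitive (hx.integrable (by norm_num)) _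

/-- On the slab the primitive is dominated by `∫₀ᵇ |g(x, t)| dt`, which is square integrable in `x`
and constant in `y`. -/
lemma memLp_vint {b : ℝ} (g : L2Omega b) : MemLp (vint g) 2 (volO b) := by
  have hm := (Lp.memLp g).norm
  have hn : MemLp (fun z : Plane × ℝ => ((‖g z‖ : ℝ) : ℂ)) 2 (volO b) := hm.ofReal
  have h1 := memLp_verticalIntegral b (hn.toLp _)
  have h2 := memLp_tens (b := b) h1 (memLp_continuous b 1)
  refine h2.of_le ?_ ?_
  · exact (stronglyMeasurable_vint (Lp.stronglyMeasurable g)).aestronglyMeasurable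
  have e := ae_ae_of_ae_volO hn.coeFn_toLp
  have i := ae_memLp_fibre (Lp.memLp g)
  have e' : ∀ᵐ z ∂volO b, ‖∫ y in Set.Ioo 0 b, (hn.toLp _ : L2Omega b) (z.1, y)‖ =
      ∫ y, ‖g (z.1, y)‖ ∂volI b := by
    refine (quasiMeasurePreserving_fst b).ae (p := fun x =>
      ‖∫ y in Set.Ioo 0 b, (hn.toLp _ : L2Omega b) (x, y)‖ = ∫ y, ‖g (x, y)‖ ∂volI b) ?_
    filter_upwards [e] with x hx
    rw [integral_congr_ae hx, integral_complex_ofReal, Complex.norm_real, Real.norm_eq_abs,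
      abs_of_nonneg (integral_nonneg fun _ => norm_nonneg _)]
  filter_upwards [e', (quasiMeasurePreserving_fst b).ae i,
    ae_restrict_mem (isOpen_slab b).measurableSet] with z h1 h2 h3
  have hz : z.2 ∈ Set.Ioo 0 b := h3.2
  rw [norm_mul, h1]
  simp only [ContinuousMap.one_apply, Complex.ofReal_one, norm_one, mul_one]
  rw [vint, intervalIntegral_eq_volI hz.1.le hz.2]
  refine (norm_integral_le_integral_norm _).trans ?_
  have h4 := h2.integrable (q := 2) (by norm_num)
  refine integral_mono_of_nonneg (Eventually.of_forall fun _ => norm_nonneg _) h4.norm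
    (Eventually.of_forall fun t => ?_)
  simp only [Set.indicator]
  split_ifs <;> simp

/-- Weak vertical differentiability, tested with functions of the vertical variable only. -/
def WeakV (b : ℝ) (f g : L2Omega b) : Prop :=
  ∀ ψ ψ' : C(ℝ, ℝ), IsTestI b ψ → (∀ y, HasDerivAt ψ (ψ' y) y) →
    pair b (cvec b ψ') f = -pair b (cvec b ψ) g

/-- The condition only involves vertical pairings, and these commute with the injective Fourier
transform. -/
lemma weakV_pfourier_iff {b : ℝ} {f g : L2Omega b} :
    WeakV b (pfourier b f) (pfourier b g) ↔ WeakV b f g := by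
  refine forall₂_congr fun ψ ψ' => forall₂_congr fun _ _ => ?_
  rw [pair_pfourier, pair_pfourier]
  have : -(𝓕 (pair b (cvec b ψ) g) : L2Sigma) = 𝓕 (-pair b (cvec b ψ) g) :=
    ((Lp.fourierTransformₗᵢ Plane ℂ).map_neg _).symm
  rw [this]
  exact (Lp.fourierTransformₗᵢ Plane ℂ).injective.eq_iff

lemma Lp_eq_zero_of_forall_test {a : L2Sigma}
    (h : ∀ η : Plane → ℂ, ContDiff ℝ ∞ η → HasCompactSupport η → ∫ x, a x * η x = 0) : a = 0 := by
  refine Lp.ext (EventuallyEq.trans ?_ (Lp.coeFn_zero ℂ 2 volume).symm)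
  refine ae_eq_zero_of_integral_contDiff_smul_eq_zero
    ((Lp.memLp a).locallyIntegrable (by norm_num)) fun φ hφ hc => ?_
  rw [← h (fun z => (φ z : ℂ)) (Complex.ofRealCLM.contDiff.comp hφ)
    (hc.comp_left (g := fun r : ℝ => (r : ℂ)) rfl)]
  refine integral_congr_ae (Eventually.of_forall fun x => ?_)
  simp [mul_comm]

lemma HasWeakPartial.weakV {b : ℝ} {f g : L2Omega b} (h : HasWeakPartial b 2 f g) :
    WeakV b f g := by
  intro ψ ψ' hψ hd
  rw [← sub_eq_zero, sub_neg_eq_add]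
  refine Lp_eq_zero_of_forall_test fun η h1 h2 => ?_
  have ht := h (fun z => η z.1 * (ψ z.2 : ℂ)) (contDiff_tens h1 hψ.1)
    (hasCompactSupport_tens h2 hψ.2.1)
    (tsupport_tens_subset.trans (Set.prod_mono (Set.subset_univ _) hψ.2.2))
  have hη : MemLp η 2 (volume : Measure Plane) := h1.continuous.memLp_of_hasCompactSupport h2
  simp only [hasFDerivAt_tens h1 hψ.1, dir_two, map_zero, zero_mul, zero_add, mul_one,
    (hd _).deriv] at ht
  rw [integral_mul_tens f hη, integral_mul_tens g hη] at ht
  have i1 : Integrable fun x => pair b (cvec b ψ') f x * η x := (Lp.memLp _).integrable_mul hη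
  have i2 : Integrable fun x => pair b (cvec b ψ) g x * η x := (Lp.memLp _).integrable_mul hη
  have : ∫ x, (pair b (cvec b ψ') f + pair b (cvec b ψ) g : L2Sigma) x * η x =
      ∫ x, (pair b (cvec b ψ') f x * η x + pair b (cvec b ψ) g x * η x) := by
    refine integral_congr_ae ?_
    filter_upwards [Lp.coeFn_add (pair b (cvec b ψ') f) (pair b (cvec b ψ) g)] with x hx
    rw [hx, Pi.add_apply, add_mul]
  rw [this, integral_add i1 i2, ht, neg_add_cancel]

lemma prim_of_test {b : ℝ} {ψ ψ' : C(ℝ, ℝ)} (hd : ∀ y, HasDerivAt ψ (ψ' y) y) :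
    Prim b (fun y => (ψ y : ℂ)) (fun y => (ψ' y : ℂ)) :=
  Prim.of_hasDerivAt (fun y => (hd y).ofReal_comp) (by fun_prop)

lemma exists_test_integral_eq_one {b : ℝ} (hb : 0 < b) :
    ∃ ρ : C(ℝ, ℝ), IsTestI b ρ ∧ ∫ t, ρ t = 1 := by
  let B : ContDiffBump (b / 2) := ⟨b / 8, b / 4, by positivity, by linarith⟩
  refine ⟨⟨B.normed volume, B.continuous_normed⟩, ⟨B.contDiff_normed, B.hasCompactSupport_normed, ?_⟩,
    B.integral_normed⟩
  intro y hy
  have := B.tsupport_normed_eq (μ := volume) ▸ hy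
  rw [Real.closedBall_eq_Icc] at this
  have hr : B.rOut = b / 4 := rfl
  rw [hr] at this
  constructor <;> linarith [this.1, this.2]

lemma IsTestI.eq_zero {b : ℝ} {ψ : C(ℝ, ℝ)} (h : IsTestI b ψ) {y : ℝ} (hy : y ∉ Set.Ioo 0 b) :
    ψ y = 0 := image_eq_zero_of_notMem_tsupport fun h' => hy (h.2.2 h')

/-- A test function with vanishing integral is the derivative of a test function. -/
lemma exists_test_primitive {b : ℝ} {ψ : C(ℝ, ℝ)} (hψ : IsTestI b ψ)
    (h0 : ∫ t, ψ t = 0) : ∃ Ψ : C(ℝ, ℝ), IsTestI b Ψ ∧ ∀ y, HasDerivAt Ψ (ψ y) y := by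
  have hd : ∀ y, HasDerivAt (fun y => ∫ t in (0 : ℝ)..y, ψ t) (ψ y) y := fun y =>
    intervalIntegral.integral_hasDerivAt_right (ψ.continuous.intervalIntegrable _ _)
      (ψ.continuous.stronglyMeasurableAtFilter _ _) ψ.continuous.continuousAt
  have hcd : ContDiff ℝ ∞ fun y => ∫ t in (0 : ℝ)..y, ψ t := by
    refine contDiff_infty_iff_deriv.2 ⟨fun y => (hd y).differentiableAt, ?_⟩
    have : deriv (fun y => ∫ t in (0 : ℝ)..y, ψ t) = ψ := funext fun y => (hd y).deriv
    rw [this]; exact hψ.1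
  have hK : IsCompact (tsupport ψ) := hψ.2.1
  -- Only `0 < l` and `u < b` matter. For an empty support any such pair will do, and `1`, `b - 1`
  -- is taken even if that interval is empty.
  obtain ⟨l, u, hl, hu, hlu⟩ : ∃ l u : ℝ, 0 < l ∧ u < b ∧ tsupport ψ ⊆ Set.Icc l u := by
    rcases (tsupport ψ).eq_empty_or_nonempty with he | hne
    · exact ⟨1, b - 1, one_pos, by linarith, by rw [he]; exact Set.empty_subset _⟩
    · obtain ⟨l, hl, hl'⟩ := hK.exists_isLeast hne
      obtain ⟨u, hu, hu'⟩ := hK.exists_isGreatest hne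
      exact ⟨l, u, (hψ.2.2 hl).1, (hψ.2.2 hu).2, fun y hy => ⟨hl' hy, hu' hy⟩⟩
  have hz : ∀ y ∉ Set.Icc l u, ψ y = 0 := fun y hy =>
    image_eq_zero_of_notMem_tsupport fun h => hy (hlu h)
  have hint : Integrable ψ volume := ψ.continuous.integrable_of_hasCompactSupport hψ.2.1
  have hsup : Function.support (fun y => ∫ t in (0 : ℝ)..y, ψ t) ⊆ Set.Icc l u := by
    intro y hy
    by_contra hyn
    apply hy
    rw [Set.mem_Icc, not_and_or, not_le, not_le] at hyn
    change ∫ t in (0 : ℝ)..y, ψ t = 0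
    rcases hyn with h | h
    · rw [intervalIntegral.integral_congr (g := fun _ => 0), intervalIntegral.integral_zero]
      intro t ht
      refine hz t fun h' => ?_
      rcases Set.mem_uIcc.1 ht with h1 | h1 <;> linarith [h1.2, h'.1]
    · have e1 := intervalIntegral.integral_Iic_sub_Iic (μ := volume) (f := ψ) (a := 0) (b := y)
        hint.integrableOn hint.integrableOn
      have e2 : ∫ t in Set.Iic (0 : ℝ), ψ t = 0 := by
        rw [setIntegral_congr_fun (g := fun _ => 0) measurableSet_Iic, integral_zero]
        intro t ht
        exact hz t fun h' => by linarith [h'.1, Set.mem_Iic.1 ht]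
      have e3 : ∫ t in Set.Iic y, ψ t = 0 := by
        rw [← h0, setIntegral_eq_integral_of_forall_compl_eq_zero]
        intro t ht
        exact hz t fun h' => ht (by rw [Set.mem_Iic]; linarith [h'.2])
      rw [← e1, e2, e3, sub_zero]
  have hts := closure_minimal hsup isClosed_Icc
  refine ⟨⟨_, hcd.continuous⟩, ⟨hcd, isCompact_Icc.of_isClosed_subset (isClosed_tsupport _) hts,
    hts.trans fun y hy => ⟨hl.trans_le hy.1, hy.2.trans_lt hu⟩⟩, hd⟩

/-- Integration by parts on each fibre: the boundary term vanishes at `0` because the primitive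
starts there, and at `b` because `ψ b = 0`. -/
lemma pair_cvec_vint {b : ℝ} (hb : 0 ≤ b) (g : L2Omega b) {ψ ψ' : C(ℝ, ℝ)} (h0 : ψ b = 0)
    (hd : ∀ y, HasDerivAt ψ (ψ' y) y) :
    pair b (cvec b ψ') ((memLp_vint g).toLp _) = -pair b (cvec b ψ) g := by
  refine Lp.ext ?_
  filter_upwards [coeFn_pair_cvec b ψ' ((memLp_vint g).toLp _), coeFn_pair_cvec b ψ g,
    Lp.coeFn_neg (pair b (cvec b ψ) g), ae_prim_vint (Lp.memLp g) 0,
    ae_ae_of_ae_volO (memLp_vint g).coeFn_toLp] with x h1 h2 h3 h4 h5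
  rw [h3, Pi.neg_apply, h1, h2]
  obtain ⟨-, -, e⟩ := Prim.integral_mul hb h4 (prim_of_test hd)
  have e1 : ∫ y, (memLp_vint g).toLp _ (x, y) * (ψ' y : ℂ) ∂volI b =
      ∫ y, ((0 : Plane → ℂ) x + vint g (x, y)) * (ψ' y : ℂ) ∂volI b := by
    refine integral_congr_ae ?_
    filter_upwards [h5] with y hy
    rw [hy]; simp
  rw [e1]
  simp only [h0, Complex.ofReal_zero, mul_zero, Pi.zero_apply, zero_add] at e ⊢
  have : vint g (x, 0) = 0 := by simp [vint]
  rw [this, zero_mul, sub_zero] at e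
  linear_combination e

/-- The lemma of du Bois-Reymond with a parameter. The difference of `f` and the primitive of `g` is
annihilated by derivatives of test functions, hence does not depend on `y`. This yields absolutely
continuous representatives on almost every fibre. -/
lemma WeakV.exists_eq {b : ℝ} (hb : 0 < b) {f g : L2Omega b} (h : WeakV b f g) :
    ∃ c : L2Sigma, f =ᵐ[volO b] fun z => c z.1 + vint g z := by
  set V : L2Omega b := (memLp_vint g).toLp _ with hV
  obtain ⟨ρ, hρ, hρ1⟩ := exists_test_integral_eq_one hb
  set c : L2Sigma := pair b (cvec b ρ) (f - V)
  have hz : ∀ ψ ψ' : C(ℝ, ℝ), IsTestI b ψ → (∀ y, HasDerivAt ψ (ψ' y) y) →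
      pair b (cvec b ψ') (f - V) = 0 := by
    intro ψ ψ' hψ hd
    rw [map_sub, h ψ ψ' hψ hd, hV, pair_cvec_vint hb.le g (hψ.eq_zero (by simp)) hd, sub_self]
  have hfV : f - V = tens b c (cvec b 1) := by
    rw [← sub_eq_zero]
    refine eq_zero_of_pair_test fun ψ hψ => ?_
    have hi : ∀ {θ : C(ℝ, ℝ)}, IsTestI b θ → Integrable θ volume := fun {θ} hθ =>
      θ.continuous.integrable_of_hasCompactSupport hθ.2.1
    -- Since `ρ` has integral one, this combination has mean zero and is therefore the derivative of
    -- a test function.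
    have ht : IsTestI b (ψ + (-∫ t, ψ t) • ρ) := by
      refine ⟨hψ.1.add (contDiff_const.mul hρ.1), hψ.2.1.add hρ.2.1.mul_left, ?_⟩
      refine (tsupport_add _ _).trans (Set.union_subset hψ.2.2 ?_)
      exact (closure_mono (Function.support_const_smul_subset _ _)).trans hρ.2.2
    have h0 : ∫ t, (ψ + (-∫ t, ψ t) • ρ) t = 0 := by
      simp only [ContinuousMap.add_apply, ContinuousMap.smul_apply, smul_eq_mul]
      rw [integral_add (hi hψ) ((hi hρ).const_mul _), integral_const_mul, hρ1]
      ring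
    obtain ⟨Ψ, hΨ, hd⟩ := exists_test_primitive ht h0
    have e := hz Ψ _ hΨ hd
    rw [cvec_add, cvec_smul, pair_add, pair_smul, Complex.conj_ofReal] at e
    have e1 : ⟪cvec b ψ, cvec b 1⟫_ℂ = ((∫ t, ψ t : ℝ) : ℂ) := by
      rw [L2.inner_def, ← integral_complex_ofReal]
      rw [← setIntegral_eq_integral_of_forall_compl_eq_zero (s := Set.Ioo 0 b) (μ := volume)
        (f := fun t => (ψ t : ℂ)) (fun t ht => by rw [hψ.eq_zero ht, Complex.ofReal_zero])]
      refine integral_congr_ae ?_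
      filter_upwards [coeFn_cvec b ψ, coeFn_cvec b 1] with y h1 h2
      rw [h1, h2]; simp
    rw [map_sub, pair_tens, e1]
    rw [Complex.ofReal_neg, neg_smul] at e
    rw [sub_eq_add_neg]
    exact e
  refine ⟨c, ?_⟩
  have hone : ∀ᵐ z ∂volO b, cvec b 1 z.2 = 1 := (quasiMeasurePreserving_snd b).ae
    (p := fun y => cvec b 1 y = 1) (by
      filter_upwards [coeFn_cvec b 1] with y hy
      rw [hy]; simp)
  have hsub := Lp.coeFn_sub f V
  rw [hfV] at hsub
  filter_upwards [hsub, coeFn_tens b c (cvec b 1), (memLp_vint g).coeFn_toLp, hone]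
    with z h1 h2 h3 h4
  rw [h2, h4, Pi.sub_apply, hV, h3] at h1
  linear_combination -h1

/-- Fibrewise integration by parts against the restriction of the test function, which vanishes at
both ends. The function `c` need not be square integrable. -/
lemma hasWeakPartial_two_of_eq {b : ℝ} (hb : 0 < b) {f g : L2Omega b} {c : Plane → ℂ}
    (h : f =ᵐ[volO b] fun z => c z.1 + vint g z) : HasWeakPartial b 2 f g := by
  intro φ h1 h2 h3
  have hφ' := memLp_test (b := b) (contDiff_fderiv_apply h1 (dir 2))
    (hasCompactSupport_fderiv_apply h2 (dir 2))
  have hφ := memLp_test (b := b) h1 h2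
  have i1 : Integrable (fun z => f z * fderiv ℝ φ z (dir 2)) (volO b) :=
    (Lp.memLp f).integrable_mul hφ'
  have i2 : Integrable (fun z => g z * φ z) (volO b) := (Lp.memLp g).integrable_mul hφ
  change ∫ z, _ ∂volO b = - ∫ z, _ ∂volO b
  rw [integral_volO i1, integral_volO i2, ← integral_neg]
  refine integral_congr_ae ?_
  filter_upwards [ae_ae_of_ae_volO h, ae_prim_vint (Lp.memLp g) c] with x a1 a2
  have hP : Prim b (fun y => φ (x, y)) (fun y => fderiv ℝ φ (x, y) (dir 2)) := by
    refine Prim.of_hasDerivAt (fun y => ?_) ?_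
    · have k1 : HasDerivAt (fun y : ℝ => (x, y)) ((0, 1) : Plane × ℝ) y :=
        (hasDerivAt_const y x).prodMk (hasDerivAt_id y)
      exact ((h1.differentiable (by simp)) (x, y)).hasFDerivAt.comp_hasDerivAt y k1
    · exact (contDiff_fderiv_apply h1 (dir 2)).continuous.comp (by fun_prop)
  obtain ⟨-, -, e⟩ := Prim.integral_mul hb.le a2 hP
  have z0 : ∀ y ∉ Set.Ioo 0 b, φ (x, y) = 0 := fun y hy =>
    image_eq_zero_of_notMem_tsupport fun h => hy (h3 h).2
  rw [z0 0 (by simp), z0 b (by simp), mul_zero, mul_zero, sub_zero] at e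
  have e1 : ∫ y, f (x, y) * fderiv ℝ φ (x, y) (dir 2) ∂volI b =
      ∫ y, (c x + vint g (x, y)) * fderiv ℝ φ (x, y) (dir 2) ∂volI b := by
    refine integral_congr_ae ?_
    filter_upwards [a1] with y hy
    rw [hy]
  rw [e1]
  linear_combination e

lemma hasWeakPartial_two_iff_weakV {b : ℝ} (hb : 0 < b) {f g : L2Omega b} :
    HasWeakPartial b 2 f g ↔ WeakV b f g :=
  ⟨HasWeakPartial.weakV, fun h => by
    obtain ⟨c, hc⟩ := h.exists_eq hb
    exact hasWeakPartial_two_of_eq hb hc⟩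

lemma hasWeakPartial_two_pfourier_iff {b : ℝ} (hb : 0 < b) {f g : L2Omega b} :
    HasWeakPartial b 2 (pfourier b f) (pfourier b g) ↔ HasWeakPartial b 2 f g := by
  rw [hasWeakPartial_two_iff_weakV hb, hasWeakPartial_two_iff_weakV hb, weakV_pfourier_iff]

/-! ### Trace operators -/

/-- The identity function as a continuous map. -/
def cid : C(ℝ, ℝ) := ⟨fun y => y, continuous_id⟩

/-- The trace at height `b` of a function `f` with vertical derivative `g`. -/
def trTop (b : ℝ) (f g : L2Omega b) : L2Sigma :=
  (b⁻¹ : ℂ) • (pair b (cvec b 1) f + pair b (cvec b cid) g)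

/-- The trace at height `0` of a function `f` with vertical derivative `g`. -/
def trBot (b : ℝ) (f g : L2Omega b) : L2Sigma :=
  (b⁻¹ : ℂ) • (pair b (cvec b 1) f + pair b (cvec b (cid + (-b) • 1)) g)

lemma fourier_trTop (b : ℝ) (f g : L2Omega b) :
    𝓕 (trTop b f g) = trTop b (pfourier b f) (pfourier b g) := by
  rw [trTop, trTop, pair_pfourier, pair_pfourier]
  change Lp.fourierTransformₗᵢ Plane ℂ _ = _
  rw [map_smul, map_add]; rfl

lemma fourier_trBot (b : ℝ) (f g : L2Omega b) :
    𝓕 (trBot b f g) = trBot b (pfourier b f) (pfourier b g) := by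
  rw [trBot, trBot, pair_pfourier, pair_pfourier]
  change Lp.fourierTransformₗᵢ Plane ℂ _ = _
  rw [map_smul, map_add]; rfl

/-- Integrate the derivative of `(y + a) v(y)`. With `a = 0` only the value at `b` survives, with `a
= -b` only the value at `0`. This is the origin of the formulas for `trTop` and `trBot`, which
express boundary values by integrals of `v` and `v'`. -/
lemma prim_mul_id {b : ℝ} {v v' : ℝ → ℂ} (hb : 0 ≤ b) (h : Prim b v v') (a : ℝ) :
    ∫ y, v y ∂volI b + ∫ y, v' y * ((y + a : ℝ) : ℂ) ∂volI b = v b * ((b + a : ℝ) : ℂ) -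
      v 0 * (a : ℂ) := by
  have hk : Prim b (fun y => ((y + a : ℝ) : ℂ)) (fun _ => 1) :=
    Prim.of_hasDerivAt (fun y => by
      simpa using ((hasDerivAt_id y).add_const a).ofReal_comp) continuous_const
  obtain ⟨-, -, e⟩ := Prim.integral_mul hb h hk
  simp only [mul_one, zero_add] at e
  linear_combination e

/-- On almost every fibre, the traces of `f` are the boundary values of any absolutely continuous
representative. -/
lemma trace_eq_of_prim {b : ℝ} (hb : 0 < b) {f g : L2Omega b} {F : Plane × ℝ → ℂ}
    (hF : ∀ᵐ x : Plane, Prim b (fun y => F (x, y)) (fun y => g (x, y)))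
    (h : ∀ᵐ x : Plane, ∀ᵐ y ∂volI b, f (x, y) = F (x, y)) :
    (trTop b f g =ᵐ[volume] fun x => F (x, b)) ∧ (trBot b f g =ᵐ[volume] fun x => F (x, 0)) := by
  have hb' : (b : ℂ) ≠ 0 := by exact_mod_cast hb.ne'
  constructor
  · filter_upwards [h, hF, coeFn_pair_cvec b 1 f, coeFn_pair_cvec b cid g,
      Lp.coeFn_smul (b⁻¹ : ℂ) (pair b (cvec b 1) f + pair b (cvec b cid) g),
      Lp.coeFn_add (pair b (cvec b 1) f) (pair b (cvec b cid) g)] with x h1 h2 h3 h4 h5 h6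
    have e := prim_mul_id hb.le h2 0
    have e1 : ∫ y, f (x, y) * ((1 : C(ℝ, ℝ)) y : ℂ) ∂volI b = ∫ y, F (x, y) ∂volI b := by
      refine integral_congr_ae ?_
      filter_upwards [h1] with y hy
      rw [hy]; simp
    rw [trTop, h5, Pi.smul_apply, h6, Pi.add_apply, h3, h4, e1, smul_eq_mul,
      inv_mul_eq_iff_eq_mul₀ hb']
    simp only [add_zero, Complex.ofReal_zero, mul_zero, sub_zero] at e
    rw [mul_comm, ← e]
    rfl
  · filter_upwards [h, hF, coeFn_pair_cvec b 1 f, coeFn_pair_cvec b (cid + (-b) • 1) g,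
      Lp.coeFn_smul (b⁻¹ : ℂ) (pair b (cvec b 1) f + pair b (cvec b (cid + (-b) • 1)) g),
      Lp.coeFn_add (pair b (cvec b 1) f) (pair b (cvec b (cid + (-b) • 1)) g)]
      with x h1 h2 h3 h4 h5 h6
    have e := prim_mul_id hb.le h2 (-b)
    have e1 : ∫ y, f (x, y) * ((1 : C(ℝ, ℝ)) y : ℂ) ∂volI b = ∫ y, F (x, y) ∂volI b := by
      refine integral_congr_ae ?_
      filter_upwards [h1] with y hy
      rw [hy]; simp
    rw [trBot, h5, Pi.smul_apply, h6, Pi.add_apply, h3, h4, e1, smul_eq_mul,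
      inv_mul_eq_iff_eq_mul₀ hb']
    have e2 : ∫ y, g (x, y) * ((cid + (-b) • 1 : C(ℝ, ℝ)) y : ℂ) ∂volI b =
        ∫ y, g (x, y) * ((y + -b : ℝ) : ℂ) ∂volI b := by
      simp [cid]
    rw [e2, e]
    push_cast
    ring

/-- The undetermined constant of `WeakV.exists_eq` is the trace at the bottom; this normalises the
representative. -/
lemma HasWeakPartial.exists_prim {b : ℝ} (hb : 0 < b) {f g : L2Omega b}
    (h : HasWeakPartial b 2 f g) :
    (∀ᵐ x : Plane, Prim b (fun y => trBot b f g x + vint g (x, y)) (fun y => g (x, y))) ∧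
    (∀ᵐ x : Plane, ∀ᵐ y ∂volI b, f (x, y) = trBot b f g x + vint g (x, y)) ∧
    trTop b f g =ᵐ[volume] fun x => trBot b f g x + vint g (x, b) := by
  obtain ⟨c, hc⟩ := h.weakV.exists_eq hb
  have h1 := ae_prim_vint (Lp.memLp g) c
  have h2 := ae_ae_of_ae_volO hc
  obtain ⟨t1, t2⟩ := trace_eq_of_prim hb (F := fun z => c z.1 + vint g z) h1 h2
  have hcb : ∀ᵐ x : Plane, trBot b f g x = c x := by
    filter_upwards [t2] with x hx
    rw [hx]; simp [vint]
  refine ⟨ae_prim_vint (Lp.memLp g) _, ?_, ?_⟩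
  · filter_upwards [h2, hcb] with x a1 a2
    rw [a2]; exact a1
  · filter_upwards [t1, hcb] with x a1 a2
    rw [a1, a2]

/-! ### Linearity and closedness of weak differentiation -/

/-- As an identity of inner products the relation is visibly linear and closed in `(f, g)`.
Conjugation of the test functions passes from one form to the other. -/
lemma hasWeakPartial_iff_inner {b : ℝ} {j : Fin 3} {f g : L2Omega b} :
    HasWeakPartial b j f g ↔ ∀ (φ : Plane × ℝ → ℂ) (h1 : ContDiff ℝ ∞ φ)
      (h2 : HasCompactSupport φ), tsupport φ ⊆ slab b →
      ⟪(memLp_test (b := b) (contDiff_fderiv_apply h1 (dir j))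
        (hasCompactSupport_fderiv_apply h2 (dir j))).toLp _, f⟫_ℂ =
      -⟪(memLp_test (b := b) h1 h2).toLp _, g⟫_ℂ := by
  have hd : ∀ (φ : Plane × ℝ → ℂ), ContDiff ℝ ∞ φ → ∀ z,
      fderiv ℝ (fun z => conj (φ z)) z (dir j) = conj (fderiv ℝ φ z (dir j)) := by
    intro φ h1 z
    have := (Complex.conjCLE.toContinuousLinearMap.hasFDerivAt.comp z
      ((h1.differentiable (by simp)) z).hasFDerivAt).fderiv
    change fderiv ℝ (Complex.conjCLE.toContinuousLinearMap ∘ φ) z _ = _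
    rw [this]
    rfl
  have hin : ∀ (f : L2Omega b) (φ : Plane × ℝ → ℂ) (h : MemLp φ 2 (volO b)),
      ⟪h.toLp _, f⟫_ℂ = ∫ z in slab b, f z * conj (φ z) := by
    intro f φ h
    rw [L2.inner_def]
    refine integral_congr_ae ?_
    filter_upwards [h.coeFn_toLp] with z hz
    rw [hz]
    simp
  have hts : ∀ φ : Plane × ℝ → ℂ, tsupport (fun z => conj (φ z)) = tsupport φ := by
    intro φ
    have : Function.support (fun z => conj (φ z)) = Function.support φ := by ext z; simp
    rw [tsupport, tsupport, this]
  constructor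
  · intro h φ h1 h2 h3
    rw [hin, hin]
    have := h (fun z => conj (φ z)) (Complex.conjCLE.contDiff.comp h1)
      (h2.comp_left (map_zero _)) (by rwa [hts])
    simpa only [hd φ h1] using this
  · intro h φ h1 h2 h3
    have := h (fun z => conj (φ z)) (Complex.conjCLE.contDiff.comp h1)
      (h2.comp_left (map_zero _)) (by rwa [hts])
    rw [hin, hin] at this
    simpa only [hd φ h1, Complex.conj_conj] using this

lemma HasWeakPartial.add {b : ℝ} {j : Fin 3} {f g f' g' : L2Omega b}
    (h : HasWeakPartial b j f g) (h' : HasWeakPartial b j f' g') :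
    HasWeakPartial b j (f + f') (g + g') := by
  rw [hasWeakPartial_iff_inner] at *
  intro φ h1 h2 h3
  rw [inner_add_right, inner_add_right, h φ h1 h2 h3, h' φ h1 h2 h3]
  ring

lemma HasWeakPartial.smul {b : ℝ} {j : Fin 3} {f g : L2Omega b} (c : ℂ)
    (h : HasWeakPartial b j f g) : HasWeakPartial b j (c • f) (c • g) := by
  rw [hasWeakPartial_iff_inner] at *
  intro φ h1 h2 h3
  rw [inner_smul_right, inner_smul_right, h φ h1 h2 h3]
  ring

lemma hasWeakPartial_zero (b : ℝ) (j : Fin 3) : HasWeakPartial b j 0 0 := by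
  rw [hasWeakPartial_iff_inner]
  intro φ h1 h2 h3
  simp

/-! ### Density of test functions in `H¹(Ω)` -/

/-- Smooth compactly supported functions on `ℝ³`. -/
def testFun : Submodule ℂ (Plane × ℝ → ℂ) where
  carrier := {φ | ContDiff ℝ ∞ φ ∧ HasCompactSupport φ}
  add_mem' h k := ⟨h.1.add k.1, h.2.add k.2⟩
  zero_mem' := ⟨contDiff_const, HasCompactSupport.zero⟩
  smul_mem' c _ h := ⟨contDiff_const.smul h.1, h.2.smul_left (f := fun _ => c)⟩

/-- The pairs (function, gradient) of square integrable functions. -/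
abbrev Jet (b : ℝ) : Type := PiLp 2 fun _ : Fin 4 => L2Omega b

/-- Restriction of a test function to the slab. -/
def restr (b : ℝ) (φ : testFun) : L2Omega b := (memLp_test (b := b) φ.2.1 φ.2.2).toLp φ

/-- Restriction of a partial derivative of a test function to the slab. -/
def restrD (b : ℝ) (j : Fin 3) (φ : testFun) : L2Omega b :=
  (memLp_test (b := b) (contDiff_fderiv_apply φ.2.1 (dir j))
    (hasCompactSupport_fderiv_apply φ.2.2 (dir j))).toLp
    fun z => fderiv ℝ (φ : Plane × ℝ → ℂ) z (dir j)

lemma coeFn_restr (b : ℝ) (φ : testFun) : restr b φ =ᵐ[volO b] (φ : Plane × ℝ → ℂ) :=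
  MemLp.coeFn_toLp _

lemma coeFn_restrD (b : ℝ) (j : Fin 3) (φ : testFun) :
    restrD b j φ =ᵐ[volO b] fun z => fderiv ℝ (φ : Plane × ℝ → ℂ) z (dir j) :=
  MemLp.coeFn_toLp _

lemma differentiable_testFun (φ : testFun) : Differentiable ℝ (φ : Plane × ℝ → ℂ) :=
  φ.2.1.differentiable (by simp)

lemma restr_add (b : ℝ) (φ θ : testFun) : restr b (φ + θ) = restr b φ + restr b θ := by
  refine Lp.ext ?_
  filter_upwards [coeFn_restr b (φ + θ), coeFn_restr b φ, coeFn_restr b θ,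
    Lp.coeFn_add (restr b φ) (restr b θ)] with z h1 h2 h3 h4
  rw [h1, h4, Pi.add_apply, h2, h3]
  rfl

lemma restr_smul (b : ℝ) (c : ℂ) (φ : testFun) : restr b (c • φ) = c • restr b φ := by
  refine Lp.ext ?_
  filter_upwards [coeFn_restr b (c • φ), coeFn_restr b φ,
    Lp.coeFn_smul c (restr b φ)] with z h1 h2 h4
  rw [h1, h4, Pi.smul_apply, h2]
  rfl

lemma restrD_add (b : ℝ) (j : Fin 3) (φ θ : testFun) :
    restrD b j (φ + θ) = restrD b j φ + restrD b j θ := by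
  refine Lp.ext ?_
  filter_upwards [coeFn_restrD b j (φ + θ), coeFn_restrD b j φ, coeFn_restrD b j θ,
    Lp.coeFn_add (restrD b j φ) (restrD b j θ)] with z h1 h2 h3 h4
  rw [h1, h4, Pi.add_apply, h2, h3, Submodule.coe_add,
    fderiv_add (differentiable_testFun φ z) (differentiable_testFun θ z)]
  rfl

lemma restrD_smul (b : ℝ) (j : Fin 3) (c : ℂ) (φ : testFun) :
    restrD b j (c • φ) = c • restrD b j φ := by
  refine Lp.ext ?_
  filter_upwards [coeFn_restrD b j (c • φ), coeFn_restrD b j φ,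
    Lp.coeFn_smul c (restrD b j φ)] with z h1 h2 h4
  rw [h1, h4, Pi.smul_apply, h2, Submodule.coe_smul,
    fderiv_const_smul (differentiable_testFun φ z)]
  rfl

/-- Restriction of a test function and of its gradient to the slab. -/
def testJet (b : ℝ) : testFun →ₗ[ℂ] Jet b where
  toFun φ := WithLp.toLp 2 (Fin.cons (restr b φ) fun j => restrD b j φ)
  map_add' φ θ := by
    ext1 i
    exact Fin.cases (restr_add b φ θ) (fun j => restrD_add b j φ θ) i
  map_smul' c φ := by
    ext1 i
    exact Fin.cases (restr_smul b c φ) (fun j => restrD_smul b j c φ) i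

lemma inner_restr {b : ℝ} (φ : testFun) (f : L2Omega b) :
    ⟪restr b φ, f⟫_ℂ = ∫ z, f z * conj ((φ : Plane × ℝ → ℂ) z) ∂volO b := by
  rw [L2.inner_def]
  refine integral_congr_ae ?_
  filter_upwards [coeFn_restr b φ] with z hz
  rw [hz]
  simp

lemma inner_restrD {b : ℝ} (j : Fin 3) (φ : testFun) (f : L2Omega b) :
    ⟪restrD b j φ, f⟫_ℂ = ∫ z, f z * conj (fderiv ℝ (φ : Plane × ℝ → ℂ) z (dir j)) ∂volO b := by
  rw [L2.inner_def]
  refine integral_congr_ae ?_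
  filter_upwards [coeFn_restrD b j φ] with z hz
  rw [hz]
  simp

lemma inner_testJet {b : ℝ} (φ : testFun) (v : Jet b) :
    ⟪testJet b φ, v⟫_ℂ = ⟪restr b φ, v 0⟫_ℂ + ∑ j : Fin 3, ⟪restrD b j φ, v j.succ⟫_ℂ := by
  rw [PiLp.inner_apply, Fin.sum_univ_succ]
  rfl

/-- The graph of the weak gradient. -/
def weakGraph (b : ℝ) : Submodule ℂ (Jet b) where
  carrier := {v | ∀ j : Fin 3, HasWeakPartial b j (v 0) (v j.succ)}
  add_mem' h k j := (h j).add (k j)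
  zero_mem' j := hasWeakPartial_zero b j
  smul_mem' c _ h j := (h j).smul c

lemma isClosed_weakGraph (b : ℝ) : IsClosed (weakGraph b : Set (Jet b)) := by
  have : (weakGraph b : Set (Jet b)) = {v | ∀ j : Fin 3, HasWeakPartial b j (v 0) (v j.succ)} := rfl
  rw [this]
  simp only [hasWeakPartial_iff_inner, Set.ofPred_forall]
  refine isClosed_iInter fun j => isClosed_iInter fun φ => isClosed_iInter fun h1 =>
    isClosed_iInter fun h2 => isClosed_iInter fun h3 => isClosed_eq ?_ ?_
  · exact continuous_const.inner (PiLp.continuous_apply 2 _ _)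
  · exact (continuous_const.inner (PiLp.continuous_apply 2 _ _)).neg

lemma testJet_mem_weakGraph (b : ℝ) (φ : testFun) : testJet b φ ∈ weakGraph b := fun j =>
  hasWeakPartial_of_contDiff j φ.2.1 φ.2.2

/-- The weak Neumann problem `m F - G' = 0` on almost every fibre only has the zero solution. -/
lemma eq_zero_of_neumann {b : ℝ} (hb : 0 < b) {m : Plane → ℝ} (hm : Measurable m)
    (hm0 : ∀ ξ, 0 < m ξ) {F G : L2Omega b} (hFG : HasWeakPartial b 2 F G)
    (h : ∀ ψ ψ' : C(ℝ, ℝ), ContDiff ℝ ∞ ψ → (∀ y, HasDerivAt ψ (ψ' y) y) →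
      ∀ᵐ ξ : Plane, (m ξ : ℂ) * pair b (cvec b ψ) F ξ + pair b (cvec b ψ') G ξ = 0) : F = 0 := by
  -- The test function `ψ = 1` shows that `F` has mean zero on fibres, so its primitive vanishes at
  -- both ends.
  have hint0 : ∀ᵐ ξ : Plane, vint F (ξ, b) = 0 := by
    have h1 := h 1 0 contDiff_const (fun y => hasDerivAt_const y (1 : ℝ))
    filter_upwards [h1, coeFn_pair_cvec b 1 F, coeFn_pair_cvec b 0 G] with ξ a1 a2 a3
    rw [a2, a3] at a1
    simp only [ContinuousMap.one_apply, ContinuousMap.zero_apply, Complex.ofReal_one,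
      Complex.ofReal_zero, mul_one, mul_zero, integral_zero, add_zero, mul_eq_zero,
      Complex.ofReal_eq_zero, (hm0 ξ).ne', false_or] at a1
    rw [vint, intervalIntegral_eq_volI' hb.le]
    exact a1
  -- Testing with primitives of test functions gives `G = m V`, where `V` is the primitive of `F`.
  set V : L2Omega b := (memLp_vint F).toLp _ with hV
  have hrel : MulRel (fun ξ => (m ξ : ℂ)) V G := by
    refine mulRel_of_pair (by fun_prop) fun γ hγ => ?_
    have hd : ∀ y, HasDerivAt (fun y => ∫ t in (0 : ℝ)..y, γ t) (γ y) y := fun y =>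
      intervalIntegral.integral_hasDerivAt_right (γ.continuous.intervalIntegrable _ _)
        (γ.continuous.stronglyMeasurableAtFilter _ _) γ.continuous.continuousAt
    have hcd : ContDiff ℝ ∞ fun y => ∫ t in (0 : ℝ)..y, γ t := by
      refine contDiff_infty_iff_deriv.2 ⟨fun y => (hd y).differentiableAt, ?_⟩
      have : deriv (fun y => ∫ t in (0 : ℝ)..y, γ t) = γ := funext fun y => (hd y).deriv
      rw [this]; exact hγ.1
    have h1 := h ⟨_, hcd.continuous⟩ γ hcd hd
    filter_upwards [h1, coeFn_pair_cvec b ⟨_, hcd.continuous⟩ F, coeFn_pair_cvec b γ V, hint0,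
      ae_prim_vint (Lp.memLp F) 0, ae_ae_of_ae_volO (memLp_vint F).coeFn_toLp]
      with ξ a1 a2 a3 a4 a5 a6
    obtain ⟨-, -, e⟩ := Prim.integral_mul hb.le a5 (prim_of_test (ψ := ⟨_, hcd.continuous⟩) hd)
    have v0 : vint F (ξ, 0) = 0 := by simp [vint]
    beta_reduce at e
    simp only [Pi.zero_apply, zero_add, a4, v0, zero_mul, sub_zero] at e
    have e3 : ∫ y, V (ξ, y) * (γ y : ℂ) ∂volI b = ∫ y, vint F (ξ, y) * (γ y : ℂ) ∂volI b := by
      refine integral_congr_ae ?_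
      filter_upwards [a6] with y hy
      rw [hV, hy]
    rw [a2] at a1
    rw [a3, e3]
    linear_combination a1 - (m ξ : ℂ) * e
  obtain ⟨p1, p2, -⟩ := hFG.exists_prim hb
  refine Lp.ext ((ae_volO_of_ae_ae (Lp.aestronglyMeasurable F)
    aestronglyMeasurable_zero ?_).trans (Lp.coeFn_zero ℂ 2 (volO b)).symm)
  filter_upwards [p1, p2, ae_prim_vint (Lp.memLp F) 0, hint0, ae_ae_of_ae_volO hrel,
    ae_ae_of_ae_volO (memLp_vint F).coeFn_toLp, ae_memLp_fibre (Lp.memLp F)]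
    with ξ a1 a2 a3 a4 a5 a6 a7
  -- Integrating `(F conj V)'` over the fibre gives `∫ m |V|² + ∫ |F|² = 0`, because `F' = G = m V`
  -- and `V` vanishes at both ends.
  have hc : Prim b (fun y => conj (vint F (ξ, y))) (fun y => conj (F (ξ, y))) := by
    refine ⟨(Complex.conjCLE.toContinuousLinearMap.integrable_comp a3.1), fun y hy => ?_⟩
    have v0 : vint F (ξ, 0) = 0 := by simp [vint]
    beta_reduce
    rw [v0, map_zero, zero_add, vint, intervalIntegral.intervalIntegral_eq_integral_uIoc,
      intervalIntegral.intervalIntegral_eq_integral_uIoc, integral_conj]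
    simp [hy.1]
  obtain ⟨i1, i2, e⟩ := Prim.integral_mul hb.le a1 hc
  have v0 : vint F (ξ, 0) = 0 := by simp [vint]
  have e1 : ∫ y, G (ξ, y) * conj (vint F (ξ, y)) ∂volI b =
      ((∫ y, m ξ * ‖vint F (ξ, y)‖ ^ 2 ∂volI b : ℝ) : ℂ) := by
    rw [← integral_complex_ofReal]
    refine integral_congr_ae ?_
    filter_upwards [a5, a6] with y h1 h2
    rw [h1, hV, h2]
    push_cast
    rw [← Complex.mul_conj']
    ring
  have e2 : ∫ y, (trBot b F G ξ + vint G (ξ, y)) * conj (F (ξ, y)) ∂volI b =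
      ((∫ y, ‖F (ξ, y)‖ ^ 2 ∂volI b : ℝ) : ℂ) := by
    rw [← integral_complex_ofReal]
    refine integral_congr_ae ?_
    filter_upwards [a2] with y h1
    rw [← h1]
    push_cast
    rw [← Complex.mul_conj']
  rw [a4, v0, map_zero, mul_zero, mul_zero, sub_zero, e1, e2, ← Complex.ofReal_add,
    Complex.ofReal_eq_zero] at e
  have n1 : 0 ≤ ∫ y, m ξ * ‖vint F (ξ, y)‖ ^ 2 ∂volI b :=
    integral_nonneg fun y => mul_nonneg (hm0 ξ).le (by positivity)
  have n2 : 0 ≤ ∫ y, ‖F (ξ, y)‖ ^ 2 ∂volI b := integral_nonneg fun y => by positivity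
  have e3 : ∫ y, ‖F (ξ, y)‖ ^ 2 ∂volI b = 0 := by linarith
  have e4 := (integral_eq_zero_iff_of_nonneg (fun y => by positivity)
    ((memLp_two_iff_integrable_sq_norm a7.1).1 a7)).1 e3
  filter_upwards [e4] with y hy
  simpa using hy

/-- A smooth product function as a test function. -/
def tensTest {η : Plane → ℂ} {ψ : C(ℝ, ℝ)} (h1 : ContDiff ℝ ∞ η) (h2 : HasCompactSupport η)
    (h3 : ContDiff ℝ ∞ ψ) (h4 : HasCompactSupport ψ) : testFun :=
  have c1 : ContDiff ℝ ∞ fun x => conj (η x) := Complex.conjCLE.contDiff.comp h1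
  have c2 : HasCompactSupport fun x => conj (η x) := h2.comp_left (map_zero _)
  have c3 : (ContDiff ℝ ∞ fun z : Plane × ℝ => conj (η z.1) * (ψ z.2 : ℂ)) ∧
      HasCompactSupport fun z : Plane × ℝ => conj (η z.1) * (ψ z.2 : ℂ) :=
    ⟨contDiff_tens (η := fun x => conj (η x)) (ψ := ψ) c1 h3,
      hasCompactSupport_tens (η := fun x => conj (η x)) (ψ := ψ) c2 h4⟩
  ⟨fun z => conj (η z.1) * (ψ z.2 : ℂ), c3⟩

lemma fderiv_conj_apply {η : Plane → ℂ} (h1 : ContDiff ℝ ∞ η) (x e : Plane) :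
    fderiv ℝ (fun z => conj (η z)) x e = conj (fderiv ℝ η x e) := by
  have := (Complex.conjCLE.toContinuousLinearMap.hasFDerivAt.comp x
    ((h1.differentiable (by simp)) x).hasFDerivAt).fderiv
  change fderiv ℝ (Complex.conjCLE.toContinuousLinearMap ∘ η) x _ = _
  rw [this]
  rfl

section tensTest

variable {b : ℝ} {η : Plane → ℂ} {ψ ψ' : C(ℝ, ℝ)} (h1 : ContDiff ℝ ∞ η)
  (h2 : HasCompactSupport η) (h3 : ContDiff ℝ ∞ ψ) (h4 : HasCompactSupport ψ)

lemma memLp_of_test (h1 : ContDiff ℝ ∞ η) (h2 : HasCompactSupport η) :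
    MemLp η 2 (volume : Measure Plane) :=
  h1.continuous.memLp_of_hasCompactSupport h2

lemma memLp_fderiv_of_test (h1 : ContDiff ℝ ∞ η) (h2 : HasCompactSupport η) (j : Fin 2) :
    MemLp (fun x => fderiv ℝ η x (hdir j)) 2 (volume : Measure Plane) :=
  ((h1.continuous_fderiv (by simp)).clm_apply
    continuous_const).memLp_of_hasCompactSupport (h2.fderiv_apply ℝ _)

lemma inner_restr_tensTest (f : L2Omega b) :
    ⟪restr b (tensTest h1 h2 h3 h4), f⟫_ℂ = ∫ x, pair b (cvec b ψ) f x * η x := by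
  rw [← integral_mul_tens _ (memLp_of_test h1 h2), inner_restr]
  refine integral_congr_ae (Eventually.of_forall fun z => ?_)
  simp [tensTest, Complex.conj_ofReal]

lemma inner_restrD_tensTest (j : Fin 2) (f : L2Omega b) :
    ⟪restrD b j.castSucc (tensTest h1 h2 h3 h4), f⟫_ℂ =
      ∫ x, pair b (cvec b ψ) f x * fderiv ℝ η x (hdir j) := by
  rw [← integral_mul_tens _ (memLp_fderiv_of_test h1 h2 j), inner_restrD]
  refine integral_congr_ae (Eventually.of_forall fun z => ?_)
  have c1 : ContDiff ℝ ∞ fun x => conj (η x) := Complex.conjCLE.contDiff.comp h1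
  simp only [tensTest, hasFDerivAt_tens c1 h3, dir_castSucc, fderiv_conj_apply h1, mul_zero,
    Complex.ofReal_zero, add_zero, map_mul, Complex.conj_conj, Complex.conj_ofReal]

lemma inner_restrD_tensTest_two (hd : ∀ y, HasDerivAt ψ (ψ' y) y) (f : L2Omega b) :
    ⟪restrD b 2 (tensTest h1 h2 h3 h4), f⟫_ℂ = ∫ x, pair b (cvec b ψ') f x * η x := by
  rw [← integral_mul_tens _ (memLp_of_test h1 h2), inner_restrD]
  refine integral_congr_ae (Eventually.of_forall fun z => ?_)
  have c1 : ContDiff ℝ ∞ fun x => conj (η x) := Complex.conjCLE.contDiff.comp h1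
  simp only [tensTest, hasFDerivAt_tens c1 h3, dir_two, map_zero, zero_mul, zero_add,
    (hd _).deriv, mul_one, map_mul, Complex.conj_conj, Complex.conj_ofReal]

end tensTest

/-- Orthogonality to all test functions is the weak form of `f - Δf = 0` with Neumann conditions.
Testing with products and transforming horizontally replaces the horizontal Laplacian by `-|2πξ|²`;
the vertical test function need not vanish at the boundary. -/
lemma neumann_identity_of_hasCompactSupport {b : ℝ} {f : L2Omega b} {g : Fin 3 → L2Omega b}
    (hv : ∀ j, HasWeakPartial b j f (g j))
    (h : ∀ φ : testFun, ⟪restr b φ, f⟫_ℂ + ∑ j : Fin 3, ⟪restrD b j φ, g j⟫_ℂ = 0)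
    {ψ ψ' : C(ℝ, ℝ)} (hψ : ContDiff ℝ ∞ ψ) (hc : HasCompactSupport ψ)
    (hd : ∀ y, HasDerivAt ψ (ψ' y) y) : ∀ᵐ ξ : Plane,
    ((1 + (2 * Real.pi) ^ 2 * (ξ 0 ^ 2 + ξ 1 ^ 2) : ℝ) : ℂ) *
      pair b (cvec b ψ) (pfourier b f) ξ + pair b (cvec b ψ') (pfourier b (g 2)) ξ = 0 := by
  have hf := fourier_eq_of_forall_test (pair b (cvec b ψ) f + pair b (cvec b ψ') (g 2))
    (fun j => pair b (cvec b ψ) (g j.castSucc)) (fun η h1 h2 => by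
      have e := h (tensTest h1 h2 hψ hc)
      have s1 := inner_restrD_tensTest h1 h2 hψ hc 0 (g 0)
      have s2 := inner_restrD_tensTest h1 h2 hψ hc 1 (g 1)
      rw [Fin.sum_univ_three] at e
      rw [inner_restrD_tensTest_two h1 h2 hψ hc hd, inner_restr_tensTest] at e
      have i : ∀ (k : L2Sigma) {θ : Plane → ℂ}, MemLp θ 2 volume →
        Integrable fun x => k x * θ x := fun k θ hθ => (Lp.memLp k).integrable_mul hθ
      have hη := memLp_of_test h1 h2
      have hη' := memLp_fderiv_of_test h1 h2
      have ia : Integrable fun x => (pair b (cvec b ψ) f +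
          pair b (cvec b ψ') (g 2) : L2Sigma) x * η x := i _ hη
      have i2 : Integrable fun x =>
          pair b (cvec b ψ) (g (Fin.castSucc 0)) x * fderiv ℝ η x (hdir 0) +
          pair b (cvec b ψ) (g (Fin.castSucc 1)) x * fderiv ℝ η x (hdir 1) :=
        (i _ (hη' 0)).add (i _ (hη' 1))
      rw [integral_add ia i2, integral_add (i _ (hη' 0)) (i _ (hη' 1))]
      have : ∫ x, (pair b (cvec b ψ) f + pair b (cvec b ψ') (g 2) : L2Sigma) x *
          η x = ∫ x, (pair b (cvec b ψ) f x * η x + pair b (cvec b ψ') (g 2) x * η x) := by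
        refine integral_congr_ae ?_
        filter_upwards [Lp.coeFn_add (pair b (cvec b ψ) f) (pair b (cvec b ψ') (g 2))] with x hx
        rw [hx, Pi.add_apply, add_mul]
      rw [this, integral_add (i _ hη) (i _ hη)]
      have s1' : ⟪restrD b 0 (tensTest h1 h2 hψ hc), g 0⟫_ℂ =
        ∫ x, pair b (cvec b ψ) (g (Fin.castSucc 0)) x * fderiv ℝ η x (hdir 0) := s1
      have s2' : ⟪restrD b 1 (tensTest h1 h2 hψ hc), g 1⟫_ℂ =
        ∫ x, pair b (cvec b ψ) (g (Fin.castSucc 1)) x * fderiv ℝ η x (hdir 1) := s2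
      rw [← s1', ← s2']
      linear_combination e)
  have hadd : (𝓕 (pair b (cvec b ψ) f + pair b (cvec b ψ') (g 2)) : L2Sigma) =
      pair b (cvec b ψ) (pfourier b f) + pair b (cvec b ψ') (pfourier b (g 2)) := by
    rw [pair_pfourier, pair_pfourier]
    exact (Lp.fourierTransformₗᵢ Plane ℂ).map_add _ _
  rw [hadd] at hf
  simp only [← pair_pfourier] at hf
  have r0 := (HasWeakPartial.mulRel (j := 0) (hv 0)).pair (cvec b ψ)
  have r1 := (HasWeakPartial.mulRel (j := 1) (hv 1)).pair (cvec b ψ)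
  filter_upwards [hf, r0, r1, Lp.coeFn_add (pair b (cvec b ψ) (pfourier b f))
    (pair b (cvec b ψ') (pfourier b (g 2)))] with ξ a1 a2 a3 a4
  rw [a4, Pi.add_apply] at a1
  have a1' : pair b (cvec b ψ) (pfourier b f) ξ + pair b (cvec b ψ') (pfourier b (g 2)) ξ =
    2 * Real.pi * Complex.I * (ξ 0 * pair b (cvec b ψ) (pfourier b (g 0)) ξ
    + ξ 1 * pair b (cvec b ψ) (pfourier b (g 1)) ξ) := a1
  rw [a2, a3] at a1'
  simp only [symb] at a1'
  push_cast
  linear_combination a1' + ((2 * Real.pi : ℂ) ^ 2 * (ξ 0 ^ 2 + ξ 1 ^ 2) *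
    pair b (cvec b ψ) (pfourier b f) ξ) * Complex.I_sq

/-- A cutoff equal to one near `(0, b)` changes neither the vertical test function nor its
derivative there, so its compact support is no restriction. -/
lemma neumann_identity {b : ℝ} (hb : 0 < b) {f : L2Omega b} {g : Fin 3 → L2Omega b}
    (hv : ∀ j, HasWeakPartial b j f (g j))
    (h : ∀ φ : testFun, ⟪restr b φ, f⟫_ℂ + ∑ j : Fin 3, ⟪restrD b j φ, g j⟫_ℂ = 0)
    {ψ ψ' : C(ℝ, ℝ)} (hψ : ContDiff ℝ ∞ ψ) (hd : ∀ y, HasDerivAt ψ (ψ' y) y) : ∀ᵐ ξ : Plane,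
    ((1 + (2 * Real.pi) ^ 2 * (ξ 0 ^ 2 + ξ 1 ^ 2) : ℝ) : ℂ) *
      pair b (cvec b ψ) (pfourier b f) ξ + pair b (cvec b ψ') (pfourier b (g 2)) ξ = 0 := by
  let B : ContDiffBump (0 : ℝ) := ⟨b + 1, b + 2, by linarith, by linarith⟩
  have hB : ContDiff ℝ ∞ B := B.contDiff
  have hB1 : ∀ y ∈ Set.Ioo 0 b, B =ᶠ[𝓝 y] 1 := fun y hy =>
    B.eventuallyEq_one_of_mem_ball (by
      rw [Metric.mem_ball, Real.dist_eq, sub_zero, abs_of_pos hy.1]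
      change y < b + 1
      linarith [hy.2])
  have hBd : Continuous (deriv B) := hB.continuous_deriv (by simp)
  have hBc : Continuous B := hB.continuous
  have e1 : cvec b ψ = cvec b ⟨fun y => B y * ψ y, by fun_prop⟩ := cvec_eq_of_eqOn fun y hy => by
    simp [(hB1 y hy).eq_of_nhds]
  have e2 : cvec b ψ' = cvec b ⟨fun y => deriv B y * ψ y + B y * ψ' y, by fun_prop⟩ :=
    cvec_eq_of_eqOn fun y hy => by
      have : deriv (1 : ℝ → ℝ) y = 0 := by
        change deriv (fun _ => (1 : ℝ)) y = 0
        simp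
      simp [(hB1 y hy).eq_of_nhds, (hB1 y hy).deriv_eq, this]
  rw [e1, e2]
  refine neumann_identity_of_hasCompactSupport hv h (hB.mul hψ)
    (B.hasCompactSupport.mul_right) fun y => ?_
  exact ((hB.differentiable (by simp)) y).hasDerivAt.mul (hd y)

/-- An element of the graph orthogonal to all test functions solves a homogeneous Neumann problem,
which on the Fourier side has only the zero solution. -/
lemma eq_zero_of_orthogonal_test {b : ℝ} (hb : 0 < b) {v : Jet b} (hv : v ∈ weakGraph b)
    (h : ∀ φ : testFun, ⟪testJet b φ, v⟫_ℂ = 0) : v = 0 := by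
  have hF : pfourier b (v 0) = 0 := by
    refine eq_zero_of_neumann hb (m := fun ξ => 1 + (2 * Real.pi) ^ 2 * (ξ 0 ^ 2 + ξ 1 ^ 2))
      (by fun_prop) (fun ξ => by positivity)
      ((hasWeakPartial_two_pfourier_iff hb).2 (hv 2)) fun ψ ψ' hψ hd => ?_
    exact neumann_identity hb hv (fun φ => (inner_testJet φ v).symm.trans (h φ)) hψ hd
  have h0 : v 0 = 0 := by
    apply (pfourier b).injective
    rw [hF, map_zero]
  ext1 i
  refine Fin.cases h0 (fun j => ?_) i
  have := hv j
  rw [h0] at this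
  exact this.unique (hasWeakPartial_zero b j)

/-- Project `(f, ∇f)` onto the closure of the test functions. The graph is closed, so the residual
is again a function with its gradient; being orthogonal to the test functions, it vanishes. -/
lemma exists_test_seq {b : ℝ} (hb : 0 < b) {f : L2Omega b} {g : Fin 3 → L2Omega b}
    (h : ∀ j, HasWeakPartial b j f (g j)) :
    ∃ φ : ℕ → testFun, Tendsto (fun n => testJet b (φ n)) atTop
      (𝓝 (WithLp.toLp 2 (Fin.cons f g : Fin 4 → L2Omega b))) := by
  set v : Jet b := WithLp.toLp 2 (Fin.cons f g : Fin 4 → L2Omega b)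
  have hv : v ∈ weakGraph b := h
  let S : Submodule ℂ (Jet b) := (LinearMap.range (testJet b)).topologicalClosure
  have hSG : S ≤ weakGraph b := Submodule.topologicalClosure_minimal _ (by
    rintro _ ⟨φ, rfl⟩; exact testJet_mem_weakGraph b φ) (isClosed_weakGraph b)
  have hSc : IsClosed (S : Set (Jet b)) := Submodule.isClosed_topologicalClosure _
  have : CompleteSpace S := hSc.completeSpace_coe
  obtain ⟨y, hy, z, hz, hyz⟩ := S.exists_add_mem_mem_orthogonal v
  have hz0 : z = 0 := by
    refine eq_zero_of_orthogonal_test hb ?_ fun φ => ?_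
    · have : z = v - y := by rw [hyz]; abel
      rw [this]
      exact (weakGraph b).sub_mem hv (hSG hy)
    · exact (Submodule.mem_orthogonal _ _).1 hz _
        (Submodule.le_topologicalClosure _ ⟨φ, rfl⟩)
  rw [hz0, add_zero] at hyz
  rw [← hyz] at hy
  have hcl : v ∈ closure (Set.range (testJet b)) := by
    have h1 : v ∈ closure ((LinearMap.range (testJet b) : Submodule ℂ (Jet b)) : Set (Jet b)) := hy
    rwa [LinearMap.coe_range] at h1
  obtain ⟨w, hw, hwt⟩ := mem_closure_iff_seq_limit.1 hcl
  choose φ hφ using hw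
  exact ⟨φ, by simpa only [hφ] using hwt⟩

/-! ### Characterisation of traces -/

lemma continuous_trTop (b : ℝ) : Continuous fun p : L2Omega b × L2Omega b => trTop b p.1 p.2 := by
  unfold trTop; fun_prop

lemma continuous_trBot (b : ℝ) : Continuous fun p : L2Omega b × L2Omega b => trBot b p.1 p.2 := by
  unfold trBot; fun_prop

lemma trace_test {b : ℝ} (hb : 0 < b) (φ : testFun) :
    (trTop b (restr b φ) (restrD b 2 φ) =ᵐ[volume] fun x => (φ : Plane × ℝ → ℂ) (x, b)) ∧
    (trBot b (restr b φ) (restrD b 2 φ) =ᵐ[volume] fun x => (φ : Plane × ℝ → ℂ) (x, 0)) := by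
  refine trace_eq_of_prim hb (F := φ) ?_ (ae_ae_of_ae_volO (coeFn_restr b φ))
  filter_upwards [ae_ae_of_ae_volO (coeFn_restrD b 2 φ)] with x hx
  have hcd : Continuous fun y => fderiv ℝ (φ : Plane × ℝ → ℂ) (x, y) (dir 2) :=
    (contDiff_fderiv_apply φ.2.1 (dir 2)).continuous.comp (by fun_prop)
  refine Prim.congr (Prim.of_hasDerivAt (fun y => ?_) hcd) (fun y _ => rfl) hx
  have k1 : HasDerivAt (fun y : ℝ => (x, y)) ((0, 1) : Plane × ℝ) y :=
    (hasDerivAt_const y x).prodMk (hasDerivAt_id y)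
  exact (differentiable_testFun φ (x, y)).hasFDerivAt.comp_hasDerivAt y k1

lemma tendsto_eLpNorm_toLp_sub {α : Type*} {m : MeasurableSpace α} {μ : Measure α}
    {φ : ℕ → α → ℂ} (hφ : ∀ n, MemLp (φ n) 2 μ) (f : Lp ℂ 2 μ) :
    Tendsto (fun n => eLpNorm (fun z => φ n z - f z) 2 μ) atTop (𝓝 0) ↔
      Tendsto (fun n => (hφ n).toLp (φ n)) atTop (𝓝 f) := by
  rw [Lp.tendsto_Lp_iff_tendsto_eLpNorm']
  refine tendsto_congr fun n => eLpNorm_congr_ae ?_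
  filter_upwards [(hφ n).coeFn_toLp] with z hz
  rw [Pi.sub_apply, hz]

/-- An operator that is continuous in `(f, ∂₃f)` and correct on test functions gives the limit of
every approximating sequence, hence uniqueness. Such a sequence exists by density in `H¹(Ω)`, hence
existence. Both boundary planes are treated at once. -/
lemma hasTrace_aux {b y₀ : ℝ} {tr : L2Omega b → L2Omega b → L2Sigma}
    (hc : Continuous fun p : L2Omega b × L2Omega b => tr p.1 p.2)
    (ht : ∀ φ : testFun, tr (restr b φ) (restrD b 2 φ) =ᵐ[volume]
      fun x => (φ : Plane × ℝ → ℂ) (x, y₀)) {f : L2Omega b} {g : Fin 3 → L2Omega b} (hb : 0 < b)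
    (h : ∀ j, HasWeakPartial b j f (g j)) (τ : L2Sigma) :
    HasTrace b y₀ f τ ↔ τ = tr f (g 2) := by
  have hm : ∀ φ : testFun, MemLp (fun x => (φ : Plane × ℝ → ℂ) (x, y₀)) 2 volume := fun φ =>
    (memLp_congr_ae (ht φ)).1 (Lp.memLp _)
  have hm' : ∀ φ : testFun, (hm φ).toLp _ = tr (restr b φ) (restrD b 2 φ) := fun φ =>
    Lp.ext ((hm φ).coeFn_toLp.trans (ht φ).symm)
  constructor
  · rintro ⟨φ, h1, h2, h3, h4⟩
    obtain ⟨g', hg', hgt⟩ := h3 2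
    rw [hg'.unique (h 2)] at hgt
    rw [tendsto_eLpNorm_toLp_sub (fun n => memLp_test (h1 n).1 (h1 n).2)] at h2
    rw [tendsto_eLpNorm_toLp_sub (fun n => memLp_test (contDiff_fderiv_apply (h1 n).1 (dir 2))
        (hasCompactSupport_fderiv_apply (h1 n).2 (dir 2)))] at hgt
    rw [tendsto_eLpNorm_toLp_sub (fun n => hm ⟨φ n, h1 n⟩)] at h4
    replace h4 := h4.congr fun n => hm' ⟨φ n, h1 n⟩
    exact tendsto_nhds_unique h4 ((hc.tendsto (f, g 2)).comp (h2.prodMk_nhds hgt))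
  · rintro rfl
    obtain ⟨φ, hφ⟩ := exists_test_seq hb h
    have hcomp : ∀ i, Tendsto (fun n => testJet b (φ n) i) atTop
        (𝓝 ((WithLp.toLp 2 (Fin.cons f g : Fin 4 → L2Omega b) : Jet b) i)) := fun i =>
      ((PiLp.continuous_apply 2 _ i).tendsto _).comp hφ
    refine ⟨fun n => φ n, fun n => (φ n).2, ?_, fun j => ⟨g j, h j, ?_⟩, ?_⟩
    · rw [tendsto_eLpNorm_toLp_sub (fun n => memLp_test (φ n).2.1 (φ n).2.2)]
      exact hcomp 0
    · rw [tendsto_eLpNorm_toLp_sub (fun n => memLp_test (contDiff_fderiv_apply (φ n).2.1 (dir j))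
        (hasCompactSupport_fderiv_apply (φ n).2.2 (dir j)))]
      exact hcomp j.succ
    · rw [tendsto_eLpNorm_toLp_sub (fun n => hm (φ n))]
      simp only [hm']
      exact (hc.tendsto (f, g 2)).comp ((hcomp 0).prodMk_nhds (hcomp (Fin.succ 2)))

lemma hasTrace_top_iff {b : ℝ} (hb : 0 < b) {f : L2Omega b} {g : Fin 3 → L2Omega b}
    (h : ∀ j, HasWeakPartial b j f (g j)) (τ : L2Sigma) :
    HasTrace b b f τ ↔ τ = trTop b f (g 2) :=
  hasTrace_aux (continuous_trTop b) (fun φ => (trace_test hb φ).1) hb h τ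

lemma hasTrace_bot_iff {b : ℝ} (hb : 0 < b) {f : L2Omega b} {g : Fin 3 → L2Omega b}
    (h : ∀ j, HasWeakPartial b j f (g j)) (τ : L2Sigma) :
    HasTrace b 0 f τ ↔ τ = trBot b f (g 2) :=
  hasTrace_aux (continuous_trBot b) (fun φ => (trace_test hb φ).2) hb h τ

/-! ### Absolutely continuous functions on the vertical interval -/

lemma Prim.conj {b : ℝ} {v v' : ℝ → ℂ} (h : Prim b v v') :
    Prim b (fun y => conj (v y)) (fun y => conj (v' y)) := by
  refine ⟨Complex.conjCLE.toContinuousLinearMap.integrable_comp h.1, fun y hy => ?_⟩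
  beta_reduce
  rw [h.2 y hy, map_add, intervalIntegral.integral_of_le hy.1,
    intervalIntegral.integral_of_le hy.1, integral_conj]

/-- `v` has the weak derivative `v'` on `(0, b)` and the boundary values `v₀` and `v_b`. -/
def HD (b : ℝ) (v v' : L2I b) (v₀ vb : ℂ) : Prop :=
  ∃ F F' : ℝ → ℂ, Prim b F F' ∧ v =ᵐ[volI b] F ∧ v' =ᵐ[volI b] F' ∧ F 0 = v₀ ∧ F b = vb

/-- Constant functions on the vertical interval. -/
def constI (b : ℝ) (c : ℂ) : L2I b := (memLp_const c).toLp fun _ => c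

namespace HD

variable {b : ℝ} {v v' z z' : L2I b} {v₀ vb z₀ zb : ℂ}

lemma ibp (hb : 0 < b) (h : HD b v v' v₀ vb) (k : HD b z z' z₀ zb) :
    ⟪v', z⟫_ℝ + ⟪v, z'⟫_ℝ = ⟪vb, zb⟫_ℝ - ⟪v₀, z₀⟫_ℝ := by
  obtain ⟨F, F', hF, e1, e2, rfl, rfl⟩ := h
  obtain ⟨G, G', hG, e3, e4, rfl, rfl⟩ := k
  obtain ⟨i1, i2, e⟩ := Prim.integral_mul hb.le hF.conj hG
  rw [L2.inner_def, L2.inner_def]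
  have r1 : ∫ y, ⟪v' y, z y⟫_ℝ ∂volI b = (∫ y, conj (F' y) * G y ∂volI b).re := by
    rw [← RCLike.re_eq_complex_re, ← integral_re i1]
    refine integral_congr_ae ?_
    filter_upwards [e2, e3] with y h1 h2
    rw [h1, h2, Complex.inner, RCLike.re_eq_complex_re, mul_comm]
  have r2 : ∫ y, ⟪v y, z' y⟫_ℝ ∂volI b = (∫ y, conj (F y) * G' y ∂volI b).re := by
    rw [← RCLike.re_eq_complex_re, ← integral_re i2]
    refine integral_congr_ae ?_
    filter_upwards [e1, e4] with y h1 h2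
    rw [h1, h2, Complex.inner, RCLike.re_eq_complex_re, mul_comm]
  rw [r1, r2, ← Complex.add_re, e, Complex.sub_re, Complex.inner, Complex.inner, mul_comm, mul_comm (G 0)]

/-- With an affine weight vanishing at one end, integration by parts retains only the boundary value
at the other end. This gives the two trace inequalities. -/
lemma mul_weight (hb : 0 < b) (h : HD b v v' v₀ vb) {m : ℝ → ℝ} {m' : ℝ}
    (hm : ∀ y, HasDerivAt m m' y) (hm' : ∀ y ∈ Set.Ioo 0 b, |m y| ≤ b) :
    ∃ w w' : L2I b, HD b w (m' • v + w') (m 0 • v₀) (m b • vb) ∧ ‖w‖ ≤ b * ‖v‖ ∧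
      ‖w'‖ ≤ b * ‖v'‖ := by
  obtain ⟨F, F', hF, e1, e2, rfl, rfl⟩ := h
  have hmc : Continuous m := continuous_iff_continuousAt.2 fun y => (hm y).continuousAt
  have hM : Prim b (fun y => (m y : ℂ)) (fun _ => (m' : ℂ)) :=
    Prim.of_hasDerivAt (fun y => (hm y).ofReal_comp) continuous_const
  have hbd : ∀ (q : L2I b), ∀ᵐ y ∂volI b, ‖(m y : ℂ) * q y‖ ≤ b * ‖q y‖ := by
    intro q
    filter_upwards [ae_restrict_mem measurableSet_Ioo] with y hy
    rw [norm_mul, Complex.norm_real, Real.norm_eq_abs]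
    exact mul_le_mul_of_nonneg_right (hm' y hy) (norm_nonneg _)
  have hq : ∀ q : L2I b, MemLp (fun y => (m y : ℂ) * q y) 2 (volI b) := fun q =>
    (Lp.memLp q).of_le_mul ((Complex.continuous_ofReal.comp hmc).aestronglyMeasurable.mul
      (Lp.aestronglyMeasurable q)) (hbd q)
  have hn : ∀ q : L2I b, ‖(hq q).toLp _‖ ≤ b * ‖q‖ := by
    intro q
    refine Lp.norm_le_mul_norm_of_ae_le_mul ?_
    filter_upwards [(hq q).coeFn_toLp, hbd q] with y h1 h2
    rwa [h1]
  refine ⟨(hq v).toLp _, (hq v').toLp _, ⟨_, _, hM.mul hb.le hF, ?_, ?_, ?_, ?_⟩, hn v, hn v'⟩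
  · filter_upwards [(hq v).coeFn_toLp, e1] with y h1 h2
    rw [h1, h2]
  · filter_upwards [(hq v').coeFn_toLp, e1, e2, Lp.coeFn_add (m' • v) ((hq v').toLp _),
      Lp.coeFn_smul m' v] with y h1 h2 h3 h4 h5
    rw [h4, Pi.add_apply, h5, Pi.smul_apply, h1, h2, h3, Complex.real_smul]
  · rw [Complex.real_smul]
  · rw [Complex.real_smul]

/-- Trace inequality at the upper end. -/
lemma norm_sq_le (hb : 0 < b) (h : HD b v v' v₀ vb) :
    |b * ‖vb‖ ^ 2 - ‖v‖ ^ 2| ≤ 2 * b * (‖v‖ * ‖v'‖) := by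
  obtain ⟨w, w', hw, n1, n2⟩ := h.mul_weight hb (m := id) (m' := 1) (fun y => hasDerivAt_id y)
    (fun y hy => by rw [id, abs_of_pos hy.1]; exact hy.2.le)
  have e := hw.ibp hb h
  simp only [one_smul, id, zero_smul, inner_zero_left, sub_zero, inner_add_left, inner_smul_left,
    real_inner_self_eq_norm_sq, RCLike.conj_to_real] at e
  have a1 := (abs_real_inner_le_norm w' v).trans
    (mul_le_mul_of_nonneg_right n2 (norm_nonneg v))
  have a2 := (abs_real_inner_le_norm w v').trans
    (mul_le_mul_of_nonneg_right n1 (norm_nonneg v'))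
  have : b * ‖vb‖ ^ 2 - ‖v‖ ^ 2 = ⟪w', v⟫_ℝ + ⟪w, v'⟫_ℝ := by linarith
  rw [this]
  refine (abs_add_le _ _).trans ?_
  linarith

/-- Trace inequality at the lower end. -/
lemma norm_sq_le' (hb : 0 < b) (h : HD b v v' v₀ vb) :
    |b * ‖v₀‖ ^ 2 - ‖v‖ ^ 2| ≤ 2 * b * (‖v‖ * ‖v'‖) := by
  obtain ⟨w, w', hw, n1, n2⟩ := h.mul_weight hb (m := fun y => b - y) (m' := -1)
    (fun y => by simpa using (hasDerivAt_id y).const_sub b)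
    (fun y hy => by rw [abs_of_pos (by linarith [hy.2])]; linarith [hy.1])
  have e := hw.ibp hb h
  simp only [neg_smul, one_smul, sub_self, zero_smul, inner_zero_left, sub_zero, inner_add_left,
    inner_smul_left, real_inner_self_eq_norm_sq, RCLike.conj_to_real, inner_neg_left] at e
  have a1 := (abs_real_inner_le_norm w' v).trans
    (mul_le_mul_of_nonneg_right n2 (norm_nonneg v))
  have a2 := (abs_real_inner_le_norm w v').trans
    (mul_le_mul_of_nonneg_right n1 (norm_nonneg v'))
  have : b * ‖v₀‖ ^ 2 - ‖v‖ ^ 2 = -(⟪w', v⟫_ℝ + ⟪w, v'⟫_ℝ) := by linarith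
  rw [this, abs_neg]
  refine (abs_add_le _ _).trans ?_
  linarith

/-- The trace inequality with zero boundary value reads `x² ≤ 2 b x y`; divide by `x`. Poincaré's
inequality is thus obtained at either end. -/
lemma poincare_aux {b x y : ℝ} (hx : 0 ≤ x) (hy : 0 ≤ y) (hb : 0 < b)
    (h : |b * ‖(0 : ℂ)‖ ^ 2 - x ^ 2| ≤ 2 * b * (x * y)) : x ≤ 2 * b * y := by
  rw [norm_zero, abs_le] at h
  rcases hx.eq_or_lt with rfl | h0
  · positivity
  · refine le_of_mul_le_mul_left (a := x) ?_ h0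
    nlinarith [h.1]

lemma poincare (hb : 0 < b) (h : HD b v v' 0 vb) : ‖v‖ ≤ 2 * b * ‖v'‖ :=
  poincare_aux (norm_nonneg _) (norm_nonneg _) hb (h.norm_sq_le' hb)

lemma poincare' (hb : 0 < b) (h : HD b v v' v₀ 0) : ‖v‖ ≤ 2 * b * ‖v'‖ :=
  poincare_aux (norm_nonneg _) (norm_nonneg _) hb (h.norm_sq_le hb)

lemma smul (h : HD b v v' v₀ vb) (r : ℝ) : HD b (r • v) (r • v') (r • v₀) (r • vb) := by
  obtain ⟨F, F', hF, e1, e2, rfl, rfl⟩ := h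
  refine ⟨_, _, hF.const_mul r, ?_, ?_, ?_, ?_⟩
  · filter_upwards [e1, Lp.coeFn_smul r v] with y h1 h2
    rw [h2, Pi.smul_apply, h1, Complex.real_smul]
  · filter_upwards [e2, Lp.coeFn_smul r v'] with y h1 h2
    rw [h2, Pi.smul_apply, h1, Complex.real_smul]
  · rw [Complex.real_smul]
  · rw [Complex.real_smul]

lemma sub_const (h : HD b v v' v₀ vb) (c : ℂ) :
    HD b (v - constI b c) v' (v₀ - c) (vb - c) := by
  obtain ⟨F, F', hF, e1, e2, rfl, rfl⟩ := h
  refine ⟨_, _, (hF.sub (Prim.const c)).congr (z' := F') (fun y _ => rfl)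
    (Eventually.of_forall fun y => (sub_zero _).symm), ?_, e2, rfl, rfl⟩
  filter_upwards [e1, Lp.coeFn_sub v (constI b c), (memLp_const (p := 2) (μ := volI b) c).coeFn_toLp]
    with y h1 h2 h3
  rw [h2, Pi.sub_apply, h1, constI, h3]

end HD

lemma exists_primitive_I {b : ℝ} (g : L2I b) :
    ∃ G : L2I b, HD b G g 0 (∫ t in (0 : ℝ)..b, g t) := by
  have h := Prim.of_primitive ((Lp.memLp g).integrable (by norm_num)) 0
  refine ⟨(h.memLp 2).toLp _, _, _, h, (h.memLp 2).coeFn_toLp, .rfl, ?_, ?_⟩ <;> simp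

lemma norm_constI {b : ℝ} (hb : 0 < b) (c : ℂ) : ‖constI b c‖ = Real.sqrt b * ‖c‖ := by
  rw [constI, Lp.norm_toLp, eLpNorm_const _ (by norm_num) (by simp [hb])]
  rw [ENNReal.toReal_mul, mul_comm]
  simp [← ENNReal.toReal_rpow, Real.sqrt_eq_rpow, ENNReal.toReal_ofReal hb.le]

lemma constI_sub (b : ℝ) (c d : ℂ) : constI b (c - d) = constI b c - constI b d :=
  MemLp.toLp_sub (memLp_const c) (memLp_const d)

lemma constI_smul (b r : ℝ) (c : ℂ) : constI b (r • c) = r • constI b c :=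
  MemLp.toLp_const_smul r (memLp_const c)

open Asymptotics

/-! ### The a priori estimate on one fibre -/

/-- A solution of the rotated system on a fibre of frequency `r`; `σ²` is comparable with `1 + r`. -/
structure FibreSol (b μ grav κ : ℝ) where
  (r σ : ℝ)
  r_pos : 0 < r
  one_le_σ : 1 ≤ σ
  σ_le : σ ^ 2 ≤ 1 + r
  r_le : r ≤ 7 * σ ^ 2
  (a a' a'' w w' P P' g g' G fa f3 d d' d'' fd : L2I b)
  (a'₀ ab a'b w'₀ h P₀ Pb g₀ gb Gb ka k3 c d'₀ db d'b kd χd om : ℂ)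
  ha : HD b a a' 0 ab
  ha' : HD b a' a'' a'₀ a'b
  hw : HD b w w' 0 h
  hw' : HD b w' (r • a' + g') w'₀ (r • ab + gb)
  hP : HD b P P' P₀ Pb
  hg : HD b g g' g₀ gb
  hG : HD b G g 0 Gb
  hd : HD b d d' 0 db
  hd' : HD b d' d'' d'₀ d'b
  eqa : r • P - μ • (a'' - r ^ 2 • a) = fa + (μ * r) • g
  eq3 : P' - μ • (r • a' + g' - r ^ 2 • w) = f3 + μ • g'
  eqw : w' = r • a + g
  eqka : μ • (a'b + r • h) = ka
  eqc : c = (r / (grav + κ * r ^ 2)) • (k3 + Pb - (2 * μ) • (r • ab + gb))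
  eqd : constI b (grav • χd) - μ • (d'' - r ^ 2 • d) = fd
  eqkd : μ • d'b = kd
  eqχ : r • χd = -om

namespace FibreSol

variable {b μ grav κ : ℝ}

/-- The size of the data. -/
def δ (S : FibreSol b μ grav κ) : ℝ :=
  S.σ ^ 2 * ‖S.g‖ + ‖S.g'‖ + ‖S.fa‖ + ‖S.f3‖ + ‖S.fd‖ + S.σ * ‖S.ka‖ + S.σ * ‖S.kd‖ +
    S.σ * ‖S.k3‖ + S.σ ^ 3 * ‖S.h‖ + S.σ * ‖S.om‖ + ‖S.h - S.Gb‖ / S.r + ‖S.om‖ / S.r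

/-- The energy. -/
def E (S : FibreSol b μ grav κ) : ℝ := ‖S.a'‖ + S.r * ‖S.a‖ + ‖S.w'‖ + S.r * ‖S.w‖

/-- Energy plus data. -/
def K (S : FibreSol b μ grav κ) : ℝ := S.σ ^ 2 * S.E + S.δ

lemma σ_pos (S : FibreSol b μ grav κ) : 0 < S.σ := zero_lt_one.trans_le S.one_le_σ

lemma E_nonneg (S : FibreSol b μ grav κ) : 0 ≤ S.E := by
  have := S.r_pos; unfold E; positivity

lemma δ_nonneg (S : FibreSol b μ grav κ) : 0 ≤ S.δ := by
  have := S.r_pos; have := S.σ_pos; unfold δ; positivity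

lemma K_nonneg (S : FibreSol b μ grav κ) : 0 ≤ S.K := by
  have := S.E_nonneg; have := S.δ_nonneg; unfold K; positivity

end FibreSol

/-! ### Uniform bounds as big-O relations, trace inequalities included -/

section calculus

variable {S : Type*} {V W : Type*} [NormedAddCommGroup V] [NormedAddCommGroup W]

lemma isBigO_of_norm_le_mul {l : Filter S} {f : S → V} {g : S → ℝ} (C : ℝ)
    (h : ∀ s, ‖f s‖ ≤ C * g s) (hg : ∀ s, 0 ≤ g s) : f =O[l] g :=
  IsBigO.of_bound C (Eventually.of_forall fun s => by
    rw [Real.norm_of_nonneg (hg s)]; exact h s)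

lemma isBigO_inner [InnerProductSpace ℝ V] {l : Filter S} {f g : S → V} {A B : S → ℝ}
    (hf : f =O[l] A) (hg : g =O[l] B) : (fun s => ⟪f s, g s⟫_ℝ) =O[l] fun s => A s * B s := by
  refine IsBigO.trans (IsBigO.of_bound 1 (Eventually.of_forall fun s => ?_))
    (hf.norm_left.mul hg.norm_left)
  rw [one_mul, Real.norm_eq_abs, norm_mul, norm_norm, norm_norm]
  exact abs_real_inner_le_norm _ _

/-- Cancels one factor `A` where it is nonzero; where `A` vanishes there is nothing to prove. With
the filter `⊤` the relations below are bounds with one constant for the whole family. -/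
lemma isBigO_of_mul_self {l : Filter S} {A B : S → ℝ} (h : (fun s => A s * A s) =O[l] fun s => A s * B s) :
    A =O[l] B := by
  obtain ⟨C, hC⟩ := h.bound
  refine IsBigO.of_bound (max C 0) ?_
  filter_upwards [hC] with s hs
  rw [norm_mul, norm_mul] at hs
  rcases (norm_nonneg (A s)).eq_or_lt with h0 | h0
  · rw [← h0]; positivity
  · refine le_of_mul_le_mul_left (hs.trans ?_) h0
    have : C * ‖B s‖ ≤ max C 0 * ‖B s‖ := mul_le_mul_of_nonneg_right (le_max_left _ _) (norm_nonneg _)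
    nlinarith

/-- Cancels `A³`; used for absorption after the cross term has been squared. -/
lemma isBigO_of_pow_four {l : Filter S} {A B : S → ℝ}
    (h : (fun s => A s ^ 4) =O[l] fun s => B s * A s ^ 3) : A =O[l] B := by
  obtain ⟨C, hC⟩ := h.bound
  refine IsBigO.of_bound (max C 0) ?_
  filter_upwards [hC] with s hs
  rw [norm_mul, norm_pow, norm_pow] at hs
  rcases (norm_nonneg (A s)).eq_or_lt with h0 | h0
  · rw [← h0]; positivity
  · have h3 : 0 < ‖A s‖ ^ 3 := by positivity
    refine le_of_mul_le_mul_left ?_ h3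
    have : C * ‖B s‖ ≤ max C 0 * ‖B s‖ := mul_le_mul_of_nonneg_right (le_max_left _ _) (norm_nonneg _)
    nlinarith

lemma isBigO_of_sq {l : Filter S} {f : S → V} {B : S → ℝ}
    (h : (fun s => ‖f s‖ ^ 2) =O[l] fun s => B s ^ 2) : f =O[l] B := by
  have := IsBigO.of_pow (f := fun s => ‖f s‖) (g := B) two_ne_zero h
  exact this.of_norm_left

variable {b : ℝ} {l : Filter S} {v v' : S → L2I b} {v₀ vb : S → ℂ} {A B : S → ℝ}

/-- The product form of the trace inequality is kept because in the absorption argument the function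
and its derivative have bounds of different kinds. -/
lemma HD.isBigO_sq_top (hb : 0 < b) (h : ∀ s, HD b (v s) (v' s) (v₀ s) (vb s))
    (h1 : v =O[l] A) (h2 : v' =O[l] B) :
    (fun s => ‖vb s‖ ^ 2) =O[l] fun s => ‖A s‖ * (‖A s‖ + ‖B s‖) := by
  have e1 := h1.norm_norm.mul (h1.norm_norm.add_add (f₂ := fun s => ‖v' s‖)
    (g₂ := fun s => ‖B s‖) h2.norm_norm)
  have e0 : (fun s => ‖vb s‖ ^ 2) =O[l] fun s => ‖v s‖ * (‖v s‖ + ‖v' s‖) := by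
    refine isBigO_of_norm_le_mul (b⁻¹ + 2) (fun s => ?_) (fun s => by positivity)
    have := (abs_le.1 ((h s).norm_sq_le hb)).2
    rw [Real.norm_of_nonneg (by positivity)]
    have h3 : ‖vb s‖ ^ 2 ≤ b⁻¹ * (‖v s‖ ^ 2 + 2 * b * (‖v s‖ * ‖v' s‖)) := by
      rw [← div_eq_inv_mul, le_div_iff₀ hb]; linarith
    have h4 : b⁻¹ * (‖v s‖ ^ 2 + 2 * b * (‖v s‖ * ‖v' s‖)) =
      b⁻¹ * ‖v s‖ ^ 2 + 2 * (‖v s‖ * ‖v' s‖) := by field_simp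
    have : 0 ≤ b⁻¹ * (‖v s‖ * ‖v' s‖) := by positivity
    nlinarith [sq_nonneg ‖v s‖]
  refine e0.trans ?_
  refine e1.trans (isBigO_of_le _ fun s => ?_)
  simp only [norm_norm]
  exact le_rfl

lemma HD.isBigO_sq_bot (hb : 0 < b) (h : ∀ s, HD b (v s) (v' s) (v₀ s) (vb s))
    (h1 : v =O[l] A) (h2 : v' =O[l] B) :
    (fun s => ‖v₀ s‖ ^ 2) =O[l] fun s => ‖A s‖ * (‖A s‖ + ‖B s‖) := by
  have e1 := h1.norm_norm.mul (h1.norm_norm.add_add (f₂ := fun s => ‖v' s‖)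
    (g₂ := fun s => ‖B s‖) h2.norm_norm)
  have e0 : (fun s => ‖v₀ s‖ ^ 2) =O[l] fun s => ‖v s‖ * (‖v s‖ + ‖v' s‖) := by
    refine isBigO_of_norm_le_mul (b⁻¹ + 2) (fun s => ?_) (fun s => by positivity)
    have := (abs_le.1 ((h s).norm_sq_le' hb)).2
    rw [Real.norm_of_nonneg (by positivity)]
    have h3 : ‖v₀ s‖ ^ 2 ≤ b⁻¹ * (‖v s‖ ^ 2 + 2 * b * (‖v s‖ * ‖v' s‖)) := by
      rw [← div_eq_inv_mul, le_div_iff₀ hb]; linarith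
    have h4 : b⁻¹ * (‖v s‖ ^ 2 + 2 * b * (‖v s‖ * ‖v' s‖)) =
      b⁻¹ * ‖v s‖ ^ 2 + 2 * (‖v s‖ * ‖v' s‖) := by field_simp
    have : 0 ≤ b⁻¹ * (‖v s‖ * ‖v' s‖) := by positivity
    nlinarith [sq_nonneg ‖v s‖]
  refine e0.trans ?_
  refine e1.trans (isBigO_of_le _ fun s => ?_)
  simp only [norm_norm]
  exact le_rfl

/-- Trace inequality when the derivative costs a factor `σ²`. -/
lemma HD.isBigO_top (hb : 0 < b) (h : ∀ s, HD b (v s) (v' s) (v₀ s) (vb s)) {σ : S → ℝ}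
    (hσ : ∀ s, 1 ≤ σ s) (h1 : v =O[l] A) (h2 : v' =O[l] fun s => σ s ^ 2 * A s) :
    vb =O[l] fun s => σ s * A s := by
  refine isBigO_of_sq ((HD.isBigO_sq_top hb h h1 h2).trans ?_)
  refine IsBigO.of_bound 2 (Eventually.of_forall fun s => ?_)
  have h3 : 1 ≤ σ s ^ 2 := one_le_pow₀ (hσ s)
  have h4 := hσ s
  rw [Real.norm_of_nonneg (show 0 ≤ ‖A s‖ * (‖A s‖ + ‖σ s ^ 2 * A s‖) by positivity),
    Real.norm_of_nonneg (show 0 ≤ (σ s * A s) ^ 2 by positivity), norm_mul, norm_pow,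
    Real.norm_of_nonneg (zero_le_one.trans h4), mul_pow, ← sq_abs (A s), Real.norm_eq_abs]
  nlinarith [mul_nonneg (sq_nonneg |A s|) (sub_nonneg.2 h3)]

end calculus

/-! ### Direct consequences of the energy and of the equations -/

namespace FibreSol

variable {b μ grav κ : ℝ}

lemma norm_le_E (S : FibreSol b μ grav κ) :
    ‖S.a'‖ ≤ S.E ∧ S.r * ‖S.a‖ ≤ S.E ∧ ‖S.w'‖ ≤ S.E ∧ S.r * ‖S.w‖ ≤ S.E := by
  have := S.r_pos
  have h1 : 0 ≤ S.r * ‖S.a‖ := by positivity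
  have h2 : 0 ≤ S.r * ‖S.w‖ := by positivity
  refine ⟨?_, ?_, ?_, ?_⟩ <;> unfold E <;> linarith [norm_nonneg S.a', norm_nonneg S.w']

lemma le_δ (S : FibreSol b μ grav κ) :
    S.σ ^ 2 * ‖S.g‖ ≤ S.δ ∧ ‖S.g'‖ ≤ S.δ ∧ ‖S.fa‖ ≤ S.δ ∧ ‖S.f3‖ ≤ S.δ ∧ ‖S.fd‖ ≤ S.δ ∧
      S.σ * ‖S.ka‖ ≤ S.δ ∧ S.σ * ‖S.kd‖ ≤ S.δ ∧ S.σ * ‖S.k3‖ ≤ S.δ ∧ S.σ ^ 3 * ‖S.h‖ ≤ S.δ ∧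
      S.σ * ‖S.om‖ ≤ S.δ ∧ ‖S.h - S.Gb‖ / S.r ≤ S.δ ∧ ‖S.om‖ / S.r ≤ S.δ := by
  have := S.r_pos
  have := S.σ_pos
  have h1 : 0 ≤ S.σ ^ 2 * ‖S.g‖ := by positivity
  have h2 : 0 ≤ S.σ * ‖S.ka‖ := by positivity
  have h3 : 0 ≤ S.σ * ‖S.kd‖ := by positivity
  have h4 : 0 ≤ S.σ * ‖S.k3‖ := by positivity
  have h5 : 0 ≤ S.σ ^ 3 * ‖S.h‖ := by positivity
  have h6 : 0 ≤ S.σ * ‖S.om‖ := by positivity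
  have h7 : 0 ≤ ‖S.h - S.Gb‖ / S.r := by positivity
  have h8 : 0 ≤ ‖S.om‖ / S.r := by positivity
  have := norm_nonneg S.g'
  have := norm_nonneg S.fa
  have := norm_nonneg S.f3
  have := norm_nonneg S.fd
  refine ⟨?_, ?_, ?_, ?_, ?_, ?_, ?_, ?_, ?_, ?_, ?_, ?_⟩ <;> unfold δ <;> linarith

lemma δ_le_K (S : FibreSol b μ grav κ) : S.δ ≤ S.K := by
  have := S.E_nonneg
  have : 0 ≤ S.σ ^ 2 * S.E := by positivity
  unfold K; linarith

lemma E_le_K (S : FibreSol b μ grav κ) : S.σ ^ 2 * S.E ≤ S.K := by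
  have := S.δ_nonneg
  unfold K; linarith

lemma one_le_σ_sq (S : FibreSol b μ grav κ) : 1 ≤ S.σ ^ 2 := one_le_pow₀ S.one_le_σ

/-- A vector of norm at most `A`, with `σ² A` bounded by a first order quantity. -/
lemma weight_le (hb : 0 < b) (S : FibreSol b μ grav κ) {x y e : ℝ} (hx : 0 ≤ x)
    (h1 : x ≤ 2 * b * y) (h2 : y ≤ e) (h3 : S.r * x ≤ e) : S.σ ^ 2 * x ≤ (2 * b + 1) * e := by
  have h4 : S.σ ^ 2 * x ≤ (1 + S.r) * x := mul_le_mul_of_nonneg_right S.σ_le hx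
  have h5 : 2 * b * y ≤ 2 * b * e := mul_le_mul_of_nonneg_left h2 (by positivity)
  linarith

lemma a_le (hb : 0 < b) (S : FibreSol b μ grav κ) : S.σ ^ 2 * ‖S.a‖ ≤ (2 * b + 1) * S.E :=
  S.weight_le hb (norm_nonneg _) (S.ha.poincare hb) S.norm_le_E.1 S.norm_le_E.2.1

lemma w_le (hb : 0 < b) (S : FibreSol b μ grav κ) : S.σ ^ 2 * ‖S.w‖ ≤ (2 * b + 1) * S.E :=
  S.weight_le hb (norm_nonneg _) (S.hw.poincare hb) S.norm_le_E.2.2.1 S.norm_le_E.2.2.2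

lemma r_mul_le (S : FibreSol b μ grav κ) {x : ℝ} (hx : x ≤ S.E) : S.r * x ≤ 7 * S.K := by
  have h1 : S.r * x ≤ S.r * S.E := mul_le_mul_of_nonneg_left hx S.r_pos.le
  have h2 : S.r * S.E ≤ 7 * S.σ ^ 2 * S.E := mul_le_mul_of_nonneg_right S.r_le S.E_nonneg
  linarith [S.E_le_K]

lemma isBigO_r_smul_a' : (fun S : FibreSol b μ grav κ => S.r • S.a') =O[⊤] K :=
  isBigO_of_norm_le_mul 7 (fun S => by
    rw [norm_smul, Real.norm_of_nonneg S.r_pos.le]; exact S.r_mul_le S.norm_le_E.1) K_nonneg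

lemma isBigO_r_sq_smul_a : (fun S : FibreSol b μ grav κ => S.r ^ 2 • S.a) =O[⊤] K :=
  isBigO_of_norm_le_mul 7 (fun S => by
    rw [norm_smul, norm_pow, Real.norm_of_nonneg S.r_pos.le, sq, mul_assoc]
    exact S.r_mul_le S.norm_le_E.2.1) K_nonneg

lemma isBigO_r_sq_smul_w : (fun S : FibreSol b μ grav κ => S.r ^ 2 • S.w) =O[⊤] K :=
  isBigO_of_norm_le_mul 7 (fun S => by
    rw [norm_smul, norm_pow, Real.norm_of_nonneg S.r_pos.le, sq, mul_assoc]
    exact S.r_mul_le S.norm_le_E.2.2.2) K_nonneg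

lemma isBigO_K_of_le_δ {V : Type*} [NormedAddCommGroup V] {f : FibreSol b μ grav κ → V} (C : ℝ)
    (hC : 0 ≤ C) (h : ∀ S, ‖f S‖ ≤ C * S.δ) : f =O[⊤] K :=
  isBigO_of_norm_le_mul C (fun S => (h S).trans (mul_le_mul_of_nonneg_left S.δ_le_K hC)) K_nonneg

lemma r_smul_g_le (S : FibreSol b μ grav κ) : ‖S.r • S.g‖ ≤ 7 * S.δ := by
  rw [norm_smul, Real.norm_of_nonneg S.r_pos.le]
  have := mul_le_mul_of_nonneg_right S.r_le (norm_nonneg S.g)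
  linarith [S.le_δ.1]

lemma isBigO_w'' : (fun S : FibreSol b μ grav κ => S.r • S.a' + S.g') =O[⊤] K :=
  isBigO_r_smul_a'.add (isBigO_K_of_le_δ 1 zero_le_one fun S => by
    rw [one_mul]; exact S.le_δ.2.1)

lemma isBigO_fa : (fun S : FibreSol b μ grav κ => S.fa + (μ * S.r) • S.g) =O[⊤] δ := by
  refine IsBigO.add (isBigO_of_norm_le_mul 1 (fun S => ?_) δ_nonneg) ?_
  · rw [one_mul]; exact S.le_δ.2.2.1
  · refine isBigO_of_norm_le_mul (|μ| * 7) (fun S => ?_) δ_nonneg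
    rw [mul_smul, norm_smul, Real.norm_eq_abs, mul_assoc]
    exact mul_le_mul_of_nonneg_left S.r_smul_g_le (abs_nonneg _)

lemma isBigO_f3 : (fun S : FibreSol b μ grav κ => S.f3 + μ • S.g') =O[⊤] δ := by
  refine IsBigO.add (isBigO_of_norm_le_mul 1 (fun S => ?_) δ_nonneg)
    (IsBigO.const_smul_left (isBigO_of_norm_le_mul 1 (fun S => ?_) δ_nonneg) μ)
  · rw [one_mul]; exact S.le_δ.2.2.2.1
  · rw [one_mul]; exact S.le_δ.2.1

lemma isBigO_δ_K : (δ : FibreSol b μ grav κ → ℝ) =O[⊤] K :=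
  isBigO_K_of_le_δ 1 zero_le_one fun S => by rw [one_mul, Real.norm_of_nonneg S.δ_nonneg]

/-- The vertical equation expresses `P'` through `w''`, `r² w` and data, and `w'' = r a' + g'` is of
first order in the energy by incompressibility. -/
lemma isBigO_P' : (fun S : FibreSol b μ grav κ => S.P') =O[⊤] K := by
  have : (fun S : FibreSol b μ grav κ => S.P') = fun S =>
      μ • (S.r • S.a' + S.g' - S.r ^ 2 • S.w) + (S.f3 + μ • S.g') := by
    funext S
    rw [← S.eq3]; abel
  rw [this]
  exact ((isBigO_w''.sub isBigO_r_sq_smul_w).const_smul_left μ).add (isBigO_f3.trans isBigO_δ_K)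

lemma isBigO_a' : (fun S : FibreSol b μ grav κ => S.a') =O[⊤] fun S => S.K / S.σ ^ 2 :=
  isBigO_of_norm_le_mul 1 (fun S => by
    have := S.σ_pos
    rw [one_mul, le_div_iff₀ (by positivity)]
    have := mul_le_mul_of_nonneg_right S.norm_le_E.1 (sq_nonneg S.σ)
    linarith [S.E_le_K]) fun S => div_nonneg S.K_nonneg (sq_nonneg _)

lemma isBigO_w' : (fun S : FibreSol b μ grav κ => S.w') =O[⊤] fun S => S.K / S.σ ^ 2 :=
  isBigO_of_norm_le_mul 1 (fun S => by
    have := S.σ_pos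
    rw [one_mul, le_div_iff₀ (by positivity)]
    have := mul_le_mul_of_nonneg_right S.norm_le_E.2.2.1 (sq_nonneg S.σ)
    linarith [S.E_le_K]) fun S => div_nonneg S.K_nonneg (sq_nonneg _)

lemma isBigO_r : (fun S : FibreSol b μ grav κ => S.r) =O[⊤] fun S => S.σ ^ 2 :=
  isBigO_of_norm_le_mul 7 (fun S => by rw [Real.norm_of_nonneg S.r_pos.le]; exact S.r_le)
    fun S => sq_nonneg _

lemma isBigO_r_smul_P' : (fun S : FibreSol b μ grav κ => S.r • S.P') =O[⊤]
    fun S => S.σ ^ 2 * S.K := isBigO_r.smul isBigO_P'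

/-! #### The pressure and the second derivative -/

/-- The quantity to be absorbed. -/
def Z (S : FibreSol b μ grav κ) : ℝ := S.r * ‖S.P‖ + ‖S.a''‖ + S.K

lemma K_le_Z (S : FibreSol b μ grav κ) : S.K ≤ S.Z := by
  have := S.r_pos
  have : 0 ≤ S.r * ‖S.P‖ := by positivity
  unfold Z; linarith [norm_nonneg S.a'']

lemma Z_nonneg (S : FibreSol b μ grav κ) : 0 ≤ S.Z := S.K_nonneg.trans S.K_le_Z

lemma isBigO_P_Z : (fun S : FibreSol b μ grav κ => S.r • S.P) =O[⊤] Z :=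
  isBigO_of_norm_le_mul 1 (fun S => by
    rw [norm_smul, Real.norm_of_nonneg S.r_pos.le]
    unfold Z; linarith [norm_nonneg S.a'', S.K_nonneg]) Z_nonneg

lemma isBigO_a''_Z : (fun S : FibreSol b μ grav κ => S.a'') =O[⊤] Z :=
  isBigO_of_norm_le_mul 1 (fun S => by
    have := S.r_pos
    have : 0 ≤ S.r * ‖S.P‖ := by positivity
    unfold Z; linarith [norm_nonneg S.a'', S.K_nonneg]) Z_nonneg

lemma bound_P {S : FibreSol b μ grav κ} :
    ‖S.Z‖ * (‖S.Z‖ + ‖S.σ ^ 2 * S.K‖) ≤ 2 * (S.σ ^ 2 * S.Z ^ 2) := by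
  have h1 := S.one_le_σ_sq
  have h2 := S.K_le_Z
  have h3 := S.K_nonneg
  have h4 := S.Z_nonneg
  have h5 : 0 ≤ S.σ ^ 2 * S.K := by positivity
  rw [Real.norm_of_nonneg h4, Real.norm_of_nonneg h5]
  have h6 : S.σ ^ 2 * S.K ≤ S.σ ^ 2 * S.Z := by gcongr
  have h7 : S.Z ≤ S.σ ^ 2 * S.Z := le_mul_of_one_le_left h4 h1
  calc S.Z * (S.Z + S.σ ^ 2 * S.K) ≤ S.Z * (S.σ ^ 2 * S.Z + S.σ ^ 2 * S.Z) := by gcongr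
    _ = _ := by ring

lemma bound_a' {S : FibreSol b μ grav κ} :
    ‖S.K / S.σ ^ 2‖ * (‖S.K / S.σ ^ 2‖ + ‖S.Z‖) ≤ 2 * (S.K * S.Z / S.σ ^ 2) := by
  have h0 := S.σ_pos
  have h1 := S.one_le_σ_sq
  have h2 := S.K_le_Z
  have h3 := S.K_nonneg
  have h4 := S.Z_nonneg
  rw [Real.norm_of_nonneg h4, Real.norm_of_nonneg (by positivity)]
  have h5 : S.K / S.σ ^ 2 ≤ S.Z := (div_le_self h3 h1).trans h2
  calc S.K / S.σ ^ 2 * (S.K / S.σ ^ 2 + S.Z) ≤ S.K / S.σ ^ 2 * (S.Z + S.Z) := by gcongr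
    _ = _ := by ring

/-- The boundary values of `r P` have square `O(σ² Z²)` and those of `a'` have square `O(K Z / σ²)`.
The powers of `σ` cancel in the product, which still contains a factor `K`. -/
lemma isBigO_mul_bdry {f g : FibreSol b μ grav κ → ℂ}
    (hf : (fun S => ‖f S‖ ^ 2) =O[⊤] fun S => ‖S.Z‖ * (‖S.Z‖ + ‖S.σ ^ 2 * S.K‖))
    (hg : (fun S => ‖g S‖ ^ 2) =O[⊤] fun S => ‖S.K / S.σ ^ 2‖ * (‖S.K / S.σ ^ 2‖ + ‖S.Z‖)) :
    (fun S => ⟪f S, g S⟫_ℝ ^ 2) =O[⊤] fun S => S.K * S.Z ^ 3 := by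
  have h1 : (fun S => ⟪f S, g S⟫_ℝ ^ 2) =O[⊤] fun S => ‖f S‖ ^ 2 * ‖g S‖ ^ 2 :=
    isBigO_of_norm_le_mul 1 (fun S => by
      rw [norm_pow, one_mul, ← mul_pow]
      exact pow_le_pow_left₀ (norm_nonneg _) (abs_real_inner_le_norm _ _) 2) fun S => by positivity
  refine h1.trans ((hf.mul hg).trans ?_)
  refine isBigO_of_norm_le_mul 4 (fun S => ?_) fun S =>
    mul_nonneg S.K_nonneg (pow_nonneg S.Z_nonneg 3)
  have h0 := S.σ_pos
  have h3 := S.K_nonneg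
  have h4 := S.Z_nonneg
  rw [Real.norm_of_nonneg (by positivity)]
  refine (mul_le_mul bound_P bound_a' (by positivity) (by positivity)).trans (le_of_eq ?_)
  field_simp
  ring

lemma isBigO_K_pow_four : (fun S : FibreSol b μ grav κ => (S.K * S.K) ^ 2) =O[⊤]
    fun S => S.K * S.Z ^ 3 :=
  isBigO_of_norm_le_mul 1 (fun S => by
    have h2 := S.K_le_Z
    have h3 := S.K_nonneg
    rw [Real.norm_of_nonneg (by positivity), one_mul]
    calc (S.K * S.K) ^ 2 = S.K * S.K ^ 3 := by ring
      _ ≤ _ := by gcongr) fun S => mul_nonneg S.K_nonneg (pow_nonneg S.Z_nonneg 3)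

lemma isBigO_add_sq {A B C : FibreSol b μ grav κ → ℝ} (h1 : (fun S => A S ^ 2) =O[⊤] C)
    (h2 : (fun S => B S ^ 2) =O[⊤] C) : (fun S => (A S + B S) ^ 2) =O[⊤] C := by
  refine IsBigO.trans ?_ (h1.add h2)
  refine isBigO_of_norm_le_mul 2 (fun S => ?_) fun S => by positivity
  rw [Real.norm_of_nonneg (sq_nonneg _)]
  nlinarith [sq_nonneg (A S - B S)]

/-- Integration by parts moves one derivative from `a''` to `P`. The interior term is of size `K²`,
and the boundary terms have squares bounded by `K Z³`; everything is squared so that no roots are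
needed. -/
lemma isBigO_cross (hb : 0 < b) : (fun S : FibreSol b μ grav κ => ⟪S.r • S.P, S.a''⟫_ℝ ^ 2) =O[⊤]
    fun S => S.K * S.Z ^ 3 := by
  have e : (fun S : FibreSol b μ grav κ => ⟪S.r • S.P, S.a''⟫_ℝ ^ 2) = fun S =>
      (⟪S.r • S.Pb, S.a'b⟫_ℝ + (⟪S.r • S.P₀, -S.a'₀⟫_ℝ + ⟪S.r • S.P', -S.a'⟫_ℝ)) ^ 2 := by
    funext S
    have := (S.hP.smul S.r).ibp hb S.ha'
    rw [inner_neg_right, inner_neg_right]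
    congr 1
    linarith
  rw [e]
  refine isBigO_add_sq (isBigO_mul_bdry ?_ ?_) (isBigO_add_sq (isBigO_mul_bdry ?_ ?_) ?_)
  · exact HD.isBigO_sq_top hb (fun S => S.hP.smul S.r) isBigO_P_Z isBigO_r_smul_P'
  · exact HD.isBigO_sq_top hb (fun S => S.ha') isBigO_a' isBigO_a''_Z
  · exact HD.isBigO_sq_bot hb (fun S => S.hP.smul S.r) isBigO_P_Z isBigO_r_smul_P'
  · simpa only [norm_neg] using HD.isBigO_sq_bot hb (fun S : FibreSol b μ grav κ => S.ha')
      isBigO_a' isBigO_a''_Z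
  · refine IsBigO.trans ((isBigO_inner isBigO_r_smul_P' isBigO_a'.neg_left).pow 2) ?_
    refine (isBigO_of_le _ fun S => le_of_eq ?_).trans isBigO_K_pow_four
    have := S.σ_pos
    congr 1
    field_simp

/-- The equation controls only the combination `r P - μ a''`. Its square differs from the sum of the
squares by the cross term, so `Z⁴ ≤ C K Z³` and the left side can be absorbed. -/
lemma isBigO_Z (hb : 0 < b) (hμ : 0 < μ) : (Z : FibreSol b μ grav κ → ℝ) =O[⊤] K := by
  apply isBigO_of_pow_four
  have hQ : (fun S : FibreSol b μ grav κ => S.r • S.P - μ • S.a'') =O[⊤] K := by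
    have : (fun S : FibreSol b μ grav κ => S.r • S.P - μ • S.a'') = fun S =>
        S.fa + (μ * S.r) • S.g - μ • (S.r ^ 2 • S.a) := by
      funext S
      rw [← S.eqa, smul_sub]; abel
    rw [this]
    exact (isBigO_fa.trans isBigO_δ_K).sub (isBigO_r_sq_smul_a.const_smul_left μ)
  have hQ2 : (fun S : FibreSol b μ grav κ => (‖S.r • S.P - μ • S.a''‖ ^ 2) ^ 2) =O[⊤]
      fun S => S.K * S.Z ^ 3 := by
    refine ((hQ.norm_left.pow 2).pow 2).trans ?_
    refine (isBigO_of_le _ fun S => le_of_eq ?_).trans isBigO_K_pow_four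
    rw [sq S.K]
  have hK2 := isBigO_K_pow_four (b := b) (μ := μ) (grav := grav) (κ := κ)
  have hq := ((isBigO_cross (μ := μ) (grav := grav) (κ := κ) hb).const_mul_left ((2 * μ) ^ 2))
  have hsum := isBigO_add_sq (isBigO_add_sq hQ2 (B := fun S => 2 * μ * ⟪S.r • S.P, S.a''⟫_ℝ)
    (by simpa only [mul_pow] using hq)) hK2
  refine IsBigO.trans ?_ hsum
  -- The factor `3` comes from the square of a sum of three terms and `μ⁻²` compensates the weight
  -- `μ²` of `‖a''‖²`; the outer square passes from `Z²` to `Z⁴`.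
  refine isBigO_of_norm_le_mul ((3 + 3 * (μ⁻¹) ^ 2) ^ 2) (fun S => ?_) fun S => by positivity
  have e1 : ‖S.r • S.P - μ • S.a''‖ ^ 2 + 2 * μ * ⟪S.r • S.P, S.a''⟫_ℝ =
      (S.r * ‖S.P‖) ^ 2 + μ ^ 2 * ‖S.a''‖ ^ 2 := by
    rw [norm_sub_sq_real, inner_smul_right, norm_smul, norm_smul, Real.norm_of_nonneg hμ.le,
      Real.norm_of_nonneg S.r_pos.le]
    ring
  rw [Real.norm_of_nonneg (pow_nonneg S.Z_nonneg 4), e1]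
  have h3 : S.Z ^ 2 ≤ (3 + 3 * μ⁻¹ ^ 2) *
      ((S.r * ‖S.P‖) ^ 2 + μ ^ 2 * ‖S.a''‖ ^ 2 + S.K * S.K) := by
    have e2 : (3 + 3 * μ⁻¹ ^ 2) * ((S.r * ‖S.P‖) ^ 2 + μ ^ 2 * ‖S.a''‖ ^ 2 + S.K * S.K) =
        3 * ((S.r * ‖S.P‖) ^ 2 + ‖S.a''‖ ^ 2 + S.K ^ 2) + 3 * μ ^ 2 * ‖S.a''‖ ^ 2 +
          3 * μ⁻¹ ^ 2 * ((S.r * ‖S.P‖) ^ 2 + S.K ^ 2) := by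
      field_simp
      ring
    rw [e2]
    have p1 : 0 ≤ 3 * μ ^ 2 * ‖S.a''‖ ^ 2 := by positivity
    have p2 : 0 ≤ 3 * μ⁻¹ ^ 2 * ((S.r * ‖S.P‖) ^ 2 + S.K ^ 2) := by positivity
    unfold Z
    nlinarith [sq_nonneg (S.r * ‖S.P‖ - ‖S.a''‖), sq_nonneg (S.r * ‖S.P‖ - S.K),
      sq_nonneg (‖S.a''‖ - S.K)]
  calc S.Z ^ 4 = (S.Z ^ 2) ^ 2 := by ring
    _ ≤ _ := by
      rw [← mul_pow]
      exact pow_le_pow_left₀ (sq_nonneg _) h3 2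

lemma isBigO_r_smul_P (hb : 0 < b) (hμ : 0 < μ) :
    (fun S : FibreSol b μ grav κ => S.r • S.P) =O[⊤] K := isBigO_P_Z.trans (isBigO_Z hb hμ)

lemma isBigO_a'' (hb : 0 < b) (hμ : 0 < μ) :
    (fun S : FibreSol b μ grav κ => S.a'') =O[⊤] K := isBigO_a''_Z.trans (isBigO_Z hb hμ)

lemma isBigO_r_smul_Pb (hb : 0 < b) (hμ : 0 < μ) :
    (fun S : FibreSol b μ grav κ => S.r • S.Pb) =O[⊤] fun S => S.σ * S.K :=
  HD.isBigO_top hb (fun S => S.hP.smul S.r) (fun S => S.one_le_σ) (isBigO_r_smul_P hb hμ)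
    isBigO_r_smul_P'

/-- Trace inequality between `w' = O(K / σ²)` and `w'' = O(K)`; the boundary value of `w'` is `r a +
g` at `b`. -/
lemma isBigO_w'b (hb : 0 < b) :
    (fun S : FibreSol b μ grav κ => S.r • S.ab + S.gb) =O[⊤] fun S => S.K / S.σ := by
  refine (HD.isBigO_top hb (fun S => S.hw') (fun S => S.one_le_σ) isBigO_w'
    (isBigO_w''.trans (isBigO_of_le _ fun S => le_of_eq ?_))).trans
    (isBigO_of_le _ fun S => le_of_eq ?_) <;> have := S.σ_pos <;> congr 1 <;> field_simp

lemma isBigO_ab (hb : 0 < b) :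
    (fun S : FibreSol b μ grav κ => S.ab) =O[⊤] fun S => S.E / S.σ := by
  have h1 : (fun S : FibreSol b μ grav κ => S.a) =O[⊤] fun S => S.E / S.σ ^ 2 :=
    isBigO_of_norm_le_mul (2 * b + 1) (fun S => by
      have := S.σ_pos
      rw [← mul_div_assoc, le_div_iff₀ (by positivity), mul_comm]
      exact S.a_le hb) fun S => div_nonneg S.E_nonneg (sq_nonneg _)
  have h2 : (fun S : FibreSol b μ grav κ => S.a') =O[⊤] fun S => S.σ ^ 2 * (S.E / S.σ ^ 2) :=
    isBigO_of_norm_le_mul 1 (fun S => by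
      have := S.σ_pos
      have e : S.σ ^ 2 * (S.E / S.σ ^ 2) = S.E := by field_simp
      rw [e, one_mul]
      exact S.norm_le_E.1) fun S => mul_nonneg (sq_nonneg _) (div_nonneg S.E_nonneg (sq_nonneg _))
  refine (HD.isBigO_top hb (fun S => S.ha) (fun S => S.one_le_σ) h1 h2).trans
    (isBigO_of_le _ fun S => le_of_eq ?_)
  have := S.σ_pos
  congr 1
  field_simp

end FibreSol

namespace FibreSol

variable {b μ grav κ : ℝ}

/-! #### The energy identity -/

/-- The work of the pressure against the divergence and the flux. -/
def J (S : FibreSol b μ grav κ) : ℝ := ⟪S.P, S.g⟫_ℝ - ⟪S.Pb, S.h⟫_ℝ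

/-- Test the longitudinal equation with `a` and the vertical one with `w`. The two contributions `r
⟨P, a⟩` cancel, and the pressure survives only against the divergence and the flux. -/
lemma energy (hb : 0 < b) (S : FibreSol b μ grav κ) :
    μ * (‖S.a'‖ ^ 2 + (S.r * ‖S.a‖) ^ 2 + ‖S.w'‖ ^ 2 + (S.r * ‖S.w‖) ^ 2) =
      S.J + ⟪S.ka - (μ * S.r) • S.h, S.ab⟫_ℝ + μ * ⟪S.r • S.ab + S.gb, S.h⟫_ℝ +
        ⟪S.fa + (μ * S.r) • S.g, S.a⟫_ℝ + ⟪S.f3 + μ • S.g', S.w⟫_ℝ := by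
  have e1 := S.ha'.ibp hb S.ha
  have e2 := S.hw'.ibp hb S.hw
  have e3 := S.hP.ibp hb S.hw
  have e4 : ⟪S.P, S.w'⟫_ℝ = S.r * ⟪S.P, S.a⟫_ℝ + ⟪S.P, S.g⟫_ℝ := by
    rw [S.eqw, inner_add_right, inner_smul_right]
  rw [inner_zero_right, sub_zero, real_inner_self_eq_norm_sq] at e1 e2
  rw [inner_zero_right, sub_zero] at e3
  have e5 : S.ka - (μ * S.r) • S.h = μ • S.a'b := by
    rw [← S.eqka, smul_add, mul_smul]; abel
  rw [← S.eqa, ← S.eq3, e5, inner_sub_left, inner_sub_left, inner_smul_left, inner_smul_left,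
    inner_smul_left, inner_smul_left, inner_sub_left, inner_sub_left, inner_smul_left,
    inner_smul_left, real_inner_self_eq_norm_sq, real_inner_self_eq_norm_sq, J]
  simp only [RCLike.conj_to_real]
  linear_combination -e3 + e4 + μ * e1 + μ * e2

/-- Replacing `g` by its primitive `G` moves the derivative to `P`. The boundary value of `P` then
meets only the flux defect `Gb - h`. -/
lemma J_eq (hb : 0 < b) (S : FibreSol b μ grav κ) :
    S.J = ⟪S.Pb, S.Gb - S.h⟫_ℝ - ⟪S.P', S.G⟫_ℝ := by
  have e := S.hP.ibp hb S.hG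
  rw [inner_zero_right, sub_zero] at e
  rw [inner_sub_right, J]
  linear_combination e

/-- Frequencies below and above `1` are treated separately: in the first range powers of `σ` are
harmless, in the second division by `r` gains a factor `σ²`. -/
lemma isBigO_sup {V : Type*} [NormedAddCommGroup V] {f : FibreSol b μ grav κ → V}
    {g : FibreSol b μ grav κ → ℝ}
    (h1 : f =O[𝓟 {S | S.r ≤ 1}] g) (h2 : f =O[𝓟 {S | 1 ≤ S.r}] g) : f =O[⊤] g := by
  have : (⊤ : Filter (FibreSol b μ grav κ)) = 𝓟 {S | S.r ≤ 1} ⊔ 𝓟 {S | 1 ≤ S.r} := by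
    rw [sup_principal, ← principal_univ]
    congr 1
    ext S
    simpa using le_total S.r 1
  rw [this]
  exact h1.sup h2

lemma isBigO_div_of_mul {V : Type*} [NormedAddCommGroup V] [NormedSpace ℝ V]
    {l : Filter (FibreSol b μ grav κ)} {f : FibreSol b μ grav κ → V}
    {B : FibreSol b μ grav κ → ℝ} (h : (fun S => S.r • f S) =O[l] B) :
    f =O[l] fun S => S.r⁻¹ * B S := by
  have h1 : (fun S : FibreSol b μ grav κ => S.r⁻¹) =O[l] fun S => S.r⁻¹ := isBigO_refl _ _
  refine (h1.smul h).congr_left fun S => ?_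
  rw [smul_smul, inv_mul_cancel₀ S.r_pos.ne', one_smul]

lemma isBigO_g : (fun S : FibreSol b μ grav κ => S.g) =O[⊤] fun S => S.δ / S.σ ^ 2 :=
  isBigO_of_norm_le_mul 1 (fun S => by
    have := S.σ_pos
    rw [one_mul, le_div_iff₀ (by positivity), mul_comm]
    exact S.le_δ.1) fun S => div_nonneg S.δ_nonneg (sq_nonneg _)

lemma isBigO_h : (fun S : FibreSol b μ grav κ => S.h) =O[⊤] fun S => S.δ / S.σ ^ 3 :=
  isBigO_of_norm_le_mul 1 (fun S => by
    have := S.σ_pos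
    rw [one_mul, le_div_iff₀ (by positivity), mul_comm]
    exact S.le_δ.2.2.2.2.2.2.2.2.1) fun S =>
      div_nonneg S.δ_nonneg (pow_nonneg (zero_le_one.trans S.one_le_σ) 3)

lemma isBigO_σ_div {V : Type*} [NormedAddCommGroup V] {f : FibreSol b μ grav κ → V}
    (h : ∀ S, S.σ * ‖f S‖ ≤ S.δ) : f =O[⊤] fun S => S.δ / S.σ :=
  isBigO_of_norm_le_mul 1 (fun S => by
    rw [one_mul, le_div_iff₀ S.σ_pos, mul_comm]
    exact h S) fun S => div_nonneg S.δ_nonneg S.σ_pos.le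

/-- On high frequencies `r⁻¹` gains a factor `σ²`. -/
lemma isBigO_inv_r_high (B : FibreSol b μ grav κ → ℝ) :
    (fun S => S.r⁻¹ * B S) =O[𝓟 {S : FibreSol b μ grav κ | 1 ≤ S.r}] fun S => B S / S.σ ^ 2 := by
  refine IsBigO.of_bound 2 (eventually_principal.2 fun S hS => ?_)
  have h0 := S.σ_pos
  have h1 := S.r_pos
  have h2 : S.σ ^ 2 ≤ 2 * S.r := S.σ_le.trans (by linarith [hS.out])
  rw [norm_mul, norm_div, norm_inv, norm_pow, Real.norm_of_nonneg h0.le,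
    Real.norm_of_nonneg h1.le, ← mul_div_assoc, le_div_iff₀ (by positivity)]
  have h3 : S.r⁻¹ * S.σ ^ 2 ≤ 2 := by
    rw [← div_eq_inv_mul, div_le_iff₀ h1]; exact h2
  calc S.r⁻¹ * ‖B S‖ * S.σ ^ 2 = (S.r⁻¹ * S.σ ^ 2) * ‖B S‖ := by ring
    _ ≤ 2 * ‖B S‖ := by gcongr

lemma isBigO_σ_pow_low (n : ℕ) {m : ℕ} : (fun S => S.σ ^ n) =O[𝓟 {S : FibreSol b μ grav κ | S.r ≤ 1}]
    fun S => S.σ ^ m := by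
  refine IsBigO.of_bound (2 ^ n) (eventually_principal.2 fun S hS => ?_)
  have h0 := S.one_le_σ
  have h1 : S.σ ≤ 2 := by nlinarith [S.σ_le, hS.out]
  have h2 := S.σ_pos
  rw [Real.norm_of_nonneg (by positivity), Real.norm_of_nonneg (by positivity)]
  calc S.σ ^ n ≤ 2 ^ n * 1 := by rw [mul_one]; gcongr
    _ ≤ _ := by gcongr; exact one_le_pow₀ h0

/-- At high frequency `P` is bounded through `r P`. At low frequency it is not, and `J_eq` is used:
`r Pb` is paired with the flux defect divided by `r`, which is part of the data by the compatibility
condition, while `P'` and `G` are bounded directly. -/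
lemma isBigO_J (hb : 0 < b) (hμ : 0 < μ) :
    (fun S : FibreSol b μ grav κ => S.σ ^ 4 * S.J) =O[⊤] fun S => S.K * S.δ := by
  refine isBigO_sup ?_ ?_
  · have e : (fun S : FibreSol b μ grav κ => S.σ ^ 4 * S.J) = fun S =>
        S.σ ^ 4 * ⟪S.r • S.Pb, (S.r⁻¹) • (S.Gb - S.h)⟫_ℝ - S.σ ^ 4 * ⟪S.P', S.G⟫_ℝ := by
      funext S
      rw [S.J_eq hb, inner_smul_left, inner_smul_right, RCLike.conj_to_real, ← mul_assoc S.r,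
        mul_inv_cancel₀ S.r_pos.ne', one_mul, mul_sub]
    rw [e]
    have hd : (fun S : FibreSol b μ grav κ => (S.r⁻¹) • (S.Gb - S.h)) =O[⊤] δ :=
      isBigO_of_norm_le_mul 1 (fun S => by
        rw [one_mul, norm_smul, norm_inv, Real.norm_of_nonneg S.r_pos.le, ← div_eq_inv_mul,
          norm_sub_rev]
        exact S.le_δ.2.2.2.2.2.2.2.2.2.2.1) δ_nonneg
    have hG : (fun S : FibreSol b μ grav κ => S.G) =O[⊤] δ :=
      isBigO_of_norm_le_mul (2 * b) (fun S => by
        refine (S.hG.poincare hb).trans (mul_le_mul_of_nonneg_left ?_ (by positivity))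
        have := mul_le_mul_of_nonneg_right S.one_le_σ_sq (norm_nonneg S.g)
        linarith [S.le_δ.1]) δ_nonneg
    refine IsBigO.sub ?_ ?_
    · refine ((isBigO_refl _ _).mul ((isBigO_inner (isBigO_r_smul_Pb hb hμ) hd).mono le_top)).trans ?_
      have := (isBigO_σ_pow_low (b := b) (μ := μ) (grav := grav) (κ := κ) 5 (m := 0)).mul
        (isBigO_refl (fun S => S.K * S.δ) _)
      refine (this.congr_left fun S => ?_).congr_right fun S => ?_ <;> ring
    · refine ((isBigO_refl _ _).mul ((isBigO_inner isBigO_P' hG).mono le_top)).trans ?_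
      have := (isBigO_σ_pow_low (b := b) (μ := μ) (grav := grav) (κ := κ) 4 (m := 0)).mul
        (isBigO_refl (fun S => S.K * S.δ) _)
      refine (this.congr_left fun S => ?_).congr_right fun S => ?_ <;> ring
  · have e : (fun S : FibreSol b μ grav κ => S.σ ^ 4 * S.J) = fun S =>
        S.σ ^ 4 * ⟪S.P, S.g⟫_ℝ - S.σ ^ 4 * ⟪S.Pb, S.h⟫_ℝ := by
      funext S
      rw [J, mul_sub]
    rw [e]
    have hP := (isBigO_div_of_mul ((isBigO_r_smul_P (grav := grav) (κ := κ) hb hμ).mono le_top)).trans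
      (isBigO_inv_r_high _)
    have hPb := (isBigO_div_of_mul ((isBigO_r_smul_Pb (grav := grav) (κ := κ) hb hμ).mono
      le_top)).trans (isBigO_inv_r_high _)
    refine IsBigO.sub ?_ ?_
    · refine ((isBigO_refl _ _).mul (isBigO_inner hP (isBigO_g.mono le_top))).trans
        (isBigO_of_le _ fun S => le_of_eq ?_)
      have := S.σ_pos
      congr 1
      field_simp
    · refine ((isBigO_refl _ _).mul (isBigO_inner hPb (isBigO_h.mono le_top))).trans
        (isBigO_of_le _ fun S => le_of_eq ?_)
      have := S.σ_pos
      congr 1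
      field_simp

/-- Every term on the right of the energy identity is a product of a quantity bounded by `K` and one
bounded by `δ`, and their weights multiply to `σ⁻⁴`. -/
lemma isBigO_energy (hb : 0 < b) (hμ : 0 < μ) :
    (fun S : FibreSol b μ grav κ => (S.σ ^ 2 * S.E) * (S.σ ^ 2 * S.E)) =O[⊤]
      fun S => S.K * S.δ := by
  have e : (fun S : FibreSol b μ grav κ => S.σ ^ 4 *
      (μ * (‖S.a'‖ ^ 2 + (S.r * ‖S.a‖) ^ 2 + ‖S.w'‖ ^ 2 + (S.r * ‖S.w‖) ^ 2))) = fun S =>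
      S.σ ^ 4 * S.J + S.σ ^ 4 * ⟪S.ka - (μ * S.r) • S.h, S.ab⟫_ℝ +
        S.σ ^ 4 * (μ * ⟪S.r • S.ab + S.gb, S.h⟫_ℝ) +
        S.σ ^ 4 * ⟪S.fa + (μ * S.r) • S.g, S.a⟫_ℝ + S.σ ^ 4 * ⟪S.f3 + μ • S.g', S.w⟫_ℝ := by
    funext S
    rw [S.energy hb]
    ring
  have hE : (fun S : FibreSol b μ grav κ => S.E) =O[⊤] fun S => S.K / S.σ ^ 2 :=
    isBigO_of_norm_le_mul 1 (fun S => by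
      have := S.σ_pos
      rw [one_mul, le_div_iff₀ (by positivity), mul_comm, Real.norm_of_nonneg S.E_nonneg]
      exact S.E_le_K) fun S => div_nonneg S.K_nonneg (sq_nonneg _)
  have hv : ∀ v : FibreSol b μ grav κ → L2I b,
      (∀ S, S.σ ^ 2 * ‖v S‖ ≤ (2 * b + 1) * S.E) → v =O[⊤] fun S => S.K / S.σ ^ 4 := by
    intro v hv
    refine isBigO_of_norm_le_mul (2 * b + 1) (fun S => ?_) fun S =>
      div_nonneg S.K_nonneg (pow_nonneg (zero_le_one.trans S.one_le_σ) 4)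
    have := S.σ_pos
    rw [← mul_div_assoc, le_div_iff₀ (by positivity)]
    calc ‖v S‖ * S.σ ^ 4 = S.σ ^ 2 * (S.σ ^ 2 * ‖v S‖) := by ring
      _ ≤ S.σ ^ 2 * ((2 * b + 1) * S.E) := mul_le_mul_of_nonneg_left (hv S) (sq_nonneg _)
      _ = (2 * b + 1) * (S.σ ^ 2 * S.E) := by ring
      _ ≤ _ := by gcongr; exact S.E_le_K
  have hbd : (fun S : FibreSol b μ grav κ => S.ka - (μ * S.r) • S.h) =O[⊤] fun S => S.δ / S.σ := by
    refine IsBigO.sub (isBigO_σ_div fun S => S.le_δ.2.2.2.2.2.1) ?_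
    have := (isBigO_r.smul (isBigO_h (b := b) (μ := μ) (grav := grav) (κ := κ))).const_smul_left μ
    refine (this.congr_left fun S => ?_).trans (isBigO_of_le _ fun S => le_of_eq ?_)
    · rw [mul_smul]; rfl
    · have := S.σ_pos
      congr 1
      rw [smul_eq_mul]
      field_simp
  have key : (fun S : FibreSol b μ grav κ => S.σ ^ 4 *
      (μ * (‖S.a'‖ ^ 2 + (S.r * ‖S.a‖) ^ 2 + ‖S.w'‖ ^ 2 + (S.r * ‖S.w‖) ^ 2))) =O[⊤]
      fun S => S.K * S.δ := by
    rw [e]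
    refine ((((isBigO_J hb hμ).add ?_).add ?_).add ?_).add ?_
    · refine ((isBigO_refl (fun S : FibreSol b μ grav κ => S.σ ^ 4) _).mul
        (isBigO_inner hbd ((isBigO_ab hb).trans (hE.mul (isBigO_refl (fun S : FibreSol b μ grav κ => S.σ⁻¹) _))))).trans
        (isBigO_of_le _ fun S => le_of_eq ?_)
      have := S.σ_pos
      congr 1
      field_simp
    · refine ((isBigO_refl (fun S : FibreSol b μ grav κ => S.σ ^ 4) _).mul
        ((isBigO_inner (isBigO_w'b hb) isBigO_h).const_mul_left μ)).trans
        (isBigO_of_le _ fun S => le_of_eq ?_)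
      have := S.σ_pos
      congr 1
      field_simp
    · refine ((isBigO_refl (fun S : FibreSol b μ grav κ => S.σ ^ 4) _).mul
        (isBigO_inner isBigO_fa (hv _ (a_le hb)))).trans (isBigO_of_le _ fun S => le_of_eq ?_)
      have := S.σ_pos
      congr 1
      field_simp
    · refine ((isBigO_refl (fun S : FibreSol b μ grav κ => S.σ ^ 4) _).mul
        (isBigO_inner isBigO_f3 (hv _ (w_le hb)))).trans (isBigO_of_le _ fun S => le_of_eq ?_)
      have := S.σ_pos
      congr 1
      field_simp
  refine IsBigO.trans ?_ key
  refine isBigO_of_norm_le_mul (4 * μ⁻¹) (fun S => ?_) fun S => by positivity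
  have e2 : 4 * μ⁻¹ * (S.σ ^ 4 *
      (μ * (‖S.a'‖ ^ 2 + (S.r * ‖S.a‖) ^ 2 + ‖S.w'‖ ^ 2 + (S.r * ‖S.w‖) ^ 2))) =
      S.σ ^ 4 * (4 * (‖S.a'‖ ^ 2 + (S.r * ‖S.a‖) ^ 2 + ‖S.w'‖ ^ 2 + (S.r * ‖S.w‖) ^ 2)) := by
    field_simp
  have h4 : S.E ^ 2 ≤ 4 * (‖S.a'‖ ^ 2 + (S.r * ‖S.a‖) ^ 2 + ‖S.w'‖ ^ 2 + (S.r * ‖S.w‖) ^ 2) := by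
    unfold E
    nlinarith [sq_nonneg (‖S.a'‖ - S.r * ‖S.a‖), sq_nonneg (‖S.a'‖ - ‖S.w'‖),
      sq_nonneg (‖S.a'‖ - S.r * ‖S.w‖), sq_nonneg (S.r * ‖S.a‖ - ‖S.w'‖),
      sq_nonneg (S.r * ‖S.a‖ - S.r * ‖S.w‖), sq_nonneg (‖S.w'‖ - S.r * ‖S.w‖)]
  rw [e2, Real.norm_of_nonneg (mul_self_nonneg _)]
  calc S.σ ^ 2 * S.E * (S.σ ^ 2 * S.E) = S.σ ^ 4 * S.E ^ 2 := by ring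
    _ ≤ _ := by gcongr

/-- From `K = σ² E + δ` and the energy bound, `K² ≤ C K δ`; one factor `K` is cancelled. All bounds
by `K` thereby become bounds by the data. -/
lemma isBigO_K (hb : 0 < b) (hμ : 0 < μ) : (K : FibreSol b μ grav κ → ℝ) =O[⊤] δ := by
  apply isBigO_of_mul_self
  have h1 : (fun S : FibreSol b μ grav κ => S.δ * S.δ) =O[⊤] fun S => S.K * S.δ :=
    isBigO_δ_K.mul (isBigO_refl _ _)
  refine IsBigO.trans ?_ ((isBigO_energy hb hμ).add h1)
  refine isBigO_of_norm_le_mul 2 (fun S => ?_) fun S => by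
    nlinarith [mul_self_nonneg (S.σ ^ 2 * S.E), mul_self_nonneg S.δ]
  rw [Real.norm_of_nonneg (mul_self_nonneg _), K]
  nlinarith [mul_self_nonneg (S.σ ^ 2 * S.E - S.δ)]

end FibreSol

namespace FibreSol

variable {b μ grav κ : ℝ}

/-! #### Bounds by the data -/

/-- The physical pressure `p = P - grav c / r`. -/
def p (S : FibreSol b μ grav κ) : L2I b := S.P - constI b ((grav / S.r) • S.c)

/-- Since `σ⁴ ≤ (1 + r)²`, the denominator dominates: gravity at low and surface tension at high
frequency. -/
lemma isBigO_coef (hgrav : 0 < grav) (hκ : 0 < κ) :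
    (fun S : FibreSol b μ grav κ => S.σ ^ 4 * (grav + κ * S.r ^ 2)⁻¹) =O[⊤] fun _ => (1 : ℝ) := by
  refine isBigO_of_norm_le_mul (2 * (grav⁻¹ + κ⁻¹)) (fun S => ?_) fun _ => zero_le_one
  have h0 := S.σ_pos
  have h1 := S.r_pos
  rw [mul_one, Real.norm_of_nonneg (by positivity), ← div_eq_mul_inv, div_le_iff₀ (by positivity)]
  have e : 2 * (grav⁻¹ + κ⁻¹) * (grav + κ * S.r ^ 2) =
      2 * (1 + S.r ^ 2) + 2 * (grav⁻¹ * κ * S.r ^ 2 + κ⁻¹ * grav) := by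
    field_simp
    ring
  have h2 : 0 ≤ grav⁻¹ * κ * S.r ^ 2 + κ⁻¹ * grav := by positivity
  calc S.σ ^ 4 = (S.σ ^ 2) ^ 2 := by ring
    _ ≤ (1 + S.r) ^ 2 := by gcongr; exact S.σ_le
    _ ≤ _ := by rw [e]; nlinarith [sq_nonneg (1 - S.r)]

lemma isBigO_r_coef (hgrav : 0 < grav) (hκ : 0 < κ) :
    (fun S : FibreSol b μ grav κ => S.σ ^ 2 * (S.r / (grav + κ * S.r ^ 2))) =O[⊤]
      fun _ => (1 : ℝ) := by
  refine ((isBigO_r.mul (isBigO_refl (fun S : FibreSol b μ grav κ =>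
    S.σ ^ 2 * (grav + κ * S.r ^ 2)⁻¹) _)).congr (fun S => ?_) fun S => ?_).trans
    (isBigO_coef hgrav hκ)
  · rw [div_eq_mul_inv]; ring
  · ring

/-- The boundary data entering the normal stress. -/
lemma isBigO_k3 (hb : 0 < b) (hμ : 0 < μ) :
    (fun S : FibreSol b μ grav κ => S.k3 - (2 * μ) • (S.r • S.ab + S.gb)) =O[⊤]
      fun S => S.δ / S.σ := by
  refine IsBigO.sub (isBigO_σ_div fun S => S.le_δ.2.2.2.2.2.2.2.1) ?_
  refine ((isBigO_w'b hb).const_smul_left (2 * μ)).trans ?_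
  exact (isBigO_K hb hμ).mul (isBigO_refl (fun S : FibreSol b μ grav κ => S.σ⁻¹) _)

lemma isBigO_r_smul_Pb_δ (hb : 0 < b) (hμ : 0 < μ) :
    (fun S : FibreSol b μ grav κ => S.r • S.Pb) =O[⊤] fun S => S.σ * S.δ :=
  (isBigO_r_smul_Pb hb hμ).trans ((isBigO_refl _ _).mul (isBigO_K hb hμ))

lemma c_eq (S : FibreSol b μ grav κ) : S.c = (grav + κ * S.r ^ 2)⁻¹ • (S.r • S.Pb) +
    (S.r / (grav + κ * S.r ^ 2)) • (S.k3 - (2 * μ) • (S.r • S.ab + S.gb)) := by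
  rw [S.eqc, smul_smul, add_sub_right_comm, smul_add, add_comm, div_eq_inv_mul]

/-- The explicit formula contains `P` at the boundary only as `r Pb`, which is controlled; the
elliptic factor `1 / (grav + κ r²)` supplies the decay `σ⁻⁴`. -/
lemma isBigO_c (hb : 0 < b) (hgrav : 0 < grav) (hμ : 0 < μ) (hκ : 0 < κ) :
    (fun S : FibreSol b μ grav κ => S.σ ^ 3 • S.c) =O[⊤] δ := by
  have e : (fun S : FibreSol b μ grav κ => S.σ ^ 3 • S.c) = fun S =>
      (S.σ ^ 4 * (grav + κ * S.r ^ 2)⁻¹) • (S.σ⁻¹ • (S.r • S.Pb)) +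
      (S.σ ^ 2 * (S.r / (grav + κ * S.r ^ 2))) •
        (S.σ • (S.k3 - (2 * μ) • (S.r • S.ab + S.gb))) := by
    funext S
    have h0 := S.σ_pos
    rw [S.c_eq, smul_add, smul_smul, smul_smul (S.σ ^ 3), smul_smul _ S.σ⁻¹, smul_smul _ S.σ]
    congr 2
    · field_simp
    · ring
  rw [e]
  refine IsBigO.add ?_ ?_
  · refine ((isBigO_coef hgrav hκ).smul ((isBigO_refl (fun S : FibreSol b μ grav κ => S.σ⁻¹)
      _).smul (isBigO_r_smul_Pb_δ hb hμ))).congr_right fun S => ?_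
    have h0 := S.σ_pos
    simp only [smul_eq_mul]
    field_simp
  · refine ((isBigO_r_coef hgrav hκ).smul ((isBigO_refl (fun S : FibreSol b μ grav κ => S.σ)
      _).smul (isBigO_k3 hb hμ))).congr_right fun S => ?_
    have h0 := S.σ_pos
    simp only [smul_eq_mul]
    field_simp

lemma isBigO_constI (hb : 0 < b) {l : Filter (FibreSol b μ grav κ)} {f : FibreSol b μ grav κ → ℂ}
    {B : FibreSol b μ grav κ → ℝ} (h : f =O[l] B) : (fun S => constI b (f S)) =O[l] B := by
  refine IsBigO.trans (IsBigO.of_bound (Real.sqrt b) (Eventually.of_forall fun S => ?_)) h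
  rw [norm_constI hb]

lemma isBigO_p (hb : 0 < b) (hgrav : 0 < grav) (hμ : 0 < μ) (hκ : 0 < κ) :
    (fun S : FibreSol b μ grav κ => S.σ ^ 2 • S.p) =O[⊤] δ := by
  refine isBigO_sup ?_ ?_
  · have hp : (fun S : FibreSol b μ grav κ => S.p) =O[𝓟 {S | S.r ≤ 1}] δ := by
      -- At low frequency neither `P` nor `grav * c / r` is bounded. The part `P - Pb` is controlled
      -- by `P'`, and inserting the formula for `c` in `Pb - grav * c / r` cancels the singular
      -- terms and leaves `r Pb` with the bounded factor `κ r / (grav + κ r²)`.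
      have e : (fun S : FibreSol b μ grav κ => S.p) = fun S => (S.P - constI b S.Pb) +
          constI b ((κ * S.r * (grav + κ * S.r ^ 2)⁻¹) • (S.r • S.Pb) -
            (grav * (grav + κ * S.r ^ 2)⁻¹) • (S.k3 - (2 * μ) • (S.r • S.ab + S.gb))) := by
        funext S
        have h1 := S.r_pos
        have h2 : (grav : ℂ) + κ * (S.r : ℂ) ^ 2 ≠ 0 := by
          have : grav + κ * S.r ^ 2 ≠ 0 := by positivity
          exact_mod_cast this
        have h3 : (S.r : ℂ) ≠ 0 := by exact_mod_cast h1.ne'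
        have key : (κ * S.r * (grav + κ * S.r ^ 2)⁻¹) • (S.r • S.Pb) -
            (grav * (grav + κ * S.r ^ 2)⁻¹) • (S.k3 - (2 * μ) • (S.r • S.ab + S.gb)) =
            S.Pb - (grav / S.r) • S.c := by
          rw [S.c_eq]
          simp only [Complex.real_smul]
          push_cast
          field_simp
          ring
        rw [key, constI_sub, p]
        abel
      rw [e]
      refine IsBigO.add ?_ (isBigO_constI hb (IsBigO.sub ?_ ?_))
      · refine IsBigO.trans ?_ ((isBigO_P'.trans (isBigO_K hb hμ)).mono le_top)
        refine IsBigO.of_bound (2 * b) (Eventually.of_forall fun S => ?_)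
        have := S.hP.sub_const S.Pb
        rw [sub_self] at this
        exact this.poincare' hb
      · have h1 : (fun S : FibreSol b μ grav κ => κ * S.r * (grav + κ * S.r ^ 2)⁻¹)
            =O[𝓟 {S | S.r ≤ 1}] fun _ => (1 : ℝ) := by
          refine IsBigO.of_bound (κ * grav⁻¹) (eventually_principal.2 fun S hS => ?_)
          have h1 := S.r_pos
          rw [norm_one, mul_one, Real.norm_of_nonneg (by positivity)]
          have h2 : (grav + κ * S.r ^ 2)⁻¹ ≤ grav⁻¹ := inv_anti₀ hgrav (by
            have : 0 ≤ κ * S.r ^ 2 := by positivity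
            linarith)
          have h3 : κ * S.r ≤ κ * 1 := mul_le_mul_of_nonneg_left hS hκ.le
          rw [mul_one] at h3
          gcongr
        have h2 := (isBigO_σ_pow_low (b := b) (μ := μ) (grav := grav) (κ := κ) 1 (m := 0)).mul
          (isBigO_refl (fun S => S.δ) _)
        have h3 : (fun S : FibreSol b μ grav κ => S.σ * S.δ) =O[𝓟 {S | S.r ≤ 1}] δ :=
          (h2.congr_left fun S => by rw [pow_one]).congr_right fun S => by rw [pow_zero, one_mul]
        have h4 := h1.smul (((isBigO_r_smul_Pb_δ hb hμ).mono le_top).trans h3)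
        exact h4.congr_right fun S => one_smul _ _
      · have h1 : (fun S : FibreSol b μ grav κ => grav * (grav + κ * S.r ^ 2)⁻¹)
            =O[𝓟 {S | S.r ≤ 1}] fun _ => (1 : ℝ) := by
          refine IsBigO.of_bound 1 (eventually_principal.2 fun S hS => ?_)
          have h1 := S.r_pos
          rw [norm_one, mul_one, Real.norm_of_nonneg (by positivity), ← div_eq_mul_inv]
          exact div_le_one_of_le₀ (by nlinarith [mul_pos hκ (pow_pos h1 2)]) (by positivity)
        refine ((h1.smul ((isBigO_k3 hb hμ).mono le_top))).trans
          (IsBigO.of_bound 1 (Eventually.of_forall fun S => ?_))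
        rw [one_smul, one_mul, norm_div, Real.norm_of_nonneg S.σ_pos.le]
        exact div_le_self (norm_nonneg _) S.one_le_σ
    have h2 := (isBigO_σ_pow_low (b := b) (μ := μ) (grav := grav) (κ := κ) 2 (m := 0)).smul hp
    exact h2.congr_right fun S => by simp
  · have hP := (isBigO_div_of_mul ((isBigO_r_smul_P (grav := grav) (κ := κ) hb hμ).mono le_top)).trans
      (isBigO_inv_r_high _)
    have e : (fun S : FibreSol b μ grav κ => S.σ ^ 2 • S.p) = fun S => S.σ ^ 2 • S.P -
        constI b (grav • (S.σ ^ 2 • (S.r⁻¹ • S.c))) := by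
      funext S
      rw [p, smul_sub, ← constI_smul, smul_smul, smul_smul, smul_smul]
      congr 3
      ring
    rw [e]
    refine IsBigO.sub ?_ (isBigO_constI hb (IsBigO.const_smul_left ?_ grav))
    · refine (((isBigO_refl (fun S : FibreSol b μ grav κ => S.σ ^ 2) _).smul hP).congr_right
        (g₂ := K) fun S => ?_).trans ((isBigO_K hb hμ).mono le_top)
      have h0 := S.σ_pos
      simp only [smul_eq_mul]
      field_simp
    · have h1 : (fun S : FibreSol b μ grav κ => S.σ⁻¹ * S.r⁻¹) =O[𝓟 {S | 1 ≤ S.r}]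
          fun _ => (1 : ℝ) := by
        refine IsBigO.of_bound 1 (eventually_principal.2 fun S hS => ?_)
        have h0 := S.σ_pos
        have h1 := S.r_pos
        rw [norm_one, mul_one, Real.norm_of_nonneg (by positivity)]
        exact mul_le_one₀ (inv_le_one_of_one_le₀ S.one_le_σ) (by positivity)
          (inv_le_one_of_one_le₀ hS)
      refine ((h1.smul ((isBigO_c hb hgrav hμ hκ).mono le_top)).congr_left fun S => ?_).congr_right
        fun S => ?_
      · have h0 := S.σ_pos
        rw [smul_smul, smul_smul]
        congr 1
        field_simp
      · simp

/-! #### The decoupled component -/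

lemma d_le (hb : 0 < b) (S : FibreSol b μ grav κ) :
    S.σ ^ 2 * ‖S.d‖ ≤ (2 * b + 1) * (‖S.d'‖ + S.r * ‖S.d‖) := by
  have := S.r_pos
  exact S.weight_le hb (norm_nonneg _) (S.hd.poincare hb)
    (le_add_of_nonneg_right (by positivity)) (le_add_of_nonneg_left (norm_nonneg _))

/-- Here `|χd| = |om| / r`, so the second compatibility condition is exactly the low frequency
bound. -/
lemma isBigO_χd : (fun S : FibreSol b μ grav κ => S.χd) =O[⊤] δ :=
  isBigO_of_norm_le_mul 1 (fun S => by
    have h1 := S.r_pos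
    have h : S.r * ‖S.χd‖ = ‖S.om‖ := by
      rw [← norm_neg S.om, ← S.eqχ, norm_smul, Real.norm_of_nonneg h1.le]
    have h2 : ‖S.χd‖ = ‖S.om‖ / S.r := by rw [← h]; field_simp
    rw [one_mul, h2]
    exact S.le_δ.2.2.2.2.2.2.2.2.2.2.2) δ_nonneg

lemma isBigO_σ_χd : (fun S : FibreSol b μ grav κ => S.σ ^ 3 • S.χd) =O[⊤] δ := by
  refine isBigO_sup ?_ ?_
  · exact ((isBigO_σ_pow_low (b := b) (μ := μ) (grav := grav) (κ := κ) 3 (m := 0)).smul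
      (isBigO_χd.mono le_top)).congr_right fun S => by simp
  · have h1 : (fun S : FibreSol b μ grav κ => S.r • S.χd) =O[𝓟 {S | 1 ≤ S.r}] fun S => S.δ / S.σ := by
      refine IsBigO.mono ?_ le_top
      refine isBigO_σ_div fun S => ?_
      rw [S.eqχ, norm_neg]
      exact S.le_δ.2.2.2.2.2.2.2.2.2.1
    have h2 := (isBigO_div_of_mul h1).trans (isBigO_inv_r_high _)
    refine ((isBigO_refl (fun S : FibreSol b μ grav κ => S.σ ^ 3) _).smul h2).congr_right
      fun S => ?_
    have h0 := S.σ_pos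
    simp only [smul_eq_mul]
    field_simp

lemma isBigO_fd (hb : 0 < b) :
    (fun S : FibreSol b μ grav κ => S.fd - constI b (grav • S.χd)) =O[⊤] δ :=
  IsBigO.sub (isBigO_of_norm_le_mul 1 (fun S => by rw [one_mul]; exact S.le_δ.2.2.2.2.1) δ_nonneg)
    (isBigO_constI hb (isBigO_χd.const_smul_left grav))

/-- Energy estimate for a scalar problem: test with `d`, using the Dirichlet condition below and the
Neumann datum above, and treat `grav * χd`, which is already bounded, as a source. -/
lemma isBigO_d (hb : 0 < b) (hμ : 0 < μ) :
    (fun S : FibreSol b μ grav κ => S.σ ^ 2 * (‖S.d'‖ + S.r * ‖S.d‖)) =O[⊤] δ := by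
  apply isBigO_of_mul_self
  have hpos : ∀ S : FibreSol b μ grav κ, 0 ≤ ‖S.d'‖ + S.r * ‖S.d‖ := fun S => by
    have := S.r_pos; positivity
  have e : (fun S : FibreSol b μ grav κ => S.σ ^ 4 *
      (μ * (‖S.d'‖ ^ 2 + (S.r * ‖S.d‖) ^ 2))) = fun S =>
      S.σ ^ 4 * ⟪S.fd - constI b (grav • S.χd), S.d⟫_ℝ + S.σ ^ 4 * ⟪S.kd, S.db⟫_ℝ := by
    funext S
    have e1 := S.hd'.ibp hb S.hd
    rw [inner_zero_right, sub_zero, real_inner_self_eq_norm_sq] at e1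
    rw [← S.eqd, ← S.eqkd, sub_sub_cancel_left, inner_neg_left, inner_smul_left, inner_sub_left,
      inner_smul_left, inner_smul_left, real_inner_self_eq_norm_sq]
    simp only [RCLike.conj_to_real]
    linear_combination S.σ ^ 4 * μ * e1
  have hd0 : (fun S : FibreSol b μ grav κ => S.d) =O[⊤]
      fun S => (‖S.d'‖ + S.r * ‖S.d‖) / S.σ ^ 2 :=
    isBigO_of_norm_le_mul (2 * b + 1) (fun S => by
      have := S.σ_pos
      rw [← mul_div_assoc, le_div_iff₀ (by positivity), mul_comm]
      exact S.d_le hb) fun S => div_nonneg (hpos S) (sq_nonneg _)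
  have hd1 : (fun S : FibreSol b μ grav κ => S.d') =O[⊤]
      fun S => S.σ ^ 2 * ((‖S.d'‖ + S.r * ‖S.d‖) / S.σ ^ 2) :=
    isBigO_of_norm_le_mul 1 (fun S => by
      have := S.σ_pos
      have := S.r_pos
      have e : S.σ ^ 2 * ((‖S.d'‖ + S.r * ‖S.d‖) / S.σ ^ 2) = ‖S.d'‖ + S.r * ‖S.d‖ := by
        field_simp
      rw [e, one_mul]
      exact le_add_of_nonneg_right (by positivity))
      fun S => mul_nonneg (sq_nonneg _) (div_nonneg (hpos S) (sq_nonneg _))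
  have hdb := HD.isBigO_top hb (fun S : FibreSol b μ grav κ => S.hd) (fun S => S.one_le_σ) hd0 hd1
  have hkd : (fun S : FibreSol b μ grav κ => S.kd) =O[⊤] fun S => S.δ / S.σ :=
    isBigO_σ_div fun S => S.le_δ.2.2.2.2.2.2.1
  have key : (fun S : FibreSol b μ grav κ => S.σ ^ 4 *
      (μ * (‖S.d'‖ ^ 2 + (S.r * ‖S.d‖) ^ 2))) =O[⊤]
      fun S => S.σ ^ 2 * (‖S.d'‖ + S.r * ‖S.d‖) * S.δ := by
    rw [e]
    refine IsBigO.add ?_ ?_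
    · refine ((isBigO_refl (fun S : FibreSol b μ grav κ => S.σ ^ 4) _).mul
        (isBigO_inner (isBigO_fd hb) hd0)).trans (isBigO_of_le _ fun S => le_of_eq ?_)
      have := S.σ_pos
      congr 1
      field_simp
    · refine ((isBigO_refl (fun S : FibreSol b μ grav κ => S.σ ^ 4) _).mul
        (isBigO_inner hkd hdb)).trans (isBigO_of_le _ fun S => le_of_eq ?_)
      have := S.σ_pos
      congr 1
      field_simp
  refine IsBigO.trans ?_ key
  refine isBigO_of_norm_le_mul (2 * μ⁻¹) (fun S => ?_) fun S => by positivity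
  have e2 : 2 * μ⁻¹ * (S.σ ^ 4 * (μ * (‖S.d'‖ ^ 2 + (S.r * ‖S.d‖) ^ 2))) =
      S.σ ^ 4 * (2 * (‖S.d'‖ ^ 2 + (S.r * ‖S.d‖) ^ 2)) := by
    field_simp
  rw [e2, Real.norm_of_nonneg (mul_self_nonneg _)]
  calc S.σ ^ 2 * (‖S.d'‖ + S.r * ‖S.d‖) * (S.σ ^ 2 * (‖S.d'‖ + S.r * ‖S.d‖)) =
      S.σ ^ 4 * (‖S.d'‖ + S.r * ‖S.d‖) ^ 2 := by ring
    _ ≤ _ := by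
      gcongr
      nlinarith [sq_nonneg (‖S.d'‖ - S.r * ‖S.d‖)]

/-- The equation gives `d''` once `r² d` is bounded by the energy. -/
lemma isBigO_d'' (hb : 0 < b) (hμ : 0 < μ) : (fun S : FibreSol b μ grav κ => S.d'') =O[⊤] δ := by
  have e : (fun S : FibreSol b μ grav κ => S.d'') = fun S =>
      S.r ^ 2 • S.d - μ⁻¹ • (S.fd - constI b (grav • S.χd)) := by
    funext S
    rw [← S.eqd, sub_sub_cancel_left, smul_neg, smul_smul, inv_mul_cancel₀ hμ.ne', one_smul]
    abel
  rw [e]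
  refine IsBigO.sub ?_ (IsBigO.const_smul_left (isBigO_fd hb) μ⁻¹)
  refine IsBigO.trans ?_ (isBigO_d hb hμ)
  refine isBigO_of_norm_le_mul 7 (fun S => ?_) fun S => by
    have := S.r_pos; positivity
  have := S.r_pos
  rw [norm_smul, norm_pow, Real.norm_of_nonneg S.r_pos.le, sq, mul_assoc]
  calc S.r * (S.r * ‖S.d‖) ≤ (7 * S.σ ^ 2) * (S.r * ‖S.d‖) := by gcongr; exact S.r_le
    _ ≤ (7 * S.σ ^ 2) * (‖S.d'‖ + S.r * ‖S.d‖) := by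
      gcongr
      exact le_add_of_nonneg_left (norm_nonneg _)
    _ = _ := by ring

/-! #### The full estimate -/

/-- The size of the solution. -/
def out (S : FibreSol b μ grav κ) : ℝ :=
  S.σ ^ 4 * ‖S.a‖ + S.σ ^ 2 * ‖S.a'‖ + ‖S.a''‖ + S.σ ^ 4 * ‖S.w‖ + S.σ ^ 2 * ‖S.w'‖ +
    ‖S.r • S.a' + S.g'‖ + S.σ ^ 4 * ‖S.d‖ + S.σ ^ 2 * ‖S.d'‖ + ‖S.d''‖ + S.σ ^ 2 * ‖S.p‖ +
    ‖S.P'‖ + S.σ ^ 3 * ‖S.c‖ + S.σ ^ 3 * ‖S.χd‖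

/-- The uniform a priori estimate on fibres: the constant depends on `b`, `μ`, `grav` and `κ`, but
not on the frequency. The terms with `σ⁴` follow from the first order energy by Poincaré's
inequality. -/
theorem exists_out_le (hb : 0 < b) (hgrav : 0 < grav) (hμ : 0 < μ) (hκ : 0 < κ) :
    ∃ C : ℝ, 0 ≤ C ∧ ∀ S : FibreSol b μ grav κ, S.out ≤ C * S.δ := by
  have hσ : ∀ (n : ℕ) (S : FibreSol b μ grav κ), 0 ≤ S.σ ^ n := fun n S => pow_nonneg S.σ_pos.le n
  have hKδ := isBigO_K (b := b) (μ := μ) (grav := grav) (κ := κ) hb hμ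
  have h4 : ∀ (v : FibreSol b μ grav κ → L2I b) (e B : FibreSol b μ grav κ → ℝ),
      (∀ S, S.σ ^ 2 * ‖v S‖ ≤ (2 * b + 1) * e S) → (∀ S, S.σ ^ 2 * e S ≤ B S) → (∀ S, 0 ≤ B S) →
      B =O[⊤] δ → (fun S => S.σ ^ 4 * ‖v S‖) =O[⊤] δ := by
    intro v e B h1 h2 h3 h
    refine (isBigO_of_norm_le_mul (2 * b + 1) (fun S => ?_) h3).trans h
    rw [Real.norm_of_nonneg (mul_nonneg (hσ 4 S) (norm_nonneg _))]
    calc S.σ ^ 4 * ‖v S‖ = S.σ ^ 2 * (S.σ ^ 2 * ‖v S‖) := by ring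
      _ ≤ S.σ ^ 2 * ((2 * b + 1) * e S) := mul_le_mul_of_nonneg_left (h1 S) (hσ 2 S)
      _ = (2 * b + 1) * (S.σ ^ 2 * e S) := by ring
      _ ≤ _ := mul_le_mul_of_nonneg_left (h2 S) (by positivity)
  have h2 : ∀ (v : FibreSol b μ grav κ → L2I b) (B : FibreSol b μ grav κ → ℝ),
      (∀ S, S.σ ^ 2 * ‖v S‖ ≤ B S) → (∀ S, 0 ≤ B S) → B =O[⊤] δ →
      (fun S => S.σ ^ 2 * ‖v S‖) =O[⊤] δ := by
    intro v B h1 h3 h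
    refine (isBigO_of_norm_le_mul 1 (fun S => ?_) h3).trans h
    rw [Real.norm_of_nonneg (mul_nonneg (hσ 2 S) (norm_nonneg _)), one_mul]
    exact h1 S
  have hs : ∀ {V : Type} [NormedAddCommGroup V] [NormedSpace ℝ V] (n : ℕ)
      (v : FibreSol b μ grav κ → V), (fun S => S.σ ^ n • v S) =O[⊤] δ →
      (fun S => S.σ ^ n * ‖v S‖) =O[⊤] δ := by
    intro V _ _ n v h
    refine h.norm_left.congr_left fun S => ?_
    rw [norm_smul, Real.norm_of_nonneg (hσ n S)]
  have hdpos : ∀ S : FibreSol b μ grav κ, 0 ≤ S.σ ^ 2 * (‖S.d'‖ + S.r * ‖S.d‖) := fun S => by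
    have := S.r_pos; positivity
  have main : (out : FibreSol b μ grav κ → ℝ) =O[⊤] δ := by
    refine ((((((((((((h4 _ _ _ (a_le hb) E_le_K K_nonneg hKδ).add (h2 _ _ (fun S => ?_) K_nonneg
      hKδ)).add ((isBigO_a'' hb hμ).trans hKδ).norm_left).add (h4 _ _ _ (w_le hb) E_le_K K_nonneg
      hKδ)).add (h2 _ _ (fun S => ?_) K_nonneg hKδ)).add (isBigO_w''.trans hKδ).norm_left).add
      (h4 _ _ _ (d_le hb) (fun S => le_rfl) hdpos (isBigO_d hb hμ))).add
      (h2 _ _ (fun S => ?_) hdpos (isBigO_d hb hμ))).add (isBigO_d'' hb hμ).norm_left).add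
      (hs 2 _ (isBigO_p hb hgrav hμ hκ))).add (isBigO_P'.trans hKδ).norm_left).add
      (hs 3 _ (isBigO_c hb hgrav hμ hκ))).add (hs 3 _ isBigO_σ_χd)
    · exact (mul_le_mul_of_nonneg_left S.norm_le_E.1 (hσ 2 S)).trans S.E_le_K
    · exact (mul_le_mul_of_nonneg_left S.norm_le_E.2.2.1 (hσ 2 S)).trans S.E_le_K
    · have := S.r_pos
      exact mul_le_mul_of_nonneg_left (le_add_of_nonneg_right (by positivity)) (hσ 2 S)
  obtain ⟨C, hC⟩ := isBigO_top.1 main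
  refine ⟨max C 0, le_max_right _ _, fun S => ?_⟩
  have h := hC S
  rw [Real.norm_of_nonneg S.δ_nonneg] at h
  exact (le_abs_self _).trans (h.trans (mul_le_mul_of_nonneg_right (le_max_left _ _) S.δ_nonneg))

end FibreSol

/-! ### The rotated system on a fibre, in terms of functions -/

/-- Data of the rotated system on a fibre of frequency `r`. -/
structure FData where
  r : ℝ
  (fa f3 g g' fd : ℝ → ℂ)
  (ka k3 kd h om : ℂ)

/-- Unknowns of the rotated system on a fibre. -/
structure FSol where
  (a a' a'' w P P' d d' d'' : ℝ → ℂ)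
  (c χd : ℂ)

/-- The rotated system. -/
structure FSys (b μ grav κ : ℝ) (D : FData) (S : FSol) : Prop where
  prim_a : Prim b S.a S.a'
  prim_a' : Prim b S.a' S.a''
  prim_w : Prim b S.w fun y => D.r * S.a y + D.g y
  prim_P : Prim b S.P S.P'
  prim_d : Prim b S.d S.d'
  prim_d' : Prim b S.d' S.d''
  prim_g : Prim b D.g D.g'
  memLp_a'' : MemLp S.a'' 2 (volI b)
  memLp_P' : MemLp S.P' 2 (volI b)
  memLp_d'' : MemLp S.d'' 2 (volI b)
  memLp_g' : MemLp D.g' 2 (volI b)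
  memLp_fa : MemLp D.fa 2 (volI b)
  memLp_f3 : MemLp D.f3 2 (volI b)
  memLp_fd : MemLp D.fd 2 (volI b)
  a_zero : S.a 0 = 0
  w_zero : S.w 0 = 0
  d_zero : S.d 0 = 0
  w_b : S.w b = D.h
  eqa : ∀ᵐ y ∂volI b, D.r * S.P y - μ * (S.a'' y - D.r ^ 2 * S.a y) = D.fa y + μ * D.r * D.g y
  eq3 : ∀ᵐ y ∂volI b,
    S.P' y - μ * (D.r * S.a' y + D.g' y - D.r ^ 2 * S.w y) = D.f3 y + μ * D.g' y
  eqka : μ * (S.a' b + D.r * D.h) = D.ka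
  eqc : S.c = D.r / (grav + κ * D.r ^ 2) * (D.k3 + S.P b - 2 * μ * (D.r * S.a b + D.g b))
  eqd : ∀ᵐ y ∂volI b, grav * S.χd - μ * (S.d'' y - D.r ^ 2 * S.d y) = D.fd y
  eqkd : μ * S.d' b = D.kd
  eqχ : D.r * S.χd = -D.om

/-- The `L²` norm on a fibre. -/
def nf (b : ℝ) (F : ℝ → ℂ) : ℝ := (eLpNorm F 2 (volI b)).toReal

lemma nf_nonneg (b : ℝ) (F : ℝ → ℂ) : 0 ≤ nf b F := ENNReal.toReal_nonneg

/-- The size of the data on a fibre. -/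
def FData.δ (D : FData) (b σ : ℝ) : ℝ :=
  σ ^ 2 * nf b D.g + nf b D.g' + nf b D.fa + nf b D.f3 + nf b D.fd + σ * ‖D.ka‖ + σ * ‖D.kd‖ +
    σ * ‖D.k3‖ + σ ^ 3 * ‖D.h‖ + σ * ‖D.om‖ + ‖D.h - ∫ t in (0 : ℝ)..b, D.g t‖ / D.r + ‖D.om‖ / D.r

/-- The size of the solution on a fibre. -/
def FSol.out (S : FSol) (D : FData) (b grav σ : ℝ) : ℝ :=
  σ ^ 4 * nf b S.a + σ ^ 2 * nf b S.a' + nf b S.a'' + σ ^ 4 * nf b S.w +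
    σ ^ 2 * nf b (fun y => D.r * S.a y + D.g y) + nf b (fun y => D.r * S.a' y + D.g' y) +
    σ ^ 4 * nf b S.d + σ ^ 2 * nf b S.d' + nf b S.d'' +
    σ ^ 2 * nf b (fun y => S.P y - grav / D.r * S.c) + nf b S.P' + σ ^ 3 * ‖S.c‖ + σ ^ 3 * ‖S.χd‖

lemma norm_toLp_eq_nf {b : ℝ} {F : ℝ → ℂ} (h : MemLp F 2 (volI b)) : ‖h.toLp F‖ = nf b F :=
  Lp.norm_toLp F h

lemma norm_eq_nf {b : ℝ} {F : ℝ → ℂ} {v : L2I b} (h : v =ᵐ[volI b] F) : ‖v‖ = nf b F := by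
  rw [Lp.norm_def, nf, eLpNorm_congr_ae h]

/-- Passes from classes in `L²(0, b)` to actual functions on a fibre, the form in which both the
transformed unknowns and the explicit solutions appear. -/
theorem exists_fibre_estimate {b μ grav κ : ℝ} (hb : 0 < b) (hgrav : 0 < grav) (hμ : 0 < μ)
    (hκ : 0 < κ) : ∃ C : ℝ, 0 ≤ C ∧ ∀ (D : FData) (S : FSol) (σ : ℝ), FSys b μ grav κ D S →
      0 < D.r → 1 ≤ σ → σ ^ 2 ≤ 1 + D.r → D.r ≤ 7 * σ ^ 2 →
      S.out D b grav σ ≤ C * D.δ b σ := by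
  obtain ⟨C, hC0, hC⟩ := FibreSol.exists_out_le (b := b) (μ := μ) (grav := grav) (κ := κ) hb hgrav
    hμ hκ
  refine ⟨C, hC0, fun D S σ hS hr hσ h1 h2 => ?_⟩
  have ma := hS.prim_a.memLp 2
  have ma' := hS.prim_a'.memLp 2
  have mw := hS.prim_w.memLp 2
  have mP := hS.prim_P.memLp 2
  have md := hS.prim_d.memLp 2
  have md' := hS.prim_d'.memLp 2
  have mg := hS.prim_g.memLp 2
  have pw' : Prim b (fun y => D.r * S.a y + D.g y) (fun y => D.r * S.a' y + D.g' y) :=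
    (hS.prim_a.const_mul D.r).add hS.prim_g
  have mw' := pw'.memLp 2
  obtain ⟨G, hG⟩ := exists_primitive_I (mg.toLp D.g)
  have hGb : ∫ t in (0 : ℝ)..b, mg.toLp D.g t = ∫ t in (0 : ℝ)..b, D.g t := by
    rw [intervalIntegral_eq_volI' hb.le, intervalIntegral_eq_volI' hb.le]
    exact integral_congr_ae mg.coeFn_toLp
  have w''eq : ∀ᵐ y ∂volI b, (D.r • ma'.toLp S.a' + hS.memLp_g'.toLp D.g' : L2I b) y =
      D.r * S.a' y + D.g' y := by
    filter_upwards [Lp.coeFn_add (D.r • ma'.toLp S.a') (hS.memLp_g'.toLp D.g'),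
      Lp.coeFn_smul D.r (ma'.toLp S.a'), ma'.coeFn_toLp, hS.memLp_g'.coeFn_toLp] with y h1 h2 h3 h4
    rw [h1, Pi.add_apply, h2, Pi.smul_apply, h3, h4, Complex.real_smul]
  have w'eq : ∀ᵐ y ∂volI b, (D.r • ma.toLp S.a + mg.toLp D.g : L2I b) y =
      D.r * S.a y + D.g y := by
    filter_upwards [Lp.coeFn_add (D.r • ma.toLp S.a) (mg.toLp D.g),
      Lp.coeFn_smul D.r (ma.toLp S.a), ma.coeFn_toLp, mg.coeFn_toLp] with y h1 h2 h3 h4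
    rw [h1, Pi.add_apply, h2, Pi.smul_apply, h3, h4, Complex.real_smul]
  let T : FibreSol b μ grav κ :=
    { r := D.r, σ := σ, r_pos := hr, one_le_σ := hσ, σ_le := h1, r_le := h2
      a := ma.toLp _, a' := ma'.toLp _, a'' := hS.memLp_a''.toLp _, w := mw.toLp _
      w' := D.r • ma.toLp S.a + mg.toLp D.g
      P := mP.toLp _, P' := hS.memLp_P'.toLp _, g := mg.toLp _, g' := hS.memLp_g'.toLp _, G := G
      fa := hS.memLp_fa.toLp _, f3 := hS.memLp_f3.toLp _, d := md.toLp _, d' := md'.toLp _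
      d'' := hS.memLp_d''.toLp _, fd := hS.memLp_fd.toLp _
      a'₀ := S.a' 0, ab := S.a b, a'b := S.a' b, w'₀ := D.r * S.a 0 + D.g 0, h := D.h
      P₀ := S.P 0, Pb := S.P b, g₀ := D.g 0, gb := D.g b, Gb := ∫ t in (0 : ℝ)..b, D.g t
      ka := D.ka, k3 := D.k3, c := S.c, d'₀ := S.d' 0, db := S.d b, d'b := S.d' b, kd := D.kd
      χd := S.χd, om := D.om
      ha := ⟨_, _, hS.prim_a, ma.coeFn_toLp, ma'.coeFn_toLp, hS.a_zero, rfl⟩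
      ha' := ⟨_, _, hS.prim_a', ma'.coeFn_toLp, hS.memLp_a''.coeFn_toLp, rfl, rfl⟩
      hw := ⟨_, _, hS.prim_w, mw.coeFn_toLp, w'eq, hS.w_zero, hS.w_b⟩
      hw' := ⟨_, _, pw', w'eq, w''eq, rfl, by rw [Complex.real_smul]⟩
      hP := ⟨_, _, hS.prim_P, mP.coeFn_toLp, hS.memLp_P'.coeFn_toLp, rfl, rfl⟩
      hg := ⟨_, _, hS.prim_g, mg.coeFn_toLp, hS.memLp_g'.coeFn_toLp, rfl, rfl⟩
      hG := hGb ▸ hG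
      hd := ⟨_, _, hS.prim_d, md.coeFn_toLp, md'.coeFn_toLp, hS.d_zero, rfl⟩
      hd' := ⟨_, _, hS.prim_d', md'.coeFn_toLp, hS.memLp_d''.coeFn_toLp, rfl, rfl⟩
      eqa := by
        refine Lp.ext ?_
        filter_upwards [hS.eqa, ma.coeFn_toLp, mP.coeFn_toLp, hS.memLp_a''.coeFn_toLp,
          hS.memLp_fa.coeFn_toLp, mg.coeFn_toLp,
          Lp.coeFn_sub (D.r • mP.toLp S.P)
            (μ • (hS.memLp_a''.toLp S.a'' - D.r ^ 2 • ma.toLp S.a)),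
          Lp.coeFn_smul D.r (mP.toLp S.P),
          Lp.coeFn_smul μ (hS.memLp_a''.toLp S.a'' - D.r ^ 2 • ma.toLp S.a),
          Lp.coeFn_sub (hS.memLp_a''.toLp S.a'') (D.r ^ 2 • ma.toLp S.a),
          Lp.coeFn_smul (D.r ^ 2) (ma.toLp S.a),
          Lp.coeFn_add (hS.memLp_fa.toLp D.fa) ((μ * D.r) • mg.toLp D.g),
          Lp.coeFn_smul (μ * D.r) (mg.toLp D.g)] with y e e1 e2 e3 e4 e5 e6 e7 e8 e9 e10 e11 e12
        rw [e6, Pi.sub_apply, e7, e8, Pi.smul_apply, Pi.smul_apply, e9, Pi.sub_apply, e10,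
          Pi.smul_apply, e11, Pi.add_apply, e12, Pi.smul_apply, e1, e2, e3, e4, e5]
        simp only [Complex.real_smul]
        push_cast
        exact e
      eq3 := by
        refine Lp.ext ?_
        filter_upwards [hS.eq3, mw.coeFn_toLp, hS.memLp_P'.coeFn_toLp,
          hS.memLp_f3.coeFn_toLp, hS.memLp_g'.coeFn_toLp, w''eq,
          Lp.coeFn_sub (hS.memLp_P'.toLp S.P')
            (μ • (D.r • ma'.toLp S.a' + hS.memLp_g'.toLp D.g' - D.r ^ 2 • mw.toLp S.w)),
          Lp.coeFn_smul μ (D.r • ma'.toLp S.a' + hS.memLp_g'.toLp D.g' - D.r ^ 2 • mw.toLp S.w),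
          Lp.coeFn_sub (D.r • ma'.toLp S.a' + hS.memLp_g'.toLp D.g') (D.r ^ 2 • mw.toLp S.w),
          Lp.coeFn_smul (D.r ^ 2) (mw.toLp S.w),
          Lp.coeFn_add (hS.memLp_f3.toLp D.f3) (μ • hS.memLp_g'.toLp D.g'),
          Lp.coeFn_smul μ (hS.memLp_g'.toLp D.g')] with y e e1 e2 e3 e4 e5 e6 e7 e8 e9 e10 e11
        rw [e6, Pi.sub_apply, e7, Pi.smul_apply, e8, Pi.sub_apply, e9, Pi.smul_apply, e10,
          Pi.add_apply, e11, Pi.smul_apply, e5, e1, e2, e3, e4]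
        simp only [Complex.real_smul]
        push_cast
        exact e
      eqw := rfl
      eqka := by simp only [Complex.real_smul]; exact hS.eqka
      eqc := by simp only [Complex.real_smul]; push_cast; exact hS.eqc
      eqd := by
        refine Lp.ext ?_
        filter_upwards [hS.eqd, md.coeFn_toLp, hS.memLp_d''.coeFn_toLp, hS.memLp_fd.coeFn_toLp,
          Lp.coeFn_sub (constI b (grav • S.χd))
            (μ • (hS.memLp_d''.toLp S.d'' - D.r ^ 2 • md.toLp S.d)),
          Lp.coeFn_smul μ (hS.memLp_d''.toLp S.d'' - D.r ^ 2 • md.toLp S.d),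
          Lp.coeFn_sub (hS.memLp_d''.toLp S.d'') (D.r ^ 2 • md.toLp S.d),
          Lp.coeFn_smul (D.r ^ 2) (md.toLp S.d),
          (memLp_const (p := 2) (μ := volI b) (grav • S.χd)).coeFn_toLp]
          with y e e1 e2 e3 e4 e5 e6 e7 e8
        rw [e4, Pi.sub_apply, e5, Pi.smul_apply, e6, Pi.sub_apply, e7, Pi.smul_apply, e1, e2, e3,
          constI, e8]
        simp only [Complex.real_smul]
        push_cast
        exact e
      eqkd := by simp only [Complex.real_smul]; exact hS.eqkd
      eqχ := by simp only [Complex.real_smul]; exact hS.eqχ }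
  have key := hC T
  have hp : ‖T.p‖ = nf b (fun y => S.P y - grav / D.r * S.c) := by
    refine norm_eq_nf ?_
    filter_upwards [Lp.coeFn_sub (mP.toLp S.P) (constI b ((grav / D.r) • S.c)), mP.coeFn_toLp,
      (memLp_const (p := 2) (μ := volI b) ((grav / D.r) • S.c)).coeFn_toLp] with y e1 e2 e3
    change (mP.toLp S.P - constI b ((grav / D.r) • S.c) : L2I b) y = _
    rw [e1, Pi.sub_apply, e2, constI, e3, Complex.real_smul]
    push_cast
    rfl
  have h5 : ‖T.w'‖ = _ := norm_eq_nf w'eq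
  have h6 : ‖T.r • T.a' + T.g'‖ = _ := norm_eq_nf w''eq
  have eout : T.out = S.out D b grav σ := by
    rw [FibreSol.out, hp, h5, h6, FSol.out]
    simp only [T, norm_toLp_eq_nf]
  have eδ : T.δ = D.δ b σ := by
    rw [FibreSol.δ, FData.δ]
    simp only [T, norm_toLp_eq_nf]
  rwa [eout, eδ] at key

/-! ### Explicit solution of the rotated system -/

/-- The solution of `v' = l v + N`, `v(0) = 0`. -/
def duh (l : ℝ) (N : ℝ → ℂ) (y : ℝ) : ℂ :=
  Complex.exp (l * y) * ∫ t in (0 : ℝ)..y, Complex.exp (-(l * t)) * N t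

lemma hasDerivAt_cexp_mul (l y : ℝ) :
    HasDerivAt (fun y : ℝ => Complex.exp (l * y)) (l * Complex.exp (l * y)) y := by
  have := (((hasDerivAt_id (y : ℂ)).const_mul (l : ℂ)).cexp).comp_ofReal
  simpa [mul_comm] using this

lemma hasDerivAt_csinh_mul (l y : ℝ) :
    HasDerivAt (fun y : ℝ => Complex.sinh (l * y)) (l * Complex.cosh (l * y)) y := by
  have := (((hasDerivAt_id (y : ℂ)).const_mul (l : ℂ)).csinh).comp_ofReal
  simpa [mul_comm] using this

lemma hasDerivAt_ccosh_mul (l y : ℝ) :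
    HasDerivAt (fun y : ℝ => Complex.cosh (l * y)) (l * Complex.sinh (l * y)) y := by
  have := (((hasDerivAt_id (y : ℂ)).const_mul (l : ℂ)).ccosh).comp_ofReal
  simpa [mul_comm] using this

/-- Product rule for Duhamel's formula, valid for a source that is merely integrable. -/
lemma prim_duh {b : ℝ} (hb : 0 ≤ b) (l : ℝ) {N : ℝ → ℂ} (hN : Integrable N (volI b)) :
    Prim b (duh l N) fun y => l * duh l N y + N y := by
  have h1 : Prim b (fun y : ℝ => Complex.exp (l * y)) fun y => l * Complex.exp (l * y) :=
    Prim.of_hasDerivAt (hasDerivAt_cexp_mul l) (by fun_prop)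
  have hint : Integrable (fun t : ℝ => Complex.exp (-(l * t)) * N t) (volI b) := by
    have hc : Continuous fun t : ℝ => Complex.exp (-(l * t)) := by fun_prop
    exact IntegrableOn.continuousOn_mul_of_subset hc.continuousOn hN isCompact_Icc
      measurableSet_Ioo Set.Ioo_subset_Icc_self
  refine (h1.mul hb (Prim.of_primitive hint 0)).congr (fun y _ => ?_) (Eventually.of_forall fun y => ?_)
  · simp [duh]
  · have : Complex.exp (l * y) * Complex.exp (-(l * y)) = 1 := by
      rw [← Complex.exp_add]; simp
    simp only [duh, zero_add]
    linear_combination -(N y) * this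

lemma duh_zero (l : ℝ) (N : ℝ → ℂ) : duh l N 0 = 0 := by simp [duh]

lemma measurable_duh {l : Plane → ℝ} {N : Plane → ℝ → ℂ} (hl : Measurable l)
    (hN : Measurable fun z : Plane × ℝ => N z.1 z.2) :
    Measurable fun z : Plane × ℝ => duh (l z.1) (N z.1) z.2 := by
  have h1 : Measurable fun z : Plane × ℝ => Complex.exp (-(l z.1 * z.2)) * N z.1 z.2 := by fun_prop
  have h2 := (stronglyMeasurable_vint h1.stronglyMeasurable).measurable
  have h3 : Measurable fun z : Plane × ℝ => Complex.exp (l z.1 * z.2) := by fun_prop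
  exact h3.mul h2

namespace FData

variable (D : FData) (b μ grav κ : ℝ)

/-- Effective horizontal force. -/
def Na (y : ℝ) : ℂ := D.fa y + 2 * μ * D.r * D.g y
/-- Effective vertical force. -/
def N3 (y : ℝ) : ℂ := D.f3 y + 2 * μ * D.g' y
/-- Growing mode of pressure and stress. -/
def φp : ℝ → ℂ := duh D.r fun y => D.N3 μ y - D.Na μ y
/-- Decaying mode of pressure and stress. -/
def φm : ℝ → ℂ := duh (-D.r) fun y => D.N3 μ y + D.Na μ y
/-- Particular stress. -/
def τ₀ (y : ℝ) : ℂ := (D.φp μ y - D.φm μ y) / 2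
/-- Particular pressure. -/
def P₀ (y : ℝ) : ℂ := (D.φp μ y + D.φm μ y) / 2
/-- Growing mode of the velocity. -/
def zp : ℝ → ℂ := duh D.r fun y => D.τ₀ μ y / μ + D.g y
/-- Decaying mode of the velocity. -/
def zm : ℝ → ℂ := duh (-D.r) fun y => D.τ₀ μ y / μ - D.g y
/-- Particular horizontal velocity. -/
def a₀ (y : ℝ) : ℂ := (D.zp μ y + D.zm μ y) / 2
/-- Particular vertical velocity. -/
def w₀ (y : ℝ) : ℂ := (D.zp μ y - D.zm μ y) / 2
/-- `cosh (r y)`. -/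
def ch (y : ℝ) : ℂ := Complex.cosh (D.r * y)
/-- `sinh (r y)`. -/
def sh (y : ℝ) : ℂ := Complex.sinh (D.r * y)
/-- Homogeneous solutions. -/
def m₁ (y : ℝ) : ℂ := y * D.ch y / 2 - D.sh y / (2 * D.r)
/-- Homogeneous solutions. -/
def m₂ (y : ℝ) : ℂ := y * D.sh y / 2
/-- Homogeneous solutions. -/
def m₃ (y : ℝ) : ℂ := y * D.ch y / 2 + D.sh y / (2 * D.r)
/-- Determinant of the boundary value problem. -/
def det : ℂ := D.m₁ b * D.ch b - D.m₂ b * D.sh b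
/-- Residual of the kinematic condition. -/
def R₁ : ℂ := μ * (D.h - D.w₀ μ b)
/-- Residual of the stress condition. -/
def R₂ : ℂ := D.ka - 2 * μ * D.r * D.h - D.τ₀ μ b
/-- Coefficient of the first homogeneous solution. -/
def β : ℂ := (D.R₁ b μ * D.ch b - D.m₂ b * D.R₂ b μ) / D.det b
/-- Coefficient of the second homogeneous solution. -/
def γ : ℂ := (D.m₁ b * D.R₂ b μ - D.sh b * D.R₁ b μ) / D.det b
/-- The stress `μ (a' - r w)`. -/
def τ (y : ℝ) : ℂ := D.τ₀ μ y + D.β b μ * D.sh y + D.γ b μ * D.ch y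
/-- Shifted pressure. -/
def solP (y : ℝ) : ℂ := D.P₀ μ y + D.β b μ * D.ch y + D.γ b μ * D.sh y
/-- Horizontal velocity. -/
def sola (y : ℝ) : ℂ := D.a₀ μ y + D.β b μ / μ * D.m₂ y + D.γ b μ / μ * D.m₃ y
/-- Vertical velocity. -/
def solw (y : ℝ) : ℂ := D.w₀ μ y + D.β b μ / μ * D.m₁ y + D.γ b μ / μ * D.m₂ y
/-- Derivative of the horizontal velocity. -/
def sola' (y : ℝ) : ℂ := D.τ b μ y / μ + D.r * D.solw b μ y
/-- Second derivative of the horizontal velocity. -/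
def sola'' (y : ℝ) : ℂ := (D.r * D.solP b μ y - D.Na μ y) / μ + D.r * (D.r * D.sola b μ y + D.g y)
/-- Derivative of the shifted pressure. -/
def solP' (y : ℝ) : ℂ := D.r * D.τ b μ y + D.N3 μ y
/-- Divergence part of the surface gradient. -/
def solc : ℂ := D.r / (grav + κ * D.r ^ 2) *
  (D.k3 + D.solP b μ b - 2 * μ * (D.r * D.sola b μ b + D.g b))
/-- Curl part of the surface gradient. -/
def solχ : ℂ := -D.om / D.r
/-- Source of the decoupled component. -/
def Nd (y : ℝ) : ℂ := (grav * D.solχ - D.fd y) / μ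
/-- Growing mode of the decoupled component. -/
def ep : ℝ → ℂ := duh D.r (D.Nd μ grav)
/-- Decaying mode of the decoupled component. -/
def em : ℝ → ℂ := duh (-D.r) (D.Nd μ grav)
/-- Coefficient of the homogeneous solution of the decoupled component. -/
def βd : ℂ := (D.kd / μ - (D.ep μ grav b + D.em μ grav b) / 2) / D.ch b
/-- The decoupled component. -/
def sold (y : ℝ) : ℂ :=
  (D.ep μ grav y - D.em μ grav y) / (2 * D.r) + D.βd b μ grav / D.r * D.sh y
/-- Derivative of the decoupled component. -/
def sold' (y : ℝ) : ℂ := (D.ep μ grav y + D.em μ grav y) / 2 + D.βd b μ grav * D.ch y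
/-- Second derivative of the decoupled component. -/
def sold'' (y : ℝ) : ℂ := D.r ^ 2 * D.sold b μ grav y + D.Nd μ grav y

/-- The explicit solution of the rotated system. -/
def sol : FSol where
  a := D.sola b μ
  a' := D.sola' b μ
  a'' := D.sola'' b μ
  w := D.solw b μ
  P := D.solP b μ
  P' := D.solP' b μ
  d := D.sold b μ grav
  d' := D.sold' b μ grav
  d'' := D.sold'' b μ grav
  c := D.solc b μ grav κ
  χd := D.solχ

lemma prim_ch : Prim b D.ch fun y => D.r * D.sh y :=
  Prim.of_hasDerivAt (hasDerivAt_ccosh_mul D.r) (by unfold sh; fun_prop)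

lemma prim_sh : Prim b D.sh fun y => D.r * D.ch y :=
  Prim.of_hasDerivAt (hasDerivAt_csinh_mul D.r) (by unfold ch; fun_prop)

variable {D b μ grav κ}

lemma prim_id (b : ℝ) : Prim b (fun y : ℝ => (y : ℂ)) fun _ => 1 :=
  Prim.of_hasDerivAt (fun y => (hasDerivAt_id y).ofReal_comp) continuous_const

/-- `m₁`, `m₂` and `m₃` are the velocity profiles generated by the homogeneous stress and pressure
pairs `(sinh, cosh)` and `(cosh, sinh)`. All three vanish at `y = 0`, so the no-slip condition holds
automatically. -/
lemma prim_m₁ (hb : 0 ≤ b) (hr : 0 < D.r) : Prim b D.m₁ fun y => D.r * D.m₂ y := by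
  have hr' : (D.r : ℂ) ≠ 0 := by exact_mod_cast hr.ne'
  refine ((((prim_id b).mul hb (D.prim_ch b)).const_mul (1 / 2)).sub
    ((D.prim_sh b).const_mul (1 / (2 * D.r)))).congr (fun y _ => ?_) (Eventually.of_forall fun y => ?_)
  · simp only [m₁]; ring
  · simp only [m₂]; field_simp; ring

lemma prim_m₃ (hb : 0 ≤ b) (hr : 0 < D.r) :
    Prim b D.m₃ fun y => D.ch y + D.r * D.m₂ y := by
  have hr' : (D.r : ℂ) ≠ 0 := by exact_mod_cast hr.ne'
  refine ((((prim_id b).mul hb (D.prim_ch b)).const_mul (1 / 2)).add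
    ((D.prim_sh b).const_mul (1 / (2 * D.r)))).congr (fun y _ => ?_) (Eventually.of_forall fun y => ?_)
  · simp only [m₃]; ring
  · simp only [m₂]; field_simp; ring

lemma prim_m₂ (hb : 0 ≤ b) (hr : 0 < D.r) :
    Prim b D.m₂ fun y => D.r * D.m₃ y := by
  have hr' : (D.r : ℂ) ≠ 0 := by exact_mod_cast hr.ne'
  refine (((prim_id b).mul hb (D.prim_sh b)).const_mul (1 / 2)).congr (fun y _ => ?_)
    (Eventually.of_forall fun y => ?_)
  · simp only [m₂]; ring
  · simp only [m₃]; field_simp; ring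

lemma m₂_eq (hr : 0 < D.r) (y : ℝ) : D.r * D.m₃ y = D.sh y + D.r * D.m₁ y := by
  have hr' : (D.r : ℂ) ≠ 0 := by exact_mod_cast hr.ne'
  simp only [m₁, m₃]
  field_simp
  ring

lemma ch_ne_zero (y : ℝ) : D.ch y ≠ 0 := by
  rw [ch, ← Complex.ofReal_mul, ← Complex.ofReal_cosh]
  exact_mod_cast (Real.cosh_pos _).ne'

/-- By `cosh² - sinh² = 1` the determinant equals `b / 2 - sinh(rb) cosh(rb) / (2r)`, which is
negative because `sinh x > x` and `cosh x ≥ 1` for `x > 0`. -/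
lemma det_ne_zero (hb : 0 < b) (hr : 0 < D.r) : D.det b ≠ 0 := by
  have hx : 0 < D.r * b := mul_pos hr hb
  have e : D.det b = ((b / 2 - Real.sinh (D.r * b) * Real.cosh (D.r * b) / (2 * D.r) : ℝ) : ℂ) := by
    have h1 := Complex.cosh_sq (D.r * b)
    simp only [det, m₁, m₂, ch, sh]
    push_cast
    linear_combination (b / 2 : ℂ) * h1
  rw [e]
  have h1 := Real.self_lt_sinh_iff.2 hx
  have h2 := Real.one_le_cosh (D.r * b)
  have h3 : D.r * b < Real.sinh (D.r * b) * Real.cosh (D.r * b) := by nlinarith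
  have h4 : b / 2 < Real.sinh (D.r * b) * Real.cosh (D.r * b) / (2 * D.r) := by
    rw [lt_div_iff₀ (by positivity)]
    linarith
  exact_mod_cast (by linarith : b / 2 - Real.sinh (D.r * b) * Real.cosh (D.r * b) / (2 * D.r) < 0).ne

end FData

/-- Square integrability of the data on a fibre. -/
structure FData.Good (b : ℝ) (D : FData) : Prop where
  r_pos : 0 < D.r
  prim_g : Prim b D.g D.g'
  memLp_g' : MemLp D.g' 2 (volI b)
  memLp_fa : MemLp D.fa 2 (volI b)
  memLp_f3 : MemLp D.f3 2 (volI b)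
  memLp_fd : MemLp D.fd 2 (volI b)

namespace FData.Good

variable {D : FData} {b μ grav κ : ℝ}

lemma memLp_Na (hD : D.Good b) : MemLp (D.Na μ) 2 (volI b) :=
  hD.memLp_fa.add ((hD.prim_g.memLp 2).const_mul _)

lemma memLp_N3 (hD : D.Good b) : MemLp (D.N3 μ) 2 (volI b) :=
  hD.memLp_f3.add (hD.memLp_g'.const_mul _)

lemma prim_φp (hD : D.Good b) (hb : 0 ≤ b) :
    Prim b (D.φp μ) fun y => D.r * D.φp μ y + (D.N3 μ y - D.Na μ y) :=
  prim_duh hb _ ((hD.memLp_N3.sub hD.memLp_Na).integrable (by norm_num))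

lemma prim_φm (hD : D.Good b) (hb : 0 ≤ b) :
    Prim b (D.φm μ) fun y => ((-D.r : ℝ) : ℂ) * D.φm μ y + (D.N3 μ y + D.Na μ y) :=
  prim_duh hb _ ((hD.memLp_N3.add hD.memLp_Na).integrable (by norm_num))

/-- With the stress `τ = μ (a' - r w)` the system is a chain of first order pairs: `τ' = r P - Na`
and `P' = r τ + N3`, then `a' = τ / μ + r w` and `w' = r a + g`. Sums and differences diagonalise
each pair, and every mode is a Duhamel integral. -/
lemma prim_τ₀ (hD : D.Good b) (hb : 0 ≤ b) :
    Prim b (D.τ₀ μ) fun y => D.r * D.P₀ μ y - D.Na μ y := by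
  refine (((hD.prim_φp (μ := μ) hb).sub (hD.prim_φm (μ := μ) hb)).const_mul (1 / 2)).congr (fun y _ => ?_)
    (Eventually.of_forall fun y => ?_)
  · simp only [τ₀]; ring
  · simp only [P₀]; push_cast; ring

lemma prim_P₀ (hD : D.Good b) (hb : 0 ≤ b) :
    Prim b (D.P₀ μ) fun y => D.r * D.τ₀ μ y + D.N3 μ y := by
  refine (((hD.prim_φp (μ := μ) hb).add (hD.prim_φm (μ := μ) hb)).const_mul (1 / 2)).congr (fun y _ => ?_)
    (Eventually.of_forall fun y => ?_)
  · simp only [P₀]; ring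
  · simp only [τ₀]; push_cast; ring

lemma prim_zp (hD : D.Good b) (hb : 0 ≤ b) :
    Prim b (D.zp μ) fun y => D.r * D.zp μ y + (D.τ₀ μ y / μ + D.g y) := by
  refine prim_duh hb _ (Integrable.add ?_ ((hD.prim_g.memLp 2).integrable (by norm_num)))
  exact (((hD.prim_τ₀ hb).memLp 2).integrable (by norm_num)).div_const _

lemma prim_zm (hD : D.Good b) (hb : 0 ≤ b) :
    Prim b (D.zm μ) fun y => ((-D.r : ℝ) : ℂ) * D.zm μ y + (D.τ₀ μ y / μ - D.g y) := by
  refine prim_duh hb _ (Integrable.sub ?_ ((hD.prim_g.memLp 2).integrable (by norm_num)))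
  exact (((hD.prim_τ₀ hb).memLp 2).integrable (by norm_num)).div_const _

lemma prim_a₀ (hD : D.Good b) (hb : 0 ≤ b) :
    Prim b (D.a₀ μ) fun y => D.τ₀ μ y / μ + D.r * D.w₀ μ y := by
  refine (((hD.prim_zp (μ := μ) hb).add (hD.prim_zm (μ := μ) hb)).const_mul (1 / 2)).congr (fun y _ => ?_)
    (Eventually.of_forall fun y => ?_)
  · simp only [a₀]; ring
  · simp only [w₀]; push_cast; ring

lemma prim_w₀ (hD : D.Good b) (hb : 0 ≤ b) :
    Prim b (D.w₀ μ) fun y => D.r * D.a₀ μ y + D.g y := by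
  refine (((hD.prim_zp (μ := μ) hb).sub (hD.prim_zm (μ := μ) hb)).const_mul (1 / 2)).congr (fun y _ => ?_)
    (Eventually.of_forall fun y => ?_)
  · simp only [w₀]; ring
  · simp only [a₀]; push_cast; ring

lemma prim_τ (hD : D.Good b) (hb : 0 ≤ b) :
    Prim b (D.τ b μ) fun y => D.r * D.solP b μ y - D.Na μ y := by
  refine (((hD.prim_τ₀ hb).add ((D.prim_sh b).const_mul (D.β b μ))).add
    ((D.prim_ch b).const_mul (D.γ b μ))).congr (fun y _ => rfl) (Eventually.of_forall fun y => ?_)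
  simp only [solP]; ring

lemma prim_P (hD : D.Good b) (hb : 0 ≤ b) : Prim b (D.solP b μ) (D.solP' b μ) := by
  refine (((hD.prim_P₀ hb).add ((D.prim_ch b).const_mul (D.β b μ))).add
    ((D.prim_sh b).const_mul (D.γ b μ))).congr (fun y _ => rfl) (Eventually.of_forall fun y => ?_)
  simp only [solP', τ]; ring

lemma prim_w (hD : D.Good b) (hb : 0 ≤ b) :
    Prim b (D.solw b μ) fun y => D.r * D.sola b μ y + D.g y := by
  refine (((hD.prim_w₀ hb).add ((prim_m₁ hb hD.r_pos).const_mul (D.β b μ / μ))).add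
    ((prim_m₂ hb hD.r_pos).const_mul (D.γ b μ / μ))).congr (fun y _ => rfl)
    (Eventually.of_forall fun y => ?_)
  simp only [sola]; ring

lemma prim_a (hD : D.Good b) (hb : 0 ≤ b) : Prim b (D.sola b μ) (D.sola' b μ) := by
  refine (((hD.prim_a₀ hb).add ((prim_m₂ hb hD.r_pos).const_mul (D.β b μ / μ))).add
    ((prim_m₃ hb hD.r_pos).const_mul (D.γ b μ / μ))).congr (fun y _ => rfl)
    (Eventually.of_forall fun y => ?_)
  have := m₂_eq hD.r_pos y
  simp only [sola', τ, solw]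
  linear_combination -(D.β b μ / μ) * this

lemma prim_a' (hD : D.Good b) (hb : 0 ≤ b) : Prim b (D.sola' b μ) (D.sola'' b μ) := by
  refine (((hD.prim_τ (μ := μ) hb).const_mul (1 / μ)).add ((hD.prim_w (μ := μ) hb).const_mul D.r)).congr
    (fun y _ => ?_) (Eventually.of_forall fun y => ?_)
  · simp only [sola']; ring
  · simp only [sola'']; ring

lemma memLp_Nd (hD : D.Good b) : MemLp (D.Nd μ grav) 2 (volI b) := by
  have h : MemLp (fun y => (1 / μ : ℂ) * (grav * D.solχ - D.fd y)) 2 (volI b) :=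
    ((memLp_const (grav * D.solχ)).sub hD.memLp_fd).const_mul _
  refine (memLp_congr_ae (Eventually.of_forall fun y => ?_)).1 h
  simp only [Nd]; ring

lemma prim_ep (hD : D.Good b) (hb : 0 ≤ b) :
    Prim b (D.ep μ grav) fun y => D.r * D.ep μ grav y + D.Nd μ grav y :=
  prim_duh hb _ (hD.memLp_Nd.integrable (by norm_num))

lemma prim_em (hD : D.Good b) (hb : 0 ≤ b) :
    Prim b (D.em μ grav) fun y => ((-D.r : ℝ) : ℂ) * D.em μ grav y + D.Nd μ grav y :=
  prim_duh hb _ (hD.memLp_Nd.integrable (by norm_num))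

lemma prim_d (hD : D.Good b) (hb : 0 ≤ b) : Prim b (D.sold b μ grav) (D.sold' b μ grav) := by
  have hr : (D.r : ℂ) ≠ 0 := by exact_mod_cast hD.r_pos.ne'
  refine ((((hD.prim_ep (μ := μ) (grav := grav) hb).sub (hD.prim_em (μ := μ) (grav := grav)
    hb)).const_mul (1 / (2 * D.r))).add ((D.prim_sh b).const_mul (D.βd b μ grav / D.r))).congr
    (fun y _ => ?_) (Eventually.of_forall fun y => ?_)
  · simp only [sold]; ring
  · simp only [sold']; push_cast; field_simp; ring

lemma prim_d' (hD : D.Good b) (hb : 0 ≤ b) : Prim b (D.sold' b μ grav) (D.sold'' b μ grav) := by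
  have hr : (D.r : ℂ) ≠ 0 := by exact_mod_cast hD.r_pos.ne'
  refine ((((hD.prim_ep (μ := μ) (grav := grav) hb).add (hD.prim_em (μ := μ) (grav := grav)
    hb)).const_mul (1 / 2)).add ((D.prim_ch b).const_mul (D.βd b μ grav))).congr
    (fun y _ => ?_) (Eventually.of_forall fun y => ?_)
  · simp only [sold']; ring
  · simp only [sold'', sold]; push_cast; field_simp; ring

/-- `β` and `γ` are given by Cramer's rule for the two conditions at `y = b`; this is the first of
them. -/
lemma sol_w_b (hD : D.Good b) (hb : 0 < b) (hμ : 0 < μ) : D.solw b μ b = D.h := by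
  have hd := det_ne_zero hb hD.r_pos
  have hμ' : (μ : ℂ) ≠ 0 := by exact_mod_cast hμ.ne'
  have e : D.β b μ * D.m₁ b + D.γ b μ * D.m₂ b = D.R₁ b μ := by
    simp only [β, γ]
    field_simp
    simp only [det]
    ring
  rw [R₁] at e
  have : D.solw b μ b = D.w₀ μ b + (D.β b μ * D.m₁ b + D.γ b μ * D.m₂ b) / μ := by
    simp only [solw]; ring
  rw [this, e]
  field_simp
  ring

/-- Second row of the same system. Since `w(b) = h`, the condition `μ (a' + r h) = ka` means `τ(b) =
ka - 2 μ r h`. -/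
lemma sol_τ_b (hD : D.Good b) (hb : 0 < b) : D.τ b μ b = D.ka - 2 * μ * D.r * D.h := by
  have hd := det_ne_zero hb hD.r_pos
  have e : D.β b μ * D.sh b + D.γ b μ * D.ch b = D.R₂ b μ := by
    simp only [β, γ]
    field_simp
    simp only [det]
    ring
  rw [R₂] at e
  simp only [τ]
  linear_combination e

theorem fsys (hD : D.Good b) (hb : 0 < b) (hμ : 0 < μ) :
    FSys b μ grav κ D (D.sol b μ grav κ) := by
  have hμ' : (μ : ℂ) ≠ 0 := by exact_mod_cast hμ.ne'
  have hr : (D.r : ℂ) ≠ 0 := by exact_mod_cast hD.r_pos.ne'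
  have pP := hD.prim_P (μ := μ) hb.le
  have pa := hD.prim_a (μ := μ) hb.le
  have pτ := hD.prim_τ (μ := μ) hb.le
  have pd := hD.prim_d (μ := μ) (grav := grav) hb.le
  refine
    { prim_a := pa
      prim_a' := hD.prim_a' hb.le
      prim_w := hD.prim_w hb.le
      prim_P := pP
      prim_d := pd
      prim_d' := hD.prim_d' hb.le
      prim_g := hD.prim_g
      memLp_a'' := ?_
      memLp_P' := ((pτ.memLp 2).const_mul _).add hD.memLp_N3
      memLp_d'' := ((pd.memLp 2).const_mul _).add hD.memLp_Nd
      memLp_g' := hD.memLp_g'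
      memLp_fa := hD.memLp_fa
      memLp_f3 := hD.memLp_f3
      memLp_fd := hD.memLp_fd
      a_zero := ?_
      w_zero := ?_
      d_zero := ?_
      w_b := hD.sol_w_b hb hμ
      eqa := Eventually.of_forall fun y => ?_
      eq3 := Eventually.of_forall fun y => ?_
      eqka := ?_
      eqc := rfl
      eqd := Eventually.of_forall fun y => ?_
      eqkd := ?_
      eqχ := ?_ }
  · have h : MemLp (fun y => (1 / μ : ℂ) * (D.r * D.solP b μ y - D.Na μ y) +
        D.r * (D.r * D.sola b μ y + D.g y)) 2 (volI b) :=
      ((((pP.memLp 2).const_mul _).sub hD.memLp_Na).const_mul _).add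
        ((((pa.memLp 2).const_mul _).add (hD.prim_g.memLp 2)).const_mul _)
    refine (memLp_congr_ae (Eventually.of_forall fun y => ?_)).1 h
    simp only [sol, sola'']
    ring
  · simp [sol, sola, a₀, zp, zm, duh_zero, m₂, m₃, sh]
  · simp [sol, solw, w₀, zp, zm, duh_zero, m₁, m₂, sh]
  · simp [sol, sold, ep, em, duh_zero, sh]
  · simp only [sol, sola'', Na]
    field_simp
    ring
  · simp only [sol, solP', sola', N3]
    field_simp
    ring
  · have e1 := hD.sol_w_b hb hμ
    have e2 := hD.sol_τ_b (μ := μ) hb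
    simp only [sol, sola', e1, e2]
    field_simp
    ring
  · simp only [sol, sold'', Nd]
    field_simp
    ring
  · have := D.ch_ne_zero b
    simp only [sol, sold', βd]
    field_simp
    ring
  · simp only [sol, solχ]
    field_simp

end FData.Good

/-! ### Joint measurability of the explicit solution -/

/-- Joint measurability of a family of data. -/
structure MeasFData (I : Plane → FData) : Prop where
  r : Measurable fun ξ => (I ξ).r
  fa : Measurable fun z : Plane × ℝ => (I z.1).fa z.2
  f3 : Measurable fun z : Plane × ℝ => (I z.1).f3 z.2
  g : Measurable fun z : Plane × ℝ => (I z.1).g z.2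
  g' : Measurable fun z : Plane × ℝ => (I z.1).g' z.2
  fd : Measurable fun z : Plane × ℝ => (I z.1).fd z.2
  ka : Measurable fun ξ => (I ξ).ka
  k3 : Measurable fun ξ => (I ξ).k3
  kd : Measurable fun ξ => (I ξ).kd
  h : Measurable fun ξ => (I ξ).h
  om : Measurable fun ξ => (I ξ).om

/-- Joint measurability of a family of solutions. -/
structure MeasFSol (J : Plane → FSol) : Prop where
  a : Measurable fun z : Plane × ℝ => (J z.1).a z.2
  a' : Measurable fun z : Plane × ℝ => (J z.1).a' z.2
  a'' : Measurable fun z : Plane × ℝ => (J z.1).a'' z.2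
  w : Measurable fun z : Plane × ℝ => (J z.1).w z.2
  P : Measurable fun z : Plane × ℝ => (J z.1).P z.2
  P' : Measurable fun z : Plane × ℝ => (J z.1).P' z.2
  d : Measurable fun z : Plane × ℝ => (J z.1).d z.2
  d' : Measurable fun z : Plane × ℝ => (J z.1).d' z.2
  d'' : Measurable fun z : Plane × ℝ => (J z.1).d'' z.2
  c : Measurable fun ξ => (J ξ).c
  χd : Measurable fun ξ => (J ξ).χd

/-- Solving by formulas rather than by abstract existence on each fibre makes the solution jointly
measurable in `(ξ, y)`, so that the fibres can be assembled. -/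
theorem MeasFData.sol {I : Plane → FData} (hI : MeasFData I) (b μ grav κ : ℝ) :
    MeasFSol fun ξ => (I ξ).sol b μ grav κ := by
  obtain ⟨hr, hfa, hf3, hg, hg', hfd, hka, hk3, hkd, hh, hom⟩ := hI
  have atb : ∀ {F : Plane → ℝ → ℂ}, (Measurable fun z : Plane × ℝ => F z.1 z.2) →
      Measurable fun ξ => F ξ b := fun hF => hF.comp (measurable_id.prodMk measurable_const)
  have hr1 : Measurable fun z : Plane × ℝ => (I z.1).r := hr.comp measurable_fst
  have hNa : Measurable fun z : Plane × ℝ => (I z.1).Na μ z.2 := by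
    simp only [FData.Na]; fun_prop
  have hN3 : Measurable fun z : Plane × ℝ => (I z.1).N3 μ z.2 := by
    simp only [FData.N3]; fun_prop
  have hφp : Measurable fun z : Plane × ℝ => (I z.1).φp μ z.2 :=
    measurable_duh (N := fun ξ y => (I ξ).N3 μ y - (I ξ).Na μ y) hr (hN3.sub hNa)
  have hφm : Measurable fun z : Plane × ℝ => (I z.1).φm μ z.2 :=
    measurable_duh (N := fun ξ y => (I ξ).N3 μ y + (I ξ).Na μ y) hr.neg (hN3.add hNa)
  have hτ₀ : Measurable fun z : Plane × ℝ => (I z.1).τ₀ μ z.2 := by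
    simp only [FData.τ₀]; fun_prop
  have hP₀ : Measurable fun z : Plane × ℝ => (I z.1).P₀ μ z.2 := by
    simp only [FData.P₀]; fun_prop
  have hzp : Measurable fun z : Plane × ℝ => (I z.1).zp μ z.2 :=
    measurable_duh (N := fun ξ y => (I ξ).τ₀ μ y / μ + (I ξ).g y) hr
      ((hτ₀.div_const _).add hg)
  have hzm : Measurable fun z : Plane × ℝ => (I z.1).zm μ z.2 :=
    measurable_duh (N := fun ξ y => (I ξ).τ₀ μ y / μ - (I ξ).g y) hr.neg
      ((hτ₀.div_const _).sub hg)
  have ha₀ : Measurable fun z : Plane × ℝ => (I z.1).a₀ μ z.2 := by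
    simp only [FData.a₀]; fun_prop
  have hw₀ : Measurable fun z : Plane × ℝ => (I z.1).w₀ μ z.2 := by
    simp only [FData.w₀]; fun_prop
  have hch : Measurable fun z : Plane × ℝ => (I z.1).ch z.2 := by
    simp only [FData.ch]; fun_prop
  have hsh : Measurable fun z : Plane × ℝ => (I z.1).sh z.2 := by
    simp only [FData.sh]; fun_prop
  have hm₁ : Measurable fun z : Plane × ℝ => (I z.1).m₁ z.2 := by
    simp only [FData.m₁]; fun_prop
  have hm₂ : Measurable fun z : Plane × ℝ => (I z.1).m₂ z.2 := by
    simp only [FData.m₂]; fun_prop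
  have hm₃ : Measurable fun z : Plane × ℝ => (I z.1).m₃ z.2 := by
    simp only [FData.m₃]; fun_prop
  have hchb := atb (F := fun ξ => (I ξ).ch) hch
  have hshb := atb (F := fun ξ => (I ξ).sh) hsh
  have hm₁b := atb (F := fun ξ => (I ξ).m₁) hm₁
  have hm₂b := atb (F := fun ξ => (I ξ).m₂) hm₂
  have hτ₀b := atb (F := fun ξ => (I ξ).τ₀ μ) hτ₀
  have hw₀b := atb (F := fun ξ => (I ξ).w₀ μ) hw₀
  have hgb := atb (F := fun ξ => (I ξ).g) hg
  have hR₁ : Measurable fun ξ => (I ξ).R₁ b μ := by simp only [FData.R₁]; fun_prop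
  have hR₂ : Measurable fun ξ => (I ξ).R₂ b μ := by simp only [FData.R₂]; fun_prop
  have hdet : Measurable fun ξ => (I ξ).det b := by simp only [FData.det]; fun_prop
  have hβ : Measurable fun ξ => (I ξ).β b μ := by simp only [FData.β]; fun_prop
  have hγ : Measurable fun ξ => (I ξ).γ b μ := by simp only [FData.γ]; fun_prop
  have hβ1 : Measurable fun z : Plane × ℝ => (I z.1).β b μ := hβ.comp measurable_fst
  have hγ1 : Measurable fun z : Plane × ℝ => (I z.1).γ b μ := hγ.comp measurable_fst
  have hτ : Measurable fun z : Plane × ℝ => (I z.1).τ b μ z.2 := by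
    simp only [FData.τ]; fun_prop
  have hP : Measurable fun z : Plane × ℝ => (I z.1).solP b μ z.2 := by
    simp only [FData.solP]; fun_prop
  have ha : Measurable fun z : Plane × ℝ => (I z.1).sola b μ z.2 := by
    simp only [FData.sola]; fun_prop
  have hw : Measurable fun z : Plane × ℝ => (I z.1).solw b μ z.2 := by
    simp only [FData.solw]; fun_prop
  have hPb := atb (F := fun ξ => (I ξ).solP b μ) hP
  have hab := atb (F := fun ξ => (I ξ).sola b μ) ha
  have hχ : Measurable fun ξ => (I ξ).solχ := by simp only [FData.solχ]; fun_prop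
  have hχ1 : Measurable fun z : Plane × ℝ => (I z.1).solχ := hχ.comp measurable_fst
  have hNd : Measurable fun z : Plane × ℝ => (I z.1).Nd μ grav z.2 := by
    simp only [FData.Nd]; fun_prop
  have hep : Measurable fun z : Plane × ℝ => (I z.1).ep μ grav z.2 :=
    measurable_duh (N := fun ξ => (I ξ).Nd μ grav) hr hNd
  have hem : Measurable fun z : Plane × ℝ => (I z.1).em μ grav z.2 :=
    measurable_duh (N := fun ξ => (I ξ).Nd μ grav) hr.neg hNd
  have hepb := atb (F := fun ξ => (I ξ).ep μ grav) hep
  have hemb := atb (F := fun ξ => (I ξ).em μ grav) hem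
  have hβd : Measurable fun ξ => (I ξ).βd b μ grav := by simp only [FData.βd]; fun_prop
  have hβd1 : Measurable fun z : Plane × ℝ => (I z.1).βd b μ grav := hβd.comp measurable_fst
  have hd : Measurable fun z : Plane × ℝ => (I z.1).sold b μ grav z.2 := by
    simp only [FData.sold]; fun_prop
  refine ⟨ha, ?_, ?_, hw, hP, ?_, hd, ?_, ?_, ?_, hχ⟩
  · simp only [FData.sol, FData.sola']; fun_prop
  · simp only [FData.sol, FData.sola'']; fun_prop
  · simp only [FData.sol, FData.solP']; fun_prop
  · simp only [FData.sol, FData.sold']; fun_prop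
  · simp only [FData.sol, FData.sold'']; fun_prop
  · simp only [FData.sol, FData.solc]; fun_prop

/-! ### Frequency weights -/

/-- The weight `(1 + |ξ|²)^{1/4}`. -/
def sig (ξ : Plane) : ℝ := (1 + ‖ξ‖ ^ 2) ^ (1 / 4 : ℝ)

lemma one_le_sig (ξ : Plane) : 1 ≤ sig ξ :=
  Real.one_le_rpow (by nlinarith [sq_nonneg ‖ξ‖]) (by norm_num)

lemma sig_pos (ξ : Plane) : 0 < sig ξ := zero_lt_one.trans_le (one_le_sig ξ)

lemma sig_nonneg (ξ : Plane) : 0 ≤ sig ξ := (sig_pos ξ).le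

@[fun_prop]
lemma measurable_sig : Measurable sig := by unfold sig; fun_prop

lemma sig_pow (ξ : Plane) (n : ℕ) : sig ξ ^ n = (1 + ‖ξ‖ ^ 2) ^ (n / 4 : ℝ) := by
  rw [sig, ← Real.rpow_natCast, ← Real.rpow_mul (by positivity)]
  congr 1; ring

lemma sig_pow_four (ξ : Plane) : sig ξ ^ 4 = 1 + ‖ξ‖ ^ 2 := by rw [sig_pow]; norm_num

/-- The frequency `2π|ξ|`. -/
def freq (ξ : Plane) : ℝ := 2 * Real.pi * ‖ξ‖

lemma freq_nonneg (ξ : Plane) : 0 ≤ freq ξ := by unfold freq; positivity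

lemma norm_le_freq (ξ : Plane) : ‖ξ‖ ≤ freq ξ := by
  unfold freq; nlinarith [Real.pi_gt_three, norm_nonneg ξ]

lemma sig_sq_le (ξ : Plane) : sig ξ ^ 2 ≤ 1 + freq ξ := by
  have := sig_pow_four ξ
  refine (pow_le_pow_iff_left₀ (by positivity) (by linarith [freq_nonneg ξ]) two_ne_zero).1 ?_
  nlinarith [norm_le_freq ξ, norm_nonneg ξ]

/-- Squared, this is `4π²|ξ|² ≤ 49 (1 + |ξ|²)`, for which `π² ≤ 12` suffices. -/
lemma freq_le (ξ : Plane) : freq ξ ≤ 7 * sig ξ ^ 2 := by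
  refine (pow_le_pow_iff_left₀ (freq_nonneg ξ) (by positivity) two_ne_zero).1 ?_
  have h4 := sig_pow_four ξ
  have hp : Real.pi ^ 2 ≤ 12 := by nlinarith [Real.pi_lt_d2, Real.pi_gt_three]
  have : freq ξ ^ 2 = 4 * Real.pi ^ 2 * ‖ξ‖ ^ 2 := by unfold freq; ring
  nlinarith [sq_nonneg ‖ξ‖]

lemma norm_symb_le (j : Fin 2) (ξ : Plane) : ‖symb j ξ‖ ≤ freq ξ := by
  have : ‖ξ j‖ ≤ ‖ξ‖ := PiLp.norm_apply_le ξ j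
  rw [Real.norm_eq_abs] at this
  simp only [symb, freq, norm_mul, Complex.norm_I, Complex.norm_real, Real.norm_eq_abs,
    Complex.norm_ofNat, mul_one, abs_of_pos Real.pi_pos]
  gcongr

/-! ### Weighted norms in the frequency variable -/

/-- The weighted `L²` norm in the slab. -/
def wO (b : ℝ) (n : ℕ) (F : Plane × ℝ → ℂ) : ℝ≥0∞ :=
  eLpNorm (fun z => ((sig z.1 ^ n : ℝ) : ℂ) * F z) 2 (volO b)

/-- The weighted `L²` norm in the plane. -/
def wS (n : ℕ) (f : Plane → ℂ) : ℝ≥0∞ := eLpNorm (fun ξ => ((sig ξ ^ n : ℝ) : ℂ) * f ξ) 2 volume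

/-- The exponent `1/4` in `sig` makes every half-integer order `n / 2` a natural power: the weight
of `H^{n/2}` is `sig ^ n`. -/
lemma normHSigma_eq (n : ℕ) {σ : ℝ} (hσ : σ = n / 2) (f : L2Sigma) :
    normHSigma σ f = (wS n (𝓕 f : L2Sigma)).toReal := by
  rw [normHSigma, wS]
  congr 3 with ξ
  rw [sig_pow, hσ, div_div]
  norm_num

lemma memSobolev_iff_wS (n : ℕ) {σ : ℝ} (hσ : σ = n / 2) (f : L2Sigma) :
    TemperedDistribution.MemSobolev σ 2 (f : 𝓢'(Plane, ℂ)) ↔ wS n (𝓕 f : L2Sigma) < ⊤ := by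
  have e : (fun ξ : Plane => (((1 + ‖ξ‖ ^ 2) ^ (σ / 2) : ℝ) : ℂ) * (𝓕 f : L2Sigma) ξ) =
      fun ξ => ((sig ξ ^ n : ℝ) : ℂ) * (𝓕 f : L2Sigma) ξ := by
    ext ξ
    rw [sig_pow, hσ, div_div]
    norm_num
  rw [memSobolev_iff_memLp, e]
  refine ⟨fun h => h.2, fun h => ⟨?_, h⟩⟩
  exact (by fun_prop : Measurable fun ξ => ((sig ξ ^ n : ℝ) : ℂ)).aestronglyMeasurable.mul
    (Lp.aestronglyMeasurable _)

lemma measurable_nf (b : ℝ) {F : Plane → ℝ → ℂ} (hF : Measurable fun z : Plane × ℝ => F z.1 z.2) :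
    Measurable fun ξ => nf b (F ξ) := by
  refine Measurable.ennreal_toReal ?_
  simp only [eLpNorm_eq_lintegral_rpow_enorm_toReal (p := 2) (by norm_num) (by norm_num)]
  exact ((hF.enorm.pow_const _).lintegral_prod_right' (ν := volI b)).pow_const _

/-- Tonelli for the squared norms: a norm over the slab is the plane norm of fibre norms. Finiteness
on fibres is needed because `nf` is real valued. -/
lemma wO_eq {b : ℝ} (n : ℕ) {F : Plane × ℝ → ℂ} (hF : AEStronglyMeasurable F (volO b))
    (h : ∀ᵐ ξ : Plane, MemLp (fun y => F (ξ, y)) 2 (volI b)) :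
    wO b n F = eLpNorm (fun ξ => sig ξ ^ n * nf b fun y => F (ξ, y)) 2 volume := by
  rw [wO, eLpNorm_eq_lintegral_rpow_enorm_toReal (by norm_num) (by norm_num),
    eLpNorm_eq_lintegral_rpow_enorm_toReal (by norm_num) (by norm_num)]
  congr 1
  have hm : AEMeasurable (fun z : Plane × ℝ =>
      ‖((sig z.1 ^ n : ℝ) : ℂ) * F z‖ₑ ^ (2 : ℝ≥0∞).toReal) (volO b) :=
    ((by fun_prop : Measurable fun z : Plane × ℝ =>
      ((sig z.1 ^ n : ℝ) : ℂ)).aestronglyMeasurable.mul hF).enorm.pow_const _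
  rw [volO_eq_prod] at hm ⊢
  rw [lintegral_prod _ hm]
  refine lintegral_congr_ae ?_
  filter_upwards [h] with ξ hξ
  have e : ‖sig ξ ^ n * nf b fun y => F (ξ, y)‖ₑ =
      ‖((sig ξ ^ n : ℝ) : ℂ)‖ₑ * eLpNorm (fun y => F (ξ, y)) 2 (volI b) := by
    rw [enorm_mul, ← ofReal_norm (nf b _), Real.norm_of_nonneg (nf_nonneg _ _), nf,
      ENNReal.ofReal_toReal hξ.2.ne, ← ofReal_norm, ← ofReal_norm, Complex.norm_real]
  rw [e, ENNReal.mul_rpow_of_nonneg _ _ (by norm_num),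
    eLpNorm_eq_lintegral_rpow_enorm_toReal (by norm_num) (by norm_num), ← ENNReal.rpow_mul]
  simp only [enorm_mul, ENNReal.toReal_ofNat]
  norm_num
  rw [← lintegral_const_mul' _ _ (by simp)]
  refine lintegral_congr fun y => ?_
  rw [mul_pow]

lemma wO_le {b : ℝ} (n : ℕ) {F : Plane × ℝ → ℂ} (hF : AEStronglyMeasurable F (volO b))
    (h : ∀ᵐ ξ : Plane, MemLp (fun y => F (ξ, y)) 2 (volI b)) {K : Plane → ℝ}
    (hK : ∀ᵐ ξ : Plane, sig ξ ^ n * nf b (fun y => F (ξ, y)) ≤ K ξ) :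
    wO b n F ≤ eLpNorm K 2 volume := by
  rw [wO_eq n hF h]
  refine eLpNorm_mono_ae_real ?_
  filter_upwards [hK] with ξ hξ
  rwa [Real.norm_of_nonneg (mul_nonneg (pow_nonneg (sig_nonneg _) _) (nf_nonneg _ _))]

lemma wS_le (n : ℕ) {f : Plane → ℂ} {K : Plane → ℝ} (hK : ∀ᵐ ξ : Plane, sig ξ ^ n * ‖f ξ‖ ≤ K ξ) :
    wS n f ≤ eLpNorm K 2 volume := by
  refine eLpNorm_mono_ae_real ?_
  filter_upwards [hK] with ξ hξ
  rwa [norm_mul, Complex.norm_real, Real.norm_of_nonneg (pow_nonneg (sig_nonneg _) _)]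

lemma eLpNorm_sig_mul_norm (n : ℕ) (f : Plane → ℂ) :
    eLpNorm (fun ξ => sig ξ ^ n * ‖f ξ‖) 2 volume = wS n f := by
  refine eLpNorm_congr_norm_ae (Eventually.of_forall fun ξ => ?_)
  simp [abs_of_pos (sig_pos ξ)]

/-! ### The integrated estimate -/

lemma norm_integral_le_nf {b : ℝ} (hb : 0 < b) {g : ℝ → ℂ} (hg : MemLp g 2 (volI b)) :
    ‖∫ t in (0 : ℝ)..b, g t‖ ≤ √b * nf b g := by
  rw [intervalIntegral_eq_volI' hb.le]
  refine (norm_integral_le_integral_norm _).trans ?_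
  have h := integral_mul_norm_le_Lp_mul_Lq (μ := volI b) (f := fun _ => (1 : ℂ)) (g := g)
    Real.HolderConjugate.two_two (memLp_const _) (by simpa using hg)
  simp only [norm_one, one_mul, Real.one_rpow] at h
  refine h.trans (le_of_eq ?_)
  rw [integral_const, nf, hg.eLpNorm_eq_integral_rpow_norm (by norm_num) (by norm_num),
    ENNReal.toReal_ofReal (by positivity)]
  simp [Measure.real, hb.le, Real.sqrt_eq_rpow]

/-- The size of the data on a fibre, weighted for `Hˢ`. -/
def FData.δs (D : FData) (b : ℝ) (s : ℕ) (ξ : Plane) : ℝ :=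
  sig ξ ^ (2 * s + 2) * nf b D.g + sig ξ ^ (2 * s) * nf b D.g' + sig ξ ^ (2 * s) * nf b D.fa +
    sig ξ ^ (2 * s) * nf b D.f3 + sig ξ ^ (2 * s) * nf b D.fd + sig ξ ^ (2 * s + 1) * ‖D.ka‖ +
    sig ξ ^ (2 * s + 1) * ‖D.kd‖ + sig ξ ^ (2 * s + 1) * ‖D.k3‖ + sig ξ ^ (2 * s + 3) * ‖D.h‖ +
    sig ξ ^ (2 * s + 1) * ‖D.om‖ + ‖ξ‖⁻¹ * ‖D.h - ∫ t in (0 : ℝ)..b, D.g t‖ + ‖ξ‖⁻¹ * ‖D.om‖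

/-- For `|ξ| ≤ 1` the weight is at most `2 ^ s` and the homogeneous seminorm remains; for `|ξ| ≥ 1`
the factor `1 / |ξ|` is harmless and the inhomogeneous norm suffices. -/
lemma sig_mul_div_le (s : ℕ) {ξ : Plane} (hξ : ξ ≠ 0) {x : ℝ} (hx : 0 ≤ x) :
    sig ξ ^ (2 * s) * (x / freq ξ) ≤ 2 ^ s * (‖ξ‖⁻¹ * x) + sig ξ ^ (2 * s + 1) * x := by
  have hn : 0 < ‖ξ‖ := norm_pos_iff.2 hξ
  have h1 : x / freq ξ ≤ ‖ξ‖⁻¹ * x := by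
    rw [div_eq_inv_mul]
    exact mul_le_mul_of_nonneg_right (inv_anti₀ hn (norm_le_freq ξ)) hx
  have hσ := one_le_sig ξ
  rcases le_total ‖ξ‖ 1 with h | h
  · have h2 : sig ξ ^ 2 ≤ 2 := by nlinarith [sig_pow_four ξ, sq_nonneg (sig ξ)]
    have h3 : sig ξ ^ (2 * s) ≤ 2 ^ s := by
      rw [pow_mul]; exact pow_le_pow_left₀ (sq_nonneg _) h2 s
    have h4 : sig ξ ^ (2 * s) * (x / freq ξ) ≤ 2 ^ s * (‖ξ‖⁻¹ * x) :=
      mul_le_mul h3 h1 (div_nonneg hx (freq_nonneg _)) (by positivity)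
    have : 0 ≤ sig ξ ^ (2 * s + 1) * x := by positivity
    linarith
  · have h2 : ‖ξ‖⁻¹ * x ≤ x := mul_le_of_le_one_left hx (inv_le_one_of_one_le₀ h)
    have h3 : sig ξ ^ (2 * s) ≤ sig ξ ^ (2 * s + 1) := pow_le_pow_right₀ hσ (by omega)
    have h4 : sig ξ ^ (2 * s) * (x / freq ξ) ≤ sig ξ ^ (2 * s + 1) * x :=
      mul_le_mul h3 (h1.trans h2) (div_nonneg hx (freq_nonneg _)) (by positivity)
    have : 0 ≤ 2 ^ s * (‖ξ‖⁻¹ * x) := by positivity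
    linarith

/-- Only the two terms divided by `r` need an argument. Their high frequency parts are bounded by
the norms of `h`, `om` and `g`; the factor `√b` is Cauchy–Schwarz for the flux of `g`. -/
lemma FData.sig_mul_δ_le {b : ℝ} (hb : 0 < b) (s : ℕ) {D : FData} {ξ : Plane} (hξ : ξ ≠ 0)
    (hr : D.r = freq ξ) (hg : MemLp D.g 2 (volI b)) :
    sig ξ ^ (2 * s) * D.δ b (sig ξ) ≤ (3 + √b + 2 ^ s) * D.δs b s ξ := by
  have hσ := one_le_sig ξ
  have h1 := sig_mul_div_le s hξ (norm_nonneg D.om)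
  have h2 := sig_mul_div_le s hξ (norm_nonneg (D.h - ∫ t in (0 : ℝ)..b, D.g t))
  have h3 : ‖D.h - ∫ t in (0 : ℝ)..b, D.g t‖ ≤ ‖D.h‖ + √b * nf b D.g :=
    (norm_sub_le _ _).trans (by gcongr; exact norm_integral_le_nf hb hg)
  have h4 : sig ξ ^ (2 * s + 1) * ‖D.h - ∫ t in (0 : ℝ)..b, D.g t‖ ≤
      sig ξ ^ (2 * s + 3) * ‖D.h‖ + √b * (sig ξ ^ (2 * s + 2) * nf b D.g) := by
    have e1 : sig ξ ^ (2 * s + 1) ≤ sig ξ ^ (2 * s + 2) := pow_le_pow_right₀ hσ (by omega)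
    have e2 : sig ξ ^ (2 * s + 1) ≤ sig ξ ^ (2 * s + 3) := pow_le_pow_right₀ hσ (by omega)
    have := nf_nonneg b D.g
    calc sig ξ ^ (2 * s + 1) * ‖D.h - ∫ t in (0 : ℝ)..b, D.g t‖
        ≤ sig ξ ^ (2 * s + 1) * (‖D.h‖ + √b * nf b D.g) := by gcongr
      _ = sig ξ ^ (2 * s + 1) * ‖D.h‖ + √b * (sig ξ ^ (2 * s + 1) * nf b D.g) := by ring
      _ ≤ _ := by gcongr
  have e : sig ξ ^ (2 * s) * D.δ b (sig ξ) = sig ξ ^ (2 * s + 2) * nf b D.g +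
      sig ξ ^ (2 * s) * nf b D.g' + sig ξ ^ (2 * s) * nf b D.fa +
      sig ξ ^ (2 * s) * nf b D.f3 + sig ξ ^ (2 * s) * nf b D.fd + sig ξ ^ (2 * s + 1) * ‖D.ka‖ +
      sig ξ ^ (2 * s + 1) * ‖D.kd‖ + sig ξ ^ (2 * s + 1) * ‖D.k3‖ +
      sig ξ ^ (2 * s + 3) * ‖D.h‖ + sig ξ ^ (2 * s + 1) * ‖D.om‖ +
      sig ξ ^ (2 * s) * (‖D.h - ∫ t in (0 : ℝ)..b, D.g t‖ / freq ξ) +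
      sig ξ ^ (2 * s) * (‖D.om‖ / freq ξ) := by
    rw [FData.δ, hr]; ring
  rw [e, FData.δs]
  have p0 : (0 : ℝ) ≤ 2 ^ s := by positivity
  have pb := Real.sqrt_nonneg b
  have p1 : 0 ≤ sig ξ ^ (2 * s + 2) * nf b D.g := mul_nonneg (by positivity) (nf_nonneg _ _)
  have p2 : 0 ≤ sig ξ ^ (2 * s) * nf b D.g' := mul_nonneg (by positivity) (nf_nonneg _ _)
  have p3 : 0 ≤ sig ξ ^ (2 * s) * nf b D.fa := mul_nonneg (by positivity) (nf_nonneg _ _)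
  have p4 : 0 ≤ sig ξ ^ (2 * s) * nf b D.f3 := mul_nonneg (by positivity) (nf_nonneg _ _)
  have p5 : 0 ≤ sig ξ ^ (2 * s) * nf b D.fd := mul_nonneg (by positivity) (nf_nonneg _ _)
  have p6 : 0 ≤ sig ξ ^ (2 * s + 1) * ‖D.ka‖ := by positivity
  have p7 : 0 ≤ sig ξ ^ (2 * s + 1) * ‖D.kd‖ := by positivity
  have p8 : 0 ≤ sig ξ ^ (2 * s + 1) * ‖D.k3‖ := by positivity
  have p9 : 0 ≤ sig ξ ^ (2 * s + 3) * ‖D.h‖ := by positivity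
  have p10 : 0 ≤ sig ξ ^ (2 * s + 1) * ‖D.om‖ := by positivity
  have p11 : 0 ≤ ‖ξ‖⁻¹ * ‖D.h - ∫ t in (0 : ℝ)..b, D.g t‖ := by positivity
  have p12 : 0 ≤ ‖ξ‖⁻¹ * ‖D.om‖ := by positivity
  -- From here on this is a linear inequality between the twelve terms of the norm.
  generalize sig ξ ^ (2 * s + 2) * nf b D.g = x1 at *
  generalize sig ξ ^ (2 * s) * nf b D.g' = x2 at *
  generalize sig ξ ^ (2 * s) * nf b D.fa = x3 at *
  generalize sig ξ ^ (2 * s) * nf b D.f3 = x4 at *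
  generalize sig ξ ^ (2 * s) * nf b D.fd = x5 at *
  generalize sig ξ ^ (2 * s + 1) * ‖D.ka‖ = x6 at *
  generalize sig ξ ^ (2 * s + 1) * ‖D.kd‖ = x7 at *
  generalize sig ξ ^ (2 * s + 1) * ‖D.k3‖ = x8 at *
  generalize sig ξ ^ (2 * s + 3) * ‖D.h‖ = x9 at *
  generalize sig ξ ^ (2 * s + 1) * ‖D.om‖ = x10 at *
  generalize ‖ξ‖⁻¹ * ‖D.h - ∫ t in (0 : ℝ)..b, D.g t‖ = x11 at *
  generalize ‖ξ‖⁻¹ * ‖D.om‖ = x12 at *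
  have q := add_nonneg pb p0
  have m1 := mul_nonneg p0 p1
  have m2 := mul_nonneg q p2
  have m3 := mul_nonneg q p3
  have m4 := mul_nonneg q p4
  have m5 := mul_nonneg q p5
  have m6 := mul_nonneg q p6
  have m7 := mul_nonneg q p7
  have m8 := mul_nonneg q p8
  have m9 := mul_nonneg q p9
  have m10 := mul_nonneg q p10
  have m11 := mul_nonneg pb p11
  have m12 := mul_nonneg pb p12
  linarith

lemma ae_ne_zero_plane : ∀ᵐ ξ : Plane, ξ ≠ 0 := by
  simp [ae_iff, measure_singleton]

/-- The integrated form of the fibrewise estimate. -/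
theorem exists_integrated_estimate {b μ grav κ : ℝ} (hb : 0 < b) (hgrav : 0 < grav) (hμ : 0 < μ)
    (hκ : 0 < κ) (s : ℕ) : ∃ C : NNReal, ∀ (I : Plane → FData) (J : Plane → FSol),
      (∀ ξ, (I ξ).r = freq ξ) → (∀ᵐ ξ, FSys b μ grav κ (I ξ) (J ξ)) →
      eLpNorm (fun ξ => sig ξ ^ (2 * s) * (J ξ).out (I ξ) b grav (sig ξ)) 2 volume ≤
        C * eLpNorm (fun ξ => (I ξ).δs b s ξ) 2 volume := by
  obtain ⟨C, hC0, hC⟩ := exists_fibre_estimate hb hgrav hμ hκ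
  refine ⟨⟨C * (3 + √b + 2 ^ s), by positivity⟩, fun I J hr h => ?_⟩
  refine eLpNorm_le_nnreal_smul_eLpNorm_of_ae_le_mul ?_ 2
  filter_upwards [h, ae_ne_zero_plane] with ξ hξ h0
  have hr0 : 0 < (I ξ).r := by
    rw [hr]; exact (norm_pos_iff.2 h0).trans_le (norm_le_freq ξ)
  have h1 := hC _ _ (sig ξ) hξ hr0 (one_le_sig ξ) (hr ξ ▸ sig_sq_le ξ) (hr ξ ▸ freq_le ξ)
  have h2 := FData.sig_mul_δ_le hb s h0 (hr ξ) (hξ.prim_g.memLp 2)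
  change ‖_‖ ≤ C * (3 + √b + 2 ^ s) * ‖_‖
  rw [Real.norm_of_nonneg]
  · calc sig ξ ^ (2 * s) * (J ξ).out (I ξ) b grav (sig ξ)
        ≤ sig ξ ^ (2 * s) * (C * (I ξ).δ b (sig ξ)) := by
          have := sig_nonneg ξ; gcongr
      _ = C * (sig ξ ^ (2 * s) * (I ξ).δ b (sig ξ)) := by ring
      _ ≤ C * ((3 + √b + 2 ^ s) * (I ξ).δs b s ξ) := by gcongr
      _ = C * (3 + √b + 2 ^ s) * (I ξ).δs b s ξ := by ring
      _ ≤ _ := mul_le_mul_of_nonneg_left (Real.le_norm_self _) (by positivity)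
  · have := sig_nonneg ξ
    have hn := nf_nonneg b
    unfold FSol.out
    have e : ∀ (m : ℕ) (F : ℝ → ℂ), 0 ≤ sig ξ ^ m * nf b F := fun m F =>
      mul_nonneg (by positivity) (hn F)
    refine mul_nonneg (by positivity) ?_
    repeat' apply add_nonneg
    all_goals first | exact e _ _ | exact hn _ | positivity

/-- Bound of the integrated data. -/
lemma eLpNorm_δs_le {b : ℝ} (s : ℕ) {I : Plane → FData} (hI : MeasFData I)
    (h : ∀ᵐ ξ, (I ξ).Good b) :
    eLpNorm (fun ξ => (I ξ).δs b s ξ) 2 volume ≤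
      wO b (2 * s + 2) (fun z => (I z.1).g z.2) + wO b (2 * s) (fun z => (I z.1).g' z.2) +
      wO b (2 * s) (fun z => (I z.1).fa z.2) + wO b (2 * s) (fun z => (I z.1).f3 z.2) +
      wO b (2 * s) (fun z => (I z.1).fd z.2) + wS (2 * s + 1) (fun ξ => (I ξ).ka) +
      wS (2 * s + 1) (fun ξ => (I ξ).kd) + wS (2 * s + 1) (fun ξ => (I ξ).k3) +
      wS (2 * s + 3) (fun ξ => (I ξ).h) + wS (2 * s + 1) (fun ξ => (I ξ).om) +
      eLpNorm (fun ξ => ‖ξ‖⁻¹ * ‖(I ξ).h - ∫ t in (0 : ℝ)..b, (I ξ).g t‖) 2 volume +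
      eLpNorm (fun ξ => ‖ξ‖⁻¹ * ‖(I ξ).om‖) 2 volume := by
  obtain ⟨hr, hfa, hf3, hg, hg', hfd, hka, hk3, hkd, hh, hom⟩ := hI
  have ng := measurable_nf b (F := fun ξ => (I ξ).g) hg
  have ng' := measurable_nf b (F := fun ξ => (I ξ).g') hg'
  have nfa := measurable_nf b (F := fun ξ => (I ξ).fa) hfa
  have nf3 := measurable_nf b (F := fun ξ => (I ξ).f3) hf3
  have nfd := measurable_nf b (F := fun ξ => (I ξ).fd) hfd
  have hint : Measurable fun ξ => ∫ t in (0 : ℝ)..b, (I ξ).g t :=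
    ((stronglyMeasurable_vint hg.stronglyMeasurable).measurable.comp
      (measurable_id.prodMk (measurable_const (a := b))) :)
  rw [wO_eq _ hg.aestronglyMeasurable (h.mono fun ξ hξ => hξ.prim_g.memLp 2),
    wO_eq _ hg'.aestronglyMeasurable (h.mono fun ξ hξ => hξ.memLp_g'),
    wO_eq _ hfa.aestronglyMeasurable (h.mono fun ξ hξ => hξ.memLp_fa),
    wO_eq _ hf3.aestronglyMeasurable (h.mono fun ξ hξ => hξ.memLp_f3),
    wO_eq _ hfd.aestronglyMeasurable (h.mono fun ξ hξ => hξ.memLp_fd)]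
  simp only [← eLpNorm_sig_mul_norm]
  unfold FData.δs
  -- Twelve summands mean eleven uses of the triangle inequality; the last one is separate.
  iterate 10
    refine (eLpNorm_add_le (by fun_prop) (by fun_prop) one_le_two).trans ?_
    refine add_le_add_left ?_ _
  exact eLpNorm_add_le (by fun_prop) (by fun_prop) one_le_two

/-! ### Anisotropic regularity on the Fourier side -/

lemma wO_mono {b : ℝ} {m n : ℕ} {F G : Plane × ℝ → ℂ} {K : NNReal}
    (h : ∀ᵐ z ∂volO b, sig z.1 ^ m * ‖F z‖ ≤ K * (sig z.1 ^ n * ‖G z‖)) :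
    wO b m F ≤ K * wO b n G := by
  refine eLpNorm_le_nnreal_smul_eLpNorm_of_ae_le_mul ?_ 2
  filter_upwards [h] with z hz
  rw [← NNReal.coe_le_coe]
  simpa [abs_of_pos (sig_pos _)] using hz

lemma wO_le_wO {b : ℝ} {m n : ℕ} (hmn : m ≤ n) (F : Plane × ℝ → ℂ) : wO b m F ≤ wO b n F := by
  simpa using wO_mono (K := 1) (b := b) (m := m) (n := n) (F := F) (G := F)
    (Eventually.of_forall fun z => by
      rw [NNReal.coe_one, one_mul]
      exact mul_le_mul_of_nonneg_right (pow_le_pow_right₀ (one_le_sig _) hmn) (norm_nonneg _))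

lemma wO_congr {b : ℝ} {n : ℕ} {F G : Plane × ℝ → ℂ} (h : F =ᵐ[volO b] G) :
    wO b n F = wO b n G :=
  eLpNorm_congr_ae (by filter_upwards [h] with z hz; rw [hz])

lemma wS_le_wS {m n : ℕ} (hmn : m ≤ n) (f : Plane → ℂ) : wS m f ≤ wS n f := by
  refine eLpNorm_mono fun ξ => ?_
  simp only [norm_mul, Complex.norm_real, norm_pow, Real.norm_of_nonneg (sig_nonneg ξ)]
  gcongr
  exact one_le_sig ξ

lemma aestronglyMeasurable_sig_mul {b : ℝ} (n : ℕ) {F : Plane × ℝ → ℂ}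
    (hF : AEStronglyMeasurable F (volO b)) :
    AEStronglyMeasurable (fun z => ((sig z.1 ^ n : ℝ) : ℂ) * F z) (volO b) :=
  (by fun_prop : Measurable fun z : Plane × ℝ =>
      ((sig z.1 ^ n : ℝ) : ℂ)).aestronglyMeasurable.mul hF

lemma wO_add_le {b : ℝ} (n : ℕ) {F G : Plane × ℝ → ℂ} (hF : AEStronglyMeasurable F (volO b))
    (hG : AEStronglyMeasurable G (volO b)) :
    wO b n (fun z => F z + G z) ≤ wO b n F + wO b n G := by
  have := eLpNorm_add_le (aestronglyMeasurable_sig_mul n hF) (aestronglyMeasurable_sig_mul n hG)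
    one_le_two
  refine le_trans (le_of_eq ?_) this
  rw [wO]
  congr 1
  ext z
  simp only [Pi.add_apply]
  ring

lemma wO_zero_eq {b : ℝ} (F : L2Omega b) : wO b 0 F = ENNReal.ofReal ‖F‖ := by
  rw [Lp.norm_def, ENNReal.ofReal_toReal (Lp.eLpNorm_ne_top F), wO]
  simp

/-- Multiplication by a symbol of polynomial growth. -/
lemma exists_mulRel {b : ℝ} {m : Plane → ℂ} (hm : Measurable m) {K : NNReal} {n : ℕ}
    (hK : ∀ ξ, ‖m ξ‖ ≤ K * sig ξ ^ n) {F : L2Omega b} (hF : wO b n F < ⊤) :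
    ∃ G : L2Omega b, MulRel m F G := by
  have h1 : MemLp (fun z => ((sig z.1 ^ n : ℝ) : ℂ) * F z) 2 (volO b) :=
    ⟨aestronglyMeasurable_sig_mul n (Lp.aestronglyMeasurable F), hF⟩
  have h2 : MemLp (fun z => m z.1 * F z) 2 (volO b) :=
    h1.of_le_mul (c := K) ((aestronglyMeasurable_fst hm).mul (Lp.aestronglyMeasurable F))
      (Eventually.of_forall fun z => by
        rw [norm_mul, norm_mul, Complex.norm_real, Real.norm_of_nonneg
          (pow_nonneg (sig_nonneg _) _), ← mul_assoc]
        exact mul_le_mul_of_nonneg_right (hK z.1) (norm_nonneg _))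
  exact ⟨h2.toLp _, h2.coeFn_toLp⟩

/-- A multiplier in `ξ` commutes with vertical pairings, by which vertical differentiation is
characterised. -/
lemma MulRel.hasWeakPartial_two {b : ℝ} (hb : 0 < b) {m : Plane → ℂ} {F F' G G' : L2Omega b}
    (hF : MulRel m F F') (hG : MulRel m G G') (h : HasWeakPartial b 2 F G) :
    HasWeakPartial b 2 F' G' := by
  refine (hasWeakPartial_two_iff_weakV hb).2 fun ψ ψ' h1 h2 => Lp.ext ?_
  have e := h.weakV ψ ψ' h1 h2
  filter_upwards [hF.pair (cvec b ψ'), hG.pair (cvec b ψ),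
    Lp.coeFn_neg (StationaryWaves.pair b (cvec b ψ) G'),
    Lp.coeFn_neg (StationaryWaves.pair b (cvec b ψ) G)] with ξ e1 e2 e3 e4
  rw [e1, e3, Pi.neg_apply, e2, e, e4, Pi.neg_apply, mul_neg]

/-- `Reg b n l F A` says that `F` has `n` vertical derivatives in `L²`, and that `A` bounds the
norms of `(1 + |ξ|²)^{(n + l - i)/2} ∂₃ⁱ F` for `i ≤ n`. -/
def Reg (b : ℝ) : ℕ → ℕ → L2Omega b → NNReal → Prop
  | 0, l, F, A => wO b (2 * l) F ≤ A
  | n + 1, l, F, A => wO b (2 * (n + 1 + l)) F ≤ A ∧ ∃ G, HasWeakPartial b 2 F G ∧ Reg b n l G A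

namespace Reg

variable {b : ℝ} {n l : ℕ} {F F' G : L2Omega b} {A A' : NNReal}

lemma wO_le (h : Reg b n l F A) : wO b (2 * (n + l)) F ≤ A := by
  cases n with
  | zero => simpa [Reg] using h
  | succ n => exact h.1

lemma mono (h : Reg b n l F A) (hA : A ≤ A') : Reg b n l F A' := by
  induction n generalizing F with
  | zero => exact h.trans (by exact_mod_cast hA)
  | succ n ih =>
    obtain ⟨h1, G, h2, h3⟩ := h
    exact ⟨h1.trans (by exact_mod_cast hA), G, h2, ih h3⟩

/-- Trades a vertical derivative for a horizontal one: the total order `n + l` is unchanged and the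
highest vertical derivative is dropped. -/
lemma bump (h : Reg b (n + 1) l F A) : Reg b n (l + 1) F A := by
  induction n generalizing F with
  | zero => exact (wO_le_wO (by omega) _).trans h.1
  | succ n ih =>
    obtain ⟨h1, G, h2, h3⟩ := h
    exact ⟨(wO_le_wO (by omega) _).trans h1, G, h2, ih h3⟩

lemma deriv (h : Reg b (n + 1) l F A) (hG : HasWeakPartial b 2 F G) : Reg b n l G A := by
  obtain ⟨-, G', h2, h3⟩ := h
  rwa [hG.unique h2]

lemma add (h : Reg b n l F A) (h' : Reg b n l F' A') : Reg b n l (F + F') (A + A') := by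
  have key : ∀ (m : ℕ) (F F' : L2Omega b), wO b m F ≤ A → wO b m F' ≤ A' →
      wO b m (F + F' : L2Omega b) ≤ (A + A' : NNReal) := fun m F F' h1 h2 => by
    rw [wO_congr (Lp.coeFn_add F F'), ENNReal.coe_add]
    exact (wO_add_le m (Lp.aestronglyMeasurable F) (Lp.aestronglyMeasurable F')).trans
      (add_le_add h1 h2)
  induction n generalizing F F' with
  | zero => exact key _ _ _ h h'
  | succ n ih =>
    obtain ⟨h1, G, h2, h3⟩ := h
    obtain ⟨h1', G', h2', h3'⟩ := h'
    exact ⟨key _ _ _ h1 h1', G + G', h2.add h2', ih h3 h3'⟩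

lemma wO_mulRel_le {m : Plane → ℂ} {K : NNReal} {k j : ℕ} (hK : ∀ ξ, ‖m ξ‖ ≤ K * sig ξ ^ (2 * k))
    (hF : MulRel m F F') (h : wO b (2 * (j + k)) F ≤ A) : wO b (2 * j) F' ≤ (K * A : NNReal) := by
  rw [ENNReal.coe_mul]
  refine le_trans (wO_mono (n := 2 * (j + k)) (G := F) ?_) (by gcongr)
  filter_upwards [hF] with z hz
  rw [hz, norm_mul]
  calc sig z.1 ^ (2 * j) * (‖m z.1‖ * ‖F z‖)
      ≤ sig z.1 ^ (2 * j) * (K * sig z.1 ^ (2 * k) * ‖F z‖) := by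
        have := sig_nonneg z.1
        gcongr
        exact hK _
    _ = _ := by ring

/-- A symbol of order `k` costs `k` units of horizontal regularity and commutes with vertical
derivatives. -/
lemma mul (hb : 0 < b) {m : Plane → ℂ} (hm : Measurable m) {K : NNReal} {k : ℕ}
    (hK : ∀ ξ, ‖m ξ‖ ≤ K * sig ξ ^ (2 * k)) (hF : MulRel m F F') (h : Reg b n (l + k) F A) :
    Reg b n l F' (K * A) := by
  induction n generalizing F F' with
  | zero => exact wO_mulRel_le hK hF h
  | succ n ih =>
    obtain ⟨h1, G, h2, h3⟩ := h
    obtain ⟨G', hG'⟩ := exists_mulRel hm hK (F := G)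
      ((wO_le_wO (by omega) _).trans_lt (h3.wO_le.trans_lt ENNReal.coe_lt_top))
    refine ⟨wO_mulRel_le hK hF (by rwa [add_assoc]), G', hF.hasWeakPartial_two hb hG' h2, ih hG' h3⟩

lemma zero : Reg b n l 0 A := by
  have hw : ∀ j, wO b j (0 : L2Omega b) = 0 := fun j => by
    rw [wO_congr (Lp.coeFn_zero ℂ 2 (volO b)), wO]
    simp
  induction n with
  | zero => exact (hw _).trans_le zero_le
  | succ n ih => exact ⟨(hw _).trans_le zero_le, 0, hasWeakPartial_zero b 2, ih⟩

/-- A function independent of `y` has zero vertical derivatives, so the weighted norm in the plane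
suffices; `√b` is the norm of the constant `1` on `(0, b)`. -/
lemma of_const (hb : 0 < b) {X : L2Sigma} (hF : F =ᵐ[volO b] fun z => X z.1)
    (h : wS (2 * (n + l)) X ≤ A) : Reg b n l F ((√b).toNNReal * A) := by
  have key : ∀ j ≤ n + l, wO b (2 * j) F ≤ ((√b).toNNReal * A : NNReal) := fun j hj => by
    rw [wO_congr hF, wO_eq (F := fun z => X z.1) _ ((Lp.aestronglyMeasurable
      X).comp_quasiMeasurePreserving (quasiMeasurePreserving_fst b)) (Eventually.of_forall fun ξ => memLp_const (X ξ)), ENNReal.coe_mul]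
    refine le_trans ?_ (mul_le_mul_right h _)
    refine eLpNorm_le_nnreal_smul_eLpNorm_of_ae_le_mul (Eventually.of_forall fun ξ => ?_) 2
    rw [← NNReal.coe_le_coe, NNReal.coe_mul, coe_nnnorm, coe_nnnorm,
      Real.coe_toNNReal _ (Real.sqrt_nonneg b)]
    have : nf b (fun _ => X ξ) = √b * ‖X ξ‖ := by
      rw [nf, eLpNorm_const _ (by norm_num) (by simp [hb])]
      simp [← ENNReal.toReal_rpow, Real.sqrt_eq_rpow, hb.le, mul_comm]
    rw [this, norm_mul, norm_mul, norm_mul, norm_norm, Complex.norm_real,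
      Real.norm_of_nonneg (Real.sqrt_nonneg b), Real.norm_of_nonneg (pow_nonneg (sig_nonneg _) _),
      Real.norm_of_nonneg (pow_nonneg (sig_nonneg _) _), mul_left_comm]
    have := sig_nonneg ξ
    gcongr
    exact one_le_sig ξ
  cases n with
  | zero => exact key _ (by omega)
  | succ n =>
    refine ⟨key _ le_rfl, 0, hasWeakPartial_two_of_eq hb (c := X) ?_, Reg.zero⟩
    refine ae_volO_of_ae_ae (Lp.aestronglyMeasurable F)
      (((Lp.aestronglyMeasurable X).comp_quasiMeasurePreserving (quasiMeasurePreserving_fst b)).add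
        (memLp_vint 0).1) ?_
    filter_upwards [ae_ae_of_ae_volO hF, ae_ae_of_ae_volO (Lp.coeFn_zero ℂ 2 (volO b))] with ξ h1 h2
    filter_upwards [h1, ae_restrict_mem measurableSet_Ioo] with y hy hy'
    have e : vint (0 : L2Omega b) (ξ, y) = 0 := by
      rw [vint, intervalIntegral_eq_volI hy'.1.le hy'.2]
      refine integral_eq_zero_of_ae ?_
      filter_upwards [h2] with t ht
      rw [Set.indicator_apply]
      split_ifs
      exacts [ht, rfl]
    rw [hy, e, add_zero]

end Reg

/-! ### Big-O families of regularity bounds -/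

/-- Regularity bounds, uniform in a family. -/
def RegO {b : ℝ} {ι : Type*} (A : ι → NNReal) (n l : ℕ) (F : ι → L2Omega b) : Prop :=
  ∃ C : NNReal, ∀ i, Reg b n l (F i) (C * A i)

namespace RegO

variable {b : ℝ} {ι : Type*} {A : ι → NNReal} {n l : ℕ} {F F' G : ι → L2Omega b}

lemma bump (h : RegO A (n + 1) l F) : RegO A n (l + 1) F := h.imp fun _ h i => (h i).bump

lemma deriv (h : RegO A (n + 1) l F) (hG : ∀ i, HasWeakPartial b 2 (F i) (G i)) : RegO A n l G :=
  h.imp fun _ h i => (h i).deriv (hG i)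

lemma add (h : RegO A n l F) (h' : RegO A n l F') : RegO A n l fun i => F i + F' i := by
  obtain ⟨C, hC⟩ := h
  obtain ⟨C', hC'⟩ := h'
  exact ⟨C + C', fun i => ((hC i).add (hC' i)).mono (by rw [add_mul])⟩

lemma mul (hb : 0 < b) {m : Plane → ℂ} (hm : Measurable m) {K : NNReal} (k : ℕ)
    (hK : ∀ ξ, ‖m ξ‖ ≤ K * sig ξ ^ (2 * k)) (h : RegO A n (l + k) F)
    (hF : ∀ i, MulRel m (F i) (F' i)) : RegO A n l F' := by
  obtain ⟨C, hC⟩ := h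
  exact ⟨K * C, fun i => ((hC i).mul hb hm hK (hF i)).mono (by rw [mul_assoc])⟩

lemma smul (hb : 0 < b) (c : ℂ) (h : RegO A n l F) : RegO A n l fun i => c • F i :=
  h.mul hb measurable_const (K := ‖c‖₊) 0 (fun ξ => by simp) fun i => Lp.coeFn_smul c (F i)

lemma succ (h : RegO A n l G) (hG : ∀ i, HasWeakPartial b 2 (F i) (G i)) {C : NNReal}
    (hF : ∀ i, wO b (2 * (n + 1 + l)) (F i) ≤ C * A i) : RegO A (n + 1) l F := by
  obtain ⟨C', hC'⟩ := h
  refine ⟨C + C', fun i => ⟨(hF i).trans ?_, G i, hG i, (hC' i).mono ?_⟩⟩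
  · rw [ENNReal.coe_mul, ENNReal.coe_add]; gcongr; exact le_self_add
  · gcongr; exact le_add_self

end RegO

/-! ### Comparison with the Sobolev spaces in the slab -/

lemma norm_symb_le_sig (j : Fin 2) (ξ : Plane) :
    ‖symb j ξ‖ ≤ (7 : NNReal) * sig ξ ^ (2 * 1) :=
  (norm_symb_le j ξ).trans (by simpa using freq_le ξ)

lemma MulRel.exists_hasWeakPartial {b : ℝ} {j : Fin 2} {f : L2Omega b} {G : L2Omega b}
    (h : MulRel (symb j) (pfourier b f) G) :
    HasWeakPartial b j.castSucc f ((pfourier b).symm G) :=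
  MulRel.hasWeakPartial (by simpa using h)

lemma normH_nonneg (b : ℝ) (m : ℕ) (f : L2Omega b) : 0 ≤ normH b m f := by
  induction m generalizing f with
  | zero => exact norm_nonneg f
  | succ m ih => exact add_nonneg (norm_nonneg f) (Finset.sum_nonneg fun j _ => ih _)

/-- Horizontal derivatives are symbols of order one bounded by `7 σ²`, and vertical ones are part of
the hypothesis. The constant is `16 = 1 + 7 + 7 + 1`, from the function, two horizontal derivatives
and the vertical one. -/
lemma Reg.memH {b : ℝ} (hb : 0 < b) {m : ℕ} {f : L2Omega b} {A : NNReal}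
    (h : Reg b m 0 (pfourier b f) A) : MemH b m f ∧ normH b m f ≤ 16 ^ m * A := by
  have h0 : ∀ (m : ℕ) (f : L2Omega b) (A : NNReal), Reg b m 0 (pfourier b f) A → ‖f‖ ≤ A :=
    fun m f A h => by
      have h1 := (wO_le_wO (Nat.zero_le _) _).trans h.wO_le
      rw [wO_zero_eq, LinearIsometryEquiv.norm_map] at h1
      exact_mod_cast (ENNReal.ofReal_le_iff_le_toReal (by simp)).1 h1
  induction m generalizing f A with
  | zero => exact ⟨trivial, by simpa [normH] using h0 0 f A h⟩
  | succ m ih =>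
    have hn := h0 _ f A h
    have hj : ∀ j : Fin 2, ∃ g, HasWeakPartial b j.castSucc f g ∧ MemH b m g ∧
        normH b m g ≤ 16 ^ m * (7 * A) := fun j => by
      obtain ⟨G, hG⟩ := exists_mulRel (measurable_symb j) (norm_symb_le_sig j)
        (F := pfourier b f) ((wO_le_wO (by omega) _).trans_lt (h.wO_le.trans_lt ENNReal.coe_lt_top))
      have hr : Reg b m 0 (pfourier b ((pfourier b).symm G)) (7 * A) := by
        rw [LinearIsometryEquiv.apply_symm_apply]
        exact h.bump.mul hb (measurable_symb j) (norm_symb_le_sig j) hG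
      exact ⟨_, hG.exists_hasWeakPartial, by simpa using ih hr⟩
    have h2 : ∃ g, HasWeakPartial b 2 f g ∧ MemH b m g ∧ normH b m g ≤ 16 ^ m * A := by
      obtain ⟨-, G, hG, hr⟩ := h
      refine ⟨(pfourier b).symm G, (hasWeakPartial_two_pfourier_iff hb).1 (by simpa using hG), ?_⟩
      exact ih (by simpa using hr)
    obtain ⟨g0, a0, b0, c0⟩ := hj 0
    obtain ⟨g1, a1, b1, c1⟩ := hj 1
    obtain ⟨g2, a2, b2, c2⟩ := h2
    refine ⟨fun j => ?_, ?_⟩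
    · fin_cases j
      exacts [⟨g0, a0, b0⟩, ⟨g1, a1, b1⟩, ⟨g2, a2, b2⟩]
    · have e0 : weakPartial b 0 f = g0 := a0.weakPartial_eq
      have e1 : weakPartial b 1 f = g1 := a1.weakPartial_eq
      rw [normH, Fin.sum_univ_three, e0, e1, a2.weakPartial_eq, pow_succ]
      have : (A : ℝ) ≤ 16 ^ m * A := le_mul_of_one_le_left A.2 (one_le_pow₀ (by norm_num))
      linarith

lemma MemH.of_succ {b : ℝ} {m : ℕ} {f : L2Omega b} (h : MemH b (m + 1) f) :
    MemH b m f ∧ normH b m f ≤ normH b (m + 1) f := by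
  induction m generalizing f with
  | zero => exact ⟨trivial, le_add_of_nonneg_right (Finset.sum_nonneg fun j _ => norm_nonneg _)⟩
  | succ m ih =>
    refine ⟨fun j => ?_, ?_⟩
    · obtain ⟨g, hg, hm⟩ := h j
      exact ⟨g, hg, (ih hm).1⟩
    · rw [normH, normH]
      refine add_le_add_right (Finset.sum_le_sum fun j _ => ?_) _
      obtain ⟨g, hg, hm⟩ := h j
      rw [hg.weakPartial_eq]
      exact (ih hm).2

/-- Weights are recovered from derivatives: multiplication by `σ²` is controlled by a function and
its two horizontal derivatives. -/
lemma sig_sq_le_symb (ξ : Plane) : sig ξ ^ 2 ≤ 1 + ‖symb 0 ξ‖ + ‖symb 1 ξ‖ := by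
  refine (sig_sq_le ξ).trans ?_
  have h : ‖ξ‖ ≤ |ξ 0| + |ξ 1| := by
    rw [EuclideanSpace.norm_eq, Fin.sum_univ_two]
    refine Real.sqrt_le_iff.2 ⟨by positivity, ?_⟩
    simp only [Real.norm_eq_abs]
    nlinarith [mul_nonneg (abs_nonneg (ξ 0)) (abs_nonneg (ξ 1))]
  simp only [symb, freq, norm_mul, Complex.norm_I, Complex.norm_real, Real.norm_eq_abs,
    Complex.norm_ofNat, mul_one, abs_of_pos Real.pi_pos]
  nlinarith [Real.pi_pos]

/-- Converse to `Reg.memH`. The top horizontal weight of `f` follows from one weight less for `f`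
and its horizontal derivatives; the vertical derivative is covered by induction. -/
lemma MemH.reg {b : ℝ} {m : ℕ} {f : L2Omega b} (hb : 0 < b) (h : MemH b m f) :
    Reg b m 0 (pfourier b f) (2 ^ m * (normH b m f).toNNReal) := by
  induction m generalizing f with
  | zero =>
    change wO b 0 _ ≤ _
    rw [wO_zero_eq, LinearIsometryEquiv.norm_map]
    simp [normH, ENNReal.ofReal]
  | succ m ih =>
    have h1 := ih h.of_succ.1
    obtain ⟨g0, a0, b0⟩ := h 0
    obtain ⟨g1, a1, b1⟩ := h 1
    obtain ⟨g2, a2, b2⟩ := h 2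
    have e : normH b (m + 1) f = ‖f‖ + (normH b m g0 + normH b m g1 + normH b m g2) := by
      rw [normH, Fin.sum_univ_three, a0.weakPartial_eq, a1.weakPartial_eq, a2.weakPartial_eq]
    have n0 := normH_nonneg b m g0
    have n1 := normH_nonneg b m g1
    have n2 := normH_nonneg b m g2
    refine ⟨?_, _, (hasWeakPartial_two_pfourier_iff hb).2 a2, (ih b2).mono ?_⟩
    · have r0 := (ih b0).wO_le
      have r1 := (ih b1).wO_le
      have r := h1.wO_le
      have k0 : MulRel (symb 0) (pfourier b f) (pfourier b g0) :=
        HasWeakPartial.mulRel (j := 0) a0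
      have k1 : MulRel (symb 1) (pfourier b f) (pfourier b g1) :=
        HasWeakPartial.mulRel (j := 1) a1
      have hm : ∀ F : L2Omega b, AEStronglyMeasurable
          (fun z => ‖((sig z.1 ^ (2 * m) : ℝ) : ℂ) * F z‖) (volO b) := fun F =>
        (aestronglyMeasurable_sig_mul _ (Lp.aestronglyMeasurable F)).norm
      have key : wO b (2 * (m + 1 + 0)) (pfourier b f) ≤ wO b (2 * m) (pfourier b f) +
          wO b (2 * m) (pfourier b g0) + wO b (2 * m) (pfourier b g1) := by
        simp only [wO]
        rw [← eLpNorm_norm (fun z => ((sig z.1 ^ (2 * m) : ℝ) : ℂ) * pfourier b f z),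
          ← eLpNorm_norm (fun z => ((sig z.1 ^ (2 * m) : ℝ) : ℂ) * pfourier b g0 z),
          ← eLpNorm_norm (fun z => ((sig z.1 ^ (2 * m) : ℝ) : ℂ) * pfourier b g1 z)]
        refine le_trans ?_ (add_le_add_left (eLpNorm_add_le (hm _) (hm _) one_le_two) _)
        refine le_trans ?_ (eLpNorm_add_le ((hm _).add (hm _)) (hm _) one_le_two)
        refine eLpNorm_mono_ae_real ?_
        filter_upwards [k0, k1] with z e0 e1
        have hs := sig_sq_le_symb z.1
        simp only [Pi.add_apply, norm_mul, Complex.norm_real,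
          Real.norm_of_nonneg (pow_nonneg (sig_nonneg z.1) _), e0, e1]
        calc sig z.1 ^ (2 * (m + 1 + 0)) * ‖pfourier b f z‖
            = sig z.1 ^ 2 * (sig z.1 ^ (2 * m) * ‖pfourier b f z‖) := by ring
          _ ≤ (1 + ‖symb 0 z.1‖ + ‖symb 1 z.1‖) * (sig z.1 ^ (2 * m) * ‖pfourier b f z‖) := by
            have := sig_nonneg z.1
            gcongr
          _ = _ := by ring
      refine key.trans ((add_le_add (add_le_add r r0) r1).trans ?_)
      rw [← ENNReal.coe_add, ← ENNReal.coe_add, ENNReal.coe_le_coe, ← NNReal.coe_le_coe]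
      have hle := h.of_succ.2
      push_cast
      rw [Real.coe_toNNReal _ n0, Real.coe_toNNReal _ n1, Real.coe_toNNReal _ (normH_nonneg _ _ _),
        Real.coe_toNNReal _ (normH_nonneg _ _ _), pow_succ]
      have : (0 : ℝ) ≤ 2 ^ m := by positivity
      have hf := norm_nonneg f
      have h3 : normH b m f + normH b m g0 + normH b m g1 ≤ 2 * normH b (m + 1) f := by
        linarith
      nlinarith
    · rw [pow_succ, mul_assoc]
      gcongr
      refine le_trans (Real.toNNReal_le_toNNReal ?_) (le_mul_of_one_le_left zero_le one_le_two)
      linarith [norm_nonneg f]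

/-! ### The system on the Fourier side -/

/-- The symmetry of second derivatives is moved to the test function. Membership in `H²` therefore
need only provide mixed derivatives in one order. -/
lemma HasWeakPartial.comm {b : ℝ} {i j : Fin 3} {f fi fj fij : L2Omega b}
    (hi : HasWeakPartial b i f fi) (hj : HasWeakPartial b j f fj)
    (hij : HasWeakPartial b j fi fij) : HasWeakPartial b i fj fij := by
  intro φ h1 h2 h3
  have ht : ∀ k, tsupport (fun z => fderiv ℝ φ z (dir k)) ⊆ slab b := fun k =>
    (tsupport_fderiv_apply_subset ℝ (dir k)).trans h3
  have hs : ∀ z, fderiv ℝ (fun w => fderiv ℝ φ w (dir i)) z (dir j) =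
      fderiv ℝ (fun w => fderiv ℝ φ w (dir j)) z (dir i) := fun z => by
    have hd : DifferentiableAt ℝ (fderiv ℝ φ) z :=
      ((h1.fderiv_right (m := 1) (by norm_cast)).differentiable (by norm_num)) z
    have := (h1.contDiffAt (x := z)).isSymmSndFDerivAt
      (by
        simp only [minSmoothness_of_isRCLikeNormedField]
        exact WithTop.coe_le_coe.2 (le_top : (2 : ℕ∞) ≤ ⊤)) (dir j) (dir i)
    rw [fderiv_clm_apply hd (by fun_prop), fderiv_clm_apply hd (by fun_prop)]
    simpa using this
  have e1 := hj _ (contDiff_fderiv_apply h1 (dir i)) (hasCompactSupport_fderiv_apply h2 _) (ht i)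
  have e2 := hi _ (contDiff_fderiv_apply h1 (dir j)) (hasCompactSupport_fderiv_apply h2 _) (ht j)
  have e3 := hij φ h1 h2 h3
  simp only [hs] at e1
  rw [e1] at e2
  rw [neg_inj.1 e2, e3]

/-- Data on the Fourier side. -/
structure FourierData (b : ℝ) where
  (G G1 : L2Omega b)
  F : Fin 3 → L2Omega b
  K : Fin 3 → L2Sigma
  (H W : L2Sigma)

/-- Unknowns on the Fourier side, with their vertical derivatives. -/
structure FourierSol (b : ℝ) where
  (V V1 V2 : Fin 3 → L2Omega b)
  (q q1 : L2Omega b)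
  X : Fin 2 → L2Sigma

/-- The system on the Fourier side. -/
structure HatSys {b : ℝ} (grav μ κ : ℝ) (S : FourierSol b) (D : FourierData b) : Prop where
  dV : ∀ i, HasWeakPartial b 2 (S.V i) (S.V1 i)
  dV1 : ∀ i, HasWeakPartial b 2 (S.V1 i) (S.V2 i)
  dq : HasWeakPartial b 2 S.q S.q1
  dG : HasWeakPartial b 2 D.G D.G1
  horiz : ∀ j : Fin 2, ∀ᵐ z ∂volO b, grav * S.X j z.1 + symb j z.1 * S.q z -
    μ * (S.V2 j.castSucc z - freq z.1 ^ 2 * S.V j.castSucc z + symb j z.1 * D.G z) =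
      D.F j.castSucc z
  vert : ∀ᵐ z ∂volO b, S.q1 z - μ * (S.V2 2 z - freq z.1 ^ 2 * S.V 2 z + D.G1 z) = D.F 2 z
  div : ∀ᵐ z ∂volO b, symb 0 z.1 * S.V 0 z + symb 1 z.1 * S.V 1 z + S.V1 2 z = D.G z
  div1 : ∀ᵐ z ∂volO b, symb 0 z.1 * S.V1 0 z + symb 1 z.1 * S.V1 1 z + S.V2 2 z = D.G1 z
  shear : ∀ j : Fin 2, ∀ᵐ ξ : Plane, μ * (trTop b (S.V1 j.castSucc) (S.V2 j.castSucc) ξ +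
    symb j ξ * trTop b (S.V 2) (S.V1 2) ξ) = D.K j.castSucc ξ
  normal : ∀ᵐ ξ : Plane, -(trTop b S.q S.q1 ξ - 2 * μ * trTop b (S.V1 2) (S.V2 2) ξ) -
    κ * (symb 0 ξ * S.X 0 ξ + symb 1 ξ * S.X 1 ξ) = D.K 2 ξ
  curl : ∀ᵐ ξ : Plane, symb 0 ξ * S.X 1 ξ - symb 1 ξ * S.X 0 ξ = D.W ξ
  kin : trTop b (S.V 2) (S.V1 2) = D.H
  noSlip : ∀ i, trBot b (S.V i) (S.V1 i) = 0

/-- The Fourier transform of a triple. -/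
def Triple.hat {b : ℝ} (t : Triple b) (u1 u2 : Fin 3 → L2Omega b) (p1 : L2Omega b) :
    FourierSol b where
  V i := pfourier b (t.u i)
  V1 i := pfourier b (u1 i)
  V2 i := pfourier b (u2 i)
  q := pfourier b t.p
  q1 := pfourier b p1
  X j := 𝓕 (t.χ j)

/-- The Fourier transform of the data. -/
def Data.hat {b : ℝ} (d : Data b) (g1 : L2Omega b) : FourierData b where
  G := pfourier b d.g
  G1 := pfourier b g1
  F i := pfourier b (d.f i)
  K i := 𝓕 (d.k i)
  H := 𝓕 d.h
  W := 𝓕 d.w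

lemma fourier_injective {f g : L2Sigma} : 𝓕 f = 𝓕 g ↔ f = g :=
  (Lp.fourierTransformₗᵢ Plane ℂ).injective.eq_iff

lemma fourier_add' (f g : L2Sigma) : 𝓕 (f + g) = 𝓕 f + 𝓕 g :=
  (Lp.fourierTransformₗᵢ Plane ℂ).map_add f g

lemma fourier_smul' (c : ℂ) (f : L2Sigma) : 𝓕 (c • f) = c • 𝓕 f :=
  (Lp.fourierTransformₗᵢ Plane ℂ).map_smul c f

lemma fourier_zero' : 𝓕 (0 : L2Sigma) = (0 : L2Sigma) := (Lp.fourierTransformₗᵢ Plane ℂ).map_zero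

lemma trTop_add (b : ℝ) (f f' g g' : L2Omega b) :
    trTop b (f + f') (g + g') = trTop b f g + trTop b f' g' := by
  rw [trTop, trTop, trTop, map_add, map_add, ← smul_add]
  congr 1
  abel

/-- Traces are combinations of vertical pairings, so multipliers in `ξ` pass through them. -/
lemma MulRel.trTop {b : ℝ} {m : Plane → ℂ} {F F' G G' : L2Omega b} (hF : MulRel m F F')
    (hG : MulRel m G G') :
    StationaryWaves.trTop b F' G' =ᵐ[volume] fun ξ => m ξ * StationaryWaves.trTop b F G ξ := by
  unfold StationaryWaves.trTop
  filter_upwards [hF.pair (cvec b 1), hG.pair (cvec b cid),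
    Lp.coeFn_smul (b⁻¹ : ℂ) (StationaryWaves.pair b (cvec b 1) F +
      StationaryWaves.pair b (cvec b cid) G),
    Lp.coeFn_smul (b⁻¹ : ℂ) (StationaryWaves.pair b (cvec b 1) F' +
      StationaryWaves.pair b (cvec b cid) G'),
    Lp.coeFn_add (StationaryWaves.pair b (cvec b 1) F) (StationaryWaves.pair b (cvec b cid) G),
    Lp.coeFn_add (StationaryWaves.pair b (cvec b 1) F') (StationaryWaves.pair b (cvec b cid) G')]
    with ξ e1 e2 e3 e4 e5 e6
  rw [e3, e4, Pi.smul_apply, Pi.smul_apply, e5, e6, Pi.add_apply, Pi.add_apply, e1, e2, smul_eq_mul,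
    smul_eq_mul]
  ring

lemma symb_sq_add (ξ : Plane) : symb 0 ξ * symb 0 ξ + symb 1 ξ * symb 1 ξ = -(freq ξ : ℂ) ^ 2 := by
  have h : ‖ξ‖ ^ 2 = ξ 0 ^ 2 + ξ 1 ^ 2 := by
    rw [EuclideanSpace.norm_sq_eq, Fin.sum_univ_two]; simp
  have h' : (‖ξ‖ : ℂ) ^ 2 = ξ 0 ^ 2 + ξ 1 ^ 2 := by exact_mod_cast h
  simp only [symb, freq]
  push_cast
  linear_combination 4 * (Real.pi : ℂ) ^ 2 * h' +
    4 * (Real.pi : ℂ) ^ 2 * ((ξ 0 : ℂ) ^ 2 + ξ 1 ^ 2) * Complex.I_sq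

/-- All second order derivatives of a function in `H²`. -/
lemma MemH.exists_two {b : ℝ} {f : L2Omega b} (h : MemH b 2 f) :
    ∃ (D : Fin 3 → L2Omega b) (D2 : Fin 3 → Fin 3 → L2Omega b),
      (∀ j, HasWeakPartial b j f (D j)) ∧ ∀ j k, HasWeakPartial b k (D j) (D2 j k) := by
  choose D h1 h2 using h
  choose D2 h3 _ using h2
  exact ⟨D, D2, h1, h3⟩

/-! ### Each equation of the system and its Fourier transform -/

section Equivalence

variable {b grav μ κ : ℝ} {t : Triple b} {d : Data b} {D : Fin 3 → Fin 3 → L2Omega b}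
  {D2 : Fin 3 → Fin 3 → Fin 3 → L2Omega b} {P : Fin 3 → L2Omega b} {g1 : L2Omega b}

lemma symGrad_eq (hD : ∀ i j, HasWeakPartial b j (t.u i) (D i j)) (i j : Fin 3) :
    symGrad b t.u i j = D j i + D i j := by
  rw [symGrad, (hD j i).weakPartial_eq, (hD i j).weakPartial_eq]

lemma div_eq (hD : ∀ i j, HasWeakPartial b j (t.u i) (D i j)) :
    StationaryWaves.div b t.u = D 0 0 + D 1 1 + D 2 2 := by
  rw [StationaryWaves.div, Fin.sum_univ_three, (hD 0 0).weakPartial_eq, (hD 1 1).weakPartial_eq,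
    (hD 2 2).weakPartial_eq]

lemma mulRel_D (hD : ∀ i j, HasWeakPartial b j (t.u i) (D i j)) (i : Fin 3) (j : Fin 2) :
    MulRel (symb j) (pfourier b (t.u i)) (pfourier b (D i j.castSucc)) := (hD i _).mulRel

lemma ae_sum_three {F G H : L2Omega b} :
    ((F + G + H : L2Omega b) : Plane × ℝ → ℂ) =ᵐ[volO b] fun z => F z + G z + H z := by
  filter_upwards [Lp.coeFn_add (F + G) H, Lp.coeFn_add F G] with z h1 h2
  rw [h1, Pi.add_apply, h2, Pi.add_apply]

lemma divergence_iff (hD : ∀ i j, HasWeakPartial b j (t.u i) (D i j)) :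
    StationaryWaves.div b t.u = d.g ↔ ∀ᵐ z ∂volO b, symb 0 z.1 * pfourier b (t.u 0) z +
      symb 1 z.1 * pfourier b (t.u 1) z + pfourier b (D 2 2) z = pfourier b d.g z := by
  rw [div_eq hD, ← (pfourier b).injective.eq_iff, map_add, map_add, Lp.ext_iff]
  have h0 := mulRel_D hD 0 0
  have h1 := mulRel_D hD 1 1
  constructor
  · intro h
    filter_upwards [h, ae_sum_three, h0, h1] with z e e' e0 e1
    rw [← e, e', ← e0, ← e1]; rfl
  · intro h
    filter_upwards [h, ae_sum_three, h0, h1] with z e e' e0 e1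
    rw [← e, e', ← e0, ← e1]; rfl

lemma laplace_ae (hD : ∀ i j, HasWeakPartial b j (t.u i) (D i j))
    (hD2 : ∀ i j k, HasWeakPartial b k (D i j) (D2 i j k)) (i : Fin 3) :
    pfourier b (D2 i 0 0 + D2 i 1 1 + D2 i 2 2) =ᵐ[volO b] fun z =>
      pfourier b (D2 i 2 2) z - freq z.1 ^ 2 * pfourier b (t.u i) z := by
  rw [map_add, map_add]
  have k0 : MulRel (symb 0) (pfourier b (D i 0)) (pfourier b (D2 i 0 0)) :=
    HasWeakPartial.mulRel (j := 0) (hD2 i 0 0)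
  have k1 : MulRel (symb 1) (pfourier b (D i 1)) (pfourier b (D2 i 1 1)) :=
    HasWeakPartial.mulRel (j := 1) (hD2 i 1 1)
  filter_upwards [ae_sum_three, mulRel_D hD i 0, mulRel_D hD i 1, k0, k1] with z e e0 e1 e2 e3
  have e0' : pfourier b (D i 0) z = symb 0 z.1 * pfourier b (t.u i) z := e0
  have e1' : pfourier b (D i 1) z = symb 1 z.1 * pfourier b (t.u i) z := e1
  rw [e, e2, e3, e0', e1']
  linear_combination pfourier b (t.u i) z * symb_sq_add z.1

/-- Regroups mixed second derivatives into the gradient of the divergence, which the second equation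
replaces by the gradient of `g`. -/
lemma gradDiv_hasWeakPartial (hD : ∀ i j, HasWeakPartial b j (t.u i) (D i j))
    (hD2 : ∀ i j k, HasWeakPartial b k (D i j) (D2 i j k)) (i : Fin 3) :
    HasWeakPartial b i (StationaryWaves.div b t.u) (D2 0 i 0 + D2 1 i 1 + D2 2 i 2) := by
  have h : ∀ j, HasWeakPartial b i (D j j) (D2 j i j) := fun j =>
    (hD j i).comm (hD j j) (hD2 j i j)
  rw [div_eq hD]
  exact ((h 0).add (h 1)).add (h 2)

lemma mulRel_D2 (hD : ∀ i j, HasWeakPartial b j (t.u i) (D i j))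
    (hD2 : ∀ i j k, HasWeakPartial b k (D i j) (D2 i j k)) (i : Fin 3) (j : Fin 2) :
    MulRel (symb j) (pfourier b (D i 2)) (pfourier b (D2 i j.castSucc 2)) :=
  HasWeakPartial.mulRel ((hD i j.castSucc).comm (hD i 2) (hD2 i j.castSucc 2))

/-- The vertical derivative of the divergence equation. It expresses the second vertical derivative
of `u₃` through first derivatives and data. -/
lemma div1_ae (hD : ∀ i j, HasWeakPartial b j (t.u i) (D i j))
    (hD2 : ∀ i j k, HasWeakPartial b k (D i j) (D2 i j k))
    (hdiv : StationaryWaves.div b t.u = d.g) (hg : HasWeakPartial b 2 d.g g1) :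
    ∀ᵐ z ∂volO b, symb 0 z.1 * pfourier b (D 0 2) z + symb 1 z.1 * pfourier b (D 1 2) z +
      pfourier b (D2 2 2 2) z = pfourier b g1 z := by
  have e : D2 0 0 2 + D2 1 1 2 + D2 2 2 2 = g1 := by
    refine HasWeakPartial.unique ?_ hg
    rw [← hdiv, div_eq hD]
    exact ((hD2 0 0 2).add (hD2 1 1 2)).add (hD2 2 2 2)
  rw [← e, map_add, map_add]
  have k0 := mulRel_D2 hD hD2 0 0
  have k1 := mulRel_D2 hD hD2 1 1
  filter_upwards [ae_sum_three (F := pfourier b (D2 0 0 2)) (G := pfourier b (D2 1 1 2))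
    (H := pfourier b (D2 2 2 2)), k0, k1] with z h e0 e1
  rw [h, ← e0, ← e1]; rfl

/-- The identity `∇·𝔻u = ∇(∇·u) + Δu`. -/
lemma sum_weakPartial_symGrad (hD : ∀ i j, HasWeakPartial b j (t.u i) (D i j))
    (hD2 : ∀ i j k, HasWeakPartial b k (D i j) (D2 i j k)) (i : Fin 3) :
    ∑ j, weakPartial b j (symGrad b t.u i j) =
      (D2 0 i 0 + D2 1 i 1 + D2 2 i 2) + (D2 i 0 0 + D2 i 1 1 + D2 i 2 2) := by
  have h : ∀ j, weakPartial b j (symGrad b t.u i j) = D2 j i j + D2 i j j := fun j => by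
    rw [symGrad_eq hD]
    exact ((hD2 j i j).add (hD2 i j j)).weakPartial_eq
  rw [Fin.sum_univ_three, h, h, h]
  abel

/-- A momentum equation as an equation in `L²`, and its Fourier transform. -/
lemma momentum_aux (c f A B : L2Omega b) (P : L2Omega b) (C : Plane × ℝ → ℂ) {Ĉ : Plane × ℝ → ℂ}
    (hC : c =ᵐ[volO b] C) (hĈ : pfourier b c =ᵐ[volO b] Ĉ) :
    (∀ᵐ z ∂volO b, (grav : ℂ) * C z + P z - (μ : ℂ) * (A + B : L2Omega b) z = f z) ↔
      ∀ᵐ z ∂volO b, (grav : ℂ) * Ĉ z + pfourier b P z -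
        (μ : ℂ) * (pfourier b A z + pfourier b B z) = pfourier b f z := by
  have key : ∀ c P S : L2Omega b, (((grav : ℂ) • c + P - (μ : ℂ) • S : L2Omega b) :
      Plane × ℝ → ℂ) =ᵐ[volO b] fun z => (grav : ℂ) * c z + P z - (μ : ℂ) * S z := fun c P S => by
    filter_upwards [Lp.coeFn_sub ((grav : ℂ) • c + P) ((μ : ℂ) • S),
      Lp.coeFn_add ((grav : ℂ) • c) P, Lp.coeFn_smul (grav : ℂ) c, Lp.coeFn_smul (μ : ℂ) S]
      with z h1 h2 h3 h4
    rw [h1, Pi.sub_apply, h2, Pi.add_apply, h3, h4, Pi.smul_apply, Pi.smul_apply, smul_eq_mul,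
      smul_eq_mul]
  have l1 : (∀ᵐ z ∂volO b, (grav : ℂ) * C z + P z - (μ : ℂ) * (A + B : L2Omega b) z = f z) ↔
      (grav : ℂ) • c + P - (μ : ℂ) • (A + B) = f := by
    rw [Lp.ext_iff]
    constructor
    · intro h
      filter_upwards [h, key c P (A + B), hC] with z e1 e2 e3
      rw [e2, e3, e1]
    · intro h
      filter_upwards [h, key c P (A + B), hC] with z e1 e2 e3
      rw [← e1, e2, e3]
  rw [l1, ← (pfourier b).injective.eq_iff, map_sub, map_add, map_smul, map_smul, map_add, Lp.ext_iff]
  have k := key (pfourier b c) (pfourier b P) (pfourier b A + pfourier b B)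
  constructor
  · intro h
    filter_upwards [h, k, hĈ, Lp.coeFn_add (pfourier b A) (pfourier b B)] with z e1 e2 e3 e4
    rw [← e1, e2, e3, e4, Pi.add_apply]
  · intro h
    filter_upwards [h, k, hĈ, Lp.coeFn_add (pfourier b A) (pfourier b B)] with z e1 e2 e3 e4
    rw [← e1, e2, e3, e4, Pi.add_apply]

lemma coeFn_tens_one (χ : L2Sigma) : tens b χ (cvec b 1) =ᵐ[volO b] fun z => χ z.1 := by
  filter_upwards [coeFn_tens b χ (cvec b 1),
    (quasiMeasurePreserving_snd b).ae_eq_comp (coeFn_cvec b 1)] with z h1 h2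
  have h2' : cvec b 1 z.2 = 1 := by simpa using h2
  rw [h1, h2', mul_one]

lemma sum_symGrad_ae (hD : ∀ i j, HasWeakPartial b j (t.u i) (D i j))
    (hD2 : ∀ i j k, HasWeakPartial b k (D i j) (D2 i j k)) (i : Fin 3) :
    ∀ᵐ z ∂volO b, ∑ k, weakPartial b k (symGrad b t.u i k) z =
      ((D2 0 i 0 + D2 1 i 1 + D2 2 i 2) + (D2 i 0 0 + D2 i 1 1 + D2 i 2 2) : L2Omega b) z := by
  rw [← sum_weakPartial_symGrad hD hD2 i, Fin.sum_univ_three]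
  filter_upwards [ae_sum_three (F := weakPartial b 0 (symGrad b t.u i 0))
    (G := weakPartial b 1 (symGrad b t.u i 1)) (H := weakPartial b 2 (symGrad b t.u i 2))] with z h
  rw [h, Fin.sum_univ_three]

lemma horiz_iff (hD : ∀ i j, HasWeakPartial b j (t.u i) (D i j))
    (hD2 : ∀ i j k, HasWeakPartial b k (D i j) (D2 i j k))
    (hP : ∀ j, HasWeakPartial b j t.p (P j)) (hdiv : StationaryWaves.div b t.u = d.g) (j : Fin 2) :
    (∀ᵐ z ∂volO b, (grav : ℂ) * ![t.χ 0 z.1, t.χ 1 z.1, 0] j.castSucc +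
      weakPartial b j.castSucc t.p z - (μ : ℂ) * ∑ k, weakPartial b k
        (symGrad b t.u j.castSucc k) z = d.f j.castSucc z) ↔
    ∀ᵐ z ∂volO b, grav * (𝓕 (t.χ j) : L2Sigma) z.1 + symb j z.1 * pfourier b t.p z -
      μ * (pfourier b (D2 j.castSucc 2 2) z - freq z.1 ^ 2 * pfourier b (t.u j.castSucc) z +
        symb j z.1 * pfourier b d.g z) = pfourier b (d.f j.castSucc) z := by
  have hχ : ∀ z : Plane × ℝ, ![t.χ 0 z.1, t.χ 1 z.1, 0] j.castSucc = t.χ j z.1 := fun z => by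
    fin_cases j <;> rfl
  simp only [hχ, (hP _).weakPartial_eq]
  have hF : pfourier b (tens b (t.χ j) (cvec b 1)) =ᵐ[volO b] fun z =>
      (𝓕 (t.χ j) : L2Sigma) z.1 := by
    rw [pfourier_tens]; exact coeFn_tens_one _
  have hdd : MulRel (symb j) (pfourier b d.g) (pfourier b (D2 0 j.castSucc 0 + D2 1 j.castSucc 1 +
      D2 2 j.castSucc 2)) := hdiv ▸ (gradDiv_hasWeakPartial hD hD2 j.castSucc).mulRel
  refine (Filter.eventually_congr ?_).trans ((momentum_aux (grav := grav) (μ := μ)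
    (tens b (t.χ j) (cvec b 1)) (d.f j.castSucc)
    (D2 0 j.castSucc 0 + D2 1 j.castSucc 1 + D2 2 j.castSucc 2)
    (D2 j.castSucc 0 0 + D2 j.castSucc 1 1 + D2 j.castSucc 2 2) (P j.castSucc)
    (fun z => t.χ j z.1) (coeFn_tens_one _) hF).trans (Filter.eventually_congr ?_))
  · filter_upwards [sum_symGrad_ae hD hD2 j.castSucc] with z h
    rw [h]
  · filter_upwards [laplace_ae hD hD2 j.castSucc, hdd, (hP j.castSucc).mulRel] with z h1 h2 h3
    rw [h1, h2, h3, add_comm (symb j z.1 * _)]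

lemma vert_iff (hD : ∀ i j, HasWeakPartial b j (t.u i) (D i j))
    (hD2 : ∀ i j k, HasWeakPartial b k (D i j) (D2 i j k))
    (hP : ∀ j, HasWeakPartial b j t.p (P j)) (hdiv : StationaryWaves.div b t.u = d.g)
    (hg : HasWeakPartial b 2 d.g g1) :
    (∀ᵐ z ∂volO b, (grav : ℂ) * ![t.χ 0 z.1, t.χ 1 z.1, 0] 2 +
      weakPartial b 2 t.p z - (μ : ℂ) * ∑ k, weakPartial b k
        (symGrad b t.u 2 k) z = d.f 2 z) ↔
    ∀ᵐ z ∂volO b, pfourier b (P 2) z -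
      μ * (pfourier b (D2 2 2 2) z - freq z.1 ^ 2 * pfourier b (t.u 2) z +
        pfourier b g1 z) = pfourier b (d.f 2) z := by
  have hχ : ∀ z : Plane × ℝ, ![t.χ 0 z.1, t.χ 1 z.1, 0] 2 = 0 := fun z => rfl
  simp only [hχ, (hP _).weakPartial_eq]
  have hdd : D2 0 2 0 + D2 1 2 1 + D2 2 2 2 = g1 :=
    (gradDiv_hasWeakPartial hD hD2 2).unique (hdiv ▸ hg)
  refine (Filter.eventually_congr ?_).trans ((momentum_aux (grav := grav) (μ := μ)
    0 (d.f 2) (D2 0 2 0 + D2 1 2 1 + D2 2 2 2) (D2 2 0 0 + D2 2 1 1 + D2 2 2 2) (P 2)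
    (fun z => 0) (Lp.coeFn_zero ..) (Ĉ := fun z => 0) ?_).trans (Filter.eventually_congr ?_))
  · filter_upwards [sum_symGrad_ae hD hD2 2] with z h
    rw [h]
  · rw [map_zero]; exact Lp.coeFn_zero ..
  · filter_upwards [laplace_ae hD hD2 2] with z h1
    rw [h1, hdd, mul_zero, zero_add, add_comm (pfourier b g1 z)]

lemma hasTrace_symGrad (hb : 0 < b) (hD : ∀ i j, HasWeakPartial b j (t.u i) (D i j))
    (hD2 : ∀ i j k, HasWeakPartial b k (D i j) (D2 i j k)) (i : Fin 3) (S : L2Sigma) :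
    HasTrace b b (symGrad b t.u i 2) S ↔
      S = trTop b (D 2 i) (D2 2 i 2) + trTop b (D i 2) (D2 i 2 2) := by
  rw [symGrad_eq hD, hasTrace_top_iff hb fun j => (hD2 2 i j).add (hD2 i 2 j), trTop_add]

lemma shear_iff (hD : ∀ i j, HasWeakPartial b j (t.u i) (D i j))
    (hD2 : ∀ i j k, HasWeakPartial b k (D i j) (D2 i j k)) (j : Fin 2) (k : L2Sigma) :
    (μ : ℂ) • (trTop b (D 2 j.castSucc) (D2 2 j.castSucc 2) +
      trTop b (D j.castSucc 2) (D2 j.castSucc 2 2)) = k ↔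
    ∀ᵐ ξ : Plane, μ * (trTop b (pfourier b (D j.castSucc 2)) (pfourier b (D2 j.castSucc 2 2)) ξ +
    symb j ξ * trTop b (pfourier b (t.u 2)) (pfourier b (D 2 2)) ξ) = (𝓕 k : L2Sigma) ξ := by
  have h2 := MulRel.trTop (mulRel_D hD 2 j) (mulRel_D2 hD hD2 2 j)
  rw [← fourier_injective, fourier_smul', fourier_add', fourier_trTop, fourier_trTop, Lp.ext_iff]
  refine Filter.eventually_congr ?_
  filter_upwards [h2, Lp.coeFn_smul (μ : ℂ)
      (trTop b (pfourier b (D 2 j.castSucc)) (pfourier b (D2 2 j.castSucc 2)) +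
        trTop b (pfourier b (D j.castSucc 2)) (pfourier b (D2 j.castSucc 2 2))),
    Lp.coeFn_add (trTop b (pfourier b (D 2 j.castSucc)) (pfourier b (D2 2 j.castSucc 2)))
      (trTop b (pfourier b (D j.castSucc 2)) (pfourier b (D2 j.castSucc 2 2)))] with ξ e1 e2 e3
  rw [e2, Pi.smul_apply, e3, Pi.add_apply, e1, smul_eq_mul, add_comm]

/-- The surface divergence of `χ` is a priori only a distribution. As `κ ≠ 0`, the equation says
that it equals an explicit `L²` function, and such an equation can be read off almost everywhere on
the Fourier side. -/
lemma normal_iff (hκ : κ ≠ 0) (χ : Fin 2 → L2Sigma) (q k S : L2Sigma) :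
    -((q : 𝓢'(Plane, ℂ)) - (μ : ℂ) • (S : 𝓢'(Plane, ℂ)))
      - (κ : ℂ) • divSigma χ = (k : 𝓢'(Plane, ℂ)) ↔
    ∀ᵐ ξ : Plane, -((𝓕 q : L2Sigma) ξ - μ * (𝓕 S : L2Sigma) ξ) -
    κ * (symb 0 ξ * (𝓕 (χ 0) : L2Sigma) ξ + symb 1 ξ * (𝓕 (χ 1) : L2Sigma) ξ) =
      (𝓕 k : L2Sigma) ξ := by
  have hκ' : (κ : ℂ) ≠ 0 := by exact_mod_cast hκ
  set w : L2Sigma := (κ⁻¹ : ℂ) • (-(q - (μ : ℂ) • S) - k) with hw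
  have hw' : (w : 𝓢'(Plane, ℂ)) = (κ⁻¹ : ℂ) • (-((q : 𝓢'(Plane, ℂ)) -
      (μ : ℂ) • (S : 𝓢'(Plane, ℂ))) - (k : 𝓢'(Plane, ℂ))) := by
    change Lp.toTemperedDistributionCLM ℂ volume 2 w = _
    rw [hw, map_smul, map_sub, map_neg, map_sub, map_smul]
    rfl
  have h1 : -((q : 𝓢'(Plane, ℂ)) - (μ : ℂ) • (S : 𝓢'(Plane, ℂ)))
      - (κ : ℂ) • divSigma χ = (k : 𝓢'(Plane, ℂ)) ↔ divSigma χ = (w : 𝓢'(Plane, ℂ)) := by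
    rw [hw', eq_inv_smul_iff₀ hκ']
    exact ⟨fun h => by rw [← h]; abel, fun h => by rw [h]; abel⟩
  rw [h1, divSigma, lineDeriv_add_eq_iff]
  refine Filter.eventually_congr ?_
  have hF : (𝓕 w : L2Sigma) = (κ⁻¹ : ℂ) • (-((𝓕 q : L2Sigma) - (μ : ℂ) • (𝓕 S : L2Sigma)) -
      (𝓕 k : L2Sigma)) := by
    change Lp.fourierTransformₗᵢ Plane ℂ w = _
    rw [hw, map_smul, map_sub, map_neg, map_sub, map_smul]
    rfl
  rw [hF]
  filter_upwards [Lp.coeFn_smul (κ⁻¹ : ℂ) (-((𝓕 q : L2Sigma) - (μ : ℂ) • (𝓕 S : L2Sigma)) -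
      (𝓕 k : L2Sigma)), Lp.coeFn_sub (-((𝓕 q : L2Sigma) - (μ : ℂ) • (𝓕 S : L2Sigma))) (𝓕 k : L2Sigma),
    Lp.coeFn_neg ((𝓕 q : L2Sigma) - (μ : ℂ) • (𝓕 S : L2Sigma)),
    Lp.coeFn_sub (𝓕 q : L2Sigma) ((μ : ℂ) • (𝓕 S : L2Sigma)),
    Lp.coeFn_smul (μ : ℂ) (𝓕 S : L2Sigma)] with ξ e1 e2 e3 e4 e5
  rw [e1, Pi.smul_apply, e2, Pi.sub_apply, e3, Pi.neg_apply, e4, Pi.sub_apply, e5, Pi.smul_apply,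
    smul_eq_mul, smul_eq_mul, inv_mul_eq_iff_eq_mul₀ hκ']
  have i0 : ⟪ξ, (EuclideanSpace.single 0 1 : Plane)⟫_ℝ = ξ 0 := inner_hdir ξ 0
  have i1 : ⟪ξ, (EuclideanSpace.single 1 1 : Plane)⟫_ℝ = ξ 1 := inner_hdir ξ 1
  rw [i0, i1]
  simp only [symb]
  constructor <;> intro h <;> linear_combination h

/-- The minus sign of the curl is absorbed by differentiating in the direction `-e₂`, so the general
first order identity applies. -/
lemma curl_iff (χ : Fin 2 → L2Sigma) (w : L2Sigma) : curlSigma χ = (w : 𝓢'(Plane, ℂ)) ↔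
    ∀ᵐ ξ : Plane, symb 0 ξ * (𝓕 (χ 1) : L2Sigma) ξ - symb 1 ξ * (𝓕 (χ 0) : L2Sigma) ξ =
      (𝓕 w : L2Sigma) ξ := by
  rw [curlSigma, ← lineDerivOp_left_neg, lineDeriv_add_eq_iff]
  refine Filter.eventually_congr (Eventually.of_forall fun ξ => ?_)
  have i0 : ⟪ξ, (EuclideanSpace.single 0 1 : Plane)⟫_ℝ = ξ 0 := inner_hdir ξ 0
  have i1 : ⟪ξ, (EuclideanSpace.single 1 1 : Plane)⟫_ℝ = ξ 1 := inner_hdir ξ 1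
  have i1' : ⟪ξ, -(EuclideanSpace.single 1 1 : Plane)⟫_ℝ = -ξ 1 := by rw [inner_neg_right, i1]
  beta_reduce
  rw [i0, i1']
  simp only [symb]
  push_cast
  constructor <;> intro h <;> linear_combination -h

end Equivalence

lemma forall_fin_three_iff {p : Fin 3 → Prop} : (∀ i, p i) ↔ (∀ j : Fin 2, p j.castSucc) ∧ p 2 :=
  ⟨fun h => ⟨fun j => h _, h 2⟩, fun h i => by
    fin_cases i
    exacts [h.1 0, h.1 1, h.2]⟩

/-- The boundary value problem is equivalent to its Fourier transform. -/
theorem solves_iff {b grav μ κ : ℝ} (hb : 0 < b) (hκ : κ ≠ 0) {t : Triple b} {d : Data b}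
    (ht : t.MemSobolev 0) {u1 u2 : Fin 3 → L2Omega b} {p1 g1 : L2Omega b}
    (h1 : ∀ i, HasWeakPartial b 2 (t.u i) (u1 i)) (h2 : ∀ i, HasWeakPartial b 2 (u1 i) (u2 i))
    (hp : HasWeakPartial b 2 t.p p1) (hg : HasWeakPartial b 2 d.g g1) :
    Solves grav μ κ t d ↔ HatSys grav μ κ (t.hat u1 u2 p1) (d.hat g1) := by
  choose D D2 hD hD2 using fun i => (ht.u i).exists_two
  choose P hP _ using ht.p
  -- Weak derivatives are unique, so the given vertical derivatives are those found in the Sobolev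
  -- space.
  obtain rfl : (fun i => D i 2) = u1 := funext fun i => (hD i 2).unique (h1 i)
  obtain rfl : (fun i => D2 i 2 2) = u2 := funext fun i => (hD2 i 2 2).unique (h2 i)
  obtain rfl : P 2 = p1 := (hP 2).unique hp
  have tr : ∀ i, HasTrace b b (symGrad b t.u i 2)
      (trTop b (D 2 i) (D2 2 i 2) + trTop b (D i 2) (D2 i 2 2)) := fun i =>
    (hasTrace_symGrad hb hD hD2 i _).2 rfl
  have hS : ∀ (q : L2Sigma) (S : Fin 3 → L2Sigma),
      (∀ i, -((![0, 0, 1] i : ℂ) • (q : 𝓢'(Plane, ℂ)) - (μ : ℂ) • (S i : 𝓢'(Plane, ℂ)))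
      - (![0, 0, 1] i : ℂ) • (κ : ℂ) • divSigma t.χ = (d.k i : 𝓢'(Plane, ℂ))) ↔
      (∀ j : Fin 2, (μ : ℂ) • S j.castSucc = d.k j.castSucc) ∧
      -((q : 𝓢'(Plane, ℂ)) - (μ : ℂ) • (S 2 : 𝓢'(Plane, ℂ)))
        - (κ : ℂ) • divSigma t.χ = (d.k 2 : 𝓢'(Plane, ℂ)) := fun q S => by
    rw [forall_fin_three_iff]
    refine and_congr (forall_congr' fun j => ?_) ?_
    · have e0 : (![0, 0, 1] j.castSucc : ℂ) = 0 := by fin_cases j <;> rfl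
      have z : ∀ T : 𝓢'(Plane, ℂ), (0 : ℂ) • T = 0 := fun T => by
        ext g
        rw [temperedDistribution_smul_apply, zero_mul]
        rfl
      rw [e0, z, z, zero_sub, neg_neg, sub_zero]
      have e : (μ : ℂ) • (S j.castSucc : 𝓢'(Plane, ℂ)) = ((μ : ℂ) • S j.castSucc : L2Sigma) :=
        ((Lp.toTemperedDistributionCLM ℂ volume 2).map_smul _ _).symm
      rw [e]
      exact ⟨toTemperedDistribution_injective, fun h => by rw [h]⟩
    · have e1 : (![0, 0, 1] 2 : ℂ) = 1 := rfl
      rw [e1, one_smul, one_smul]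
  have hn := normal_iff (μ := μ) hκ t.χ (trTop b t.p (P 2)) (d.k 2)
    (trTop b (D 2 2) (D2 2 2 2) + trTop b (D 2 2) (D2 2 2 2))
  have hn' : ∀ ξ, -((𝓕 (trTop b t.p (P 2)) : L2Sigma) ξ - μ * (2 * trTop b (pfourier b (D 2 2))
      (pfourier b (D2 2 2 2)) ξ)) = -(trTop b (pfourier b t.p) (pfourier b (P 2)) ξ -
        2 * μ * trTop b (pfourier b (D 2 2)) (pfourier b (D2 2 2 2)) ξ) := fun ξ => by
    rw [fourier_trTop]; ring
  have h𝓕 : (𝓕 (trTop b (D 2 2) (D2 2 2 2) + trTop b (D 2 2) (D2 2 2 2)) : L2Sigma) =ᵐ[volume]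
      fun ξ => 2 * trTop b (pfourier b (D 2 2)) (pfourier b (D2 2 2 2)) ξ := by
    rw [fourier_add', fourier_trTop]
    filter_upwards [Lp.coeFn_add (trTop b (pfourier b (D 2 2)) (pfourier b (D2 2 2 2)))
      (trTop b (pfourier b (D 2 2)) (pfourier b (D2 2 2 2)))] with ξ e
    rw [e, Pi.add_apply, two_mul]
  have hkin := hasTrace_top_iff hb (hD 2) d.h
  have hns := fun i => hasTrace_bot_iff hb (hD i) 0
  have hbot : ∀ i, (0 = trBot b (t.u i) (D i 2) ↔
      trBot b (pfourier b (t.u i)) (pfourier b (D i 2)) = 0) := fun i => by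
    rw [← fourier_trBot, ← fourier_zero', fourier_injective, eq_comm, fourier_zero']
  constructor
  · intro h
    obtain ⟨q, S, t1, t2, t3⟩ := h.stress
    obtain rfl := (hasTrace_top_iff hb hP q).1 t1
    obtain rfl : S = fun i => trTop b (D 2 i) (D2 2 i 2) + trTop b (D i 2) (D2 i 2 2) :=
      funext fun i => (hasTrace_symGrad hb hD hD2 i _).1 (t2 i)
    obtain ⟨s1, s2⟩ := (hS _ _).1 t3
    exact
      { dV := fun i => (hasWeakPartial_two_pfourier_iff hb).2 (hD i 2)
        dV1 := fun i => (hasWeakPartial_two_pfourier_iff hb).2 (hD2 i 2 2)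
        dq := (hasWeakPartial_two_pfourier_iff hb).2 (hP 2)
        dG := (hasWeakPartial_two_pfourier_iff hb).2 hg
        horiz := fun j => (horiz_iff hD hD2 hP h.divergence j).1 (h.momentum _)
        vert := (vert_iff hD hD2 hP h.divergence hg).1 (h.momentum 2)
        div := (divergence_iff hD).1 h.divergence
        div1 := div1_ae hD hD2 h.divergence hg
        shear := fun j => (shear_iff hD hD2 j _).1 (s1 j)
        normal := by
          filter_upwards [hn.1 s2, h𝓕] with ξ e1 e2
          rw [e2, hn'] at e1
          exact e1
        curl := (curl_iff _ _).1 h.curl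
        kin := by
          change _ = 𝓕 d.h
          rw [hkin.1 h.kinematic, fourier_trTop]; rfl
        noSlip := fun i => (hbot i).1 ((hns i).1 (h.noSlip i)) }
  · intro h
    have hdiv := (divergence_iff hD).2 h.div
    exact
      { momentum := forall_fin_three_iff.2 ⟨fun j => (horiz_iff hD hD2 hP hdiv j).2 (h.horiz j),
          (vert_iff hD hD2 hP hdiv hg).2 h.vert⟩
        divergence := hdiv
        stress := ⟨trTop b t.p (P 2), _, (hasTrace_top_iff hb hP _).2 rfl, tr, (hS _ _).2
          ⟨fun j => (shear_iff hD hD2 j _).2 (h.shear j), hn.2 (by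
            filter_upwards [h.normal, h𝓕] with ξ e1 e2
            rw [e2, hn']
            exact e1)⟩⟩
        curl := (curl_iff _ _).2 h.curl
        kinematic := hkin.2 (by
          rw [← fourier_injective, fourier_trTop]; exact h.kin.symm)
        noSlip := fun i => (hns i).2 ((hbot i).2 (h.noSlip i)) }

/-! ### Rotation to the direction of the frequency -/

/-- The direction of the frequency. -/
def nrm (j : Fin 2) (ξ : Plane) : ℝ := ξ j / ‖ξ‖

@[fun_prop]
lemma measurable_nrm (j : Fin 2) : Measurable (nrm j) := by unfold nrm; fun_prop

@[fun_prop]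
lemma measurable_freq : Measurable freq := by unfold freq; fun_prop

/-- The longitudinal component. -/
def rotA (ξ : Plane) (x : Fin 2 → ℂ) : ℂ := -Complex.I * (nrm 0 ξ * x 0 + nrm 1 ξ * x 1)

/-- The transversal component. -/
def rotD (ξ : Plane) (x : Fin 2 → ℂ) : ℂ := -Complex.I * (-nrm 1 ξ * x 0 + nrm 0 ξ * x 1)

/-- The symbol is `i r` times a real unit vector; the factor `-i` in `rotA` and `rotD` then makes
the rotated system real. -/
lemma symb_eq (j : Fin 2) {ξ : Plane} (hξ : ξ ≠ 0) :
    symb j ξ = Complex.I * freq ξ * nrm j ξ := by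
  have : (‖ξ‖ : ℂ) ≠ 0 := by exact_mod_cast (norm_pos_iff.2 hξ).ne'
  simp only [symb, freq, nrm]
  push_cast
  field_simp

lemma nrm_sq_add {ξ : Plane} (hξ : ξ ≠ 0) : (nrm 0 ξ : ℂ) ^ 2 + (nrm 1 ξ : ℂ) ^ 2 = 1 := by
  have h : ‖ξ‖ ^ 2 = ξ 0 ^ 2 + ξ 1 ^ 2 := by
    rw [EuclideanSpace.norm_sq_eq, Fin.sum_univ_two]; simp
  have h0 : ‖ξ‖ ≠ 0 := (norm_pos_iff.2 hξ).ne'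
  have : nrm 0 ξ ^ 2 + nrm 1 ξ ^ 2 = 1 := by
    simp only [nrm]
    field_simp
    exact h.symm
  exact_mod_cast this

lemma norm_nrm_le (j : Fin 2) (ξ : Plane) : ‖(nrm j ξ : ℂ)‖ ≤ 1 := by
  rw [Complex.norm_real, nrm, norm_div, norm_norm]
  exact div_le_one_of_le₀ (PiLp.norm_apply_le ξ j) (norm_nonneg _)

/-- The direction orthogonal to the frequency. -/
def nrp (j : Fin 2) (ξ : Plane) : ℝ := ![-nrm 1 ξ, nrm 0 ξ] j

/-- The vector with given longitudinal and transversal components. -/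
def irot (j : Fin 2) (ξ : Plane) (x y : ℂ) : ℂ := Complex.I * (nrm j ξ * x + nrp j ξ * y)

@[fun_prop]
lemma measurable_nrp (j : Fin 2) : Measurable (nrp j) := by
  fin_cases j
  exacts [(measurable_nrm 1).neg, measurable_nrm 0]

/-- `nrm` and `nrp` form an orthonormal frame, and the factors `-i` and `i` cancel, so the rotation
is inverted exactly. -/
lemma eq_irot {ξ : Plane} (hξ : ξ ≠ 0) (x : Fin 2 → ℂ) (j : Fin 2) :
    x j = irot j ξ (rotA ξ x) (rotD ξ x) := by
  fin_cases j <;>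
  · simp only [rotA, rotD, irot, nrp, Fin.mk_one, Fin.zero_eta, Matrix.cons_val]
    push_cast
    first
    | linear_combination -x 0 * nrm_sq_add hξ + x 0 * ((nrm 0 ξ : ℂ) ^ 2 + (nrm 1 ξ : ℂ) ^ 2) *
        Complex.I_sq
    | linear_combination -x 1 * nrm_sq_add hξ + x 1 * ((nrm 0 ξ : ℂ) ^ 2 + (nrm 1 ξ : ℂ) ^ 2) *
        Complex.I_sq

lemma norm_comb_le {a b x y : ℂ} (ha : ‖a‖ ≤ 1) (hb : ‖b‖ ≤ 1) :
    ‖a * x + b * y‖ ≤ ‖x‖ + ‖y‖ := by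
  refine (norm_add_le _ _).trans ?_
  rw [norm_mul, norm_mul]
  exact add_le_add (mul_le_of_le_one_left (norm_nonneg _) ha)
    (mul_le_of_le_one_left (norm_nonneg _) hb)

lemma norm_rotA_le (ξ : Plane) (x : Fin 2 → ℂ) : ‖rotA ξ x‖ ≤ ‖x 0‖ + ‖x 1‖ := by
  rw [rotA, norm_mul, norm_neg, Complex.norm_I, one_mul]
  exact norm_comb_le (norm_nrm_le 0 ξ) (norm_nrm_le 1 ξ)

lemma norm_rotD_le (ξ : Plane) (x : Fin 2 → ℂ) : ‖rotD ξ x‖ ≤ ‖x 0‖ + ‖x 1‖ := by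
  rw [rotD, norm_mul, norm_neg, Complex.norm_I, one_mul]
  exact norm_comb_le (by rw [norm_neg]; exact norm_nrm_le 1 ξ) (norm_nrm_le 0 ξ)

lemma norm_nrp_le (j : Fin 2) (ξ : Plane) : ‖(nrp j ξ : ℂ)‖ ≤ 1 := by
  fin_cases j
  · simpa [nrp] using norm_nrm_le 1 ξ
  · exact norm_nrm_le 0 ξ

lemma norm_irot_le (j : Fin 2) (ξ : Plane) (x y : ℂ) : ‖irot j ξ x y‖ ≤ ‖x‖ + ‖y‖ := by
  rw [irot, norm_mul, Complex.norm_I, one_mul]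
  exact norm_comb_le (norm_nrm_le j ξ) (norm_nrp_le j ξ)

lemma norm_le_rot {ξ : Plane} (hξ : ξ ≠ 0) (x : Fin 2 → ℂ) (j : Fin 2) :
    ‖x j‖ ≤ ‖rotA ξ x‖ + ‖rotD ξ x‖ := by
  conv_lhs => rw [eq_irot hξ x j]
  exact norm_irot_le _ _ _ _

lemma Prim.rotA {b : ℝ} {x x' : ℝ → Fin 2 → ℂ} (ξ : Plane)
    (h : ∀ j, Prim b (fun y => x y j) fun y => x' y j) :
    Prim b (fun y => StationaryWaves.rotA ξ (x y)) fun y => StationaryWaves.rotA ξ (x' y) :=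
  (((h 0).const_mul _).add ((h 1).const_mul _)).const_mul _

lemma Prim.rotD {b : ℝ} {x x' : ℝ → Fin 2 → ℂ} (ξ : Plane)
    (h : ∀ j, Prim b (fun y => x y j) fun y => x' y j) :
    Prim b (fun y => StationaryWaves.rotD ξ (x y)) fun y => StationaryWaves.rotD ξ (x' y) :=
  (((h 0).const_mul _).add ((h 1).const_mul _)).const_mul _

lemma memLp_rotA {b : ℝ} {x : ℝ → Fin 2 → ℂ} (ξ : Plane)
    (h : ∀ j, MemLp (fun y => x y j) 2 (volI b)) :
    MemLp (fun y => rotA ξ (x y)) 2 (volI b) :=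
  (((h 0).const_mul _).add ((h 1).const_mul _)).const_mul _

lemma memLp_rotD {b : ℝ} {x : ℝ → Fin 2 → ℂ} (ξ : Plane)
    (h : ∀ j, MemLp (fun y => x y j) 2 (volI b)) :
    MemLp (fun y => rotD ξ (x y)) 2 (volI b) :=
  (((h 0).const_mul _).add ((h 1).const_mul _)).const_mul _

/-! ### Representatives that are absolutely continuous on fibres -/

/-- The representative of `f` with vertical derivative `g`. -/
def rep (b : ℝ) (f g : L2Omega b) (z : Plane × ℝ) : ℂ := trBot b f g z.1 + vint g z

lemma measurable_rep (b : ℝ) (f g : L2Omega b) : Measurable (rep b f g) :=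
  ((Lp.stronglyMeasurable _).measurable.comp measurable_fst).add
    (stronglyMeasurable_vint (Lp.stronglyMeasurable g)).measurable

lemma vint_zero (G : Plane × ℝ → ℂ) (ξ : Plane) : vint G (ξ, 0) = 0 := by simp [vint]

lemma HasWeakPartial.rep {b : ℝ} (hb : 0 < b) {f g : L2Omega b} (h : HasWeakPartial b 2 f g) :
    ∀ᵐ ξ : Plane, Prim b (fun y => rep b f g (ξ, y)) (fun y => g (ξ, y)) ∧
      (∀ᵐ y ∂volI b, f (ξ, y) = StationaryWaves.rep b f g (ξ, y)) ∧
      trTop b f g ξ = StationaryWaves.rep b f g (ξ, b) ∧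
      trBot b f g ξ = StationaryWaves.rep b f g (ξ, 0) := by
  obtain ⟨h1, h2, h3⟩ := h.exists_prim hb
  filter_upwards [h1, h2, h3] with ξ e1 e2 e3
  exact ⟨e1, e2, e3, by rw [StationaryWaves.rep, vint_zero, add_zero]⟩

/-- The fibres of the data, rotated to the direction of the frequency. -/
def FourierData.fibre {b : ℝ} (D : FourierData b) (ξ : Plane) : FData where
  r := freq ξ
  fa y := rotA ξ fun j => D.F j.castSucc (ξ, y)
  f3 y := D.F 2 (ξ, y)
  g y := rep b D.G D.G1 (ξ, y)
  g' y := D.G1 (ξ, y)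
  fd y := rotD ξ fun j => D.F j.castSucc (ξ, y)
  ka := rotA ξ fun j => D.K j.castSucc ξ
  k3 := D.K 2 ξ
  kd := rotD ξ fun j => D.K j.castSucc ξ
  h := D.H ξ
  om := D.W ξ

/-- The fibres of the solution, rotated to the direction of the frequency. -/
def FourierSol.fibre {b : ℝ} (S : FourierSol b) (grav : ℝ) (ξ : Plane) : FSol where
  a y := rotA ξ fun j => rep b (S.V j.castSucc) (S.V1 j.castSucc) (ξ, y)
  a' y := rotA ξ fun j => rep b (S.V1 j.castSucc) (S.V2 j.castSucc) (ξ, y)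
  a'' y := rotA ξ fun j => S.V2 j.castSucc (ξ, y)
  w y := rep b (S.V 2) (S.V1 2) (ξ, y)
  P y := rep b S.q S.q1 (ξ, y) + grav / freq ξ * rotA ξ fun j => S.X j ξ
  P' y := S.q1 (ξ, y)
  d y := rotD ξ fun j => rep b (S.V j.castSucc) (S.V1 j.castSucc) (ξ, y)
  d' y := rotD ξ fun j => rep b (S.V1 j.castSucc) (S.V2 j.castSucc) (ξ, y)
  d'' y := rotD ξ fun j => S.V2 j.castSucc (ξ, y)
  c := rotA ξ fun j => S.X j ξ
  χd := rotD ξ fun j => S.X j ξ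

lemma FourierData.good {b : ℝ} (hb : 0 < b) {D : FourierData b}
    (hG : HasWeakPartial b 2 D.G D.G1) : ∀ᵐ ξ, (D.fibre ξ).Good b := by
  have hF : ∀ᵐ ξ : Plane, ∀ i, MemLp (fun y => D.F i (ξ, y)) 2 (volI b) :=
    ae_all_iff.2 fun i => ae_memLp_fibre (Lp.memLp (D.F i))
  filter_upwards [hG.rep hb, ae_memLp_fibre (Lp.memLp D.G1), hF, ae_ne_zero_plane]
    with ξ h1 h2 h3 h4
  exact
    { r_pos := (norm_pos_iff.2 h4).trans_le (norm_le_freq ξ)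
      prim_g := h1.1
      memLp_g' := h2
      memLp_fa := memLp_rotA (x := fun y j => D.F j.castSucc (ξ, y)) ξ fun j => h3 _
      memLp_f3 := h3 2
      memLp_fd := memLp_rotD (x := fun y j => D.F j.castSucc (ξ, y)) ξ fun j => h3 _ }

lemma FourierData.measFData {b : ℝ} (D : FourierData b) : MeasFData D.fibre := by
  have h1 : ∀ i, Measurable (D.F i) := fun i => (Lp.stronglyMeasurable _).measurable
  have h2 : ∀ i, Measurable (D.K i) := fun i => (Lp.stronglyMeasurable _).measurable
  have h3 : Measurable D.G1 := (Lp.stronglyMeasurable _).measurable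
  have h4 := measurable_rep b D.G D.G1
  refine ⟨measurable_freq, ?_, h1 2, h4, h3, ?_, ?_, h2 2, ?_,
    (Lp.stronglyMeasurable _).measurable, (Lp.stronglyMeasurable _).measurable⟩
  all_goals
    simp only [FourierData.fibre, rotA, rotD]
    fun_prop

/-- On a fibre the divergence equation is `w' = r a + g`, and its vertical derivative is `w'' = r a'
+ g'`. Stated with representatives, these identities also give boundary values. -/
lemma HatSys.div_fibre {b grav μ κ : ℝ} (hb : 0 < b) {S : FourierSol b} {D : FourierData b}
    (h : HatSys grav μ κ S D) : ∀ᵐ ξ : Plane,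
      (∀ᵐ y ∂volI b, (freq ξ : ℂ) * rotA ξ (fun j => rep b (S.V j.castSucc) (S.V1 j.castSucc) (ξ, y)) +
        rep b D.G D.G1 (ξ, y) = S.V1 2 (ξ, y)) ∧
      (∀ᵐ y ∂volI b, (freq ξ : ℂ) * rotA ξ (fun j => rep b (S.V1 j.castSucc) (S.V2 j.castSucc) (ξ, y)) +
        D.G1 (ξ, y) = S.V2 2 (ξ, y)) := by
  have c1 : Fin.castSucc (1 : Fin 2) = 1 := rfl
  filter_upwards [ae_all_iff.2 fun i => (h.dV i).rep hb, ae_all_iff.2 fun i => (h.dV1 i).rep hb,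
    h.dG.rep hb, ae_ae_of_ae_volO h.div, ae_ae_of_ae_volO h.div1, ae_ne_zero_plane]
    with ξ hV hV1 hG hdiv hdiv1 h0
  constructor
  · filter_upwards [hdiv, (hV 0).2.1, (hV 1).2.1, hG.2.1] with y e e0 e1 e2
    rw [symb_eq 0 h0, symb_eq 1 h0] at e
    simp only [rotA, Fin.castSucc_zero, c1]
    rw [← e0, ← e1, ← e2]
    linear_combination -e
  · filter_upwards [hdiv1, (hV1 0).2.1, (hV1 1).2.1] with y e e0 e1
    rw [symb_eq 0 h0, symb_eq 1 h0] at e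
    simp only [rotA, Fin.castSucc_zero, c1]
    rw [← e0, ← e1]
    linear_combination -e

lemma HatSys.prim_a {b grav μ κ : ℝ} (hb : 0 < b) {S : FourierSol b} {D : FourierData b}
    (h : HatSys grav μ κ S D) : ∀ᵐ ξ : Plane,
      Prim b (S.fibre grav ξ).a (S.fibre grav ξ).a' ∧ Prim b (S.fibre grav ξ).d (S.fibre grav ξ).d' := by
  filter_upwards [ae_all_iff.2 fun i => (h.dV i).rep hb, ae_all_iff.2 fun i => (h.dV1 i).rep hb]
    with ξ hV hV1
  have e : ∀ᵐ y ∂volI b, ∀ i, S.V1 i (ξ, y) = rep b (S.V1 i) (S.V2 i) (ξ, y) :=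
    ae_all_iff.2 fun i => (hV1 i).2.1
  constructor
  · refine (Prim.rotA ξ (x := fun y j => rep b (S.V j.castSucc) (S.V1 j.castSucc) (ξ, y))
      (x' := fun y j => S.V1 j.castSucc (ξ, y)) fun j => (hV _).1).congr (fun _ _ => rfl) ?_
    filter_upwards [e] with y hy
    simp only [FourierSol.fibre, hy]
  · refine (Prim.rotD ξ (x := fun y j => rep b (S.V j.castSucc) (S.V1 j.castSucc) (ξ, y))
      (x' := fun y j => S.V1 j.castSucc (ξ, y)) fun j => (hV _).1).congr (fun _ _ => rfl) ?_
    filter_upwards [e] with y hy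
    simp only [FourierSol.fibre, hy]

/-- The normal stress contains the trace of `w'`, which is evaluated through the absolutely
continuous representative `r a + g`. -/
lemma HatSys.trTop_V1 {b grav μ κ : ℝ} (hb : 0 < b) {S : FourierSol b} {D : FourierData b}
    (h : HatSys grav μ κ S D) : ∀ᵐ ξ : Plane, trTop b (S.V1 2) (S.V2 2) ξ =
      (freq ξ : ℂ) * rotA ξ (fun j => rep b (S.V j.castSucc) (S.V1 j.castSucc) (ξ, b)) +
        rep b D.G D.G1 (ξ, b) := by
  refine (trace_eq_of_prim hb (F := fun z => (freq z.1 : ℂ) * rotA z.1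
    (fun j => rep b (S.V j.castSucc) (S.V1 j.castSucc) z) + rep b D.G D.G1 z) ?_ ?_).1
  · filter_upwards [h.prim_a hb, h.dG.rep hb, h.div_fibre hb] with ξ h1 h2 h3
    refine ((h1.1.const_mul (freq ξ)).add h2.1).congr (fun _ _ => rfl) ?_
    filter_upwards [h3.2] with y hy
    rw [← hy]
    rfl
  · filter_upwards [h.div_fibre hb] with ξ h3
    filter_upwards [h3.1] with y hy
    exact hy.symm

/-- Solutions of the system on the Fourier side solve the rotated system on almost every fibre. -/
theorem HatSys.fsys {b grav μ κ : ℝ} (hb : 0 < b) (hgrav : 0 < grav) (hκ : 0 < κ)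
    {S : FourierSol b} {D : FourierData b} (h : HatSys grav μ κ S D) :
    ∀ᵐ ξ, FSys b μ grav κ (D.fibre ξ) (S.fibre grav ξ) := by
  have rV := ae_all_iff.2 fun i => (h.dV i).rep hb
  have rV1 := ae_all_iff.2 fun i => (h.dV1 i).rep hb
  have mV2 : ∀ᵐ ξ : Plane, ∀ i, MemLp (fun y => S.V2 i (ξ, y)) 2 (volI b) :=
    ae_all_iff.2 fun i => ae_memLp_fibre (Lp.memLp (S.V2 i))
  have hno : ∀ᵐ ξ : Plane, ∀ i, trBot b (S.V i) (S.V1 i) ξ = 0 := ae_all_iff.2 fun i => by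
    rw [h.noSlip i]; exact Lp.coeFn_zero ..
  filter_upwards [rV, rV1, mV2, hno, h.dq.rep hb, h.dG.rep hb, FourierData.good hb h.dG,
    ae_memLp_fibre (Lp.memLp S.q1), ae_all_iff.2 fun j => ae_ae_of_ae_volO (h.horiz j),
    ae_ae_of_ae_volO h.vert,
    ae_all_iff.2 fun j => h.shear j, h.normal, h.curl,
    ae_ne_zero_plane, h.div_fibre hb, h.prim_a hb, h.trTop_V1 hb]
    with ξ hV hV1 mV2 hno hq hG hD hq1 hhor hver hsh hno' hcu h0 hdf pa htr
  have s0 := symb_eq 0 h0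
  have s1 := symb_eq 1 h0
  have hn := nrm_sq_add h0
  have hr : (freq ξ : ℂ) ≠ 0 := by exact_mod_cast hD.r_pos.ne'
  have hI := Complex.I_sq
  have c1 : Fin.castSucc (1 : Fin 2) = 1 := rfl
  have eV : ∀ᵐ y ∂volI b, ∀ i, S.V i (ξ, y) = rep b (S.V i) (S.V1 i) (ξ, y) :=
    ae_all_iff.2 fun i => (hV i).2.1
  have eh : ∀ᵐ y ∂volI b, ∀ j : Fin 2, grav * S.X j ξ + symb j ξ * rep b S.q S.q1 (ξ, y) -
      μ * (S.V2 j.castSucc (ξ, y) - freq ξ ^ 2 *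
        rep b (S.V j.castSucc) (S.V1 j.castSucc) (ξ, y) + symb j ξ * rep b D.G D.G1 (ξ, y)) =
        D.F j.castSucc (ξ, y) := by
    filter_upwards [ae_all_iff.2 hhor, eV, hq.2.1, hG.2.1] with y e1 e2 e3 e4 j
    rw [← e1 j, ← e2, ← e3, ← e4]
  exact
    { prim_a := pa.1
      prim_a' := Prim.rotA ξ (x := fun y j => rep b (S.V1 j.castSucc) (S.V2 j.castSucc) (ξ, y))
        (x' := fun y j => S.V2 j.castSucc (ξ, y)) fun j => (hV1 _).1
      prim_w := (hV 2).1.congr (fun _ _ => rfl) hdf.1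
      prim_P := (hq.1.add (Prim.const _)).congr (fun _ _ => rfl)
        (Eventually.of_forall fun y => (add_zero _).symm)
      prim_d := pa.2
      prim_d' := Prim.rotD ξ (x := fun y j => rep b (S.V1 j.castSucc) (S.V2 j.castSucc) (ξ, y))
        (x' := fun y j => S.V2 j.castSucc (ξ, y)) fun j => (hV1 _).1
      prim_g := hG.1
      memLp_a'' := memLp_rotA (x := fun y j => S.V2 j.castSucc (ξ, y)) ξ fun j => mV2 _
      memLp_P' := hq1
      memLp_d'' := memLp_rotD (x := fun y j => S.V2 j.castSucc (ξ, y)) ξ fun j => mV2 _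
      memLp_g' := hD.memLp_g'
      memLp_fa := hD.memLp_fa
      memLp_f3 := hD.memLp_f3
      memLp_fd := hD.memLp_fd
      a_zero := by
        change rotA ξ (fun j => rep b (S.V j.castSucc) (S.V1 j.castSucc) (ξ, 0)) = 0
        simp only [← (hV _).2.2.2, hno, rotA, mul_zero, add_zero]
      w_zero := by
        change rep b (S.V 2) (S.V1 2) (ξ, 0) = 0
        rw [← (hV _).2.2.2, hno]
      d_zero := by
        change rotD ξ (fun j => rep b (S.V j.castSucc) (S.V1 j.castSucc) (ξ, 0)) = 0
        simp only [← (hV _).2.2.2, hno, rotD, mul_zero, add_zero]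
      w_b := by
        change rep b (S.V 2) (S.V1 2) (ξ, b) = D.H ξ
        rw [← (hV _).2.2.1, h.kin]
      eqa := by
        filter_upwards [eh] with y e
        have e0 := e 0
        have e1 := e 1
        simp only [FourierData.fibre, FourierSol.fibre, rotA]
        -- The shift is chosen so that `r * (grav / r * c)` reproduces the gravity term of the
        -- unrotated equation.
        rw [mul_add (freq ξ : ℂ), ← mul_assoc (freq ξ : ℂ) (_ / _), mul_div_cancel₀ _ hr]
        rw [s0] at e0
        rw [s1] at e1
        simp only [Fin.castSucc_zero, c1] at e0 e1 ⊢
        linear_combination (-Complex.I * nrm 0 ξ) * e0 + (-Complex.I * nrm 1 ξ) * e1 +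
          freq ξ * (rep b S.q S.q1 (ξ, y) - μ * rep b D.G D.G1 (ξ, y)) *
            (((nrm 0 ξ : ℂ) ^ 2 + (nrm 1 ξ : ℂ) ^ 2) * hI - hn)
      eq3 := by
        filter_upwards [hver, hdf.2, eV] with y e e1 e2
        rw [e2] at e
        change S.q1 (ξ, y) - μ * ((freq ξ : ℂ) * rotA ξ (fun j => rep b (S.V1 j.castSucc)
          (S.V2 j.castSucc) (ξ, y)) + D.G1 (ξ, y) - (freq ξ : ℂ) ^ 2 * rep b (S.V 2) (S.V1 2)
          (ξ, y)) = D.F 2 (ξ, y) + μ * D.G1 (ξ, y)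
        rw [e1]
        linear_combination e
      eqka := by
        have e0 := hsh 0
        have e1 := hsh 1
        rw [s0] at e0
        rw [s1] at e1
        rw [h.kin] at e0 e1
        simp only [FourierData.fibre, FourierSol.fibre, rotA, ← (hV1 _).2.2.1]
        simp only [Fin.castSucc_zero, c1] at e0 e1 ⊢
        linear_combination (-Complex.I * nrm 0 ξ) * e0 + (-Complex.I * nrm 1 ξ) * e1 +
          μ * freq ξ * D.H ξ * (((nrm 0 ξ : ℂ) ^ 2 + (nrm 1 ξ : ℂ) ^ 2) * hI - hn)
      eqc := by
        have hq' : (grav + κ * freq ξ ^ 2 : ℂ) ≠ 0 := by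
          have : 0 < grav + κ * freq ξ ^ 2 := by positivity
          exact_mod_cast this.ne'
        rw [htr, hq.2.2.1, s0, s1] at hno'
        simp only [FourierData.fibre, FourierSol.fibre]
        rw [← hno']
        have hx : Complex.I * freq ξ * nrm 0 ξ * S.X 0 ξ + Complex.I * freq ξ * nrm 1 ξ * S.X 1 ξ =
            -freq ξ * rotA ξ fun j => S.X j ξ := by
          simp only [rotA]; ring
        rw [hx, div_mul_eq_mul_div, eq_div_iff hq']
        field_simp
        ring
      eqd := by
        filter_upwards [eh] with y e
        have e0 := e 0
        have e1 := e 1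
        simp only [FourierData.fibre, FourierSol.fibre, rotD]
        rw [s0] at e0
        rw [s1] at e1
        simp only [Fin.castSucc_zero, c1] at e0 e1 ⊢
        linear_combination (Complex.I * nrm 1 ξ) * e0 + (-Complex.I * nrm 0 ξ) * e1
      eqkd := by
        have e0 := hsh 0
        have e1 := hsh 1
        rw [s0] at e0
        rw [s1] at e1
        simp only [FourierData.fibre, FourierSol.fibre, rotD, ← (hV1 _).2.2.1]
        simp only [Fin.castSucc_zero, c1] at e0 e1 ⊢
        linear_combination (Complex.I * nrm 1 ξ) * e0 + (-Complex.I * nrm 0 ξ) * e1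
      eqχ := by
        rw [s0, s1] at hcu
        simp only [FourierData.fibre, FourierSol.fibre, rotD]
        linear_combination -hcu }

/-! ### Bounds for solutions on the Fourier side -/

lemma eLpNorm_le_add_of_norm_le {α : Type*} [MeasurableSpace α] {ν : Measure α} {f g h : α → ℂ}
    (hf : AEStronglyMeasurable f ν) (hg : AEStronglyMeasurable g ν)
    (H : ∀ᵐ z ∂ν, ‖h z‖ ≤ ‖f z‖ + ‖g z‖) : eLpNorm h 2 ν ≤ eLpNorm f 2 ν + eLpNorm g 2 ν := by
  rw [← eLpNorm_norm f, ← eLpNorm_norm g]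
  exact (eLpNorm_mono_ae_real H).trans (eLpNorm_add_le hf.norm hg.norm one_le_two)

lemma nf_le_rot {b : ℝ} {x : ℝ → Fin 2 → ℂ} {ξ : Plane} (hξ : ξ ≠ 0)
    (h : ∀ j, MemLp (fun y => x y j) 2 (volI b)) {v : ℝ → ℂ} (j : Fin 2)
    (hv : ∀ᵐ y ∂volI b, v y = x y j) :
    nf b v ≤ nf b (fun y => rotA ξ (x y)) + nf b (fun y => rotD ξ (x y)) := by
  have hA := memLp_rotA ξ h
  have hD := memLp_rotD ξ h
  rw [nf, nf, nf, ← ENNReal.toReal_add hA.2.ne hD.2.ne]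
  refine ENNReal.toReal_mono (ENNReal.add_ne_top.2 ⟨hA.2.ne, hD.2.ne⟩)
    (eLpNorm_le_add_of_norm_le hA.1 hD.1 ?_)
  filter_upwards [hv] with y hy
  rw [hy]
  exact norm_le_rot hξ _ j

lemma nf_congr {b : ℝ} {v w : ℝ → ℂ} (h : v =ᵐ[volI b] w) : nf b v = nf b w := by
  rw [nf, nf, eLpNorm_congr_ae h]

lemma FSol.le_out (S : FSol) (D : FData) (b grav : ℝ) {σ : ℝ} (hσ : 0 ≤ σ) :
    σ ^ 4 * (nf b S.a + nf b S.d) ≤ S.out D b grav σ ∧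
    σ ^ 2 * (nf b S.a' + nf b S.d') ≤ S.out D b grav σ ∧
    nf b S.a'' + nf b S.d'' ≤ S.out D b grav σ ∧ σ ^ 4 * nf b S.w ≤ S.out D b grav σ ∧
    σ ^ 2 * nf b (fun y => D.r * S.a y + D.g y) ≤ S.out D b grav σ ∧
    nf b (fun y => D.r * S.a' y + D.g' y) ≤ S.out D b grav σ ∧
    σ ^ 2 * nf b (fun y => S.P y - grav / D.r * S.c) ≤ S.out D b grav σ ∧
    nf b S.P' ≤ S.out D b grav σ ∧ σ ^ 3 * (‖S.c‖ + ‖S.χd‖) ≤ S.out D b grav σ := by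
  have hn := nf_nonneg b
  have e : ∀ (m : ℕ) (F : ℝ → ℂ), 0 ≤ σ ^ m * nf b F := fun m F => mul_nonneg (by positivity) (hn F)
  have c1 : 0 ≤ σ ^ 3 * ‖S.c‖ := by positivity
  have c2 : 0 ≤ σ ^ 3 * ‖S.χd‖ := by positivity
  have a1 := e 4 S.a
  have a2 := e 2 S.a'
  have a3 := hn S.a''
  have a4 := e 4 S.w
  have a5 := e 2 (fun y => D.r * S.a y + D.g y)
  have a6 := hn (fun y => D.r * S.a' y + D.g' y)
  have a7 := e 4 S.d
  have a8 := e 2 S.d'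
  have a9 := hn S.d''
  have b1 := e 2 (fun y => S.P y - grav / D.r * S.c)
  have b2 := hn S.P'
  unfold FSol.out
  refine ⟨?_, ?_, ?_, ?_, ?_, ?_, ?_, ?_, ?_⟩ <;> linarith

/-- Weighted bounds for the solution on the Fourier side. -/
structure HatBound {b : ℝ} (s : ℕ) (S : FourierSol b) (A : ℝ≥0∞) : Prop where
  V : ∀ i, wO b (2 * (s + 2)) (S.V i) ≤ A
  V1 : ∀ i, wO b (2 * (s + 1)) (S.V1 i) ≤ A
  V2 : ∀ i, wO b (2 * s) (S.V2 i) ≤ A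
  q : wO b (2 * (s + 1)) S.q ≤ A
  q1 : wO b (2 * s) S.q1 ≤ A
  X : ∀ j, wS (2 * s + 3) (S.X j) ≤ A

/-- The rotation and its inverse are bounded, so the fibrewise size controls all components. The
derivatives of `w` are controlled as `r a + g` and `r a' + g'`, and the pressure is recovered by
undoing the shift. -/
lemma HatSys.hatBound {b grav μ κ : ℝ} (hb : 0 < b) {S : FourierSol b} {D : FourierData b}
    (h : HatSys grav μ κ S D) (s : ℕ) : HatBound s S
      (eLpNorm (fun ξ => sig ξ ^ (2 * s) * (S.fibre grav ξ).out (D.fibre ξ) b grav (sig ξ)) 2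
        volume) := by
  have rV : ∀ᵐ ξ : Plane, ∀ i, Prim b (fun y => rep b (S.V i) (S.V1 i) (ξ, y))
      (fun y => S.V1 i (ξ, y)) ∧ ∀ᵐ y ∂volI b, S.V i (ξ, y) = rep b (S.V i) (S.V1 i) (ξ, y) :=
    ae_all_iff.2 fun i => ((h.dV i).rep hb).mono fun ξ e => ⟨e.1, e.2.1⟩
  have rV1 : ∀ᵐ ξ : Plane, ∀ i, Prim b (fun y => rep b (S.V1 i) (S.V2 i) (ξ, y))
      (fun y => S.V2 i (ξ, y)) ∧ ∀ᵐ y ∂volI b, S.V1 i (ξ, y) = rep b (S.V1 i) (S.V2 i) (ξ, y) :=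
    ae_all_iff.2 fun i => ((h.dV1 i).rep hb).mono fun ξ e => ⟨e.1, e.2.1⟩
  have mV2 : ∀ᵐ ξ : Plane, ∀ i, MemLp (fun y => S.V2 i (ξ, y)) 2 (volI b) :=
    ae_all_iff.2 fun i => ae_memLp_fibre (Lp.memLp (S.V2 i))
  have hw : ∀ (n k : ℕ) (F : L2Omega b), (∀ᵐ ξ : Plane, sig ξ ^ k * nf b (fun y => F (ξ, y)) ≤
      (S.fibre grav ξ).out (D.fibre ξ) b grav (sig ξ)) → n = 2 * s + k → wO b n F ≤
      eLpNorm (fun ξ => sig ξ ^ (2 * s) * (S.fibre grav ξ).out (D.fibre ξ) b grav (sig ξ)) 2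
        volume := fun n k F hF hn => by
    refine wO_le n (Lp.aestronglyMeasurable F) (ae_memLp_fibre (Lp.memLp F)) ?_
    filter_upwards [hF] with ξ hξ
    rw [hn, pow_add, mul_assoc]
    exact mul_le_mul_of_nonneg_left hξ (pow_nonneg (sig_nonneg ξ) _)
  have low := fun ξ : Plane =>
    (S.fibre grav ξ).le_out (D.fibre ξ) b grav (sig_nonneg ξ)
  refine ⟨forall_fin_three_iff.2 ⟨fun j => hw _ 4 _ ?_ (by ring), hw _ 4 _ ?_ (by ring)⟩,
    forall_fin_three_iff.2 ⟨fun j => hw _ 2 _ ?_ (by ring), hw _ 2 _ ?_ (by ring)⟩,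
    forall_fin_three_iff.2 ⟨fun j => hw _ 0 _ ?_ (by ring), hw _ 0 _ ?_ (by ring)⟩,
    hw _ 2 _ ?_ (by ring), hw _ 0 _ ?_ (by ring), fun j => wS_le _ ?_⟩
  · filter_upwards [rV, ae_ne_zero_plane] with ξ e h0
    refine le_trans ?_ (low ξ).1
    gcongr
    exact nf_le_rot (x := fun y j => rep b (S.V j.castSucc) (S.V1 j.castSucc) (ξ, y)) h0
      (fun j => (e _).1.memLp 2) j (e _).2
  · filter_upwards [rV] with ξ e
    rw [nf_congr (e 2).2]
    exact (low ξ).2.2.2.1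
  · filter_upwards [rV1, ae_ne_zero_plane] with ξ e h0
    refine le_trans ?_ (low ξ).2.1
    gcongr
    exact nf_le_rot (x := fun y j => rep b (S.V1 j.castSucc) (S.V2 j.castSucc) (ξ, y)) h0
      (fun j => (e _).1.memLp 2) j (e _).2
  · filter_upwards [h.div_fibre hb] with ξ e
    rw [← nf_congr e.1]
    exact (low ξ).2.2.2.2.1
  · filter_upwards [mV2, ae_ne_zero_plane] with ξ e h0
    rw [pow_zero, one_mul]
    refine le_trans ?_ (low ξ).2.2.1
    exact nf_le_rot (x := fun y j => S.V2 j.castSucc (ξ, y)) h0 (fun j => e _) j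
      (Eventually.of_forall fun y => rfl)
  · filter_upwards [h.div_fibre hb] with ξ e
    rw [← nf_congr e.2, pow_zero, one_mul]
    exact (low ξ).2.2.2.2.2.1
  · filter_upwards [h.dq.rep hb] with ξ e
    have : (fun y => S.q (ξ, y)) =ᵐ[volI b] fun y =>
        (S.fibre grav ξ).P y - grav / (D.fibre ξ).r * (S.fibre grav ξ).c := by
      filter_upwards [e.2.1] with y hy
      rw [hy]
      exact (add_sub_cancel_right _ _).symm
    rw [nf_congr this]
    exact (low ξ).2.2.2.2.2.2.1
  · refine Eventually.of_forall fun ξ => ?_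
    rw [pow_zero, one_mul]
    exact (low ξ).2.2.2.2.2.2.2.1
  · filter_upwards [ae_ne_zero_plane] with ξ h0
    rw [pow_add, mul_assoc]
    refine mul_le_mul_of_nonneg_left (le_trans ?_ (low ξ).2.2.2.2.2.2.2.2)
      (pow_nonneg (sig_nonneg ξ) _)
    have := sig_nonneg ξ
    gcongr
    exact norm_le_rot h0 (fun j => S.X j ξ) j

/-- The total size of the data. -/
def Data.size {b : ℝ} (d : Data b) (s : ℕ) : ℝ :=
  d.norm s + seminormHDotNegOne d.fluxDefect + seminormHDotNegOne d.w

lemma normHSigma_nonneg (σ : ℝ) (f : L2Sigma) : 0 ≤ normHSigma σ f := ENNReal.toReal_nonneg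

lemma seminormHDotNegOne_nonneg (f : L2Sigma) : 0 ≤ seminormHDotNegOne f := ENNReal.toReal_nonneg

lemma Data.le_size {b : ℝ} (d : Data b) (s : ℕ) : normH b (1 + s) d.g ≤ d.size s ∧
    (∀ i, normH b s (d.f i) ≤ d.size s) ∧ (∀ i, normHSigma (1 / 2 + s) (d.k i) ≤ d.size s) ∧
    normHSigma (3 / 2 + s) d.h ≤ d.size s ∧ normHSigma (1 / 2 + s) d.w ≤ d.size s ∧
    seminormHDotNegOne d.fluxDefect ≤ d.size s ∧ seminormHDotNegOne d.w ≤ d.size s := by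
  have h1 := normH_nonneg b (1 + s) d.g
  have h2 : ∀ i, 0 ≤ normH b s (d.f i) := fun i => normH_nonneg b s (d.f i)
  have h3 : ∀ i, 0 ≤ normHSigma (1 / 2 + s) (d.k i) := fun i => normHSigma_nonneg _ _
  have h4 := normHSigma_nonneg (3 / 2 + s) d.h
  have h5 := normHSigma_nonneg (1 / 2 + s) d.w
  have h6 := seminormHDotNegOne_nonneg d.fluxDefect
  have h7 := seminormHDotNegOne_nonneg d.w
  have s2 := Finset.sum_nonneg fun i (_ : i ∈ Finset.univ) => h2 i
  have s3 := Finset.sum_nonneg fun i (_ : i ∈ Finset.univ) => h3 i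
  have t2 := fun i => Finset.single_le_sum (fun i _ => h2 i) (Finset.mem_univ i)
  have t3 := fun i => Finset.single_le_sum (fun i _ => h3 i) (Finset.mem_univ i)
  unfold Data.size Data.norm
  refine ⟨?_, fun i => ?_, fun i => ?_, ?_, ?_, ?_, ?_⟩ <;> first | linarith | skip
  · linarith [t2 i]
  · linarith [t3 i]

lemma wS_le_toNNReal {n : ℕ} {σ A : ℝ} (hσ : σ = n / 2) {f : L2Sigma}
    (h : TemperedDistribution.MemSobolev σ 2 (f : 𝓢'(Plane, ℂ))) (hA : normHSigma σ f ≤ A) :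
    wS n (𝓕 f : L2Sigma) ≤ A.toNNReal := by
  rw [normHSigma_eq n hσ] at hA
  exact ENNReal.le_ofReal_iff_toReal_le ((memSobolev_iff_wS n hσ f).1 h).ne
    (ENNReal.toReal_nonneg.trans hA) |>.2 hA

/-- The vertical integral is a pairing with `1` and commutes with the Fourier transform, so the
fibre expression is the transform of the flux defect. -/
lemma eLpNorm_fluxDefect {b : ℝ} (hb : 0 < b) (d : Data b) {g1 : L2Omega b}
    (hg : HasWeakPartial b 2 d.g g1) :
    eLpNorm (fun ξ => ‖ξ‖⁻¹ * ‖((d.hat g1).fibre ξ).h -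
      ∫ t in (0 : ℝ)..b, ((d.hat g1).fibre ξ).g t‖) 2 volume =
      eLpNorm (invFreq d.fluxDefect) 2 volume := by
  have e : (𝓕 d.fluxDefect : L2Sigma) = 𝓕 d.h - pair b (cvec b 1) (pfourier b d.g) := by
    rw [Data.fluxDefect, verticalIntegral_eq_pair, pair_pfourier]
    exact (Lp.fourierTransformₗᵢ Plane ℂ).map_sub _ _
  refine eLpNorm_congr_norm_ae ?_
  have hd : HasWeakPartial b 2 (d.hat g1).G (d.hat g1).G1 :=
    (hasWeakPartial_two_pfourier_iff hb).2 hg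
  filter_upwards [Lp.coeFn_sub (𝓕 d.h : L2Sigma) (pair b (cvec b 1) (pfourier b d.g)),
    coeFn_pair_cvec b 1 (pfourier b d.g), hd.rep hb] with ξ e1 e2 e3
  rw [invFreq, e, e1, Pi.sub_apply, e2, norm_mul, norm_mul, norm_norm, Complex.norm_real]
  congr 3
  rw [intervalIntegral_eq_volI' hb.le]
  refine integral_congr_ae ?_
  filter_upwards [e3.2.1] with y hy
  exact hy.symm.trans (by simp [Data.hat])

lemma wO_rep {b : ℝ} (hb : 0 < b) (n : ℕ) {f g : L2Omega b} (h : HasWeakPartial b 2 f g) :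
    wO b n (rep b f g) = wO b n f :=
  wO_congr (ae_volO_of_ae_ae (measurable_rep b f g).aestronglyMeasurable
    (Lp.aestronglyMeasurable f) ((h.rep hb).mono fun _ e => e.2.1.mono fun _ hy => hy.symm))

lemma wO_le_add {b : ℝ} (n : ℕ) {H : Plane × ℝ → ℂ} {F G : L2Omega b}
    (h : ∀ z, ‖H z‖ ≤ ‖F z‖ + ‖G z‖) : wO b n H ≤ wO b n F + wO b n G := by
  refine eLpNorm_le_add_of_norm_le (aestronglyMeasurable_sig_mul n (Lp.aestronglyMeasurable F))
    (aestronglyMeasurable_sig_mul n (Lp.aestronglyMeasurable G)) (Eventually.of_forall fun z => ?_)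
  rw [norm_mul, norm_mul, norm_mul, ← mul_add]
  exact mul_le_mul_of_nonneg_left (h z) (norm_nonneg _)

lemma wS_le_add (n : ℕ) {h : Plane → ℂ} {f g : L2Sigma}
    (H : ∀ ξ, ‖h ξ‖ ≤ ‖f ξ‖ + ‖g ξ‖) : wS n h ≤ wS n f + wS n g := by
  have hm : AEStronglyMeasurable (fun ξ : Plane => ((sig ξ ^ n : ℝ) : ℂ)) volume :=
    (by fun_prop : Measurable fun ξ : Plane => ((sig ξ ^ n : ℝ) : ℂ)).aestronglyMeasurable
  refine eLpNorm_le_add_of_norm_le (hm.mul (Lp.aestronglyMeasurable f))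
    (hm.mul (Lp.aestronglyMeasurable g)) (Eventually.of_forall fun ξ => ?_)
  rw [norm_mul, norm_mul, norm_mul, ← mul_add]
  exact mul_le_mul_of_nonneg_left (H ξ) (norm_nonneg _)

/-- Regularity of the data on the Fourier side. -/
lemma Data.MemSobolev.reg {b : ℝ} (hb : 0 < b) {s : ℕ} {d : Data b} (hd : d.MemSobolev s) :
    Reg b (s + 1) 0 (pfourier b d.g) (2 ^ (s + 1) * (d.size s).toNNReal) ∧
    ∀ i, Reg b s 0 (pfourier b (d.f i)) (2 ^ (s + 1) * (d.size s).toNNReal) := by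
  have hs := d.le_size s
  refine ⟨?_, fun i => ((hd.f i).reg hb).mono ?_⟩
  · rw [add_comm s 1]
    exact (hd.g.reg hb).mono (by gcongr; exact hs.1)
  · gcongr
    · exact one_le_two
    · omega
    · exact hs.2.1 i

/-- Each of the twelve terms is bounded by the size of the data up to `2 ^ (s + 1)`, the constant of
`MemH.reg`. -/
lemma eLpNorm_data_le {b : ℝ} (hb : 0 < b) {s : ℕ} {d : Data b} (hd : d.MemSobolev s)
    (hc : d.Compatible) {g1 : L2Omega b} (hg : HasWeakPartial b 2 d.g g1) :
    eLpNorm (fun ξ => ((d.hat g1).fibre ξ).δs b s ξ) 2 volume ≤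
      (16 * 2 ^ (s + 1) : NNReal) * (d.size s).toNNReal := by
  have hG : HasWeakPartial b 2 (d.hat g1).G (d.hat g1).G1 :=
    (hasWeakPartial_two_pfourier_iff hb).2 hg
  obtain ⟨r1, r2⟩ := hd.reg hb
  obtain ⟨-, -, z3, z4, z5, z6, z7⟩ := d.le_size s
  set N := (d.size s).toNNReal with hN
  set A : ℝ≥0∞ := ((2 ^ (s + 1) * N : NNReal) : ℝ≥0∞) with hA
  have hNA : (N : ℝ≥0∞) ≤ A := by
    rw [hA, ENNReal.coe_le_coe]
    exact le_mul_of_one_le_left zero_le (one_le_pow₀ one_le_two)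
  have k1 : ∀ i, wS (2 * s + 1) (𝓕 (d.k i) : L2Sigma) ≤ A := fun i =>
    (wS_le_toNNReal (by push_cast; ring) (hd.k i) (z3 i)).trans hNA
  have k2 : wS (2 * s + 3) (𝓕 d.h : L2Sigma) ≤ A :=
    (wS_le_toNNReal (by push_cast; ring) hd.h z4).trans hNA
  have k3 : wS (2 * s + 1) (𝓕 d.w : L2Sigma) ≤ A :=
    (wS_le_toNNReal (by push_cast; ring) hd.w z5).trans hNA
  have k4 : ∀ f, MemHDotNegOne f → seminormHDotNegOne f ≤ d.size s →
      eLpNorm (invFreq f) 2 volume ≤ A := fun f h1 h2 =>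
    ((ENNReal.le_ofReal_iff_toReal_le h1.2.ne (ENNReal.toReal_nonneg.trans h2)).2 h2).trans hNA
  have k5 : wO b (2 * s + 2) (pfourier b d.g) ≤ A := r1.wO_le
  have k6 : wO b (2 * s) (pfourier b g1) ≤ A := (r1.deriv hG).wO_le
  have k7 : ∀ i, wO b (2 * s) (pfourier b (d.f i)) ≤ A := fun i => (r2 i).wO_le
  refine (eLpNorm_δs_le s (d.hat g1).measFData (FourierData.good hb hG)).trans ?_
  have e1 : wO b (2 * s + 2) (fun z => ((d.hat g1).fibre z.1).g z.2) ≤ A :=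
    (wO_rep hb _ hG).trans_le k5
  have e3 : wO b (2 * s) (fun z => ((d.hat g1).fibre z.1).fa z.2) ≤ A + A :=
    (wO_le_add (F := pfourier b (d.f 0)) (G := pfourier b (d.f 1)) _ fun z =>
      norm_rotA_le z.1 fun j => pfourier b (d.f j.castSucc) z).trans (add_le_add (k7 0) (k7 1))
  have e5 : wO b (2 * s) (fun z => ((d.hat g1).fibre z.1).fd z.2) ≤ A + A :=
    (wO_le_add (F := pfourier b (d.f 0)) (G := pfourier b (d.f 1)) _ fun z =>
      norm_rotD_le z.1 fun j => pfourier b (d.f j.castSucc) z).trans (add_le_add (k7 0) (k7 1))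
  have e6 : wS (2 * s + 1) (fun ξ => ((d.hat g1).fibre ξ).ka) ≤ A + A :=
    (wS_le_add (f := 𝓕 (d.k 0)) (g := 𝓕 (d.k 1)) _ fun z =>
      norm_rotA_le z fun j => (𝓕 (d.k j.castSucc) : L2Sigma) z).trans (add_le_add (k1 0) (k1 1))
  have e7 : wS (2 * s + 1) (fun ξ => ((d.hat g1).fibre ξ).kd) ≤ A + A :=
    (wS_le_add (f := 𝓕 (d.k 0)) (g := 𝓕 (d.k 1)) _ fun z =>
      norm_rotD_le z fun j => (𝓕 (d.k j.castSucc) : L2Sigma) z).trans (add_le_add (k1 0) (k1 1))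
  have e11 := (eLpNorm_fluxDefect hb d hg).trans_le (k4 _ hc.1 z6)
  have e12 : eLpNorm (fun ξ => ‖ξ‖⁻¹ * ‖((d.hat g1).fibre ξ).om‖) 2 volume ≤ A := by
    refine le_trans (le_of_eq (eLpNorm_congr_norm_ae (Eventually.of_forall fun ξ => ?_)))
      (k4 _ hc.2 z7)
    rw [invFreq, norm_mul, norm_mul, norm_norm, Complex.norm_real]
    rfl
  calc _ ≤ A + A + (A + A) + A + (A + A) + (A + A) + (A + A) + A + A + A + A + A := by
        gcongr
        exacts [k6, k7 2, k1 2, k2, k3]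
    -- The four rotated terms count twice, since both horizontal components enter; the other eight
    -- count once.
    _ = 16 * A := by ring
    _ = _ := by rw [hA]; push_cast; ring

/-- The weighted bounds in terms of the data. -/
theorem exists_hatBound {b μ grav κ : ℝ} (hb : 0 < b) (hgrav : 0 < grav) (hμ : 0 < μ)
    (hκ : 0 < κ) (s : ℕ) : ∃ C : NNReal, ∀ (d : Data b) (g1 : L2Omega b) (S : FourierSol b),
      d.MemSobolev s → d.Compatible → HasWeakPartial b 2 d.g g1 →
      HatSys grav μ κ S (d.hat g1) → HatBound s S (C * (d.size s).toNNReal : NNReal) := by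
  obtain ⟨C, hC⟩ := exists_integrated_estimate hb hgrav hμ hκ s
  refine ⟨C * (16 * 2 ^ (s + 1)), fun d g1 S hd hc hg hS => ?_⟩
  have h := hS.hatBound hb s
  have hle := (hC (d.hat g1).fibre (S.fibre grav) (fun ξ => rfl) (hS.fsys hb hgrav hκ)).trans
    (mul_le_mul_right (eLpNorm_data_le hb hd hc hg) _)
  rw [← mul_assoc, ← ENNReal.coe_mul, ← ENNReal.coe_mul] at hle
  exact ⟨fun i => (h.V i).trans hle, fun i => (h.V1 i).trans hle, fun i => (h.V2 i).trans hle,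
    h.q.trans hle, h.q1.trans hle, fun j => (h.X j).trans hle⟩

/-! ### Vertical regularity -/

namespace RegO

variable {b : ℝ} {ι : Type*} {A : ι → NNReal} {n l : ℕ} {F : ι → L2Omega b}

lemma bump_many (j : ℕ) (h : RegO A (n + j) l F) : RegO A n (l + j) F := by
  induction j generalizing l with
  | zero => exact h
  | succ j ih => rw [show l + (j + 1) = l + 1 + j by omega]; exact ih h.bump

lemma exists_mul (hb : 0 < b) {m : Plane → ℂ} (hm : Measurable m) {K : NNReal} (k : ℕ)
    (hK : ∀ ξ, ‖m ξ‖ ≤ K * sig ξ ^ (2 * k)) (h : RegO A n (l + k) F) :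
    ∃ F' : ι → L2Omega b, (∀ i, MulRel m (F i) (F' i)) ∧ RegO A n l F' := by
  obtain ⟨C, hC⟩ := h
  choose F' hF' using fun i => exists_mulRel hm hK (F := F i)
    ((wO_le_wO (by omega) _).trans_lt ((hC i).wO_le.trans_lt ENNReal.coe_lt_top))
  exact ⟨F', hF', RegO.mul hb hm k hK ⟨C, hC⟩ hF'⟩

lemma linComb (hb : 0 < b) {N : ℕ} (c : Fin N → ℂ) {G : Fin N → ι → L2Omega b}
    (h : ∀ k, RegO A n l (G k))
    (hF : ∀ i, ∀ᵐ z ∂volO b, F i z = ∑ k, c k * G k i z) : RegO A n l F := by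
  have hF' : F = fun i => ∑ k, c k • G k i := funext fun i => Lp.ext <| by
    filter_upwards [hF i, Lp.coeFn_fun_finsetSum Finset.univ fun k => c k • G k i,
      ae_all_iff.2 fun k => Lp.coeFn_smul (c k) (G k i)] with z e1 e2 e3
    rw [e1, e2]
    simp [e3]
  rw [hF']
  clear hF hF'
  induction N with
  | zero => exact ⟨0, fun i => by simpa using Reg.zero⟩
  | succ N ih =>
    simp only [Fin.sum_univ_succ]
    exact ((h 0).smul hb (c 0)).add (ih _ fun k => h k.succ)

end RegO

lemma norm_freq_sq_le (ξ : Plane) : ‖(freq ξ : ℂ) ^ 2‖ ≤ (49 : NNReal) * sig ξ ^ (2 * 2) := by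
  rw [norm_pow, Complex.norm_real, Real.norm_of_nonneg (freq_nonneg ξ)]
  calc freq ξ ^ 2 ≤ (7 * sig ξ ^ 2) ^ 2 := by
        have := freq_nonneg ξ
        gcongr
        exact freq_le ξ
    _ = _ := by norm_num; ring

section Ladder

variable {b grav μ κ : ℝ} {ι : Type*} {A : ι → NNReal} {s : ℕ} {S : ι → FourierSol b}
  {D : ι → FourierData b}

/-- The differentiated divergence equation gives `∂₃²u₃`, the horizontal momentum equations give
`∂₃²u₁` and `∂₃²u₂`, and the vertical one gives `∂₃p`. The right sides have one vertical derivative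
more than was known for these quantities, at the price of one unit of `l`. The field `χ` is constant
in `y` and does not interfere. -/
lemma regO_vertical_step (hb : 0 < b) (hμ : μ ≠ 0) (hS : ∀ i, HatSys grav μ κ (S i) (D i))
    {C : NNReal} (hB : ∀ i, HatBound s (S i) (C * A i : NNReal))
    (hG : RegO A (s + 1) 0 fun i => (D i).G) (hF : ∀ j, RegO A s 0 fun i => (D i).F j)
    {k l : ℕ} (hkl : k + 1 + l = s) (hV : ∀ j, RegO A (k + 2) (l + 1) fun i => (S i).V j)
    (hq : RegO A (k + 1) (l + 1) fun i => (S i).q) :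
    (∀ j, RegO A (k + 3) l fun i => (S i).V j) ∧ RegO A (k + 2) l fun i => (S i).q := by
  subst hkl
  have hμ' : (μ : ℂ) ≠ 0 := by exact_mod_cast hμ
  have hG1 : RegO A (k + 1) l fun i => (D i).G1 := by
    have := (hG.deriv fun i => (hS i).dG).bump_many (n := k + 1) l
    rwa [zero_add] at this
  have hF' : ∀ j, RegO A (k + 1) l fun i => (D i).F j := fun j => by
    have := (hF j).bump_many (n := k + 1) l
    rwa [zero_add] at this
  have hG' : RegO A (k + 1) (l + 1) fun i => (D i).G := by
    have := RegO.bump_many (n := k + 1) (l + 1) hG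
    rwa [zero_add] at this
  have hV1 : ∀ j, RegO A (k + 1) (l + 1) fun i => (S i).V1 j := fun j =>
    (hV j).deriv fun i => (hS i).dV j
  choose sG msG hsG using fun j : Fin 2 =>
    hG'.exists_mul hb (measurable_symb j) 1 (norm_symb_le_sig j)
  choose sq msq hsq using fun j : Fin 2 =>
    hq.exists_mul hb (measurable_symb j) 1 (norm_symb_le_sig j)
  choose sV msV hsV using fun j : Fin 2 =>
    (hV1 j.castSucc).exists_mul hb (measurable_symb j) 1 (norm_symb_le_sig j)
  choose rV mrV hrV using fun j =>
    (hV j).bump.exists_mul (l := l) hb (m := fun ξ => (freq ξ : ℂ) ^ 2) (by fun_prop) 2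
      norm_freq_sq_le
  have hX : ∀ j, RegO A (k + 1) l fun i => tens b ((S i).X j) (cvec b 1) := fun j =>
    ⟨(√b).toNNReal * C, fun i => (Reg.of_const hb (coeFn_tens_one _)
      ((wS_le_wS (by omega) _).trans ((hB i).X j))).mono (by rw [mul_assoc])⟩
  have h32 : RegO A (k + 1) l fun i => (S i).V2 2 :=
    RegO.linComb hb ![1, -1, -1] (G := ![fun i => (D i).G1, sV 0, sV 1])
      (fun k => by fin_cases k; exacts [hG1, hsV 0, hsV 1]) fun i => by
        filter_upwards [(hS i).div1, msV 0 i, msV 1 i] with z e e0 e1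
        simp only [Fin.sum_univ_three, Matrix.cons_val]
        rw [e0, e1]
        simp only [Fin.castSucc_zero, show Fin.castSucc (1 : Fin 2) = 1 from rfl]
        linear_combination e
  have hj2 : ∀ j : Fin 2, RegO A (k + 1) l fun i => (S i).V2 j.castSucc := fun j =>
    RegO.linComb hb ![1, -1, grav / μ, 1 / μ, -1 / μ]
      (G := ![rV j.castSucc, sG j, fun i => tens b ((S i).X j) (cvec b 1), sq j,
        fun i => (D i).F j.castSucc])
      (fun k => by fin_cases k; exacts [hrV _, hsG j, hX j, hsq j, hF' _]) fun i => by
        filter_upwards [(hS i).horiz j, mrV j.castSucc i, msG j i, msq j i,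
          coeFn_tens_one ((S i).X j)] with z e e0 e1 e2 e3
        simp only [Fin.sum_univ_five, Matrix.cons_val]
        rw [e0, e1, e2, e3]
        field_simp
        linear_combination -e
  have hq1 : RegO A (k + 1) l fun i => (S i).q1 :=
    RegO.linComb hb ![1, μ, -μ, μ]
      (G := ![fun i => (D i).F 2, fun i => (S i).V2 2, rV 2, fun i => (D i).G1])
      (fun k => by fin_cases k; exacts [hF' 2, h32, hrV 2, hG1]) fun i => by
        filter_upwards [(hS i).vert, mrV 2 i] with z e e0
        simp only [Fin.sum_univ_four, Matrix.cons_val]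
        rw [e0]
        linear_combination e
  have hV2 : ∀ j, RegO A (k + 1) l fun i => (S i).V2 j := forall_fin_three_iff.2 ⟨hj2, h32⟩
  refine ⟨fun j => ?_, hq1.succ (fun i => (hS i).dq) (C := C) fun i => ?_⟩
  · have h1 : RegO A (k + 2) l fun i => (S i).V1 j :=
      (hV2 j).succ (fun i => (hS i).dV1 j) (C := C) fun i => by
        rw [Nat.add_right_comm _ 1 l]
        exact_mod_cast (hB i).V1 j
    exact h1.succ (fun i => (hS i).dV j) (C := C) fun i => by
      rw [show k + 2 + 1 + l = k + 1 + l + 2 by omega]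
      exact_mod_cast (hB i).V j
  · rw [Nat.add_right_comm _ 1 l]
    exact_mod_cast (hB i).q

/-- Induction along `k + l = s`. The start `k = 0` is the integrated a priori bound, and the end `l
= 0` is full isotropic regularity. -/
lemma regO_vertical (hb : 0 < b) (hμ : μ ≠ 0) (hS : ∀ i, HatSys grav μ κ (S i) (D i))
    {C : NNReal} (hB : ∀ i, HatBound s (S i) (C * A i : NNReal))
    (hG : RegO A (s + 1) 0 fun i => (D i).G) (hF : ∀ j, RegO A s 0 fun i => (D i).F j)
    (k l : ℕ) (hkl : k + l = s) :
    (∀ j, RegO A (k + 2) l fun i => (S i).V j) ∧ RegO A (k + 1) l fun i => (S i).q := by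
  induction k generalizing l with
  | zero =>
    obtain rfl : l = s := by omega
    have h1 : ∀ j, RegO A 1 l fun i => (S i).V1 j := fun j =>
      RegO.succ (n := 0) (G := fun i => (S i).V2 j) ⟨C, fun i => (hB i).V2 j⟩
        (fun i => (hS i).dV1 j) (C := C) fun i => by
          rw [show 0 + 1 + l = l + 1 by omega]; exact_mod_cast (hB i).V1 j
    refine ⟨fun j => (h1 j).succ (fun i => (hS i).dV j) (C := C) fun i => ?_,
      RegO.succ (n := 0) (G := fun i => (S i).q1) ⟨C, fun i => (hB i).q1⟩
        (fun i => (hS i).dq) (C := C) fun i => ?_⟩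
    · rw [show 1 + 1 + l = l + 2 by omega]; exact_mod_cast (hB i).V j
    · rw [show 0 + 1 + l = l + 1 by omega]; exact_mod_cast (hB i).q
  | succ k ih =>
    obtain ⟨h1, h2⟩ := ih (l + 1) (by omega)
    exact regO_vertical_step hb hμ hS hB hG hF hkl h1 h2

end Ladder

/-- Regularity of solutions on the Fourier side, with bounds. -/
theorem exists_regularity {b μ grav κ : ℝ} (hb : 0 < b) (hgrav : 0 < grav) (hμ : 0 < μ)
    (hκ : 0 < κ) (s : ℕ) : ∃ C : NNReal, ∀ (d : Data b) (g1 : L2Omega b) (S : FourierSol b),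
      d.MemSobolev s → d.Compatible → HasWeakPartial b 2 d.g g1 →
      HatSys grav μ κ S (d.hat g1) →
      (∀ j, Reg b (s + 2) 0 (S.V j) (C * (d.size s).toNNReal)) ∧
      Reg b (s + 1) 0 S.q (C * (d.size s).toNNReal) ∧
      ∀ j, wS (2 * s + 3) (S.X j) ≤ (C * (d.size s).toNNReal : NNReal) := by
  obtain ⟨C, hC⟩ := exists_hatBound hb hgrav hμ hκ s
  -- The family is indexed by all admissible data with all their solutions, so that the big-O
  -- constant is uniform in both.
  let ι := {x : Data b × L2Omega b × FourierSol b // x.1.MemSobolev s ∧ x.1.Compatible ∧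
    HasWeakPartial b 2 x.1.g x.2.1 ∧ HatSys grav μ κ x.2.2 (x.1.hat x.2.1)}
  obtain ⟨h1, C', hC'⟩ := regO_vertical (ι := ι) (A := fun x => (x.1.1.size s).toNNReal)
    (S := fun x => x.1.2.2) (D := fun x => x.1.1.hat x.1.2.1) hb hμ.ne' (fun x => x.2.2.2.2)
    (fun x => hC _ _ _ x.2.1 x.2.2.1 x.2.2.2.1 x.2.2.2.2)
    ⟨2 ^ (s + 1), fun x => (x.2.1.reg hb).1⟩ (fun j => ⟨2 ^ (s + 1), fun x => (x.2.1.reg hb).2 j⟩)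
    s 0 (add_zero s)
  choose c hc using h1
  refine ⟨C + C' + ∑ j, c j, fun d g1 S a1 a2 a3 a4 => ⟨fun j => ?_, ?_, fun j => ?_⟩⟩
  · refine (hc j ⟨(d, g1, S), a1, a2, a3, a4⟩).mono ?_
    gcongr
    exact (Finset.single_le_sum (fun _ _ => zero_le) (Finset.mem_univ j)).trans le_add_self
  · refine (hC' ⟨(d, g1, S), a1, a2, a3, a4⟩).mono ?_
    gcongr
    exact le_add_self.trans le_self_add
  · refine ((hC d g1 S a1 a2 a3 a4).X j).trans ?_
    rw [ENNReal.coe_le_coe]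
    gcongr
    exact le_self_add.trans le_self_add

/-! ### Existence on the Fourier side -/

lemma Prim.irot {b : ℝ} {x x' y y' : ℝ → ℂ} (j : Fin 2) (ξ : Plane) (hx : Prim b x x')
    (hy : Prim b y y') : Prim b (fun t => StationaryWaves.irot j ξ (x t) (y t))
      fun t => StationaryWaves.irot j ξ (x' t) (y' t) :=
  ((hx.const_mul _).add (hy.const_mul _)).const_mul _

lemma symb_mul_irot {ξ : Plane} (hξ : ξ ≠ 0) (x y : ℂ) :
    symb 0 ξ * irot 0 ξ x y + symb 1 ξ * irot 1 ξ x y = -freq ξ * x ∧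
    symb 0 ξ * irot 1 ξ x y - symb 1 ξ * irot 0 ξ x y = -freq ξ * y := by
  have hn := nrm_sq_add hξ
  have hI := Complex.I_sq
  simp only [symb_eq _ hξ, irot, nrp, Matrix.cons_val]
  push_cast
  constructor
  · linear_combination freq ξ * x * (((nrm 0 ξ : ℂ) ^ 2 + (nrm 1 ξ : ℂ) ^ 2) * hI - hn)
  · linear_combination freq ξ * y * (((nrm 0 ξ : ℂ) ^ 2 + (nrm 1 ξ : ℂ) ^ 2) * hI - hn)

/-- A function that is absolutely continuous on fibres is weakly differentiable. -/
lemma exists_Lp_of_prim {b : ℝ} (hb : 0 < b) {F F' : Plane × ℝ → ℂ} (hF : MemLp F 2 (volO b))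
    (hF' : MemLp F' 2 (volO b)) (hm : Measurable F)
    (h : ∀ᵐ ξ : Plane, Prim b (fun y => F (ξ, y)) fun y => F' (ξ, y)) :
    HasWeakPartial b 2 (hF.toLp F) (hF'.toLp F') ∧
    (trTop b (hF.toLp F) (hF'.toLp F') =ᵐ[volume] fun ξ => F (ξ, b)) ∧
    trBot b (hF.toLp F) (hF'.toLp F') =ᵐ[volume] fun ξ => F (ξ, 0) := by
  have hP : ∀ᵐ ξ : Plane, Prim b (fun y => F (ξ, y)) fun y => hF'.toLp F' (ξ, y) := by
    filter_upwards [h, ae_ae_of_ae_volO hF'.coeFn_toLp] with ξ h1 h2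
    exact h1.congr (fun _ _ => rfl) h2
  refine ⟨hasWeakPartial_two_of_eq hb (c := fun ξ => F (ξ, 0)) ?_,
    trace_eq_of_prim hb hP (ae_ae_of_ae_volO hF.coeFn_toLp)⟩
  refine ae_volO_of_ae_ae (Lp.aestronglyMeasurable _) (Measurable.aestronglyMeasurable ?_) ?_
  · exact (hm.comp (measurable_fst.prodMk measurable_const)).add
      (stronglyMeasurable_vint (Lp.stronglyMeasurable _)).measurable
  · filter_upwards [hP, ae_ae_of_ae_volO hF.coeFn_toLp] with ξ h1 h2
    filter_upwards [h2, ae_restrict_mem measurableSet_Ioo] with y hy hy'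
    rw [hy]
    exact h1.2 y (Set.Ioo_subset_Icc_self hy')

lemma nf_irot_le {b : ℝ} (j : Fin 2) (ξ : Plane) {x y : ℝ → ℂ} (hx : MemLp x 2 (volI b))
    (hy : MemLp y 2 (volI b)) : nf b (fun t => irot j ξ (x t) (y t)) ≤ nf b x + nf b y := by
  rw [nf, nf, nf, ← ENNReal.toReal_add hx.2.ne hy.2.ne]
  exact ENNReal.toReal_mono (ENNReal.add_ne_top.2 ⟨hx.2.ne, hy.2.ne⟩)
    (eLpNorm_le_add_of_norm_le hx.1 hy.1 (Eventually.of_forall fun t => norm_irot_le _ _ _ _))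

lemma memLp_irot {b : ℝ} (j : Fin 2) (ξ : Plane) {x y : ℝ → ℂ} (hx : MemLp x 2 (volI b))
    (hy : MemLp y 2 (volI b)) : MemLp (fun t => irot j ξ (x t) (y t)) 2 (volI b) :=
  ((hx.const_mul _).add (hy.const_mul _)).const_mul _

lemma exists_append {b : ℝ} (v : Fin 2 → L2Omega b) (w : L2Omega b) :
    ∃ V : Fin 3 → L2Omega b, (∀ j : Fin 2, V j.castSucc = v j) ∧ V 2 = w :=
  ⟨![v 0, v 1, w], fun j => by fin_cases j <;> rfl, rfl⟩

/-- `S` consists of the square integrable functions that are given on fibres by `J`. -/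
structure IsFibre {b : ℝ} (grav : ℝ) (S : FourierSol b) (D : FourierData b) (J : Plane → FSol) :
    Prop where
  dV : ∀ i, HasWeakPartial b 2 (S.V i) (S.V1 i)
  dV1 : ∀ i, HasWeakPartial b 2 (S.V1 i) (S.V2 i)
  dq : HasWeakPartial b 2 S.q S.q1
  V : ∀ j : Fin 2, ∀ᵐ z ∂volO b, S.V j.castSucc z = irot j z.1 ((J z.1).a z.2) ((J z.1).d z.2)
  V1 : ∀ j : Fin 2, ∀ᵐ z ∂volO b, S.V1 j.castSucc z =
    irot j z.1 ((J z.1).a' z.2) ((J z.1).d' z.2)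
  V2 : ∀ j : Fin 2, ∀ᵐ z ∂volO b, S.V2 j.castSucc z =
    irot j z.1 ((J z.1).a'' z.2) ((J z.1).d'' z.2)
  w : ∀ᵐ z ∂volO b, S.V 2 z = (J z.1).w z.2
  w1 : ∀ᵐ z ∂volO b, S.V1 2 z = freq z.1 * (J z.1).a z.2 + rep b D.G D.G1 z
  w2 : ∀ᵐ z ∂volO b, S.V2 2 z = freq z.1 * (J z.1).a' z.2 + D.G1 z
  q : ∀ᵐ z ∂volO b, S.q z = (J z.1).P z.2 - grav / freq z.1 * (J z.1).c
  q1 : ∀ᵐ z ∂volO b, S.q1 z = (J z.1).P' z.2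
  X : ∀ j : Fin 2, ∀ᵐ ξ, S.X j ξ = irot j ξ (J ξ).c (J ξ).χd
  tV1 : ∀ j : Fin 2, ∀ᵐ ξ, trTop b (S.V1 j.castSucc) (S.V2 j.castSucc) ξ =
    irot j ξ ((J ξ).a' b) ((J ξ).d' b)
  tw : ∀ᵐ ξ, trTop b (S.V 2) (S.V1 2) ξ = (J ξ).w b
  tw1 : ∀ᵐ ξ, trTop b (S.V1 2) (S.V2 2) ξ = freq ξ * (J ξ).a b + rep b D.G D.G1 (ξ, b)
  tq : ∀ᵐ ξ, trTop b S.q S.q1 ξ = (J ξ).P b - grav / freq ξ * (J ξ).c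
  bV : ∀ j : Fin 2, ∀ᵐ ξ, trBot b (S.V j.castSucc) (S.V1 j.castSucc) ξ =
    irot j ξ ((J ξ).a 0) ((J ξ).d 0)
  bw : ∀ᵐ ξ, trBot b (S.V 2) (S.V1 2) ξ = (J ξ).w 0

/-- Fibrewise solutions of finite size assemble to square integrable functions. -/
lemma exists_isFibre {b μ grav κ : ℝ} (hb : 0 < b) {D : FourierData b} {J : Plane → FSol}
    (hS : ∀ᵐ ξ, FSys b μ grav κ (D.fibre ξ) (J ξ)) (hM : MeasFSol J)
    (hfin' : eLpNorm (fun ξ => (J ξ).out (D.fibre ξ) b grav (sig ξ)) 2 volume < ⊤) :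
    ∃ S : FourierSol b, IsFibre grav S D J := by
  have hDm := D.measFData
  have low := fun ξ : Plane => (J ξ).le_out (D.fibre ξ) b grav (sig_nonneg ξ)
  obtain ⟨ma, ma', ma'', mw, mP, mP', md, md', md'', mc, mχ⟩ := hM
  have mr : Measurable fun ξ => (D.fibre ξ).r := measurable_freq
  have mg : Measurable fun z : Plane × ℝ => (D.fibre z.1).g z.2 := hDm.g
  have mg' : Measurable fun z : Plane × ℝ => (D.fibre z.1).g' z.2 := hDm.g'
  -- Square integrability of each component follows from the integrated bound after dropping the
  -- weight, which is at least one.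
  have key : ∀ (k : ℕ) (F : Plane × ℝ → ℂ), Measurable F →
      (∀ᵐ ξ : Plane, MemLp (fun y => F (ξ, y)) 2 (volI b) ∧ sig ξ ^ k * nf b (fun y => F (ξ, y)) ≤
        (J ξ).out (D.fibre ξ) b grav (sig ξ)) → MemLp F 2 (volO b) := fun k F hF h => by
    refine ⟨hF.aestronglyMeasurable, ?_⟩
    have h1 := (wO_le_wO (Nat.zero_le k) F).trans (wO_le k hF.aestronglyMeasurable
      (h.mono fun _ e => e.1) (h.mono fun _ e => e.2))
    have h2 : wO b 0 F = eLpNorm F 2 (volO b) := by simp [wO]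
    rw [← h2]
    exact h1.trans_lt hfin'
  have LV : ∀ j : Fin 2, MemLp (fun z : Plane × ℝ => irot j z.1 ((J z.1).a z.2) ((J z.1).d z.2)) 2
      (volO b) := fun j => key 4 _ (by unfold irot; fun_prop) <| by
    filter_upwards [hS] with ξ h
    have h1 := h.prim_a.memLp 2
    have h2 := h.prim_d.memLp 2
    refine ⟨memLp_irot j ξ h1 h2, le_trans ?_ (low ξ).1⟩
    have := sig_nonneg ξ
    gcongr
    exact nf_irot_le j ξ h1 h2
  have LV1 : ∀ j : Fin 2, MemLp (fun z : Plane × ℝ => irot j z.1 ((J z.1).a' z.2) ((J z.1).d' z.2)) 2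
      (volO b) := fun j => key 2 _ (by unfold irot; fun_prop) <| by
    filter_upwards [hS] with ξ h
    have h1 := h.prim_a'.memLp 2
    have h2 := h.prim_d'.memLp 2
    refine ⟨memLp_irot j ξ h1 h2, le_trans ?_ (low ξ).2.1⟩
    have := sig_nonneg ξ
    gcongr
    exact nf_irot_le j ξ h1 h2
  have LV2 : ∀ j : Fin 2, MemLp (fun z : Plane × ℝ => irot j z.1 ((J z.1).a'' z.2)
      ((J z.1).d'' z.2)) 2 (volO b) := fun j => key 0 _ (by unfold irot; fun_prop) <| by
    filter_upwards [hS] with ξ h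
    refine ⟨memLp_irot j ξ h.memLp_a'' h.memLp_d'', le_trans ?_ (low ξ).2.2.1⟩
    rw [pow_zero, one_mul]
    exact nf_irot_le j ξ h.memLp_a'' h.memLp_d''
  have Lw : MemLp (fun z : Plane × ℝ => (J z.1).w z.2) 2 (volO b) := key 4 _ mw <| by
    filter_upwards [hS] with ξ h
    exact ⟨h.prim_w.memLp 2, (low ξ).2.2.2.1⟩
  have Lw1 : MemLp (fun z : Plane × ℝ => (D.fibre z.1).r * (J z.1).a z.2 + (D.fibre z.1).g z.2) 2
      (volO b) := key 2 _ (by fun_prop) <| by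
    filter_upwards [hS] with ξ h
    exact ⟨((h.prim_a.memLp 2).const_mul _).add (h.prim_g.memLp 2), (low ξ).2.2.2.2.1⟩
  have Lw2 : MemLp (fun z : Plane × ℝ => (D.fibre z.1).r * (J z.1).a' z.2 + (D.fibre z.1).g' z.2) 2
      (volO b) := key 0 _ (by fun_prop) <| by
    filter_upwards [hS] with ξ h
    rw [pow_zero, one_mul]
    exact ⟨((h.prim_a'.memLp 2).const_mul _).add h.memLp_g', (low ξ).2.2.2.2.2.1⟩
  have mcr : Measurable fun z : Plane × ℝ => (grav : ℂ) / (D.fibre z.1).r * (J z.1).c :=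
    ((measurable_const.div (Complex.measurable_ofReal.comp mr)).mul mc).comp measurable_fst
  have mq : Measurable fun z : Plane × ℝ =>
      (J z.1).P z.2 - grav / (D.fibre z.1).r * (J z.1).c := mP.sub mcr
  have Lq : MemLp (fun z : Plane × ℝ => (J z.1).P z.2 - grav / (D.fibre z.1).r * (J z.1).c) 2
      (volO b) := key 2 _ mq <| by
    filter_upwards [hS] with ξ h
    exact ⟨(h.prim_P.memLp 2).sub (memLp_const _), (low ξ).2.2.2.2.2.2.1⟩
  have Lq1 : MemLp (fun z : Plane × ℝ => (J z.1).P' z.2) 2 (volO b) := key 0 _ mP' <| by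
    filter_upwards [hS] with ξ h
    rw [pow_zero, one_mul]
    exact ⟨h.memLp_P', (low ξ).2.2.2.2.2.2.2.1⟩
  have LX : ∀ j : Fin 2, MemLp (fun ξ => irot j ξ (J ξ).c (J ξ).χd) 2 volume := fun j => by
    refine ⟨Measurable.aestronglyMeasurable (by unfold irot; fun_prop), ?_⟩
    refine (eLpNorm_mono_real fun ξ => ?_).trans_lt hfin'
    refine (norm_irot_le _ _ _ _).trans (le_trans ?_ (low ξ).2.2.2.2.2.2.2.2)
    exact le_mul_of_one_le_left (by positivity) (one_le_pow₀ (one_le_sig ξ))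
  have pV := fun j : Fin 2 => exists_Lp_of_prim hb (LV j) (LV1 j) (by unfold irot; fun_prop)
    (hS.mono fun ξ h => h.prim_a.irot j ξ h.prim_d)
  have pV1 := fun j : Fin 2 => exists_Lp_of_prim hb (LV1 j) (LV2 j) (by unfold irot; fun_prop)
    (hS.mono fun ξ h => h.prim_a'.irot j ξ h.prim_d')
  have pw := exists_Lp_of_prim hb Lw Lw1 mw (hS.mono fun ξ h => h.prim_w)
  have pw1 := exists_Lp_of_prim hb Lw1 Lw2 (by fun_prop)
    (hS.mono fun ξ h => (h.prim_a.const_mul ((D.fibre ξ).r : ℂ)).add h.prim_g)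
  have pq := exists_Lp_of_prim hb Lq Lq1 mq
    (hS.mono fun ξ h => (h.prim_P.sub (Prim.const
      ((grav : ℂ) / (D.fibre ξ).r * (J ξ).c))).congr (fun _ _ => rfl)
      (Eventually.of_forall fun y => (sub_zero _).symm))
  obtain ⟨V, hV, hV'⟩ := exists_append (fun j => (LV j).toLp _) (Lw.toLp _)
  obtain ⟨V1, hV1, hV1'⟩ := exists_append (fun j => (LV1 j).toLp _) (Lw1.toLp _)
  obtain ⟨V2, hV2, hV2'⟩ := exists_append (fun j => (LV2 j).toLp _) (Lw2.toLp _)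
  refine ⟨⟨V, V1, V2, Lq.toLp _, Lq1.toLp _, fun j => (LX j).toLp _⟩, ?_⟩
  constructor
  · refine forall_fin_three_iff.2 ⟨fun j => ?_, ?_⟩
    · simp only [hV, hV1]; exact (pV j).1
    · simp only [hV', hV1']; exact pw.1
  · refine forall_fin_three_iff.2 ⟨fun j => ?_, ?_⟩
    · simp only [hV1, hV2]; exact (pV1 j).1
    · simp only [hV1', hV2']; exact pw1.1
  · exact pq.1
  · intro j; simp only [hV]; exact (LV j).coeFn_toLp
  · intro j; simp only [hV1]; exact (LV1 j).coeFn_toLp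
  · intro j; simp only [hV2]; exact (LV2 j).coeFn_toLp
  · simp only [hV']; exact Lw.coeFn_toLp
  · simp only [hV1']; exact Lw1.coeFn_toLp
  · simp only [hV2']; exact Lw2.coeFn_toLp
  · exact Lq.coeFn_toLp
  · exact Lq1.coeFn_toLp
  · intro j; exact (LX j).coeFn_toLp
  · intro j; simp only [hV1, hV2]; exact (pV1 j).2.1
  · simp only [hV', hV1']; exact pw.2.1
  · simp only [hV1', hV2']; exact pw1.2.1
  · exact pq.2.1
  · intro j; simp only [hV, hV1]; exact (pV j).2.2
  · simp only [hV', hV1']; exact pw.2.2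

lemma ae_volO_of_fibres {b : ℝ} {F G : Plane × ℝ → ℂ} (hF : Measurable F) (hG : Measurable G)
    (h : ∀ᵐ ξ : Plane, ∀ᵐ y ∂volI b, F (ξ, y) = G (ξ, y)) : ∀ᵐ z ∂volO b, F z = G z :=
  ae_volO_of_ae_ae hF.aestronglyMeasurable hG.aestronglyMeasurable h

/-- Fibrewise solutions assemble to solutions of the system on the Fourier side. -/
theorem IsFibre.hatSys {b μ grav κ : ℝ} (hb : 0 < b) (hgrav : 0 < grav) (hκ : 0 < κ)
    {S : FourierSol b} {D : FourierData b} {J : Plane → FSol} (h : IsFibre grav S D J)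
    (hG : HasWeakPartial b 2 D.G D.G1) (hS : ∀ᵐ ξ, FSys b μ grav κ (D.fibre ξ) (J ξ)) :
    HatSys grav μ κ S D := by
  have ms0 := measurable_symb 0
  have ms1 := measurable_symb 1
  have mL : ∀ f : L2Omega b, Measurable f := fun f => (Lp.stronglyMeasurable f).measurable
  have mX : ∀ f : L2Sigma, Measurable f := fun f => (Lp.stronglyMeasurable f).measurable
  have fV := fun j => ae_ae_of_ae_volO (h.V j)
  have fV1 := fun j => ae_ae_of_ae_volO (h.V1 j)
  have fV2 := fun j => ae_ae_of_ae_volO (h.V2 j)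
  have fw := ae_ae_of_ae_volO h.w
  have fw1 := ae_ae_of_ae_volO h.w1
  have fw2 := ae_ae_of_ae_volO h.w2
  have fq := ae_ae_of_ae_volO h.q
  have fq1 := ae_ae_of_ae_volO h.q1
  have hGr := hG.rep hb
  refine
    { dV := h.dV, dV1 := h.dV1, dq := h.dq, dG := hG
      horiz := fun j => ?_, vert := ?_, div := ?_, div1 := ?_, shear := fun j => ?_, normal := ?_
      curl := ?_, kin := ?_, noSlip := forall_fin_three_iff.2 ⟨fun j => ?_, ?_⟩ }
  · have m1 := mL S.q
    have m2 := mL (S.V2 j.castSucc)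
    have m3 := mL (S.V j.castSucc)
    have m4 := mL D.G
    have m5 := mX (S.X j)
    have m6 := measurable_symb j
    refine ae_volO_of_fibres (by fun_prop) (mL _) ?_
    filter_upwards [hS, fV j, fV2 j, fq, hGr, h.X j, ae_ne_zero_plane] with ξ e e1 e2 e3 e4 e5 h0
    filter_upwards [e.eqa, e.eqd, e1, e2, e3, e4.2.1] with y a1 a2 a3 a4 a5 a6
    have hr : (freq ξ : ℂ) * (grav / freq ξ * (J ξ).c) = grav * (J ξ).c := by
      have : (freq ξ : ℂ) ≠ 0 := by
        exact_mod_cast ((norm_pos_iff.2 h0).trans_le (norm_le_freq ξ)).ne'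
      field_simp
    have eF := eq_irot h0 (fun j => D.F j.castSucc (ξ, y)) j
    beta_reduce at eF
    simp only [FourierData.fibre] at a1 a2
    rw [eF, a3, a4, a5, a6, e5, symb_eq j h0]
    simp only [irot]
    linear_combination (Complex.I * nrm j ξ) * a1 + (Complex.I * nrp j ξ) * a2 -
      Complex.I * nrm j ξ * hr
  · have m1 := mL S.q1
    have m2 := mL (S.V2 2)
    have m3 := mL (S.V 2)
    have m4 := mL D.G1
    refine ae_volO_of_fibres (by fun_prop) (mL _) ?_
    filter_upwards [hS, fw, fw2, fq1] with ξ e e1 e2 e3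
    filter_upwards [e.eq3, e1, e2, e3] with y a1 a2 a3 a4
    simp only [FourierData.fibre] at a1
    rw [a2, a3, a4]
    linear_combination a1
  · have m1 := mL (S.V 0)
    have m2 := mL (S.V 1)
    have m3 := mL (S.V1 2)
    refine ae_volO_of_fibres (by fun_prop) (mL _) ?_
    filter_upwards [fV 0, fV 1, fw1, hGr, ae_ne_zero_plane] with ξ e1 e2 e3 e4 h0
    filter_upwards [e1, e2, e3, e4.2.1] with y a1 a2 a3 a4
    have a1' : S.V 0 (ξ, y) = _ := a1
    have a2' : S.V 1 (ξ, y) = _ := a2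
    rw [a1', a2', a3, a4]
    linear_combination (symb_mul_irot h0 ((J ξ).a y) ((J ξ).d y)).1
  · have m1 := mL (S.V1 0)
    have m2 := mL (S.V1 1)
    have m3 := mL (S.V2 2)
    refine ae_volO_of_fibres (by fun_prop) (mL _) ?_
    filter_upwards [fV1 0, fV1 1, fw2, ae_ne_zero_plane] with ξ e1 e2 e3 h0
    filter_upwards [e1, e2, e3] with y a1 a2 a3
    have a1' : S.V1 0 (ξ, y) = _ := a1
    have a2' : S.V1 1 (ξ, y) = _ := a2
    rw [a1', a2', a3]
    linear_combination (symb_mul_irot h0 ((J ξ).a' y) ((J ξ).d' y)).1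
  · filter_upwards [hS, h.tV1 j, h.tw, ae_ne_zero_plane] with ξ e e1 e2 h0
    have eK := eq_irot h0 (fun j => D.K j.castSucc ξ) j
    have a1 := e.eqka
    have a2 := e.eqkd
    simp only [FourierData.fibre] at a1 a2
    beta_reduce at eK
    rw [eK, e1, e2, e.w_b, symb_eq j h0, ← a1, ← a2]
    simp only [irot, FourierData.fibre]
    ring
  · filter_upwards [hS, h.tq, h.tw1, h.X 0, h.X 1, ae_ne_zero_plane] with ξ e e1 e2 e3 e4 h0
    have hr : (freq ξ : ℂ) ≠ 0 := by
      exact_mod_cast ((norm_pos_iff.2 h0).trans_le (norm_le_freq ξ)).ne'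
    have hq' : (grav + κ * freq ξ ^ 2 : ℂ) ≠ 0 := by
      have : 0 < grav + κ * freq ξ ^ 2 := by positivity
      exact_mod_cast this.ne'
    have a1 := e.eqc
    simp only [FourierData.fibre] at a1
    rw [div_mul_eq_mul_div, eq_div_iff hq'] at a1
    rw [e1, e2, e3, e4, (symb_mul_irot h0 _ _).1]
    have hc : (grav : ℂ) / freq ξ * (J ξ).c + κ * (freq ξ * (J ξ).c) = D.K 2 ξ + (J ξ).P b -
        2 * μ * (freq ξ * (J ξ).a b + rep b D.G D.G1 (ξ, b)) := by
      refine mul_left_cancel₀ hr ?_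
      rw [← a1]
      field_simp
    linear_combination hc
  · filter_upwards [hS, h.X 0, h.X 1, ae_ne_zero_plane] with ξ e e3 e4 h0
    have a1 := e.eqχ
    simp only [FourierData.fibre] at a1
    rw [e3, e4, (symb_mul_irot h0 _ _).2]
    linear_combination -a1
  · refine Lp.ext ?_
    filter_upwards [hS, h.tw] with ξ e e1
    rw [e1, e.w_b]
    rfl
  · refine Lp.ext (EventuallyEq.trans ?_ (Lp.coeFn_zero ..).symm)
    filter_upwards [hS, h.bV j] with ξ e e1
    rw [e1, e.a_zero, e.d_zero, irot, mul_zero, mul_zero, add_zero, mul_zero]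
    rfl
  · refine Lp.ext (EventuallyEq.trans ?_ (Lp.coeFn_zero ..).symm)
    filter_upwards [hS, h.bw] with ξ e e1
    rw [e1, e.w_zero]
    rfl

/-- The system on the Fourier side has a solution as soon as the data have finite size. -/
theorem exists_hatSys {b μ grav κ : ℝ} (hb : 0 < b) (hgrav : 0 < grav) (hμ : 0 < μ)
    (hκ : 0 < κ) {D : FourierData b} (hG : HasWeakPartial b 2 D.G D.G1)
    (hfin : eLpNorm (fun ξ => (D.fibre ξ).δs b 0 ξ) 2 volume < ⊤) :
    ∃ S : FourierSol b, HatSys grav μ κ S D := by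
  obtain ⟨C, hC⟩ := exists_integrated_estimate hb hgrav hμ hκ 0
  have hS : ∀ᵐ ξ, FSys b μ grav κ (D.fibre ξ) ((D.fibre ξ).sol b μ grav κ) :=
    (FourierData.good hb hG).mono fun ξ h => h.fsys hb hμ
  obtain ⟨S, hF⟩ := exists_isFibre hb hS (D.measFData.sol b μ grav κ) (by
    have := hC D.fibre _ (fun ξ => rfl) hS
    simp only [mul_zero, pow_zero, one_mul] at this
    exact this.trans_lt (ENNReal.mul_lt_top ENNReal.coe_lt_top hfin))
  exact ⟨S, hF.hatSys hb hgrav hκ hG hS⟩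

/-! ### Differences of solutions -/

lemma HasWeakPartial.sub {b : ℝ} {j : Fin 3} {f g f' g' : L2Omega b}
    (h : HasWeakPartial b j f g) (h' : HasWeakPartial b j f' g') :
    HasWeakPartial b j (f - f') (g - g') := by
  have := h.add (h'.smul (-1))
  rwa [neg_one_smul, neg_one_smul, ← sub_eq_add_neg, ← sub_eq_add_neg] at this

/-- The componentwise difference. -/
def FourierSol.sub {b : ℝ} (S T : FourierSol b) : FourierSol b where
  V i := S.V i - T.V i
  V1 i := S.V1 i - T.V1 i
  V2 i := S.V2 i - T.V2 i
  q := S.q - T.q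
  q1 := S.q1 - T.q1
  X j := S.X j - T.X j

/-- The zero data. -/
def Data.zero (b : ℝ) : Data b := ⟨0, 0, 0, 0, 0⟩

lemma trTop_sub {b : ℝ} (f g f' g' : L2Omega b) :
    trTop b (f - f') (g - g') = trTop b f g - trTop b f' g' := by
  rw [trTop, trTop, trTop, map_sub, map_sub, ← smul_sub]
  congr 1; abel

lemma trBot_sub {b : ℝ} (f g f' g' : L2Omega b) :
    trBot b (f - f') (g - g') = trBot b f g - trBot b f' g' := by
  rw [trBot, trBot, trBot, map_sub, map_sub, ← smul_sub]
  congr 1; abel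

/-- By linearity the difference solves the system with zero data, so the a priori estimate applies
to it. -/
lemma HatSys.sub {b grav μ κ : ℝ} {S T : FourierSol b} {D : FourierData b}
    (h : HatSys grav μ κ S D) (h' : HatSys grav μ κ T D) :
    HatSys grav μ κ (S.sub T) ((Data.zero b).hat 0) := by
  have oz := Lp.coeFn_zero ℂ 2 (volO b)
  have sz := Lp.coeFn_zero ℂ 2 (volume : Measure Plane)
  have hf0 : (𝓕 (0 : L2Sigma) : L2Sigma) = 0 := (Lp.fourierTransformₗᵢ Plane ℂ).map_zero
  have e : (Data.zero b).hat 0 = ⟨0, 0, fun _ => 0, fun _ => 0, 0, 0⟩ := by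
    simp only [Data.hat, Data.zero, map_zero, Pi.zero_apply, hf0]
  rw [e]
  have X : ∀ᵐ ξ : Plane, ∀ j, (S.X j - T.X j : L2Sigma) ξ = S.X j ξ - T.X j ξ :=
    ae_all_iff.2 fun j => Lp.coeFn_sub _ _
  have V : ∀ᵐ z ∂volO b, ∀ i, (S.V i - T.V i : L2Omega b) z = S.V i z - T.V i z :=
    ae_all_iff.2 fun i => Lp.coeFn_sub _ _
  have V1 : ∀ᵐ z ∂volO b, ∀ i, (S.V1 i - T.V1 i : L2Omega b) z = S.V1 i z - T.V1 i z :=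
    ae_all_iff.2 fun i => Lp.coeFn_sub _ _
  have V2 : ∀ᵐ z ∂volO b, ∀ i, (S.V2 i - T.V2 i : L2Omega b) z = S.V2 i z - T.V2 i z :=
    ae_all_iff.2 fun i => Lp.coeFn_sub _ _
  have q := Lp.coeFn_sub S.q T.q
  have q1 := Lp.coeFn_sub S.q1 T.q1
  have tr : ∀ f g f' g' : L2Omega b, ∀ᵐ ξ, trTop b (f - f') (g - g') ξ =
      trTop b f g ξ - trTop b f' g' ξ := fun f g f' g' => by
    rw [trTop_sub]; exact Lp.coeFn_sub _ _
  refine ⟨fun i => (h.dV i).sub (h'.dV i), fun i => (h.dV1 i).sub (h'.dV1 i), h.dq.sub h'.dq,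
    hasWeakPartial_zero b 2, fun j => ?_, ?_, ?_, ?_, fun j => ?_, ?_, ?_, ?_, fun i => ?_⟩
  · filter_upwards [h.horiz j, h'.horiz j, oz, (quasiMeasurePreserving_fst b).ae X,
      V, V2, q] with z a a' o x v v2 q
    simp only [FourierSol.sub, o, x, v, v2, q, Pi.sub_apply, Pi.zero_apply]
    linear_combination a - a'
  · filter_upwards [h.vert, h'.vert, oz, V, V2, q1] with z a a' o v v2 q
    simp only [FourierSol.sub, o, v, v2, q, Pi.sub_apply, Pi.zero_apply]
    linear_combination a - a'
  · filter_upwards [h.div, h'.div, oz, V, V1] with z a a' o v v1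
    simp only [FourierSol.sub, o, v, v1, Pi.zero_apply]
    linear_combination a - a'
  · filter_upwards [h.div1, h'.div1, oz, V1, V2] with z a a' o v v1
    simp only [FourierSol.sub, o, v, v1, Pi.zero_apply]
    linear_combination a - a'
  · filter_upwards [h.shear j, h'.shear j, sz, tr (S.V1 j.castSucc) (S.V2 j.castSucc)
      (T.V1 j.castSucc) (T.V2 j.castSucc), tr (S.V 2) (S.V1 2) (T.V 2) (T.V1 2)]
      with z a a' o t1 t2
    simp only [FourierSol.sub, o, t1, t2, Pi.zero_apply]
    linear_combination a - a'
  · filter_upwards [h.normal, h'.normal, sz, tr S.q S.q1 T.q T.q1,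
      tr (S.V1 2) (S.V2 2) (T.V1 2) (T.V2 2), X] with z a a' o t1 t2 x
    simp only [FourierSol.sub, o, t1, t2, x, Pi.zero_apply]
    linear_combination a - a'
  · filter_upwards [h.curl, h'.curl, sz, X] with z a a' o x
    simp only [FourierSol.sub, o, x, Pi.zero_apply]
    linear_combination a - a'
  · exact (trTop_sub ..).trans (by rw [h.kin, h'.kin, sub_self])
  · exact (trBot_sub ..).trans (by rw [h.noSlip, h'.noSlip, sub_self])

lemma wS_zero (n : ℕ) : wS n (0 : L2Sigma) = 0 := by
  rw [wS, eLpNorm_congr_ae (g := 0), eLpNorm_zero]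
  filter_upwards [Lp.coeFn_zero ℂ 2 (volume : Measure Plane)] with ξ h
  rw [h, Pi.zero_apply, mul_zero]

lemma memH_zero {b : ℝ} (hb : 0 < b) (m : ℕ) : MemH b m 0 ∧ normH b m 0 = 0 := by
  have h := Reg.memH (m := m) (f := (0 : L2Omega b)) (A := 0) hb (by
    rw [map_zero]; exact Reg.zero ..)
  rw [NNReal.coe_zero, mul_zero] at h
  exact ⟨h.1, h.2.antisymm (normH_nonneg ..)⟩

lemma memSobolev_zero (n : ℕ) {σ : ℝ} (hσ : σ = n / 2) :
    TemperedDistribution.MemSobolev σ 2 ((0 : L2Sigma) : 𝓢'(Plane, ℂ)) ∧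
      normHSigma σ 0 = 0 := by
  have hf0 : (𝓕 (0 : L2Sigma) : L2Sigma) = 0 := (Lp.fourierTransformₗᵢ Plane ℂ).map_zero
  rw [memSobolev_iff_wS n hσ, normHSigma_eq n hσ, hf0, wS_zero]
  exact ⟨ENNReal.zero_lt_top, rfl⟩

lemma memHDotNegOne_zero : MemHDotNegOne 0 ∧ seminormHDotNegOne 0 = 0 := by
  have hf0 : (𝓕 (0 : L2Sigma) : L2Sigma) = 0 := (Lp.fourierTransformₗᵢ Plane ℂ).map_zero
  have h : invFreq 0 =ᵐ[volume] 0 := by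
    filter_upwards [Lp.coeFn_zero ℂ 2 (volume : Measure Plane)] with ξ h
    rw [invFreq, hf0, h, Pi.zero_apply, mul_zero]
  exact ⟨(memLp_congr_ae h).2 MemLp.zero, by
    rw [seminormHDotNegOne, eLpNorm_congr_ae h, eLpNorm_zero, ENNReal.toReal_zero]⟩

lemma Data.zero_size {b : ℝ} (hb : 0 < b) : (Data.zero b).MemSobolev 0 ∧
    (Data.zero b).Compatible ∧ (Data.zero b).size 0 = 0 := by
  have k := memSobolev_zero 1 (σ := 1 / 2 + (0 : ℕ)) (by norm_num)
  have h := memSobolev_zero 3 (σ := 3 / 2 + (0 : ℕ)) (by norm_num)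
  have e : (Data.zero b).fluxDefect = 0 := by
    rw [Data.fluxDefect, verticalIntegral_eq_pair]
    change (0 : L2Sigma) - pair b (cvec b 1) 0 = 0
    rw [map_zero, sub_zero]
  refine ⟨⟨(memH_zero hb 1).1, fun i => (memH_zero hb 0).1, fun i => k.1, h.1, k.1⟩,
    ⟨e ▸ memHDotNegOne_zero.1, memHDotNegOne_zero.1⟩, ?_⟩
  rw [Data.size, e, Data.norm]
  simp only [Data.zero, Pi.zero_apply, k.2, h.2, (memH_zero hb _).2, memHDotNegOne_zero.2,
    Finset.sum_const_zero, add_zero]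

lemma eq_zero_of_wO {b : ℝ} {n : ℕ} {F : L2Omega b} (h : wO b n F ≤ 0) : F = 0 := by
  have h1 := (wO_le_wO (Nat.zero_le n) _).trans h
  rw [wO_zero_eq] at h1
  simpa using h1

lemma eq_zero_of_wS {n : ℕ} {f : L2Sigma} (h : wS n f ≤ 0) : f = 0 := by
  have h1 := (wS_le_wS (Nat.zero_le n) f).trans h
  simp only [wS, pow_zero, Complex.ofReal_one, one_mul] at h1
  rw [← Lp.enorm_def] at h1
  simpa using h1

/-- Solutions on the Fourier side are unique. -/
theorem HatSys.unique {b μ grav κ : ℝ} (hb : 0 < b) (hgrav : 0 < grav) (hμ : 0 < μ)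
    (hκ : 0 < κ) {S T : FourierSol b} {D : FourierData b} (h : HatSys grav μ κ S D)
    (h' : HatSys grav μ κ T D) : S.V = T.V ∧ S.q = T.q ∧ S.X = T.X := by
  obtain ⟨C, hC⟩ := exists_regularity hb hgrav hμ hκ 0
  obtain ⟨z1, z2, z3⟩ := Data.zero_size hb
  obtain ⟨h1, h2, h3⟩ := hC _ 0 _ z1 z2 (hasWeakPartial_zero b 2) (h.sub h')
  rw [z3, Real.toNNReal_zero, mul_zero] at h1 h2 h3
  exact ⟨funext fun i => sub_eq_zero.1 (eq_zero_of_wO (h1 i).wO_le),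
    sub_eq_zero.1 (eq_zero_of_wO h2.wO_le), funext fun j => sub_eq_zero.1 (eq_zero_of_wS ((h3 j).trans_eq (by rw [mul_zero, ENNReal.coe_zero])))⟩

/-! ### The main result -/

lemma MemH.of_le {b : ℝ} {m n : ℕ} (hmn : m ≤ n) {f : L2Omega b} (h : MemH b n f) :
    MemH b m f := by
  induction n, hmn using Nat.le_induction with
  | base => exact h
  | succ n _ ih => exact ih h.of_succ.1

lemma memSobolev_mono {m n : ℕ} (hmn : m ≤ n) {σ τ : ℝ} (hσ : σ = m / 2) (hτ : τ = n / 2)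
    {f : L2Sigma} (h : TemperedDistribution.MemSobolev τ 2 (f : 𝓢'(Plane, ℂ))) :
    TemperedDistribution.MemSobolev σ 2 (f : 𝓢'(Plane, ℂ)) :=
  (memSobolev_iff_wS m hσ f).2 ((wS_le_wS hmn _).trans_lt ((memSobolev_iff_wS n hτ f).1 h))

lemma Data.MemSobolev.to_zero {b : ℝ} {s : ℕ} {d : Data b} (h : d.MemSobolev s) :
    d.MemSobolev 0 where
  g := h.g.of_le (by omega)
  f i := (h.f i).of_le s.zero_le
  k i := memSobolev_mono (m := 1) (n := 2 * s + 1) (by omega) (by norm_num)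
    (by push_cast; ring) (h.k i)
  h := memSobolev_mono (m := 3) (n := 2 * s + 3) (by omega) (by norm_num)
    (by push_cast; ring) h.h
  w := memSobolev_mono (m := 1) (n := 2 * s + 1) (by omega) (by norm_num)
    (by push_cast; ring) h.w

lemma Triple.MemSobolev.to_zero {b : ℝ} {s : ℕ} {t : Triple b} (h : t.MemSobolev s) :
    t.MemSobolev 0 where
  p := h.p.of_le (by omega)
  u i := (h.u i).of_le (by omega)
  χ i := memSobolev_mono (m := 3) (n := 2 * s + 3) (by omega) (by norm_num)
    (by push_cast; ring) (h.χ i)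

lemma Triple.MemSobolev.exists_partials {b : ℝ} {t : Triple b} (h : t.MemSobolev 0) :
    ∃ (u1 u2 : Fin 3 → L2Omega b) (p1 : L2Omega b), (∀ i, HasWeakPartial b 2 (t.u i) (u1 i)) ∧
      (∀ i, HasWeakPartial b 2 (u1 i) (u2 i)) ∧ HasWeakPartial b 2 t.p p1 := by
  choose D D2 hD hD2 using fun i => (h.u i).exists_two
  obtain ⟨p1, hp, -⟩ := h.p 2
  exact ⟨fun i => D i 2, fun i => D2 i 2 2, p1, fun i => hD i 2, fun i => hD2 i 2 2, hp⟩

lemma Triple.ext_hat {b : ℝ} {t t' : Triple b} {u1 u2 u1' u2' : Fin 3 → L2Omega b}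
    {p1 p1' : L2Omega b} (hV : (t.hat u1 u2 p1).V = (t'.hat u1' u2' p1').V)
    (hq : (t.hat u1 u2 p1).q = (t'.hat u1' u2' p1').q)
    (hX : (t.hat u1 u2 p1).X = (t'.hat u1' u2' p1').X) : t = t' := by
  cases t
  cases t'
  rw [Triple.mk.injEq]
  exact ⟨(pfourier b).injective hq, funext fun i => (pfourier b).injective (congrFun hV i),
    funext fun j => fourier_injective.1 (congrFun hX j)⟩

/-- Every element of `FourierSol` whose components are vertical derivatives of each other is the
transform of a triple. -/
lemma HatSys.exists_hat {b grav μ κ : ℝ} (hb : 0 < b) {S : FourierSol b} {D : FourierData b}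
    (h : HatSys grav μ κ S D) : ∃ (t : Triple b) (u1 u2 : Fin 3 → L2Omega b) (p1 : L2Omega b),
      t.hat u1 u2 p1 = S ∧ (∀ i, HasWeakPartial b 2 (t.u i) (u1 i)) ∧
      (∀ i, HasWeakPartial b 2 (u1 i) (u2 i)) ∧ HasWeakPartial b 2 t.p p1 := by
  have hw : ∀ {f g : L2Omega b}, HasWeakPartial b 2 f g →
      HasWeakPartial b 2 ((pfourier b).symm f) ((pfourier b).symm g) := fun {f g} hfg =>
    (hasWeakPartial_two_pfourier_iff hb).1 (by simpa using hfg)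
  refine ⟨⟨(pfourier b).symm S.q, fun i => (pfourier b).symm (S.V i),
    fun j => (Lp.fourierTransformₗᵢ Plane ℂ).symm (S.X j)⟩, fun i => (pfourier b).symm (S.V1 i),
    fun i => (pfourier b).symm (S.V2 i), (pfourier b).symm S.q1, ?_, fun i => hw (h.dV i),
    fun i => hw (h.dV1 i), hw h.dq⟩
  have e : ∀ f : L2Sigma, 𝓕 ((Lp.fourierTransformₗᵢ Plane ℂ).symm f) = f :=
    (Lp.fourierTransformₗᵢ Plane ℂ).apply_symm_apply
  simp only [Triple.hat, LinearIsometryEquiv.apply_symm_apply, e]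

/-- Regularity of triples solving the system on the Fourier side, with bounds. -/
theorem exists_norm_le {b μ grav κ : ℝ} (hb : 0 < b) (hgrav : 0 < grav) (hμ : 0 < μ)
    (hκ : 0 < κ) (s : ℕ) : ∃ C : ℝ, 0 < C ∧ ∀ (d : Data b) (g1 : L2Omega b) (t : Triple b)
      (u1 u2 : Fin 3 → L2Omega b) (p1 : L2Omega b), d.MemSobolev s → d.Compatible →
      HasWeakPartial b 2 d.g g1 → HatSys grav μ κ (t.hat u1 u2 p1) (d.hat g1) →
      t.MemSobolev s ∧ t.norm s ≤ C * d.size s := by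
  obtain ⟨C, hC⟩ := exists_regularity hb hgrav hμ hκ s
  -- The pressure, three velocity components and two components of `χ`; the final `1` makes the
  -- constant positive.
  refine ⟨16 ^ (1 + s) * C + 3 * (16 ^ (2 + s) * C) + 2 * C + 1, by positivity,
    fun d g1 t u1 u2 p1 hd hc hg h => ?_⟩
  obtain ⟨h1, h2, h3⟩ := hC d g1 _ hd hc hg h
  rw [add_comm] at h2
  simp only [add_comm s 2] at h1
  have hs : 0 ≤ d.size s := (normH_nonneg ..).trans (d.le_size s).1
  have r1 : ∀ j, _ := fun j => Reg.memH hb (f := t.u j) (h1 j)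
  have r2 := Reg.memH hb (f := t.p) h2
  have r3 : ∀ j, normHSigma (3 / 2 + s) (t.χ j) ≤ C * d.size s := fun j => by
    rw [normHSigma_eq (2 * s + 3) (by push_cast; ring)]
    refine (ENNReal.toReal_mono ENNReal.coe_ne_top (h3 j)).trans_eq ?_
    rw [ENNReal.coe_toReal, NNReal.coe_mul, Real.coe_toNNReal _ hs]
  simp only [NNReal.coe_mul, Real.coe_toNNReal _ hs] at r1 r2
  refine ⟨⟨r2.1, fun i => (r1 i).1, fun i => (memSobolev_iff_wS (2 * s + 3)
    (by push_cast; ring) _).2 ((h3 i).trans_lt ENNReal.coe_lt_top)⟩, ?_⟩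
  calc t.norm s ≤ 16 ^ (1 + s) * (C * d.size s) + ∑ _i : Fin 3, 16 ^ (2 + s) * (C * d.size s) +
        ∑ _i : Fin 2, C * d.size s := by
        refine add_le_add (add_le_add r2.2 ?_) (Finset.sum_le_sum fun i _ => r3 i)
        exact Finset.sum_le_sum fun i _ => (r1 i).2
    _ ≤ _ := by
        simp only [Finset.sum_const, Finset.card_univ, Fintype.card_fin, nsmul_eq_mul]
        push_cast
        linarith

/-- A solution is constructed from finiteness of the data at order `0` only; its regularity of order
`s` follows from the a priori theory, which applies to any solution on the Fourier side. Uniqueness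
is transferred back through the injectivity of the transforms. -/
theorem existsUnique_solution {b μ grav κ : ℝ} (hb : 0 < b) (hgrav : 0 < grav) (hμ : 0 < μ)
    (hκ : 0 < κ) {s : ℕ} {d : Data b} (hd : d.MemSobolev s) (hc : d.Compatible) :
    ∃! t : Triple b, t.MemSobolev s ∧ Solves grav μ κ t d := by
  obtain ⟨g1, hg, -⟩ := hd.to_zero.g 2
  have hfin := (eLpNorm_data_le hb hd.to_zero hc hg).trans_lt
    (by rw [← ENNReal.coe_mul]; exact ENNReal.coe_lt_top)
  obtain ⟨S, hS⟩ := exists_hatSys hb hgrav hμ hκ ((hasWeakPartial_two_pfourier_iff hb).2 hg) hfin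
  obtain ⟨t, u1, u2, p1, rfl, h1, h2, h3⟩ := hS.exists_hat hb
  obtain ⟨C, -, hC⟩ := exists_norm_le hb hgrav hμ hκ s
  have ht := (hC d g1 t u1 u2 p1 hd hc hg hS).1
  refine ⟨t, ⟨ht, (solves_iff hb hκ.ne' ht.to_zero h1 h2 h3 hg).2 hS⟩, fun t' ⟨ht', hs⟩ => ?_⟩
  obtain ⟨v1, v2, q1, k1, k2, k3⟩ := ht'.to_zero.exists_partials
  have hS' := (solves_iff hb hκ.ne' ht'.to_zero k1 k2 k3 hg).1 hs
  obtain ⟨e1, e2, e3⟩ := hS'.unique hb hgrav hμ hκ hS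
  exact Triple.ext_hat e1 e2 e3

/-- The bound belongs to the Fourier side, so any solution is first transformed by `solves_iff`, for
which regularity of order `0` is enough. -/
theorem exists_estimate {b μ grav κ : ℝ} (hb : 0 < b) (hgrav : 0 < grav) (hμ : 0 < μ)
    (hκ : 0 < κ) (s : ℕ) : ∃ C : ℝ, 0 < C ∧ ∀ (d : Data b) (t : Triple b), d.MemSobolev s →
      d.Compatible → t.MemSobolev s → Solves grav μ κ t d → t.norm s ≤ C * d.size s := by
  obtain ⟨C, hC0, hC⟩ := exists_norm_le hb hgrav hμ hκ s
  refine ⟨C, hC0, fun d t hd hc ht hs => ?_⟩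
  obtain ⟨g1, hg, -⟩ := hd.to_zero.g 2
  obtain ⟨v1, v2, q1, k1, k2, k3⟩ := ht.to_zero.exists_partials
  exact (hC d g1 t v1 v2 q1 hd hc hg
    ((solves_iff hb hκ.ne' ht.to_zero k1 k2 k3 hg).1 hs)).2

end StationaryWaves

end

theorem mainTheorem8 (b grav μ κ : ℝ) (hb : 0 < b) (hgrav : 0 < grav) (hμ : 0 < μ) (hκ : 0 < κ)
    (s : ℕ) :
    (∀ d : StationaryWaves.Data b, d.MemSobolev s → d.Compatible →
      ∃! t : StationaryWaves.Triple b,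
        t.MemSobolev s ∧ StationaryWaves.Solves grav μ κ t d) ∧
    ∃ C : ℝ, 0 < C ∧ ∀ (d : StationaryWaves.Data b) (t : StationaryWaves.Triple b),
      d.MemSobolev s → d.Compatible → t.MemSobolev s → StationaryWaves.Solves grav μ κ t d →
        t.norm s ≤ C * (d.norm s + StationaryWaves.seminormHDotNegOne d.fluxDefect +
          StationaryWaves.seminormHDotNegOne d.w) :=
  ⟨fun _ hd hc => StationaryWaves.existsUnique_solution hb hgrav hμ hκ hd hc,
    StationaryWaves.exists_estimate hb hgrav hμ hκ s⟩
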